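/- **Conventions.** For permutations $\sigma,\tau$ of a finite set of squares, the origami $(\sigma,\tau)$ is the translation surface $(X,\omega)$ obtained from unit squares in $\mathbb{C}$ (with $\omega=dz$ on each square) by gluing, by translations, the right side of square $i$ to the left side of square $\sigma(i)$ and the top side of square $i$ to the bottom side of square $\tau(i)$; pairs that differ by simultaneous conjugation give the same origami. Let $\sigma_g=(1,2,\ldots,2g-1)$. A two-row array describes $\tau$ by writing $x$ above $\tau(x)$. A translation surface $(X,\omega)$ is an *orientation double cover* of $(Y,q)$, where $Y$ is a closed connected Riemann surface and $q$ is a non-zero quadratic differential on $Y$ with at most simple poles, if there is a (possibly ramified) holomorphic double cover $\pi:X\to Y$ with $\pi^*q=\omega^2$. It is an *orientation double cover* if it is one of some $(Y,q)$. $\mathcal{Q}_h(k_1,\ldots,k_n)$ denotes the stratum of quadratic differentials on surfaces of genus $h$ whose zeros and poles have orders $k_1,\ldots,k_n$ (a pole counts with negative order). **Pair placing.** For $m\le g$ and a label $c$, "placing pairs with $m$, ending at $c$" means: for an ordering $k_1,\ldots,k_{g-m}$ of $\{m,m+1,\ldots,g-1\}$, put $3,2$ above $2k_1,2k_1+1$,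 then $2k_i+1,2k_i$ above $2k_{i+1},2k_{i+1}+1$ for $1\le i<g-m$, and finally $2k_{g-m}+1,2k_{g-m}$ above $c,c+1$ (if $g=m$, put $3,2$ above $c,c+1$). Consider the following families of origamis $(\sigma_g,\tau)$. 1. *Odd genus AMN (Aougab–Menasco–Nieland) origamis*, $g\ge 3$ odd: put $1$ above $3$, and place pairs with $m=2$, ending at $c=1$. 2. *Even genus AMN origamis*, $g\ge 4$ even: take $\eta$ from family 1 in genus $g-1$ and $k\in\{3,5,\ldots,2g-3\}$ with $\eta(k)\ne 1$; let $\tau(x)=\eta(x)$ for $x\le 2g-3$, $x\neq k$, and $\tau(k)=2g-1$, $\tau(2g-1)=2g-2$, $\tau(2g-2)=\eta(k)$. 3. *Odd genus, even spin*, $g\ge 5$ odd: put $9,6,1,8,7,5,4$ above $1,\ldots,7$, and place pairs with $m=5$, ending at $c=8$. 4. *Even genus, odd spin*, $g\ge4$ even: put $4,6,1,5,7$ above $1,\ldots,5$, and place pairs with $m=4$, ending at $c=6$. 5. *Even genus, even spin*, $g\ge4$ even: put $7,5,1,6,4$ above $1,\ldots,5$, and place pairs with $m=4$, ending at $c=6$.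 **Theorem.** For every odd $g\ge 3$, family 1 consists of $(g-2)!$ permutations $\tau$, which give pairwise distinct origamis. Exactly $(g-3)!!$ of these origamis (with $0!!=1$) are orientation double covers of quadratic differentials in $\mathcal{Q}_{\frac{g-1}{2}}(2g-3,-1^3)$; the others are not orientation double covers of any quadratic differential. No origami of the families 2, 3, 4 and 5 is an orientation double cover. -/

import Mathlib

open scoped Manifold ContDiff Topology Nat

noncomputable section

/-! ### Riemann surfaces, Abelian and quadratic differentials -/

/-- A closed (compact, without boundary), connected Riemann surface. -/
structure ClosedRiemannSurface where
  carrier : Type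
  [topology : TopologicalSpace carrier]
  [t2 : T2Space carrier]
  [compact : CompactSpace carrier]
  [connected : ConnectedSpace carrier]
  [charted : ChartedSpace ℂ carrier]
  [isManifold : IsManifold 𝓘(ℂ) ω carrier]

instance : CoeSort ClosedRiemannSurface Type := ⟨ClosedRiemannSurface.carrier⟩

attribute [instance] ClosedRiemannSurface.topology ClosedRiemannSurface.t2
  ClosedRiemannSurface.compact ClosedRiemannSurface.connected ClosedRiemannSurface.charted
  ClosedRiemannSurface.isManifold

/-- A non-zero holomorphic `1`-form: in each chart `e` of the atlas it is `coeff e z dz`.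
The values of `coeff e` outside `e.target` are irrelevant. -/
structure AbelianDifferential (X : ClosedRiemannSurface) where
  coeff : OpenPartialHomeomorph X ℂ → ℂ → ℂ
  holomorphic : ∀ e ∈ atlas ℂ X, DifferentiableOn ℂ (coeff e) e.target
  transform : ∀ e ∈ atlas ℂ X, ∀ e' ∈ atlas ℂ X, ∀ z ∈ (e.symm.trans e').source,
    coeff e z = coeff e' (e' (e.symm z)) * deriv (e' ∘ e.symm) z
  nonzero : ∃ e ∈ atlas ℂ X, ∃ z ∈ e.target, coeff e z ≠ 0

/-- A meromorphic quadratic differential: in each chart `e` of the atlas it is `coeff e z dz²`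
with `coeff e` meromorphic. As usual for meromorphic objects in Mathlib, the value of `coeff e` at
a single point (such as a pole) carries no information, so that the transformation rule is imposed
on punctured neighbourhoods. -/
structure MeromorphicQuadraticDifferential (Y : ClosedRiemannSurface) where
  coeff : OpenPartialHomeomorph Y ℂ → ℂ → ℂ
  meromorphic : ∀ e ∈ atlas ℂ Y, ∀ z ∈ e.target, MeromorphicAt (coeff e) z
  transform : ∀ e ∈ atlas ℂ Y, ∀ e' ∈ atlas ℂ Y, ∀ z ∈ (e.symm.trans e').source,
    ∀ᶠ w in 𝓝[≠] z, coeff e w = coeff e' (e' (e.symm w)) * deriv (e' ∘ e.symm) w ^ 2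

/-- The order of a meromorphic quadratic differential at a point (positive at a zero, negative at
a pole). It does not depend on the chart. -/
def MeromorphicQuadraticDifferential.order {Y : ClosedRiemannSurface}
    (q : MeromorphicQuadraticDifferential Y) (p : Y) : WithTop ℤ :=
  meromorphicOrderAt (q.coeff (chartAt ℂ p)) (chartAt ℂ p p)

/-- A quadratic differential: non-zero and with at most simple poles. (On a connected surface,
being non-zero and vanishing identically near no point are the same.) -/
structure QuadraticDifferential (Y : ClosedRiemannSurface) extends
    MeromorphicQuadraticDifferential Y where
  nonzero : ∀ p : Y, toMeromorphicQuadraticDifferential.order p ≠ ⊤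
  simple_poles : ∀ p : Y, ((-1 : ℤ) : WithTop ℤ) ≤ toMeromorphicQuadraticDifferential.order p

/-- A closed connected orientable surface `Y` has genus `h` if its Euler characteristic is
`2 - 2h`, where the Euler characteristic is `V - E + F` for a finite two-dimensional cell
decomposition (CW structure) of `Y`. -/
def HasGenus (Y : Type) [TopologicalSpace Y] (h : ℕ) : Prop :=
  ∃ C : Topology.CWComplex (Set.univ : Set Y),
    (∀ n, Finite (C.cell n)) ∧ (∀ n, 2 < n → IsEmpty (C.cell n)) ∧
    (Nat.card (C.cell 0) : ℤ) - Nat.card (C.cell 1) + Nat.card (C.cell 2) = 2 - 2 * (h : ℤ)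

/-- The quadratic differential `q` belongs to the stratum `𝓠_h(κ)`: the underlying surface has
genus `h`, and `κ` lists, with repetition, the orders of the zeros and poles of `q`.
(If `κ` has an odd entry, such a `q` is never the square of an Abelian differential.) -/
def QuadraticDifferential.InStratum {Y : ClosedRiemannSurface} (q : QuadraticDifferential Y)
    (h : ℕ) (κ : Multiset ℤ) : Prop :=
  HasGenus Y h ∧
  ∃ S : Finset Y, (∀ p, p ∈ S ↔ q.order p ≠ 0) ∧
    S.val.map (fun p => q.order p) = κ.map (fun k => (k : WithTop ℤ))

/-! ### Orientation double covers -/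

/-- A (possibly ramified) double cover of Riemann surfaces: a holomorphic map all of whose fibres
but finitely many consist of exactly two points. -/
structure IsDoubleCover {X Y : ClosedRiemannSurface} (π : X → Y) : Prop where
  holomorphic : ContMDiff 𝓘(ℂ) 𝓘(ℂ) ω π
  degree_two : ∃ S : Set Y, S.Finite ∧ ∀ y ∉ S, (π ⁻¹' {y}).ncard = 2

/-- `π^* q = α²`, in local coordinates. -/
def PullbackEqSq {X Y : ClosedRiemannSurface} (π : X → Y) (q : QuadraticDifferential Y)
    (α : AbelianDifferential X) : Prop :=
  ∀ e ∈ atlas ℂ X, ∀ e' ∈ atlas ℂ Y, ∀ z ∈ e.target, π (e.symm z) ∈ e'.source →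
    ∀ᶠ w in 𝓝[≠] z,
      q.coeff e' (e' (π (e.symm w))) * deriv (e' ∘ π ∘ e.symm) w ^ 2 = α.coeff e w ^ 2

/-- The translation surface `(X, α)` is an orientation double cover of `(Y, q)`. -/
def IsOrientationDoubleCoverOf {X Y : ClosedRiemannSurface} (α : AbelianDifferential X)
    (q : QuadraticDifferential Y) : Prop :=
  ∃ π : X → Y, IsDoubleCover π ∧ PullbackEqSq π q α

/-! ### Origamis -/

/-- The combinatorial data of an origami with set of squares `ι`: the right side of the square `i`
is glued to the left side of `right i`, its top side to the bottom side of `top i`. -/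
structure Origami (ι : Type) where
  right : Equiv.Perm ι
  top : Equiv.Perm ι

namespace Origami

variable {ι : Type}

/-- Two pairs of permutations describe the same origami if they differ by a relabelling of the
squares, i.e. by simultaneous conjugation. -/
def Equivalent (O O' : Origami ι) : Prop :=
  ∃ ρ : Equiv.Perm ι, ρ * O.right * ρ⁻¹ = O'.right ∧ ρ * O.top * ρ⁻¹ = O'.top

/-- The gluing by translations of the sides of the closed unit squares; `(i, z)` is the point `z`
of the square numbered `i`. -/
inductive Glue (O : Origami ι) : ι × ℂ → ι × ℂ → Prop
  | horizontal (i : ι) (t : ℝ) (h0 : 0 ≤ t) (h1 : t ≤ 1) :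
      Glue O (i, 1 + t * Complex.I) (O.right i, t * Complex.I)
  | vertical (i : ι) (t : ℝ) (h0 : 0 ≤ t) (h1 : t ≤ 1) :
      Glue O (i, t + Complex.I) (O.top i, t)

/-- The closed unit square. -/
def closedSquare : Set ℂ := {z | 0 ≤ z.re ∧ z.re ≤ 1 ∧ 0 ≤ z.im ∧ z.im ≤ 1}

/-- The open unit square. -/
def openSquare : Set ℂ := {z | 0 < z.re ∧ z.re < 1 ∧ 0 < z.im ∧ z.im < 1}

/-- `(X, α)` is the translation surface obtained by gluing unit squares according to `O`, with
`P i` the resulting parametrisation of the square `i`: `X` is the union of the squares, two points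
of squares are equal in `X` exactly when the gluing identifies them, and on the interior of
each square `P i` is holomorphic with `(P i)^* α = dz`. -/
structure IsTiling (O : Origami ι) {X : ClosedRiemannSurface} (α : AbelianDifferential X)
    (P : ι → ℂ → X) : Prop where
  continuousOn : ∀ i, ContinuousOn (P i) closedSquare
  surjective : ∀ x : X, ∃ i, ∃ z ∈ closedSquare, P i z = x
  eq_iff : ∀ i j, ∀ z ∈ closedSquare, ∀ w ∈ closedSquare,
    P i z = P j w ↔ Relation.EqvGen O.Glue (i, z) (j, w)
  pullback : ∀ i, ∀ z ∈ openSquare, ∀ e ∈ atlas ℂ X, P i z ∈ e.source →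
    DifferentiableAt ℂ (e ∘ P i) z ∧ α.coeff e (e (P i z)) * deriv (e ∘ P i) z = 1

/-- `(X, α)` is the translation surface of the origami `O` (unique up to isomorphism). -/
def IsSurfaceOf (O : Origami ι) {X : ClosedRiemannSurface} (α : AbelianDifferential X) : Prop :=
  ∃ P : ι → ℂ → X, O.IsTiling α P

/-- The origami is an orientation double cover (of some quadratic differential). -/
def IsOrientationDoubleCover (O : Origami ι) : Prop :=
  ∃ (X : ClosedRiemannSurface) (α : AbelianDifferential X), O.IsSurfaceOf α ∧
    ∃ (Y : ClosedRiemannSurface) (q : QuadraticDifferential Y), IsOrientationDoubleCoverOf α q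

/-- The origami is an orientation double cover of a quadratic differential in `𝓠_h(κ)`. -/
def IsOrientationDoubleCoverIn (O : Origami ι) (h : ℕ) (κ : Multiset ℤ) : Prop :=
  ∃ (X : ClosedRiemannSurface) (α : AbelianDifferential X), O.IsSurfaceOf α ∧
    ∃ (Y : ClosedRiemannSurface) (q : QuadraticDifferential Y),
      q.InStratum h κ ∧ IsOrientationDoubleCoverOf α q

end Origami

/-! ### The constructions -/

/-- The labels `1, 2, …, 2g - 1` of the squares. -/
abbrev Squares (g : ℕ) : Type := {i : ℕ // 1 ≤ i ∧ i ≤ 2 * g - 1}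

/-- The cycle `σ_g = (1, 2, …, 2g - 1)`. -/
def sigma (g : ℕ) : Equiv.Perm (Squares g) where
  toFun i := ⟨if i.1 < 2 * g - 1 then i.1 + 1 else 1, by
    have := i.2; split_ifs <;> omega⟩
  invFun i := ⟨if 1 < i.1 then i.1 - 1 else 2 * g - 1, by
    have := i.2; split_ifs <;> omega⟩
  left_inv i := by
    have := i.2; ext; dsimp only; split_ifs <;> omega
  right_inv i := by
    have := i.2; ext; dsimp only; split_ifs <;> omega

/-- The origami `(σ_g, τ)`. -/
def origamiOf (g : ℕ) (τ : Equiv.Perm (Squares g)) : Origami (Squares g) := ⟨sigma g, τ⟩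

/-- `τ` sends the label `a` to the label `b`: in two-row notation, `a` is placed above `b`. -/
def Sends {g : ℕ} (τ : Equiv.Perm (Squares g)) (a b : ℕ) : Prop :=
  ∃ x : Squares g, x.1 = a ∧ (τ x).1 = b

/-- In two-row notation, the pair `(a, a')` is placed above the pair `(b, b')`. -/
def PairAbove {g : ℕ} (τ : Equiv.Perm (Squares g)) (a a' b b' : ℕ) : Prop :=
  Sends τ a b ∧ Sends τ a' b'

/-- The pair-placing procedure, using the positions `(2j, 2j + 1)`, `m ≤ j ≤ g - 1`, in some order
`(2k₁, 2k₁ + 1), (2k₂, 2k₂ + 1), …`, and finishing above `(c, c + 1)`: the pair `(3, 2)` is placed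
above `(2k₁, 2k₁ + 1)`, then `(2k₁ + 1, 2k₁)` above `(2k₂, 2k₂ + 1)`, and so on, and the last pair
is placed above `(c, c + 1)`. Here `k 0 = 1` accounts for the initial pair `(3, 2)`. -/
def PlacesPairs (g m c : ℕ) (τ : Equiv.Perm (Squares g)) : Prop :=
  ∃ k : ℕ → ℕ, k 0 = 1 ∧ Set.BijOn k (Set.Icc 1 (g - m)) (Set.Icc m (g - 1)) ∧
    (∀ i < g - m,
      PairAbove τ (2 * k i + 1) (2 * k i) (2 * k (i + 1)) (2 * k (i + 1) + 1)) ∧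
    PairAbove τ (2 * k (g - m) + 1) (2 * k (g - m)) c (c + 1)

/-- The permutations `τ` of the Aougab–Menasco–Nieland construction in odd genus `g ≥ 3`. -/
def IsAMNOdd (g : ℕ) (τ : Equiv.Perm (Squares g)) : Prop :=
  Sends τ 1 3 ∧ PlacesPairs g 2 1 τ

/-- The permutations `τ` of the Aougab–Menasco–Nieland construction in even genus `g ≥ 4`, built
from a permutation `η` of the construction in genus `g - 1` and an odd label
`k ∈ {3, 5, …, 2g - 3}` with `η k ≠ 1`. -/
def IsAMNEven (g : ℕ) (τ : Equiv.Perm (Squares g)) : Prop :=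
  ∃ η : Equiv.Perm (Squares (g - 1)), IsAMNOdd (g - 1) η ∧
    ∃ k : ℕ, Odd k ∧ 3 ≤ k ∧ k ≤ 2 * g - 3 ∧ ¬ Sends η k 1 ∧
      (∀ x y, Sends η x y → x ≠ k → Sends τ x y) ∧
      Sends τ k (2 * g - 1) ∧ Sends τ (2 * g - 1) (2 * g - 2) ∧
      (∀ y, Sends η k y → Sends τ (2 * g - 2) y)

/-- The generalised construction in odd genus `g ≥ 5` with even spin: the top row of `τ` starts
with `9 6 1 8 7 5 4`. -/
def IsOddGenusEvenSpin (g : ℕ) (τ : Equiv.Perm (Squares g)) : Prop :=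
  Sends τ 9 1 ∧ Sends τ 6 2 ∧ Sends τ 1 3 ∧ Sends τ 8 4 ∧ Sends τ 7 5 ∧ Sends τ 5 6 ∧
    Sends τ 4 7 ∧ PlacesPairs g 5 8 τ

/-- The generalised construction in even genus `g ≥ 4` with odd spin: the top row of `τ` starts
with `4 6 1 5 7`. -/
def IsEvenGenusOddSpin (g : ℕ) (τ : Equiv.Perm (Squares g)) : Prop :=
  Sends τ 4 1 ∧ Sends τ 6 2 ∧ Sends τ 1 3 ∧ Sends τ 5 4 ∧ Sends τ 7 5 ∧ PlacesPairs g 4 6 τ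

/-- The generalised construction in even genus `g ≥ 4` with even spin: the top row of `τ` starts
with `7 5 1 6 4`. -/
def IsEvenGenusEvenSpin (g : ℕ) (τ : Equiv.Perm (Squares g)) : Prop :=
  Sends τ 7 1 ∧ Sends τ 5 2 ∧ Sends τ 1 3 ∧ Sends τ 6 4 ∧ Sends τ 4 5 ∧ PlacesPairs g 4 6 τ

end

/-! Suppose that the origami $(\sigma,\tau)$ is a double cover of $(Y,q)$ with $\pi^*q=\omega^2$.
Exchanging the two points of a fibre is an involution off a finite set. It preserves $\omega^2$, so
in the projection to the torus $\mathbb C/\mathbb Z[i]$ it is locally $z\mapsto\pm z+c$, and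
connectedness makes the sign and the constant global (`exists_isFlatInvolution`, `exists_global`).
If two different squares share their lower left corner, the surface is branched over the origin of
the torus, and $c=0$ because it is unbranched elsewhere (`translation_eq_zero`). The involution then
permutes the squares by some $\rho$ with $\rho^2=1$, and either $\rho\ne1$ commutes with $\sigma$
and $\tau$, or $\sigma\rho\sigma=\rho$ and $\tau\rho\tau=\rho$
(`IsOrientationDoubleCover.exists_perm`).

The first case is impossible for $\sigma_g$, a cycle of odd length. In the second, $\rho$ is a
reflection $x\mapsto c-x$ modulo $2g-1$, which takes an entry $a\mapsto b$ of $\tau$ to the entry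
$c-b\mapsto c-a$ of the same displacement $b-a$. In families 1, 3, 4 and 5 the entry $1\mapsto3$ is
the only one of displacement $2$, so $c=4$; in families 3, 4 and 5 the reflection of one well chosen
entry then has a wrong value. In family 2 only $c=4$ and $c=2g$ survive, and the entry
$2g-1\mapsto2g-2$ excludes both.

The permutations of family 1 are the conjugates $BTB^{-1}$ of the one for the increasing order
(`amnPerm`), where $B$ permutes the $g-2$ pairs by some $e$. The reflection $R:x\mapsto4-x$ inverts
$T$. As $T$ is a single cycle when $g$ is odd, $R$ inverts $BTB^{-1}$ exactly when $B$ commutes with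
$R$, that is, when $e$ commutes with the reversal of the $g-2=2m+1$ pairs
(`amnPerm_mul_reflection_mul_iff`). The centraliser of the reversal, a product of $m$
transpositions, has $2^m\,m!=(2m)!!$ elements. The origamis are distinct because a conjugation
between two of them has to fix the only label of displacement $2$.

Conversely, an origami of family 1 has a single vertex (`IsAMNOdd.hasOneVertex`), a cone point of
angle $2\pi n$ with $n=2g-1$. An explicit atlas makes it a Riemann surface on which a symmetric
$\rho$ acts by half turns of the squares. In a chart of degree $d$ centred at a fixed point,
$(d\,z^{d-1}dz)^2$ equals $\tfrac{d^2}{4}u^{d-2}du^2$ with $u=z^2$. The vertex therefore gives a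
zero of order $2g-3$, and the fixed points at one square centre, one midpoint of a right side and
one midpoint of a top side give three simple poles. The genus $h$ of the quotient is read off from a
decomposition into half squares (`hasGenus_of_half_tiling`). -/

noncomputable section

/-! ### The torus -/

/-- The real torus `ℂ / ℤ[i]`. -/
abbrev Torus : Type := UnitAddCircle × UnitAddCircle

/-- The projection of the plane to the torus `ℂ / ℤ[i]`. -/
def toTorus : ℂ →+ Torus where
  toFun z := ((z.re : UnitAddCircle), (z.im : UnitAddCircle))
  map_zero' := by simp
  map_add' z w := by simp

theorem toTorus_apply (z : ℂ) :
    toTorus z = ((z.re : UnitAddCircle), (z.im : UnitAddCircle)) := rfl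

theorem continuous_toTorus : Continuous toTorus :=
  ((AddCircle.continuous_mk' 1).comp Complex.continuous_re).prodMk
    ((AddCircle.continuous_mk' 1).comp Complex.continuous_im)

theorem toTorus_eq_zero_iff {z : ℂ} :
    toTorus z = 0 ↔ (∃ a : ℤ, z.re = a) ∧ ∃ b : ℤ, z.im = b := by
  rw [toTorus_apply, Prod.mk_eq_zero, AddCircle.coe_eq_zero_iff, AddCircle.coe_eq_zero_iff]
  simp [eq_comm]

theorem toTorus_eq_iff {z w : ℂ} :
    toTorus z = toTorus w ↔ (∃ a : ℤ, z.re - w.re = a) ∧ ∃ b : ℤ, z.im - w.im = b := by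
  rw [← sub_eq_zero, ← map_sub, toTorus_eq_zero_iff]
  simp

theorem toTorus_eq_of_norm_lt {z w : ℂ} (h : toTorus z = toTorus w) (hre : |z.re - w.re| < 1)
    (him : |z.im - w.im| < 1) : z = w := by
  obtain ⟨⟨a, ha⟩, b, hb⟩ := toTorus_eq_iff.1 h
  rw [ha, ← Int.cast_abs] at hre
  rw [hb, ← Int.cast_abs] at him
  have h1 : a = 0 := Int.abs_lt_one_iff.1 (by exact_mod_cast hre)
  have h2 : b = 0 := Int.abs_lt_one_iff.1 (by exact_mod_cast him)
  subst h1 h2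
  apply Complex.ext
  · simpa [sub_eq_zero] using ha
  · simpa [sub_eq_zero] using hb

@[simp] theorem toTorus_one : toTorus 1 = 0 := toTorus_eq_zero_iff.2 ⟨⟨1, by simp⟩, 0, by simp⟩

@[simp] theorem toTorus_I : toTorus Complex.I = 0 :=
  toTorus_eq_zero_iff.2 ⟨⟨0, by simp⟩, 1, by simp⟩

/-! ### Unit squares and the equivalence relation generated by the gluing. -/

namespace Origami

variable {ι : Type}

theorem isCompact_closedSquare : IsCompact closedSquare := by
  have : closedSquare = Set.Icc (0 : ℝ) 1 ×ℂ Set.Icc (0 : ℝ) 1 := by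
    ext z; simp [closedSquare, Complex.mem_reProdIm, and_assoc]
  rw [this]
  exact isCompact_Icc.reProdIm isCompact_Icc

theorem isOpen_openSquare : IsOpen openSquare := by
  have : openSquare = Set.Ioo (0 : ℝ) 1 ×ℂ Set.Ioo (0 : ℝ) 1 := by
    ext z; simp [openSquare, Complex.mem_reProdIm, and_assoc]
  rw [this]
  exact isOpen_Ioo.reProdIm isOpen_Ioo

theorem isOpen_rectangle (a b : ℝ) : IsOpen {d : ℂ | |d.re| < a ∧ |d.im| < b} :=
  (isOpen_lt Complex.continuous_re.abs continuous_const).inter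
    (isOpen_lt Complex.continuous_im.abs continuous_const)

theorem openSquare_subset : openSquare ⊆ closedSquare :=
  fun _ h => ⟨h.1.le, h.2.1.le, h.2.2.1.le, h.2.2.2.le⟩

/-- The corners of the unit square. -/
def IsCorner (z : ℂ) : Prop := (z.re = 0 ∨ z.re = 1) ∧ (z.im = 0 ∨ z.im = 1)

theorem Glue.toTorus_eq {O : Origami ι} {a b : ι × ℂ} (h : O.Glue a b) :
    toTorus a.2 = toTorus b.2 := by
  cases h <;> simp

theorem Glue.mem_closedSquare {O : Origami ι} {a b : ι × ℂ} (h : O.Glue a b) :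
    a.2 ∈ closedSquare ∧ b.2 ∈ closedSquare := by
  cases h <;> simp_all [closedSquare]

theorem eqvGen_toTorus {O : Origami ι} {a b : ι × ℂ} (h : Relation.EqvGen O.Glue a b) :
    toTorus a.2 = toTorus b.2 := by
  induction h with
  | rel _ _ h => exact h.toTorus_eq
  | refl => rfl
  | symm _ _ _ ih => exact ih.symm
  | trans _ _ _ _ _ h1 h2 => exact h1.trans h2

theorem eqvGen_map {O : Origami ι} {β : Type*} {f : ι × ℂ → β} (hf : ∀ a b, O.Glue a b → f a = f b)
    {a b : ι × ℂ} (h : Relation.EqvGen O.Glue a b) : f a = f b := by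
  induction h with
  | rel _ _ h => exact hf _ _ h
  | refl => rfl
  | symm _ _ _ ih => exact ih.symm
  | trans _ _ _ _ _ h1 h2 => exact h1.trans h2

open Classical in
/-- The normal form of a point of a square: corners are forgotten, points on the right side and on
the top side are moved to the adjacent square. -/
def nf (O : Origami ι) (a : ι × ℂ) : Option (ι × ℂ) :=
  if IsCorner a.2 then none else
    if a.2.re = 1 then some (O.right a.1, a.2 - 1) else
      if a.2.im = 1 then some (O.top a.1, a.2 - Complex.I) else some a

theorem nf_eq_of_glue {O : Origami ι} {a b : ι × ℂ} (h : O.Glue a b) : O.nf a = O.nf b := by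
  cases h with
  | horizontal i t h0 h1 =>
    by_cases ht : t = 0 ∨ t = 1
    · rcases ht with rfl | rfl <;> simp [nf, IsCorner]
    · push Not at ht
      simp [nf, IsCorner, ht]
  | vertical i t h0 h1 =>
    by_cases ht : t = 0 ∨ t = 1
    · rcases ht with rfl | rfl <;> simp [nf, IsCorner]
    · push Not at ht
      simp [nf, IsCorner, ht]

theorem glue_right {O : Origami ι} {i : ι} {z : ℂ} (hz : z ∈ closedSquare) (h : z.re = 1) :
    O.Glue (i, z) (O.right i, z - 1) := by
  have := Glue.horizontal (O := O) i z.im hz.2.2.1 hz.2.2.2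
  have e : z = 1 + z.im * Complex.I := by apply Complex.ext <;> simp [h]
  have e' : z - 1 = z.im * Complex.I := by apply Complex.ext <;> simp [h]
  rwa [← e, ← e'] at this

theorem glue_top {O : Origami ι} {i : ι} {z : ℂ} (hz : z ∈ closedSquare) (h : z.im = 1) :
    O.Glue (i, z) (O.top i, z - Complex.I) := by
  have := Glue.vertical (O := O) i z.re hz.1 hz.2.1
  have e : z = z.re + Complex.I := by apply Complex.ext <;> simp [h]
  have e' : z - Complex.I = z.re := by apply Complex.ext <;> simp [h]
  rwa [← e, ← e'] at this

theorem eqvGen_of_nf {O : Origami ι} {i : ι} {z : ℂ} (hz : z ∈ closedSquare) {b : ι × ℂ}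
    (h : O.nf (i, z) = some b) : Relation.EqvGen O.Glue (i, z) b := by
  unfold nf at h
  split_ifs at h with h1 h2 h3
  · rw [← Option.some.inj h]
    exact .rel _ _ (glue_right hz h2)
  · rw [← Option.some.inj h]
    exact .rel _ _ (glue_top hz h3)
  · rw [← Option.some.inj h]
    exact .refl _

theorem nf_eq_none {O : Origami ι} {a : ι × ℂ} : O.nf a = none ↔ IsCorner a.2 := by
  unfold nf
  split_ifs with h1 h2 h3 <;> simp [h1]

/-- Away from the corners a class has a unique representative in the half-open square, which `nf`
selects. Corners must be excluded: all of them have normal form `none`, although they may represent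
different vertices. -/
theorem eqvGen_iff_nf {O : Origami ι} {i j : ι} {z w : ℂ} (hz : z ∈ closedSquare)
    (hw : w ∈ closedSquare) (hc : ¬ IsCorner z) :
    Relation.EqvGen O.Glue (i, z) (j, w) ↔ O.nf (i, z) = O.nf (j, w) := by
  refine ⟨eqvGen_map fun _ _ => nf_eq_of_glue, fun h => ?_⟩
  obtain ⟨b, hb⟩ := Option.ne_none_iff_exists'.1 (mt nf_eq_none.1 hc : O.nf (i, z) ≠ none)
  exact (eqvGen_of_nf hz hb).trans _ _ _ (.symm _ _ (eqvGen_of_nf hw (h ▸ hb)))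

theorem nf_of_mem_openSquare {O : Origami ι} {i : ι} {z : ℂ} (hz : z ∈ openSquare) :
    O.nf (i, z) = some (i, z) := by
  obtain ⟨h1, h2, h3, h4⟩ := hz
  simp [nf, IsCorner, h1.ne', h2.ne, h4.ne]

/-- A topological space obtained by gluing unit squares according to `O`. -/
structure IsTopTiling (O : Origami ι) {X : Type*} [TopologicalSpace X] (P : ι → ℂ → X) : Prop where
  continuousOn : ∀ i, ContinuousOn (P i) closedSquare
  surjective : ∀ x : X, ∃ i, ∃ z ∈ closedSquare, P i z = x
  eq_iff : ∀ i j, ∀ z ∈ closedSquare, ∀ w ∈ closedSquare,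
    P i z = P j w ↔ Relation.EqvGen O.Glue (i, z) (j, w)

theorem IsTiling.isTopTiling {O : Origami ι} {X : ClosedRiemannSurface} {α : AbelianDifferential X}
    {P : ι → ℂ → X} (h : O.IsTiling α P) : O.IsTopTiling P :=
  ⟨h.continuousOn, h.surjective, h.eq_iff⟩

/-! ### Square-tiled spaces: the projection to the torus and the charts. -/

namespace IsTopTiling

variable {O : Origami ι} {X : Type*} [TopologicalSpace X] {P : ι → ℂ → X}

theorem eq_iff_nf (hP : O.IsTopTiling P) {i j : ι} {z w : ℂ} (hz : z ∈ closedSquare)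
    (hw : w ∈ closedSquare) (hc : ¬ IsCorner z) : P i z = P j w ↔ O.nf (i, z) = O.nf (j, w) := by
  rw [hP.eq_iff i j z hz w hw, eqvGen_iff_nf hz hw hc]

theorem eq_right (hP : O.IsTopTiling P) {i : ι} {z : ℂ} (hz : z ∈ closedSquare) (h : z.re = 1) :
    P i z = P (O.right i) (z - 1) :=
  (hP.eq_iff _ _ _ hz _ (glue_right (O := O) (i := i) hz h).mem_closedSquare.2).2
    (.rel _ _ (glue_right hz h))

theorem eq_top (hP : O.IsTopTiling P) {i : ι} {z : ℂ} (hz : z ∈ closedSquare) (h : z.im = 1) :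
    P i z = P (O.top i) (z - Complex.I) :=
  (hP.eq_iff _ _ _ hz _ (glue_top (O := O) (i := i) hz h).mem_closedSquare.2).2
    (.rel _ _ (glue_top hz h))

/-- The projection of a square-tiled surface to the torus. -/
def proj (hP : O.IsTopTiling P) (x : X) : Torus := toTorus (hP.surjective x).choose_spec.choose

theorem proj_apply (hP : O.IsTopTiling P) {i : ι} {z : ℂ} (hz : z ∈ closedSquare) :
    hP.proj (P i z) = toTorus z := by
  have h := (hP.surjective (P i z)).choose_spec.choose_spec
  exact eqvGen_toTorus ((hP.eq_iff _ _ _ h.1 _ hz).1 h.2)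

variable [T2Space X] [Finite ι]

/-- Compactness of the squares and the Hausdorff property force `X` to carry the quotient topology,
which `IsTopTiling` does not postulate. Continuity statements about `X` are reduced to the squares
through this lemma. -/
theorem isClosed_iUnion_image (hP : O.IsTopTiling P) {A : ι → Set ℂ}
    (hA : ∀ i, IsClosed (A i)) (hs : ∀ i, A i ⊆ closedSquare) : IsClosed (⋃ i, P i '' A i) :=
  isClosed_iUnion_of_finite fun i => ((isCompact_closedSquare.of_isClosed_subset (hA i)
    (hs i)).image_of_continuousOn ((hP.continuousOn i).mono (hs i))).isClosed

theorem continuous_of_comp (hP : O.IsTopTiling P) {Y : Type*} [TopologicalSpace Y] {f : X → Y}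
    (hf : ∀ i, ContinuousOn (fun z => f (P i z)) closedSquare) : Continuous f := by
  rw [continuous_iff_isClosed]
  intro C hC
  have := hP.isClosed_iUnion_image (A := fun i => closedSquare ∩ (fun z => f (P i z)) ⁻¹' C)
    (fun i => (hf i).preimage_isClosed_of_isClosed isCompact_closedSquare.isClosed hC)
    (fun i => Set.inter_subset_left)
  convert this using 1
  ext x
  obtain ⟨i, z, hz, rfl⟩ := hP.surjective x
  simp only [Set.mem_preimage, Set.mem_iUnion, Set.mem_image, Set.mem_inter_iff]
  constructor
  · intro hx
    exact ⟨i, z, ⟨hz, hx⟩, rfl⟩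
  · rintro ⟨j, w, ⟨_, hw⟩, e⟩
    rwa [← e]

theorem continuous_proj (hP : O.IsTopTiling P) : Continuous hP.proj :=
  hP.continuous_of_comp fun _ => continuous_toTorus.continuousOn.congr fun _ hz => hP.proj_apply hz

/-- Points near `x` lie, in every square, near the points that represent `x`. -/
theorem eventually_of_forall_fiber (hP : O.IsTopTiling P) {x : X} {p : X → Prop}
    (h : ∀ i, ∀ z ∈ closedSquare, P i z = x → ∀ᶠ w in 𝓝[closedSquare] z, p (P i w)) :
    ∀ᶠ y in 𝓝 x, p y := by
  let V : ι → Set ℂ := fun i => interior {w | w ∈ closedSquare → p (P i w)}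
  have hcl := hP.isClosed_iUnion_image (A := fun i => closedSquare \ V i)
    (fun i => isCompact_closedSquare.isClosed.sdiff isOpen_interior) (fun i => Set.sdiff_subset)
  have hx : x ∈ (⋃ i, P i '' (closedSquare \ V i))ᶜ := by
    simp only [Set.mem_compl_iff, Set.mem_iUnion, Set.mem_image, not_exists, not_and]
    rintro i z ⟨hz, hzV⟩ e
    apply hzV
    rw [mem_interior_iff_mem_nhds]
    exact eventually_nhdsWithin_iff.1 (h i z hz e)
  filter_upwards [hcl.isOpen_compl.mem_nhds hx] with y hy
  obtain ⟨i, z, hz, rfl⟩ := hP.surjective y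
  by_contra hp
  refine hy (Set.mem_iUnion.2 ⟨i, z, ⟨hz, fun hzV => hp (interior_subset hzV hz)⟩, rfl⟩)

/-- A chart of a square-tiled surface, described by a function on the squares. -/
theorem exists_chart [Nonempty ι] (hP : O.IsTopTiling P) (f : ι → ℂ → ℂ) (K W : ι → Set ℂ)
    (D : Set ℂ)
    (hD : IsOpen D) (hK : ∀ i, IsClosed (K i)) (hKs : ∀ i, K i ⊆ closedSquare)
    (hWK : ∀ i, W i ⊆ K i) (hW : ∀ i, IsClosed (closedSquare \ W i))
    (hf : ∀ i, ContinuousOn (f i) (K i))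
    (hinj : ∀ i, ∀ z ∈ W i, ∀ j, ∀ w ∈ closedSquare, P i z = P j w ↔ w ∈ W j ∧ f i z = f j w)
    (hfD : ∀ i, ∀ z ∈ K i, f i z ∈ D ↔ z ∈ W i) (hsurj : ∀ d ∈ D, ∃ i, ∃ z ∈ W i, f i z = d) :
    ∃ e : OpenPartialHomeomorph X ℂ,
      (∀ i, ∀ z ∈ closedSquare, P i z ∈ e.source ↔ z ∈ W i) ∧ e.target = D ∧
      ∀ i, ∀ z ∈ W i, e (P i z) = f i z := by
  classical
  have hU : IsOpen (⋃ i, P i '' W i) := by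
    have := hP.isClosed_iUnion_image hW (fun i => Set.sdiff_subset)
    rw [← isOpen_compl_iff] at this
    convert this using 1
    ext x
    obtain ⟨i, z, hz, rfl⟩ := hP.surjective x
    simp only [Set.mem_compl_iff, Set.mem_iUnion, Set.mem_image, not_exists, not_and]
    constructor
    · rintro ⟨j, w, hw, e⟩ k u ⟨hu, hu'⟩ e'
      exact hu' ((hinj j w hw k u hu).1 (e.trans e'.symm)).1
    · intro H
      by_cases hzW : z ∈ W i
      · exact ⟨i, z, hzW, rfl⟩
      · exact absurd rfl (H i z ⟨hz, hzW⟩)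
  let F : X → ℂ := fun x => if h : ∃ i, ∃ z ∈ W i, P i z = x then f h.choose h.choose_spec.choose
    else 0
  have hF : ∀ i, ∀ z ∈ W i, F (P i z) = f i z := by
    intro i z hz
    have h : ∃ j, ∃ w ∈ W j, P j w = P i z := ⟨i, z, hz, rfl⟩
    have e : F (P i z) = f h.choose h.choose_spec.choose := dif_pos h
    rw [e]
    have := h.choose_spec.choose_spec
    exact ((hinj _ _ this.1 i z (hKs _ (hWK _ hz))).1 this.2).2
  choose! J w hw hJ using hsurj
  let G : ℂ → X := fun d => P (J d) (w d)
  have hFG : ∀ d ∈ D, F (G d) = d := fun d hd => (hF _ _ (hw d hd)).trans (hJ d hd)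
  have hGF : ∀ i, ∀ z ∈ W i, G (f i z) = P i z := by
    intro i z hz
    have hd := (hfD i z (hWK i hz)).2 hz
    exact ((hinj i z hz _ _ (hKs _ (hWK _ (hw _ hd)))).2 ⟨hw _ hd, (hJ _ hd).symm⟩).symm
  refine ⟨{ toFun := F, invFun := G, source := ⋃ i, P i '' W i, target := D,
            map_source' := ?_, map_target' := ?_, left_inv' := ?_, right_inv' := ?_,
            open_source := hU, open_target := hD, continuousOn_toFun := ?_,
            continuousOn_invFun := ?_ }, ?_, rfl, hF⟩
  · rintro x hx
    simp only [Set.mem_iUnion, Set.mem_image] at hx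
    obtain ⟨i, z, hz, rfl⟩ := hx
    rw [hF i z hz]
    exact (hfD i z (hWK i hz)).2 hz
  · intro d hd
    exact Set.mem_iUnion.2 ⟨J d, w d, hw d hd, rfl⟩
  · rintro x hx
    simp only [Set.mem_iUnion, Set.mem_image] at hx
    obtain ⟨i, z, hz, rfl⟩ := hx
    rw [hF i z hz, hGF i z hz]
  · exact hFG
  · intro x hx
    refine ContinuousAt.continuousWithinAt ?_
    rw [ContinuousAt, Filter.tendsto_def]
    intro N hN
    refine hP.eventually_of_forall_fiber (p := fun y => y ∈ F ⁻¹' N) fun i z hz e => ?_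
    have hzW : z ∈ W i := by
      simp only [Set.mem_iUnion, Set.mem_image] at hx
      obtain ⟨j, u, hu, e'⟩ := hx
      exact ((hinj j u hu i z hz).1 (e'.trans e.symm)).1
    have hWn : W i ∈ 𝓝[closedSquare] z := by
      have := (hW i).isOpen_compl.mem_nhds (x := z) (by simp [hzW])
      filter_upwards [nhdsWithin_le_nhds this, self_mem_nhdsWithin] with u hu hu'
      simpa [hu'] using hu
    have hc := (hf i z (hWK i hzW)).mono (hWK i)
    have hc' : Filter.Tendsto (f i) (𝓝[closedSquare] z) (𝓝 (f i z)) :=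
      hc.tendsto.mono_left (nhdsWithin_le_of_mem hWn)
    rw [← e, hF i z hzW] at hN
    filter_upwards [hc' hN, hWn] with u hu huW
    rw [Set.mem_preimage, hF i u huW]
    exact hu
  -- The inverse is continuous because `f i` is a closed map on the compact set `K i`, which
  -- contains `W i`; by `hfD` the additional points of `K i` have values outside `D`.
  · rw [continuousOn_iff_isClosed]
    intro C hC
    refine ⟨⋃ i, f i '' (K i ∩ P i ⁻¹' C), isClosed_iUnion_of_finite fun i => ?_, ?_⟩
    · have hc : IsClosed (K i ∩ P i ⁻¹' C) :=
        ((hP.continuousOn i).mono (hKs i)).preimage_isClosed_of_isClosed (hK i) hC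
      exact ((isCompact_closedSquare.of_isClosed_subset hc (Set.inter_subset_left.trans
        (hKs i))).image_of_continuousOn ((hf i).mono Set.inter_subset_left)).isClosed
    · ext d
      constructor
      · rintro ⟨hdC, hd⟩
        refine ⟨Set.mem_iUnion.2 ⟨J d, w d, ⟨hWK _ (hw d hd), hdC⟩, hJ d hd⟩, hd⟩
      · rintro ⟨hd, hdD⟩
        simp only [Set.mem_iUnion, Set.mem_image] at hd
        obtain ⟨i, z, ⟨hzK, hzC⟩, rfl⟩ := hd
        refine ⟨?_, hdD⟩
        rw [Set.mem_preimage, hGF i z ((hfD i z hzK).1 hdD)]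
        exact hzC
  · intro i z hz
    simp only [Set.mem_iUnion, Set.mem_image]
    constructor
    · rintro ⟨j, w, hw, e⟩
      exact ((hinj j w hw i z hz).1 e).1
    · exact fun h => ⟨i, z, h, rfl⟩

/-- The centre of a square, of its right side and of its top side are the origins of three kinds of
charts: the interior of a square, a neighbourhood of its right side without the end points, and a
neighbourhood of its top side without the end points. -/
theorem exists_faceChart (hP : O.IsTopTiling P) (i₀ : ι) :
    ∃ e : OpenPartialHomeomorph X ℂ,
      (∀ k, ∀ z ∈ closedSquare, P k z ∈ e.source ↔ k = i₀ ∧ z ∈ openSquare) ∧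
      e.target = {d : ℂ | |d.re| < 1 / 2 ∧ |d.im| < 1 / 2} ∧
      ∀ z ∈ openSquare, e (P i₀ z) = z - (1 / 2 + Complex.I / 2) := by
  have : Nonempty ι := ⟨i₀⟩
  suffices H : ∃ e : OpenPartialHomeomorph X ℂ,
      (∀ i, ∀ z ∈ closedSquare, P i z ∈ e.source ↔ z ∈ {z | i = i₀ ∧ z ∈ openSquare}) ∧
      e.target = {d : ℂ | |d.re| < 1 / 2 ∧ |d.im| < 1 / 2} ∧
      ∀ i, ∀ z ∈ {z | i = i₀ ∧ z ∈ openSquare}, e (P i z) = z - (1 / 2 + Complex.I / 2) by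
    obtain ⟨e, h1, h2, h3⟩ := H
    exact ⟨e, h1, h2, fun z hz => h3 i₀ z ⟨rfl, hz⟩⟩
  refine hP.exists_chart (fun _ z => z - (1 / 2 + Complex.I / 2))
    (fun i => {z | i = i₀ ∧ z ∈ closedSquare}) (fun i => {z | i = i₀ ∧ z ∈ openSquare})
    {d : ℂ | |d.re| < 1 / 2 ∧ |d.im| < 1 / 2}
    (isOpen_rectangle _ _)
    (fun i => isClosed_const.inter isCompact_closedSquare.isClosed) (fun i z hz => hz.2)
    (fun i z hz => ⟨hz.1, openSquare_subset hz.2⟩)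
    (fun i => isCompact_closedSquare.isClosed.sdiff (isOpen_const.inter isOpen_openSquare))
    (fun i => by fun_prop) ?_ ?_ ?_
  · rintro i z ⟨rfl, hz⟩ j w hw
    have hc : ¬ IsCorner z := fun h => by
      rcases h.1 with h | h
      · exact hz.1.ne' h
      · exact hz.2.1.ne h
    rw [hP.eq_iff_nf (openSquare_subset hz) hw hc, nf_of_mem_openSquare hz]
    constructor
    · intro h
      have hi : Option.elim (O.nf (j, w)) False (fun a => a.2 ∈ openSquare) := by
        rw [← h]; exact hz
      unfold nf at h hi
      split_ifs at h hi with c1 c2 c3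
      · simp [openSquare] at hi
        exact absurd hi.1 (not_lt.2 hw.2.1)
      · simp [openSquare] at hi
        exact absurd hi.2.2.1 (not_lt.2 hw.2.2.2)
      · obtain ⟨rfl, rfl⟩ := Prod.mk.inj (Option.some.inj h)
        exact ⟨⟨rfl, hz⟩, rfl⟩
    · rintro ⟨⟨rfl, hw⟩, e⟩
      rw [sub_left_inj] at e
      rw [nf_of_mem_openSquare hw, e]
  · rintro i z ⟨rfl, hz⟩
    simp only [openSquare, Set.mem_ofPred_eq, abs_lt, true_and]
    constructor
    · rintro ⟨⟨a, b⟩, c, d⟩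
      simp at a b c d
      refine ⟨?_, ?_, ?_, ?_⟩ <;> linarith
    · rintro ⟨a, b, c, d⟩
      simp
      refine ⟨⟨?_, ?_⟩, ?_, ?_⟩ <;> linarith
  · rintro d ⟨h1, h2⟩
    rw [abs_lt] at h1 h2
    refine ⟨i₀, d + (1 / 2 + Complex.I / 2), ⟨rfl, ?_⟩, by simp⟩
    refine ⟨?_, ?_, ?_, ?_⟩ <;> simp <;> linarith

/-- The part of the square `k` in the chart around the right side of the square `i₀`. -/
def rightNhd (O : Origami ι) (i₀ k : ι) : Set ℂ :=
  {z | ((k = i₀ ∧ 3 / 4 < z.re ∧ z.re ≤ 1) ∨ (k = O.right i₀ ∧ 0 ≤ z.re ∧ z.re < 1 / 4)) ∧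
    0 < z.im ∧ z.im < 1}

/-- The part of the square `k` in the chart around the top side of the square `i₀`. -/
def topNhd (O : Origami ι) (i₀ k : ι) : Set ℂ :=
  {z | ((k = i₀ ∧ 3 / 4 < z.im ∧ z.im ≤ 1) ∨ (k = O.top i₀ ∧ 0 ≤ z.im ∧ z.im < 1 / 4)) ∧
    0 < z.re ∧ z.re < 1}

open Classical in
/-- The coordinate of the chart around the right side of a square. -/
def rightCoord (z : ℂ) : ℂ :=
  if 1 / 2 < z.re then z - (1 + Complex.I / 2) else z - Complex.I / 2

open Classical in
/-- The coordinate of the chart around the top side of a square. -/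
def topCoord (z : ℂ) : ℂ :=
  if 1 / 2 < z.im then z - (1 / 2 + Complex.I) else z - 1 / 2

theorem exists_rightChart (hP : O.IsTopTiling P) (i₀ : ι) :
    ∃ e : OpenPartialHomeomorph X ℂ,
      (∀ k, ∀ z ∈ closedSquare, P k z ∈ e.source ↔ z ∈ rightNhd O i₀ k) ∧
      e.target = {d : ℂ | |d.re| < 1 / 4 ∧ |d.im| < 1 / 2} ∧
      ∀ k, ∀ z ∈ rightNhd O i₀ k, e (P k z) = rightCoord z := by
  have hs : ∀ k, rightNhd O i₀ k ⊆ closedSquare := by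
    rintro k z ⟨⟨h1, h2, h3⟩ | ⟨h1, h2, h3⟩, h4, h5⟩ <;> refine ⟨?_, ?_, ?_, ?_⟩ <;> linarith
  have : Nonempty ι := ⟨i₀⟩
  refine hP.exists_chart (fun _ => rightCoord)
    (fun k => {z | z ∈ closedSquare ∧ ((k = i₀ ∧ 3 / 4 ≤ z.re) ∨ (k = O.right i₀ ∧ z.re ≤ 1 / 4))})
    (rightNhd O i₀) {d : ℂ | |d.re| < 1 / 4 ∧ |d.im| < 1 / 2}
    (isOpen_rectangle _ _)
    (fun k => isCompact_closedSquare.isClosed.inter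
      ((isClosed_const.inter (isClosed_le continuous_const Complex.continuous_re)).union
        (isClosed_const.inter (isClosed_le Complex.continuous_re continuous_const))))
          (fun k z hz => hz.1)
    ?_ ?_ ?_ ?_ ?_ ?_
  · rintro k z hz
    refine ⟨hs k hz, ?_⟩
    obtain ⟨⟨h1, h2, h3⟩ | ⟨h1, h2, h3⟩, h4, h5⟩ := hz
    · exact .inl ⟨h1, h2.le⟩
    · exact .inr ⟨h1, h3.le⟩
  · intro k
    have : closedSquare \ rightNhd O i₀ k = closedSquare \
        {z | ((k = i₀ ∧ 3 / 4 < z.re) ∨ (k = O.right i₀ ∧ z.re < 1 / 4)) ∧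
          0 < z.im ∧ z.im < 1} := by
      ext z
      simp only [rightNhd, closedSquare, Set.mem_sdiff, Set.mem_ofPred_eq]
      tauto
    rw [this]
    refine isCompact_closedSquare.isClosed.sdiff ?_
    exact ((isOpen_const.inter (isOpen_lt continuous_const Complex.continuous_re)).union
        (isOpen_const.inter (isOpen_lt Complex.continuous_re continuous_const))).inter
        ((isOpen_lt continuous_const Complex.continuous_im).inter
          (isOpen_lt Complex.continuous_im continuous_const))
  · intro k z hz
    refine ContinuousAt.continuousWithinAt ?_
    have hz' : z.re < 1 / 2 ∨ 1 / 2 < z.re := by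
      rcases hz.2 with h | h
      · right; linarith [h.2]
      · left; linarith [h.2]
    rcases hz' with h | h
    · have : ContinuousAt (fun z : ℂ => z - Complex.I / 2) z := by fun_prop
      refine this.congr ?_
      filter_upwards [(isOpen_lt Complex.continuous_re continuous_const).mem_nhds h] with w hw
      exact (if_neg (not_lt.2 (le_of_lt hw))).symm
    · have : ContinuousAt (fun z : ℂ => z - (1 + Complex.I / 2)) z := by fun_prop
      refine this.congr ?_
      filter_upwards [(isOpen_lt continuous_const Complex.continuous_re).mem_nhds h] with w hw
      exact (if_pos hw).symm
  · intro k z hz j w hw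
    constructor
    · intro h
      rw [hP.eq_iff _ _ _ (hs k hz) _ hw] at h
      classical
      have := eqvGen_map (f := fun a => if a.2 ∈ rightNhd O i₀ a.1 then some (rightCoord a.2)
        else none) ?_ h
      · simp only [if_pos hz] at this
        by_cases hw' : w ∈ rightNhd O i₀ j
        · rw [if_pos hw'] at this
          exact ⟨hw', Option.some.inj this⟩
        · rw [if_neg hw'] at this
          exact absurd this (by simp)
      · rintro _ _ (⟨i, t, h0, h1⟩ | ⟨i, t, h0, h1⟩)
        · have e1 : (1 + t * Complex.I ∈ rightNhd O i₀ i) ↔ i = i₀ ∧ 0 < t ∧ t < 1 := by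
            simp [rightNhd]; norm_num
          have e2 : ((t : ℂ) * Complex.I ∈ rightNhd O i₀ (O.right i)) ↔ i = i₀ ∧ 0 < t ∧ t < 1 := by
            simp [rightNhd]; norm_num
          have e3 : rightCoord (1 + t * Complex.I) = rightCoord ((t : ℂ) * Complex.I) := by
            simp [rightCoord]; norm_num
          simp only [e1, e2, e3]
        · have e1 : ¬ (t + Complex.I ∈ rightNhd O i₀ i) := by simp [rightNhd]
          have e2 : ¬ ((t : ℂ) ∈ rightNhd O i₀ (O.top i)) := by simp [rightNhd]
          simp only [e1, e2, if_false]
    · rintro ⟨hw', h⟩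
      have hz' := hz
      obtain ⟨⟨a1, a2, a3⟩ | ⟨a1, a2, a3⟩, a4, a5⟩ := hz' <;>
        obtain ⟨⟨b1, b2, b3⟩ | ⟨b1, b2, b3⟩, b4, b5⟩ := hw'
      · rw [rightCoord, rightCoord, if_pos (by linarith), if_pos (by linarith), sub_left_inj] at h
        rw [h, a1, b1]
      · rw [rightCoord, rightCoord, if_pos (by linarith), if_neg (by linarith)] at h
        have e : w = z - 1 := by linear_combination -h
        have : z.re = 1 := by
          have := congrArg Complex.re e
          simp at this
          linarith
        rw [hP.eq_right (hs k hz) this, e, a1, b1]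
      · rw [rightCoord, rightCoord, if_neg (by linarith), if_pos (by linarith)] at h
        have e : z = w - 1 := by linear_combination h
        have : w.re = 1 := by
          have := congrArg Complex.re e
          simp at this
          linarith
        rw [hP.eq_right hw this, e, a1, b1]
      · rw [rightCoord, rightCoord, if_neg (by linarith), if_neg (by linarith), sub_left_inj] at h
        rw [h, a1, b1]
  · rintro k z ⟨⟨h1, h2, h3, h4⟩, h⟩
    simp only [rightNhd, Set.mem_ofPred_eq, abs_lt]
    by_cases hz : 1 / 2 < z.re
    · have : ¬ z.re < 1 / 4 := by linarith
      have h' : k = i₀ := by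
        rcases h with h | h
        · exact h.1
        · linarith [h.2]
      simp only [rightCoord, if_pos hz, this, and_false, or_false]
      simp [h']
      constructor
      · rintro ⟨⟨a, b⟩, c, d⟩
        refine ⟨⟨?_, ?_⟩, ?_, ?_⟩ <;> linarith
      · rintro ⟨⟨a, b⟩, c, d⟩
        refine ⟨⟨?_, ?_⟩, ?_, ?_⟩ <;> linarith
    · have : ¬ 3 / 4 < z.re := by linarith
      have h' : k = O.right i₀ := by
        rcases h with h | h
        · linarith [h.2]
        · exact h.1
      simp only [rightCoord, if_neg hz, this, false_and, and_false, false_or]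
      simp [h']
      constructor
      · rintro ⟨⟨a, b⟩, c, d⟩
        refine ⟨⟨?_, ?_⟩, ?_, ?_⟩ <;> linarith
      · rintro ⟨⟨a, b⟩, c, d⟩
        refine ⟨⟨?_, ?_⟩, ?_, ?_⟩ <;> linarith
  · rintro d ⟨h1, h2⟩
    rw [abs_lt] at h1 h2
    rcases le_or_gt d.re 0 with h | h
    · refine ⟨i₀, d + (1 + Complex.I / 2), ⟨.inl ⟨rfl, ?_, ?_⟩, ?_, ?_⟩, ?_⟩
      · simp; linarith
      · simp; linarith
      · simp; linarith
      · simp; linarith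
      · rw [rightCoord, if_pos (by simp; linarith)]; simp
    · refine ⟨O.right i₀, d + Complex.I / 2, ⟨.inr ⟨rfl, ?_, ?_⟩, ?_, ?_⟩, ?_⟩
      · simp; linarith
      · simp; linarith
      · simp; linarith
      · simp; linarith
      · rw [rightCoord, if_neg (by simp; linarith)]; simp

theorem exists_topChart (hP : O.IsTopTiling P) (i₀ : ι) :
    ∃ e : OpenPartialHomeomorph X ℂ,
      (∀ k, ∀ z ∈ closedSquare, P k z ∈ e.source ↔ z ∈ topNhd O i₀ k) ∧
      e.target = {d : ℂ | |d.im| < 1 / 4 ∧ |d.re| < 1 / 2} ∧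
      ∀ k, ∀ z ∈ topNhd O i₀ k, e (P k z) = topCoord z := by
  have hs : ∀ k, topNhd O i₀ k ⊆ closedSquare := by
    rintro k z ⟨⟨h1, h2, h3⟩ | ⟨h1, h2, h3⟩, h4, h5⟩ <;> refine ⟨?_, ?_, ?_, ?_⟩ <;> linarith
  have : Nonempty ι := ⟨i₀⟩
  refine hP.exists_chart (fun _ => topCoord)
    (fun k => {z | z ∈ closedSquare ∧ ((k = i₀ ∧ 3 / 4 ≤ z.im) ∨ (k = O.top i₀ ∧ z.im ≤ 1 / 4))})
    (topNhd O i₀) {d : ℂ | |d.im| < 1 / 4 ∧ |d.re| < 1 / 2}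
    (by simpa only [and_comm] using isOpen_rectangle (1 / 2) (1 / 4))
    (fun k => isCompact_closedSquare.isClosed.inter
      ((isClosed_const.inter (isClosed_le continuous_const Complex.continuous_im)).union
        (isClosed_const.inter (isClosed_le Complex.continuous_im continuous_const))))
          (fun k z hz => hz.1)
    ?_ ?_ ?_ ?_ ?_ ?_
  · rintro k z hz
    refine ⟨hs k hz, ?_⟩
    obtain ⟨⟨h1, h2, h3⟩ | ⟨h1, h2, h3⟩, h4, h5⟩ := hz
    · exact .inl ⟨h1, h2.le⟩
    · exact .inr ⟨h1, h3.le⟩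
  · intro k
    have : closedSquare \ topNhd O i₀ k = closedSquare \
        {z | ((k = i₀ ∧ 3 / 4 < z.im) ∨ (k = O.top i₀ ∧ z.im < 1 / 4)) ∧
          0 < z.re ∧ z.re < 1} := by
      ext z
      simp only [topNhd, closedSquare, Set.mem_sdiff, Set.mem_ofPred_eq]
      tauto
    rw [this]
    refine isCompact_closedSquare.isClosed.sdiff ?_
    exact ((isOpen_const.inter (isOpen_lt continuous_const Complex.continuous_im)).union
        (isOpen_const.inter (isOpen_lt Complex.continuous_im continuous_const))).inter
        ((isOpen_lt continuous_const Complex.continuous_re).inter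
          (isOpen_lt Complex.continuous_re continuous_const))
  · intro k z hz
    refine ContinuousAt.continuousWithinAt ?_
    have hz' : z.im < 1 / 2 ∨ 1 / 2 < z.im := by
      rcases hz.2 with h | h
      · right; linarith [h.2]
      · left; linarith [h.2]
    rcases hz' with h | h
    · have : ContinuousAt (fun z : ℂ => z - (1 / 2)) z := by fun_prop
      refine this.congr ?_
      filter_upwards [(isOpen_lt Complex.continuous_im continuous_const).mem_nhds h] with w hw
      exact (if_neg (not_lt.2 (le_of_lt hw))).symm
    · have : ContinuousAt (fun z : ℂ => z - (1 / 2 + Complex.I)) z := by fun_prop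
      refine this.congr ?_
      filter_upwards [(isOpen_lt continuous_const Complex.continuous_im).mem_nhds h] with w hw
      exact (if_pos hw).symm
  · intro k z hz j w hw
    constructor
    · intro h
      rw [hP.eq_iff _ _ _ (hs k hz) _ hw] at h
      classical
      have := eqvGen_map (f := fun a => if a.2 ∈ topNhd O i₀ a.1 then some (topCoord a.2)
        else none) ?_ h
      · simp only [if_pos hz] at this
        by_cases hw' : w ∈ topNhd O i₀ j
        · rw [if_pos hw'] at this
          exact ⟨hw', Option.some.inj this⟩
        · rw [if_neg hw'] at this
          exact absurd this (by simp)
      · rintro _ _ (⟨i, t, h0, h1⟩ | ⟨i, t, h0, h1⟩)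
        · have e1 : ¬ (1 + t * Complex.I ∈ topNhd O i₀ i) := by simp [topNhd]
          have e2 : ¬ ((t : ℂ) * Complex.I ∈ topNhd O i₀ (O.right i)) := by simp [topNhd]
          simp only [e1, e2, if_false]
        · have e1 : (t + Complex.I ∈ topNhd O i₀ i) ↔ i = i₀ ∧ 0 < t ∧ t < 1 := by
            simp [topNhd]; norm_num
          have e2 : ((t : ℂ) ∈ topNhd O i₀ (O.top i)) ↔ i = i₀ ∧ 0 < t ∧ t < 1 := by
            simp [topNhd]; norm_num
          have e3 : topCoord (t + Complex.I) = topCoord (t : ℂ) := by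
            simp [topCoord]; norm_num
          simp only [e1, e2, e3]
    · rintro ⟨hw', h⟩
      have hz' := hz
      obtain ⟨⟨a1, a2, a3⟩ | ⟨a1, a2, a3⟩, a4, a5⟩ := hz' <;>
        obtain ⟨⟨b1, b2, b3⟩ | ⟨b1, b2, b3⟩, b4, b5⟩ := hw'
      · rw [topCoord, topCoord, if_pos (by linarith), if_pos (by linarith), sub_left_inj] at h
        rw [h, a1, b1]
      · rw [topCoord, topCoord, if_pos (by linarith), if_neg (by linarith)] at h
        have e : w = z - Complex.I := by linear_combination -h
        have : z.im = 1 := by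
          have := congrArg Complex.im e
          simp at this
          linarith
        rw [hP.eq_top (hs k hz) this, e, a1, b1]
      · rw [topCoord, topCoord, if_neg (by linarith), if_pos (by linarith)] at h
        have e : z = w - Complex.I := by linear_combination h
        have : w.im = 1 := by
          have := congrArg Complex.im e
          simp at this
          linarith
        rw [hP.eq_top hw this, e, a1, b1]
      · rw [topCoord, topCoord, if_neg (by linarith), if_neg (by linarith), sub_left_inj] at h
        rw [h, a1, b1]
  · rintro k z ⟨⟨h1, h2, h3, h4⟩, h⟩
    simp only [topNhd, Set.mem_ofPred_eq, abs_lt]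
    by_cases hz : 1 / 2 < z.im
    · have : ¬ z.im < 1 / 4 := by linarith
      have h' : k = i₀ := by
        rcases h with h | h
        · exact h.1
        · linarith [h.2]
      simp only [topCoord, if_pos hz, this, and_false, or_false]
      simp [h']
      constructor
      · rintro ⟨⟨a, b⟩, c, d⟩
        refine ⟨⟨?_, ?_⟩, ?_, ?_⟩ <;> linarith
      · rintro ⟨⟨a, b⟩, c, d⟩
        refine ⟨⟨?_, ?_⟩, ?_, ?_⟩ <;> linarith
    · have : ¬ 3 / 4 < z.im := by linarith
      have h' : k = O.top i₀ := by
        rcases h with h | h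
        · linarith [h.2]
        · exact h.1
      simp only [topCoord, if_neg hz, this, false_and, and_false, false_or]
      simp [h']
      constructor
      · rintro ⟨⟨a, b⟩, c, d⟩
        refine ⟨⟨?_, ?_⟩, ?_, ?_⟩ <;> linarith
      · rintro ⟨⟨a, b⟩, c, d⟩
        refine ⟨⟨?_, ?_⟩, ?_, ?_⟩ <;> linarith
  · rintro d ⟨h1, h2⟩
    rw [abs_lt] at h1 h2
    rcases le_or_gt d.im 0 with h | h
    · refine ⟨i₀, d + (1 / 2 + Complex.I), ⟨.inl ⟨rfl, ?_, ?_⟩, ?_, ?_⟩, ?_⟩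
      · simp; linarith
      · simp; linarith
      · simp; linarith
      · simp; linarith
      · rw [topCoord, if_pos (by simp; linarith)]; simp
    · refine ⟨O.top i₀, d + (1 / 2), ⟨.inr ⟨rfl, ?_, ?_⟩, ?_, ?_⟩, ?_⟩
      · simp; linarith
      · simp; linarith
      · simp; linarith
      · simp; linarith
      · rw [topCoord, if_neg (by simp; linarith)]; simp

end IsTopTiling

end Origami
end

noncomputable section

/-! ### Topology: finite sets, punctured neighbourhoods, families of disjoint open sets -/

theorem finite_setOf_not_of_eventually {X : Type*} [TopologicalSpace X] [CompactSpace X]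
    {p : X → Prop} (h : ∀ x, ∀ᶠ y in 𝓝[≠] x, p y) : {x | ¬ p x}.Finite := by
  by_contra hinf
  obtain ⟨x, hx⟩ := Set.Infinite.exists_accPt_principal hinf
  rw [accPt_iff_frequently_nhdsNE] at hx
  exact hx ((h x).mono fun y hy hy' => hy' hy)

theorem IsPreconnected.subset_of_disjoint_iUnion {X κ : Type*} [TopologicalSpace X] {s : Set X}
    (hs : IsPreconnected s) {A : κ → Set X} (hA : ∀ k, IsOpen (A k))
    (hd : ∀ k l, (A k ∩ A l).Nonempty → k = l) (hc : s ⊆ ⋃ k, A k) (hne : s.Nonempty) :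
    ∃ k, s ⊆ A k := by
  obtain ⟨x, hx⟩ := hne
  obtain ⟨k, hk⟩ := Set.mem_iUnion.1 (hc hx)
  refine ⟨k, hs.subset_left_of_subset_union (hA k)
    (isOpen_iUnion fun l : {l // l ≠ k} => hA l) ?_ ?_ ⟨x, hx, hk⟩⟩
  · rw [Set.disjoint_left]
    intro y hy hy'
    obtain ⟨⟨l, hl⟩, hyl⟩ := Set.mem_iUnion.1 hy'
    exact hl (hd l k ⟨y, hyl, hy⟩)
  · intro y hy
    obtain ⟨l, hl⟩ := Set.mem_iUnion.1 (hc hy)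
    by_cases e : l = k
    · exact .inl (e ▸ hl)
    · exact .inr (Set.mem_iUnion.2 ⟨⟨l, e⟩, hl⟩)

theorem isOpen_setOfPred_eventually_nhdsNE {X : Type*} [TopologicalSpace X] [T1Space X]
    {p : X → Prop} :
    IsOpen {x | ∀ᶠ y in 𝓝[≠] x, p y} := by
  rw [isOpen_iff_mem_nhds]
  intro x hx
  have h : ∀ᶠ y in 𝓝 x, y ≠ x → p y := eventually_nhdsWithin_iff.1 hx
  filter_upwards [eventually_eventually_nhds.2 h] with y hy
  by_cases e : y = x
  · subst e; exact hx
  · have h1 : ∀ᶠ w in 𝓝 y, w ≠ x := isOpen_ne.mem_nhds e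
    exact nhdsWithin_le_nhds (h1.and hy |>.mono fun w hw => hw.2 hw.1)

/-- Every point has arbitrarily small neighbourhoods that stay connected when the point is removed. -/
def HasConnectedPuncturedNhds (X : Type*) [TopologicalSpace X] : Prop :=
  ∀ x : X, ∀ N ∈ 𝓝 x, ∃ D ∈ 𝓝 x, D ⊆ N ∧ IsPreconnected (D \ {x})

theorem one_lt_rank_real_complex : 1 < Module.rank ℝ ℂ := by
  rw [Complex.rank_real_complex]; norm_num

theorem hasConnectedPuncturedNhds_complex : HasConnectedPuncturedNhds ℂ := by
  intro z N hN
  obtain ⟨r, hr, hrN⟩ := Metric.mem_nhds_iff.1 hN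
  refine ⟨Metric.ball z r, Metric.ball_mem_nhds z hr, hrN, ?_⟩
  -- The ball is homeomorphic to the whole plane, and the plane minus one point is connected.
  let ψ := OpenPartialHomeomorph.univBall z r
  have hs : ψ.source = Set.univ := OpenPartialHomeomorph.univBall_source z r
  have ht : ψ.target = Metric.ball z r := OpenPartialHomeomorph.univBall_target z hr
  have : Metric.ball z r \ {z} = ψ '' {ψ.symm z}ᶜ := by
    have hz : z ∈ ψ.target := ht ▸ Metric.mem_ball_self hr
    ext w
    constructor
    · rintro ⟨hw, hw'⟩
      rw [← ht] at hw
      refine ⟨ψ.symm w, fun h => hw' ?_, ψ.right_inv hw⟩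
      exact ψ.symm.injOn hw hz h
    · rintro ⟨u, hu, rfl⟩
      have hu' : u ∈ ψ.source := hs ▸ Set.mem_univ u
      refine ⟨ht ▸ ψ.map_source hu', fun h => hu ?_⟩
      rw [Set.mem_singleton_iff] at h
      rw [Set.mem_singleton_iff, ← ψ.left_inv hu', h]
  rw [this]
  exact ((Set.countable_singleton _).isConnected_compl_of_one_lt_rank
    one_lt_rank_real_complex).isPreconnected.image _
    (ψ.continuousOn.mono fun u _ => hs ▸ Set.mem_univ u)

theorem hasConnectedPuncturedNhds_of_chartedSpace (X : Type*) [TopologicalSpace X]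
    [ChartedSpace ℂ X] : HasConnectedPuncturedNhds X := by
  intro x N hN
  set e := chartAt ℂ x
  have hx : x ∈ e.source := mem_chart_source ℂ x
  have hN' : e.symm ⁻¹' N ∩ e.target ∈ 𝓝 (e x) := by
    refine Filter.inter_mem ?_ (e.open_target.mem_nhds (e.map_source hx))
    exact (e.continuousAt_symm (e.map_source hx)).preimage_mem_nhds (by rwa [e.left_inv hx])
  obtain ⟨D, hD, hDN, hDc⟩ := hasConnectedPuncturedNhds_complex (e x) _ hN'
  refine ⟨e.symm '' D, ?_, ?_, ?_⟩
  · have := e.symm.image_mem_nhds (e.map_source hx) hD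
    rwa [e.left_inv hx] at this
  · rintro _ ⟨w, hw, rfl⟩
    exact (hDN hw).1
  · have : e.symm '' D \ {x} = e.symm '' (D \ {e x}) := by
      ext y
      constructor
      · rintro ⟨⟨w, hw, rfl⟩, hy⟩
        refine ⟨w, ⟨hw, fun h => hy ?_⟩, rfl⟩
        rw [Set.mem_singleton_iff] at h ⊢
        rw [h, e.left_inv hx]
      · rintro ⟨w, ⟨hw, hw'⟩, rfl⟩
        refine ⟨⟨w, hw, rfl⟩, fun h => hw' ?_⟩
        rw [Set.mem_singleton_iff] at h ⊢
        rw [← h, e.right_inv (hDN hw).2]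
    rw [this]
    exact hDc.image _ (e.continuousOn_symm.mono fun w hw => (hDN hw.1).2)

/-! ### Connectedness of punctured squares and the sheets over the torus. -/

namespace Origami

/-- The sigmoid function in both coordinates identifies the plane with the open square, and the
complement of a countable subset of the plane is connected. -/
theorem isPreconnected_openSquare_diff {S : Set ℂ} (hS : (S ∩ openSquare).Finite) :
    IsPreconnected (openSquare \ S) := by
  let ψ : ℂ → ℂ := fun z => Real.sigmoid z.re + Real.sigmoid z.im * Complex.I
  have hψ : Continuous ψ := by
    have := continuous_sigmoid
    fun_prop
  have hinj : Function.Injective ψ := by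
    intro z w h
    have h1 := congrArg Complex.re h
    have h2 := congrArg Complex.im h
    simp [ψ] at h1 h2
    exact Complex.ext h1 h2
  have himg : openSquare \ S = ψ '' (ψ ⁻¹' (S ∩ openSquare))ᶜ := by
    ext w
    constructor
    · rintro ⟨⟨h1, h2, h3, h4⟩, hw⟩
      have ha : w.re ∈ Set.range Real.sigmoid := by rw [Real.range_sigmoid]; exact ⟨h1, h2⟩
      have hb : w.im ∈ Set.range Real.sigmoid := by rw [Real.range_sigmoid]; exact ⟨h3, h4⟩
      obtain ⟨a, ha⟩ := ha
      obtain ⟨b, hb⟩ := hb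
      have e : ψ (a + b * Complex.I) = w := by apply Complex.ext <;> simp [ψ, ha, hb]
      exact ⟨_, fun h => hw (e ▸ h.1), e⟩
    · rintro ⟨z, hz, rfl⟩
      have : ψ z ∈ openSquare := by
        refine ⟨?_, ?_, ?_, ?_⟩ <;> simp [ψ, Real.sigmoid_pos, Real.sigmoid_lt_one]
      exact ⟨this, fun h => hz ⟨h, this⟩⟩
  rw [himg]
  exact (((hS.preimage hinj.injOn).countable).isConnected_compl_of_one_lt_rank
    one_lt_rank_real_complex).isPreconnected.image _ hψ.continuousOn

theorem mem_closure_openSquare {z : ℂ} (hz : z ∈ closedSquare) {N : Set ℂ} (hN : N ∈ 𝓝 z) :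
    ∃ w ∈ openSquare, w ∈ N := by
  let γ : ℝ → ℂ := fun t => z + t * ((1 / 2 + Complex.I / 2) - z)
  have hγ : Filter.Tendsto γ (𝓝[>] 0) (𝓝 z) := by
    have : Continuous γ := by fun_prop
    have h := this.tendsto 0
    simp only [γ, Complex.ofReal_zero, zero_mul, add_zero] at h
    exact h.mono_left nhdsWithin_le_nhds
  have h1 : ∀ᶠ t : ℝ in 𝓝[>] 0, t ∈ Set.Ioo (0 : ℝ) 1 := Ioo_mem_nhdsGT one_pos
  obtain ⟨t, ht, h0, h1⟩ := ((hγ.eventually hN).and h1).exists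
  refine ⟨γ t, ?_, ht⟩
  obtain ⟨a, b, c, d⟩ := hz
  refine ⟨?_, ?_, ?_, ?_⟩ <;> simp [γ] <;> nlinarith

namespace IsTopTiling

variable {ι : Type} {O : Origami ι} {X : Type*} [TopologicalSpace X] {P : ι → ℂ → X}

theorem injOn_openSquare (hP : O.IsTopTiling P) {i j : ι} {z w : ℂ} (hz : z ∈ openSquare)
    (hw : w ∈ openSquare) (h : P i z = P j w) : i = j ∧ z = w := by
  rw [hP.eq_iff _ _ _ (openSquare_subset hz) _ (openSquare_subset hw)] at h
  have := eqvGen_map (fun _ _ => nf_eq_of_glue) h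
  rw [nf_of_mem_openSquare hz, nf_of_mem_openSquare hw] at this
  simpa using this

variable [T2Space X] [Finite ι]

/-- Near a point of the torus other than the origin, a square-tiled surface is a trivial covering;
only what is needed below is stated. -/
theorem exists_sheets (hP : O.IsTopTiling P) {c : Torus} (hc : c ≠ 0) :
    ∃ B : ι → Set X, (∀ k, IsOpen (B k)) ∧ (∀ k l, (B k ∩ B l).Nonempty → k = l) ∧
      (∀ k, Set.InjOn hP.proj (B k)) ∧ ∀ᶠ t in 𝓝 c, ∀ x, hP.proj x = t → ∃ k, x ∈ B k := by
  obtain ⟨z₀, ⟨⟨a0, a1⟩, b0, b1⟩, rfl⟩ : ∃ z : ℂ, ((0 ≤ z.re ∧ z.re < 1) ∧ 0 ≤ z.im ∧ z.im < 1) ∧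
      toTorus z = c := by
    obtain ⟨a, b⟩ := c
    obtain ⟨a, rfl⟩ := QuotientAddGroup.mk_surjective a
    obtain ⟨b, rfl⟩ := QuotientAddGroup.mk_surjective b
    refine ⟨⟨Int.fract a, Int.fract b⟩, ⟨⟨Int.fract_nonneg a, Int.fract_lt_one a⟩,
      Int.fract_nonneg b, Int.fract_lt_one b⟩, ?_⟩
    rw [show ((QuotientAddGroup.mk a, QuotientAddGroup.mk b) : Torus) = toTorus ⟨a, b⟩ from rfl,
      toTorus_eq_iff]
    refine ⟨⟨-⌊a⌋, ?_⟩, -⌊b⌋, ?_⟩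
    · push_cast; linarith [Int.self_sub_floor a, Int.self_sub_floor b]
    · push_cast; linarith [Int.self_sub_floor a, Int.self_sub_floor b]
  -- The set `closedSquare \ G` is compact, so its image in the torus is closed. It misses the class
  -- of `z₀`, hence a whole neighbourhood of that class.
  have key : ∀ G : Set ℂ, IsClosed (closedSquare \ G) →
      (∀ z ∈ closedSquare, toTorus z = toTorus z₀ → z ∈ G) →
      ∀ᶠ t in 𝓝 (toTorus z₀), ∀ i, ∀ z ∈ closedSquare, hP.proj (P i z) = t → z ∈ G := by
    intro G hG h
    have : IsClosed (toTorus '' (closedSquare \ G)) :=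
      ((isCompact_closedSquare.of_isClosed_subset hG Set.sdiff_subset).image
        continuous_toTorus).isClosed
    have hz : toTorus z₀ ∈ (toTorus '' (closedSquare \ G))ᶜ := by
      rintro ⟨z, ⟨hz, hzG⟩, e⟩
      exact hzG (h z hz e)
    filter_upwards [this.isOpen_compl.mem_nhds hz] with t ht i z hz e
    by_contra hzG
    rw [hP.proj_apply hz] at e
    exact ht ⟨z, ⟨hz, hzG⟩, e⟩
  have hre : ∀ z ∈ closedSquare, toTorus z = toTorus z₀ → z.re = z₀.re ∨ (z.re = 1 ∧ z₀.re = 0) :=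
    by
    rintro z ⟨h1, h2, h3, h4⟩ e
    obtain ⟨⟨a, ha⟩, -⟩ := toTorus_eq_iff.1 e
    have l1 : (-1 : ℝ) < a := by linarith
    have l2 : (a : ℝ) < 2 := by linarith
    have l1' : -1 < a := by exact_mod_cast l1
    have l2' : a < 2 := by exact_mod_cast l2
    obtain rfl | rfl : a = 0 ∨ a = 1 := by omega
    · left; simpa [sub_eq_zero] using ha
    · right; push_cast at ha; constructor <;> linarith
  have him : ∀ z ∈ closedSquare, toTorus z = toTorus z₀ → z.im = z₀.im ∨ (z.im = 1 ∧ z₀.im = 0) :=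
    by
    rintro z ⟨h1, h2, h3, h4⟩ e
    obtain ⟨-, a, ha⟩ := toTorus_eq_iff.1 e
    have l1 : (-1 : ℝ) < a := by linarith
    have l2 : (a : ℝ) < 2 := by linarith
    have l1' : -1 < a := by exact_mod_cast l1
    have l2' : a < 2 := by exact_mod_cast l2
    obtain rfl | rfl : a = 0 ∨ a = 1 := by omega
    · left; simpa [sub_eq_zero] using ha
    · right; push_cast at ha; constructor <;> linarith
  -- The representative lies on a vertical side, on a horizontal side or in the interior of the
  -- square; the sheets are the right charts, the top charts or the face charts accordingly.
  rcases eq_or_lt_of_le a0 with a0 | a0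
  · have b0 : 0 < z₀.im := by
      rcases eq_or_lt_of_le b0 with b0 | b0
      · exact absurd (by rw [show z₀ = 0 from Complex.ext a0.symm b0.symm, map_zero]) hc
      · exact b0
    choose e h1 h2 h3 using hP.exists_rightChart
    refine ⟨fun k => (e k).source, fun k => (e k).open_source, ?_, ?_, ?_⟩
    · rintro k l ⟨x, hk, hl⟩
      obtain ⟨i, z, hz, rfl⟩ := hP.surjective x
      simp only [h1 _ _ z hz, rightNhd, Set.mem_ofPred_eq] at hk hl
      rcases hk.1 with ⟨rfl, u, v⟩ | ⟨rfl, u, v⟩ <;> rcases hl.1 with ⟨e1, u', v'⟩ | ⟨e1, u', v'⟩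
      · exact e1
      · linarith
      · linarith
      · exact O.right.injective e1
    · intro k x hx y hy exy
      obtain ⟨i, z, hz, rfl⟩ := hP.surjective x
      obtain ⟨j, w, hw, rfl⟩ := hP.surjective y
      refine (e k).injOn hx hy ?_
      rw [h1 k _ _ hz] at hx
      rw [h1 k _ _ hw] at hy
      rw [h3 k _ _ hx, h3 k _ _ hy]
      rw [hP.proj_apply hz, hP.proj_apply hw] at exy
      have hr : ∀ z, toTorus (rightCoord z) = toTorus (z - Complex.I / 2) := by
        intro z
        unfold rightCoord
        split_ifs
        · rw [← sub_sub, sub_right_comm, map_sub, toTorus_one, sub_zero]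
        · rfl
      have hx' := (e k).map_source ((h1 k _ _ hz).2 hx)
      have hy' := (e k).map_source ((h1 k _ _ hw).2 hy)
      rw [h2, h3 k _ _ hx] at hx'
      rw [h2, h3 k _ _ hy] at hy'
      refine toTorus_eq_of_norm_lt ?_ ?_ ?_
      · rw [hr, hr, map_sub, map_sub, exy]
      · exact (abs_sub _ _).trans_lt (by linarith [hx'.1, hy'.1])
      · exact (abs_sub _ _).trans_lt (by linarith [hx'.2, hy'.2])
    · have := key {z | (3 / 4 < z.re ∨ z.re < 1 / 4) ∧ 0 < z.im ∧ z.im < 1} ?_ ?_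
      · filter_upwards [this] with t ht x hx
        obtain ⟨i, z, hz, rfl⟩ := hP.surjective x
        obtain ⟨hr | hr, hi⟩ := ht i z hz hx
        · exact ⟨i, (h1 _ _ z hz).2 ⟨.inl ⟨rfl, hr, hz.2.1⟩, hi⟩⟩
        · exact ⟨O.right.symm i, (h1 _ _ z hz).2 ⟨.inr ⟨by simp, hz.1, hr⟩, hi⟩⟩
      · refine isCompact_closedSquare.isClosed.sdiff (IsOpen.inter (IsOpen.union ?_ ?_)
          (IsOpen.inter ?_ ?_))
        · exact isOpen_lt continuous_const Complex.continuous_re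
        · exact isOpen_lt Complex.continuous_re continuous_const
        · exact isOpen_lt continuous_const Complex.continuous_im
        · exact isOpen_lt Complex.continuous_im continuous_const
      · intro z hz e
        have h1 := hre z hz e
        have h2 := him z hz e
        refine ⟨?_, ?_, ?_⟩
        · rcases h1 with h1 | h1
          · right; linarith
          · left; linarith [h1.1]
        · rcases h2 with h2 | h2 <;> linarith
        · rcases h2 with h2 | h2 <;> linarith
  · rcases eq_or_lt_of_le b0 with b0 | b0
    · choose e h1 h2 h3 using hP.exists_topChart
      refine ⟨fun k => (e k).source, fun k => (e k).open_source, ?_, ?_, ?_⟩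
      · rintro k l ⟨x, hk, hl⟩
        obtain ⟨i, z, hz, rfl⟩ := hP.surjective x
        simp only [h1 _ _ z hz, topNhd, Set.mem_ofPred_eq] at hk hl
        rcases hk.1 with ⟨rfl, u, v⟩ | ⟨rfl, u, v⟩ <;> rcases hl.1 with ⟨e1, u', v'⟩ | ⟨e1, u', v'⟩
        · exact e1
        · linarith
        · linarith
        · exact O.top.injective e1
      · intro k x hx y hy exy
        obtain ⟨i, z, hz, rfl⟩ := hP.surjective x
        obtain ⟨j, w, hw, rfl⟩ := hP.surjective y
        refine (e k).injOn hx hy ?_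
        rw [h1 k _ _ hz] at hx
        rw [h1 k _ _ hw] at hy
        rw [h3 k _ _ hx, h3 k _ _ hy]
        rw [hP.proj_apply hz, hP.proj_apply hw] at exy
        have hr : ∀ z, toTorus (topCoord z) = toTorus (z - 1 / 2) := by
          intro z
          unfold topCoord
          split_ifs
          · rw [← sub_sub, map_sub, toTorus_I, sub_zero]
          · rfl
        have hx' := (e k).map_source ((h1 k _ _ hz).2 hx)
        have hy' := (e k).map_source ((h1 k _ _ hw).2 hy)
        rw [h2, h3 k _ _ hx] at hx'
        rw [h2, h3 k _ _ hy] at hy'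
        refine toTorus_eq_of_norm_lt ?_ ?_ ?_
        · rw [hr, hr, map_sub, map_sub, exy]
        · exact (abs_sub _ _).trans_lt (by linarith [hx'.2, hy'.2])
        · exact (abs_sub _ _).trans_lt (by linarith [hx'.1, hy'.1])
      · have := key {z | (3 / 4 < z.im ∨ z.im < 1 / 4) ∧ 0 < z.re ∧ z.re < 1} ?_ ?_
        · filter_upwards [this] with t ht x hx
          obtain ⟨i, z, hz, rfl⟩ := hP.surjective x
          obtain ⟨hr | hr, hi⟩ := ht i z hz hx
          · exact ⟨i, (h1 _ _ z hz).2 ⟨.inl ⟨rfl, hr, hz.2.2.2⟩, hi⟩⟩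
          · exact ⟨O.top.symm i, (h1 _ _ z hz).2 ⟨.inr ⟨by simp, hz.2.2.1, hr⟩, hi⟩⟩
        · refine isCompact_closedSquare.isClosed.sdiff (IsOpen.inter (IsOpen.union ?_ ?_)
            (IsOpen.inter ?_ ?_))
          · exact isOpen_lt continuous_const Complex.continuous_im
          · exact isOpen_lt Complex.continuous_im continuous_const
          · exact isOpen_lt continuous_const Complex.continuous_re
          · exact isOpen_lt Complex.continuous_re continuous_const
        · intro z hz e
          have h1 := hre z hz e
          have h2 := him z hz e
          refine ⟨?_, ?_, ?_⟩
          · rcases h2 with h2 | h2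
            · right; linarith
            · left; linarith [h2.1]
          · rcases h1 with h1 | h1 <;> linarith
          · rcases h1 with h1 | h1 <;> linarith
    · choose e h1 h2 h3 using hP.exists_faceChart
      refine ⟨fun k => (e k).source, fun k => (e k).open_source, ?_, ?_, ?_⟩
      · rintro k l ⟨x, hk, hl⟩
        obtain ⟨i, z, hz, rfl⟩ := hP.surjective x
        rw [h1 _ _ z hz] at hk hl
        exact hk.1.symm.trans hl.1
      · intro k x hx y hy exy
        obtain ⟨i, z, hz, rfl⟩ := hP.surjective x
        obtain ⟨j, w, hw, rfl⟩ := hP.surjective y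
        rw [h1 _ _ _ hz] at hx
        rw [h1 _ _ _ hw] at hy
        rw [hP.proj_apply hz, hP.proj_apply hw] at exy
        obtain ⟨rfl, c1, c2, c3, c4⟩ := hx
        obtain ⟨rfl, d1, d2, d3, d4⟩ := hy
        rw [toTorus_eq_of_norm_lt exy (by rw [abs_lt]; constructor <;> linarith)
          (by rw [abs_lt]; constructor <;> linarith)]
      · have := key openSquare (isCompact_closedSquare.isClosed.sdiff isOpen_openSquare) ?_
        · filter_upwards [this] with t ht x hx
          obtain ⟨i, z, hz, rfl⟩ := hP.surjective x
          exact ⟨i, (h1 _ _ z hz).2 ⟨rfl, ht i z hz hx⟩⟩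
        · intro z hz e
          have h1 := hre z hz e
          have h2 := him z hz e
          refine ⟨?_, ?_, ?_, ?_⟩
          · rcases h1 with h1 | h1 <;> linarith
          · rcases h1 with h1 | h1 <;> linarith
          · rcases h2 with h2 | h2 <;> linarith
          · rcases h2 with h2 | h2 <;> linarith

end IsTopTiling

end Origami
end

/-! ### Flat involutions of a square-tiled surface permute the squares. -/

noncomputable section
namespace Origami
namespace IsTopTiling

variable {ι : Type} {O : Origami ι} {X : Type*} [TopologicalSpace X] {P : ι → ℂ → X}

/-- A fixed point free involution of the complement of a finite set that is locally, in the
coordinates given by the projection to the torus, of the form `z ↦ ± z + c`. -/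
structure IsFlatInvolution (hP : O.IsTopTiling P) (F : Set X) (inv : X → X) : Prop where
  finite : F.Finite
  continuousAt : ∀ x ∉ F, ContinuousAt inv x
  notMem : ∀ x ∉ F, inv x ∉ F
  inv_inv : ∀ x ∉ F, inv (inv x) = x
  ne : ∀ x ∉ F, inv x ≠ x
  flat : ∀ x ∉ F, ∃ ε : ℤ, (ε = 1 ∨ ε = -1) ∧ ∃ c : Torus,
    ∀ᶠ y in 𝓝 x, hP.proj (inv y) = ε • hP.proj y + c

variable [T2Space X]

/-- A short horizontal shift inside a square changes twice the projection. This separates the two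
signs in `unique`, shows that punctured neighbourhoods are not empty, and prevents the Abelian
differential from vanishing near a point. -/
theorem not_eventually_two_nsmul_proj (hP : O.IsTopTiling P) {x : X} (c : Torus) :
    ¬ ∀ᶠ y in 𝓝[≠] x, (2 : ℤ) • hP.proj y = c := by
  intro h
  obtain ⟨i, z, hz, rfl⟩ := hP.surjective x
  rw [eventually_nhdsWithin_iff] at h
  have h1 : ∀ᶠ w in 𝓝 z, w ∈ closedSquare → P i w ∈ ({P i z}ᶜ : Set X) →
      (2 : ℤ) • hP.proj (P i w) = c :=
    eventually_nhdsWithin_iff.1 ((hP.continuousOn i z hz).eventually h)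
  obtain ⟨N, hN, hNo, hzN⟩ := eventually_nhds_iff.1 h1
  obtain ⟨w, hw, hwN⟩ := mem_closure_openSquare hz (hNo.mem_nhds hzN)
  -- The point `w` might represent the excluded point `P i z`; in that case it is moved slightly to
  -- the right.
  obtain ⟨u, huN, hu, hne⟩ : ∃ u ∈ N, u ∈ openSquare ∧ P i u ≠ P i z := by
    by_cases e : P i w = P i z
    · have ht : Filter.Tendsto (fun t : ℝ => w + t) (𝓝[>] 0) (𝓝 w) := by
        have : Continuous fun t : ℝ => w + t := by fun_prop
        have h := this.tendsto 0
        simp only [Complex.ofReal_zero, add_zero] at h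
        exact h.mono_left nhdsWithin_le_nhds
      obtain ⟨t, ⟨h1, h2⟩, h3⟩ := ((ht.eventually (Filter.inter_mem (hNo.mem_nhds hwN)
        (isOpen_openSquare.mem_nhds hw))).and self_mem_nhdsWithin).exists
      refine ⟨w + t, h1, h2, fun e' => ?_⟩
      have := (hP.injOn_openSquare h2 hw (e'.trans e.symm)).2
      simp at this
      exact (ne_of_gt h3) this
    · exact ⟨w, hwN, hw, e⟩
  have ht : Filter.Tendsto (fun t : ℝ => u + t) (𝓝[>] 0) (𝓝 u) := by
    have : Continuous fun t : ℝ => u + t := by fun_prop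
    have h := this.tendsto 0
    simp only [Complex.ofReal_zero, add_zero] at h
    exact h.mono_left nhdsWithin_le_nhds
  have hS : {v : ℂ | v ∈ openSquare → P i v ≠ P i z} ∈ 𝓝 u := by
    have h4 : ContinuousAt (P i) u := (hP.continuousOn i).continuousAt
      (Filter.mem_of_superset (isOpen_openSquare.mem_nhds hu) openSquare_subset)
    filter_upwards [h4 (isOpen_ne.mem_nhds hne)] with v hv _ using hv
  -- For `0 < t < 1/2` the real part `2t` lies strictly between `0` and `1`, so it is not an
  -- integer.
  have h5 : ∀ᶠ t : ℝ in 𝓝[>] 0, t ∈ Set.Ioo (0 : ℝ) (1 / 2) := Ioo_mem_nhdsGT (by norm_num)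
  obtain ⟨t, ⟨h1, h2, h3⟩, h4⟩ := ((ht.eventually (Filter.inter_mem (hNo.mem_nhds huN)
    (Filter.inter_mem (isOpen_openSquare.mem_nhds hu) hS))).and h5).exists
  have a1 := hN u huN (openSquare_subset hu) hne
  have a2 := hN _ h1 (openSquare_subset h2) (h3 h2)
  rw [hP.proj_apply (openSquare_subset hu)] at a1
  rw [hP.proj_apply (openSquare_subset h2), map_add, smul_add, a1, add_eq_left,
    ← map_zsmul, toTorus_eq_zero_iff] at a2
  obtain ⟨⟨a, ha⟩, -⟩ := a2
  simp at ha
  have l1 : (0 : ℝ) < a := by rw [← ha]; linarith [h4.1]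
  have l2 : (a : ℝ) < 1 := by rw [← ha]; linarith [h4.2]
  have l1' : 0 < a := by exact_mod_cast l1
  have l2' : a < 1 := by exact_mod_cast l2
  omega

namespace IsFlatInvolution

variable {hP : O.IsTopTiling P} {F : Set X} {inv : X → X}

/-- Two expressions with opposite signs would make twice the projection constant near `x`. With
equal signs, a single point of the punctured neighbourhood compares the constants. -/
theorem unique (hP : O.IsTopTiling P) {inv : X → X} {x : X} {ε ε' : ℤ} (hε : ε = 1 ∨ ε = -1)
    (hε' : ε' = 1 ∨ ε' = -1) {c c' : Torus}
    (h : ∀ᶠ y in 𝓝[≠] x, hP.proj (inv y) = ε • hP.proj y + c)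
    (h' : ∀ᶠ y in 𝓝[≠] x, hP.proj (inv y) = ε' • hP.proj y + c') : ε = ε' ∧ c = c' := by
  have hne : (𝓝[≠] x).NeBot := by
    refine ⟨fun hb => not_eventually_two_nsmul_proj hP (x := x) 0 ?_⟩
    rw [hb]; trivial
  by_cases e : ε = ε'
  · subst e
    obtain ⟨y, h1, h2⟩ := (h.and h').exists
    exact ⟨rfl, add_left_cancel (h1.symm.trans h2)⟩
  · exfalso
    refine not_eventually_two_nsmul_proj hP (x := x) (ε • (c' - c)) ?_
    filter_upwards [h, h'] with y h1 h2
    have h3 := h1.symm.trans h2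
    rcases hε with rfl | rfl <;> rcases hε' with rfl | rfl
    · exact absurd rfl e
    · simp only [one_smul, neg_smul] at h3 ⊢
      have : hP.proj y = -hP.proj y + c' - c := eq_sub_of_add_eq h3
      rw [two_zsmul]
      nth_rewrite 1 [this]
      abel
    · simp only [one_smul, neg_smul] at h3 ⊢
      have : hP.proj y = -hP.proj y + c - c' := eq_sub_of_add_eq h3.symm
      rw [two_zsmul]
      nth_rewrite 1 [this]
      abel
    · exact absurd rfl e

/-- The sets of points near which a given sign and constant are valid are open and pairwise
disjoint. They cover the connected space `X`, so one of them is everything. -/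
theorem exists_global [ConnectedSpace X] (h : IsFlatInvolution hP F inv)
    (hX : HasConnectedPuncturedNhds X) : ∃ ε : ℤ, (ε = 1 ∨ ε = -1) ∧ ∃ c : Torus,
      ∀ x ∉ F, hP.proj (inv x) = ε • hP.proj x + c := by
  let κ := {ε : ℤ // ε = 1 ∨ ε = -1} × Torus
  let A : κ → Set X := fun k =>
    {x | ∀ᶠ y in 𝓝[≠] x, hP.proj (inv y) = k.1.1 • hP.proj y + k.2}
  let B : κ → Set X := fun k =>
    {x | ∀ᶠ y in 𝓝 x, hP.proj (inv y) = k.1.1 • hP.proj y + k.2}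
  have hA : ∀ k, IsOpen (A k) := fun k => isOpen_setOfPred_eventually_nhdsNE
  have hB : ∀ k, IsOpen (B k) := fun k => isOpen_setOfPred_eventually_nhds
  have hBA : ∀ k, B k ⊆ A k := fun k x hx => nhdsWithin_le_nhds hx
  have hd : ∀ k l, (A k ∩ A l).Nonempty → k = l := by
    rintro k l ⟨x, h1, h2⟩
    have := unique hP k.1.2 l.1.2 h1 h2
    exact Prod.ext (Subtype.ext this.1) this.2
  have hcovB : Fᶜ ⊆ ⋃ k, B k := by
    intro x hx
    obtain ⟨ε, hε, c, hc⟩ := h.flat x hx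
    exact Set.mem_iUnion.2 ⟨(⟨ε, hε⟩, c), hc⟩
  have hcov : (Set.univ : Set X) ⊆ ⋃ k, A k := by
    intro x _
    -- At a point of `F` the sign and the constant are read off on a connected punctured
    -- neighbourhood that avoids the other points of `F`.
    have hF : (F \ {x})ᶜ ∈ 𝓝 x :=
      (h.finite.subset Set.sdiff_subset).isClosed.isOpen_compl.mem_nhds (by simp)
    obtain ⟨D, hD, hDF, hDc⟩ := hX x _ hF
    have hDF' : D \ {x} ⊆ Fᶜ := fun y hy hyF => hDF hy.1 ⟨hyF, hy.2⟩
    have hne : (D \ {x}).Nonempty := by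
      by_contra hem
      rw [Set.not_nonempty_iff_eq_empty] at hem
      refine not_eventually_two_nsmul_proj hP (x := x) 0 ?_
      rw [eventually_nhdsWithin_iff]
      filter_upwards [hD] with y hy hyx
      have : y ∈ D \ {x} := ⟨hy, hyx⟩
      simp [hem] at this
    obtain ⟨k, hk⟩ := hDc.subset_of_disjoint_iUnion hB
      (fun k l hkl => hd k l (hkl.mono (Set.inter_subset_inter (hBA k) (hBA l))))
      (hDF'.trans hcovB) hne
    refine Set.mem_iUnion.2 ⟨k, ?_⟩
    refine eventually_nhdsWithin_iff.2 ?_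
    filter_upwards [hD] with y hy hyx
    exact (show ∀ᶠ w in 𝓝 y, _ from hk ⟨hy, hyx⟩).self_of_nhds
  obtain ⟨k, hk⟩ := isPreconnected_univ.subset_of_disjoint_iUnion hA hd hcov Set.univ_nonempty
  refine ⟨k.1.1, k.1.2, k.2, fun x hx => ?_⟩
  obtain ⟨l, hl⟩ := Set.mem_iUnion.1 (hcovB hx)
  have : l = k := hd l k ⟨x, hBA l hl, hk (Set.mem_univ x)⟩
  subst this
  exact (show ∀ᶠ w in 𝓝 x, _ from hl).self_of_nhds

variable [Finite ι]

/-- If `c ≠ 0`, a small punctured neighbourhood of the vertex `P i 0` is mapped to points over a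
neighbourhood of `c`, where the surface splits into sheets. Being connected, it lands in a single
sheet, on which the projection is injective. But it contains the distinct points `P i w` and `P j
w`, which have the same projection; their images agree, against the injectivity of the involution.
-/
theorem translation_eq_zero (h : IsFlatInvolution hP F inv) (hX : HasConnectedPuncturedNhds X)
    {ε : ℤ} {c : Torus}
    (hc : ∀ x ∉ F, hP.proj (inv x) = ε • hP.proj x + c) {i j : ι} (hij : i ≠ j)
    (hv : P i 0 = P j 0) : c = 0 := by
  by_contra hc0
  obtain ⟨B, hBo, hBd, hBi, hBc⟩ := hP.exists_sheets hc0
  have h0 : (0 : ℂ) ∈ closedSquare := by simp [closedSquare]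
  have hv0 : hP.proj (P i 0) = 0 := by rw [hP.proj_apply h0, map_zero]
  have hN1 : ∀ᶠ x in 𝓝 (P i 0), ∀ y, hP.proj y = ε • hP.proj x + c → ∃ k, y ∈ B k := by
    have : ContinuousAt (fun x => ε • hP.proj x + c) (P i 0) :=
      ((hP.continuous_proj.const_smul ε).add continuous_const).continuousAt
    have h2 : Filter.Tendsto (fun x => ε • hP.proj x + c) (𝓝 (P i 0)) (𝓝 c) := by
      simpa [ContinuousAt, hv0] using this
    exact h2.eventually hBc
  have hN2 : (F \ {P i 0})ᶜ ∈ 𝓝 (P i 0) :=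
    (h.finite.subset Set.sdiff_subset).isClosed.isOpen_compl.mem_nhds (by simp)
  obtain ⟨D, hD, hDN, hDc⟩ := hX (P i 0) _ (Filter.inter_mem hN1 hN2)
  have hDF : ∀ x ∈ D \ {P i 0}, x ∉ F := fun x hx hxF => (hDN hx.1).2 ⟨hxF, hx.2⟩
  have hpt : ∀ᶠ w in 𝓝 (0 : ℂ), w ∈ openSquare → P i w ∈ D ∧ P j w ∈ D := by
    have h1 := (hP.continuousOn i 0 h0).eventually hD
    have h2 := (hP.continuousOn j 0 h0).eventually (hv ▸ hD)
    filter_upwards [eventually_nhdsWithin_iff.1 h1, eventually_nhdsWithin_iff.1 h2] with w a b hw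
    exact ⟨a (openSquare_subset hw), b (openSquare_subset hw)⟩
  obtain ⟨w, hw, hwD⟩ := mem_closure_openSquare h0 hpt
  obtain ⟨hwi, hwj⟩ := hwD hw
  have hcorner : ¬ IsCorner w := by
    rintro ⟨h1 | h1, -⟩
    · exact hw.1.ne' h1
    · exact hw.2.1.ne h1
  have hne : ∀ k, P k w ≠ P i 0 := by
    intro k e
    rw [hP.eq_iff_nf (openSquare_subset hw) h0 hcorner, nf_of_mem_openSquare hw,
      nf_eq_none.2 (show IsCorner ((i, 0) : ι × ℂ).2 from ⟨.inl rfl, .inl rfl⟩)] at e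
    exact absurd e (by simp)
  have hci : ContinuousOn inv (D \ {P i 0}) := fun x hx =>
    (h.continuousAt x (hDF x hx)).continuousWithinAt
  obtain ⟨k, hk⟩ := (hDc.image inv hci).subset_of_disjoint_iUnion hBo hBd (by
    rintro _ ⟨x, hx, rfl⟩
    exact Set.mem_iUnion.2 ((hDN hx.1).1 _ (hc x (hDF x hx)))) ⟨_, P i w, ⟨hwi, hne i⟩, rfl⟩
  have e1 := hDF _ ⟨hwi, hne i⟩
  have e2 := hDF _ ⟨hwj, hne j⟩
  have : inv (P i w) = inv (P j w) := by
    refine hBi k (hk ⟨_, ⟨hwi, hne i⟩, rfl⟩) (hk ⟨_, ⟨hwj, hne j⟩, rfl⟩) ?_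
    rw [hc _ e1, hc _ e2, hP.proj_apply (openSquare_subset hw),
      hP.proj_apply (openSquare_subset hw)]
  have h3 : P i w = P j w := by rw [← h.inv_inv _ e1, this, h.inv_inv _ e2]
  exact hij (hP.injOn_openSquare hw hw h3).1

/-- The identity or the rotation by a half turn of the unit square. -/
def flip (ε : ℤ) (z : ℂ) : ℂ := if ε = 1 then z else 1 + Complex.I - z

theorem flip_mem_openSquare (ε : ℤ) {z : ℂ} (hz : z ∈ openSquare) : flip ε z ∈ openSquare := by
  unfold flip
  split_ifs
  · exact hz
  · obtain ⟨a, b, c, d⟩ := hz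
    refine ⟨?_, ?_, ?_, ?_⟩ <;> simp <;> linarith

theorem flip_mem_closedSquare (ε : ℤ) {z : ℂ} (hz : z ∈ closedSquare) :
    flip ε z ∈ closedSquare := by
  unfold flip
  split_ifs
  · exact hz
  · obtain ⟨a, b, c, d⟩ := hz
    refine ⟨?_, ?_, ?_, ?_⟩ <;> simp <;> linarith

theorem flip_flip (ε : ℤ) (z : ℂ) : flip ε (flip ε z) = z := by
  unfold flip
  split_ifs <;> simp

theorem toTorus_flip {ε : ℤ} (hε : ε = 1 ∨ ε = -1) (z : ℂ) :
    toTorus (flip ε z) = ε • toTorus z := by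
  rcases hε with rfl | rfl <;> simp [flip]

theorem continuous_flip (ε : ℤ) : Continuous (flip ε) := by
  unfold flip
  split_ifs <;> fun_prop

/-- Without translation part the involution preserves the grid, so it takes the open squares to open
squares, by `flip ε`. Comparing the images of the two squares along a common side gives the
relations with `O.right` and `O.top`: a translation preserves the kinds of sides, a half turn
exchanges left with right and top with bottom. -/
theorem exists_perm [ConnectedSpace X] [Nonempty ι] (h : IsFlatInvolution hP F inv)
    (hX : HasConnectedPuncturedNhds X) {i j : ι} (hij : i ≠ j) (hv : P i 0 = P j 0) :
    ∃ ρ : Equiv.Perm ι, ρ * ρ = 1 ∧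
      ((ρ ≠ 1 ∧ ρ * O.right = O.right * ρ ∧ ρ * O.top = O.top * ρ) ∨
        (O.right * ρ * O.right = ρ ∧ O.top * ρ * O.top = ρ)) := by
  obtain ⟨ε, hε, c, hc⟩ := h.exists_global hX
  obtain rfl := h.translation_eq_zero hX hc hij hv
  simp only [add_zero] at hc
  choose e he1 he2 he3 using hP.exists_faceChart
  -- The image has the same class in the torus as the interior point `flip ε z`. A point of the
  -- closed square congruent to an interior point is equal to it.
  have hinv : ∀ k, ∀ z ∈ openSquare, P k z ∉ F → ∃ m, inv (P k z) = P m (flip ε z) := by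
    intro k z hz hF
    obtain ⟨m, w, hw, e⟩ := hP.surjective (inv (P k z))
    have h1 := hc _ hF
    rw [← e, hP.proj_apply hw, hP.proj_apply (openSquare_subset hz), ← toTorus_flip hε] at h1
    have hf := flip_mem_openSquare ε hz
    refine ⟨m, ?_⟩
    rw [← e, toTorus_eq_of_norm_lt h1]
    · rw [abs_lt]; constructor <;> linarith [hw.1, hw.2.1, hf.1, hf.2.1]
    · rw [abs_lt]; constructor <;> linarith [hw.2.2.1, hw.2.2.2, hf.2.2.1, hf.2.2.2]
  have hfin : ∀ k, (P k ⁻¹' F ∩ openSquare).Finite := by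
    intro k
    refine Set.Finite.of_finite_image (f := P k) (h.finite.subset ?_) ?_
    · rintro _ ⟨z, hz, rfl⟩; exact hz.1
    · intro z hz w hw e
      exact (hP.injOn_openSquare hz.2 hw.2 e).2
  have hinf : openSquare.Infinite :=
    infinite_of_mem_nhds (1 / 2 + Complex.I / 2)
      (isOpen_openSquare.mem_nhds (by simp [openSquare]; norm_num))
  have hgood : ∀ k, ∃ z ∈ openSquare, P k z ∉ F := by
    intro k
    obtain ⟨z, hz, hz'⟩ := (hinf.sdiff (hfin k)).nonempty
    exact ⟨z, hz, fun hF => hz' ⟨hF, hz⟩⟩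
  -- The open square minus finitely many points is connected, so its image lies in one of the
  -- disjoint open squares: `m` does not depend on `z`.
  have hρ : ∀ k, ∃ m, ∀ z ∈ openSquare, P k z ∉ F → inv (P k z) = P m (flip ε z) := by
    intro k
    have hconn : IsPreconnected ((fun z => inv (P k z)) '' (openSquare \ P k ⁻¹' F)) := by
      refine (isPreconnected_openSquare_diff (hfin k)).image _ fun z hz => ?_
      refine ContinuousAt.continuousWithinAt ?_
      exact ContinuousAt.comp (h.continuousAt _ hz.2) ((hP.continuousOn k).continuousAt
        (Filter.mem_of_superset (isOpen_openSquare.mem_nhds hz.1) openSquare_subset))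
    obtain ⟨z₀, hz₀, hz₀F⟩ := hgood k
    obtain ⟨m, hm⟩ := hconn.subset_of_disjoint_iUnion (A := fun m => (e m).source)
      (fun m => (e m).open_source) (by
        rintro k l ⟨x, hk, hl⟩
        obtain ⟨i, z, hz, rfl⟩ := hP.surjective x
        rw [he1 _ _ z hz] at hk hl
        exact hk.1.symm.trans hl.1) (by
        rintro _ ⟨z, hz, rfl⟩
        obtain ⟨m, hm⟩ := hinv k z hz.1 hz.2
        refine Set.mem_iUnion.2 ⟨m, ?_⟩
        simp only [hm]
        exact (he1 _ _ _ (openSquare_subset (flip_mem_openSquare ε hz.1))).2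
          ⟨rfl, flip_mem_openSquare ε hz.1⟩) ⟨_, z₀, ⟨hz₀, hz₀F⟩, rfl⟩
    refine ⟨m, fun z hz hF => ?_⟩
    obtain ⟨m', hm'⟩ := hinv k z hz hF
    have h1 : inv (P k z) ∈ (e m).source := hm ⟨z, ⟨hz, hF⟩, rfl⟩
    rw [hm', he1 _ _ _ (openSquare_subset (flip_mem_openSquare ε hz))] at h1
    rw [hm', h1.1]
  choose ρ hρ using hρ
  have hρρ : Function.Involutive ρ := by
    intro k
    obtain ⟨z, hz, hF⟩ := hgood k
    have h1 := hρ k z hz hF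
    have h2 := hρ (ρ k) _ (flip_mem_openSquare ε hz) (h1 ▸ h.notMem _ hF)
    rw [flip_flip, ← h1, h.inv_inv _ hF] at h2
    exact (hP.injOn_openSquare hz hz h2).1.symm
  -- The formula extends to the sides by continuity, because interior points are dense in the closed
  -- square and `X` is Hausdorff.
  have hcl : ∀ k, ∀ z ∈ closedSquare, P k z ∉ F → inv (P k z) = P (ρ k) (flip ε z) := by
    intro k z hz hF
    by_contra hne
    obtain ⟨U, V, hU, hV, hxU, hxV, hUV⟩ := t2_separation hne
    have h1 : ∀ᶠ y in 𝓝 (P k z), inv y ∈ U ∧ y ∉ F :=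
      ((h.continuousAt _ hF).eventually (hU.mem_nhds hxU)).and
        (h.finite.isClosed.isOpen_compl.mem_nhds hF)
    have h2 := eventually_nhdsWithin_iff.1 ((hP.continuousOn k z hz).eventually h1)
    have h3 : ∀ᶠ w in 𝓝 z, w ∈ closedSquare → P (ρ k) (flip ε w) ∈ V := by
      have : ContinuousWithinAt (fun w => P (ρ k) (flip ε w)) closedSquare z :=
        ContinuousWithinAt.comp (t := closedSquare)
          (hP.continuousOn (ρ k) _ (flip_mem_closedSquare ε hz))
          (continuous_flip ε).continuousWithinAt fun w hw => flip_mem_closedSquare ε hw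
      exact eventually_nhdsWithin_iff.1 (this.eventually (hV.mem_nhds hxV))
    obtain ⟨w, hw, hw1, hw2⟩ := mem_closure_openSquare hz (h2.and h3)
    have hw1 := hw1 (openSquare_subset hw)
    have hw2 := hw2 (openSquare_subset hw)
    rw [← hρ k w hw hw1.2] at hw2
    exact Set.disjoint_left.1 hUV hw1.1 hw2
  -- An open side has infinitely many points, so one of them lies outside the finite set `F`.
  have hedge : ∀ γ : ℝ → ι × ℂ, (∀ t ∈ Set.Ioo (0 : ℝ) 1, (γ t).2 ∈ closedSquare) →
      Set.InjOn (fun t => P (γ t).1 (γ t).2) (Set.Ioo 0 1) →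
      ∃ t ∈ Set.Ioo (0 : ℝ) 1, P (γ t).1 (γ t).2 ∉ F := by
    intro γ hγ hinj
    by_contra! hcon
    have : (Set.Ioo (0 : ℝ) 1).Finite :=
      Set.Finite.of_finite_image (h.finite.subset (Set.image_subset_iff.2 hcon)) hinj
    exact Set.Ioo_infinite (by norm_num) this
  have hright : ∀ k, ∃ t ∈ Set.Ioo (0 : ℝ) 1,
      P (ρ k) (flip ε (1 + t * Complex.I)) = P (ρ (O.right k)) (flip ε (t * Complex.I)) := by
    intro k
    have hm : ∀ t ∈ Set.Ioo (0 : ℝ) 1, (1 + t * Complex.I : ℂ) ∈ closedSquare := by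
      intro t ht; simp [closedSquare, ht.1.le, ht.2.le]
    have hm' : ∀ t ∈ Set.Ioo (0 : ℝ) 1, (t * Complex.I : ℂ) ∈ closedSquare := by
      intro t ht; simp [closedSquare, ht.1.le, ht.2.le]
    obtain ⟨t, ht, htF⟩ := hedge (fun t => (k, 1 + t * Complex.I)) hm (by
      intro t ht s hs e
      have := congrArg hP.proj e
      rw [hP.proj_apply (hm t ht), hP.proj_apply (hm s hs)] at this
      have := toTorus_eq_of_norm_lt this (by simp)
        (by simp [abs_lt]; constructor <;> linarith [ht.1, ht.2, hs.1, hs.2])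
      simpa using this)
    have e1 : P k (1 + t * Complex.I) = P (O.right k) (t * Complex.I) := by
      simpa using hP.eq_right (hm t ht) (by simp : (1 + t * Complex.I : ℂ).re = 1)
    refine ⟨t, ht, ?_⟩
    rw [← hcl k _ (hm t ht) htF, ← hcl _ _ (hm' t ht) (e1 ▸ htF), e1]
  have htop : ∀ k, ∃ t ∈ Set.Ioo (0 : ℝ) 1,
      P (ρ k) (flip ε (t + Complex.I)) = P (ρ (O.top k)) (flip ε t) := by
    intro k
    have hm : ∀ t ∈ Set.Ioo (0 : ℝ) 1, (t + Complex.I : ℂ) ∈ closedSquare := by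
      intro t ht; simp [closedSquare, ht.1.le, ht.2.le]
    have hm' : ∀ t ∈ Set.Ioo (0 : ℝ) 1, (t : ℂ) ∈ closedSquare := by
      intro t ht; simp [closedSquare, ht.1.le, ht.2.le]
    obtain ⟨t, ht, htF⟩ := hedge (fun t => (k, t + Complex.I)) hm (by
      intro t ht s hs e
      have := congrArg hP.proj e
      rw [hP.proj_apply (hm t ht), hP.proj_apply (hm s hs)] at this
      have := toTorus_eq_of_norm_lt this
        (by simp [abs_lt]; constructor <;> linarith [ht.1, ht.2, hs.1, hs.2]) (by simp)
      simpa using this)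
    have e1 : P k (t + Complex.I) = P (O.top k) t := by
      simpa using hP.eq_top (hm t ht) (by simp : (t + Complex.I : ℂ).im = 1)
    refine ⟨t, ht, ?_⟩
    rw [← hcl k _ (hm t ht) htF, ← hcl _ _ (hm' t ht) (e1 ▸ htF), e1]
  refine ⟨hρρ.toPerm, Equiv.ext hρρ, ?_⟩
  rcases hε with rfl | rfl
  · left
    refine ⟨fun h1 => ?_, Equiv.ext fun k => ?_, Equiv.ext fun k => ?_⟩
    · obtain ⟨k⟩ := ‹Nonempty ι›
      obtain ⟨z, hz, hF⟩ := hgood k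
      have h2 := hρ k z hz hF
      rw [show ρ k = k from Equiv.congr_fun h1 k] at h2
      exact h.ne _ hF (by simpa [flip] using h2)
    · obtain ⟨t, ht, e⟩ := hright k
      simp only [flip, if_true] at e
      have hnc : ¬ IsCorner (1 + t * Complex.I) := by simp [IsCorner, ht.1.ne', ht.2.ne]
      rw [hP.eq_iff_nf (by simp [closedSquare, ht.1.le, ht.2.le])
        (by simp [closedSquare, ht.1.le, ht.2.le]) hnc] at e
      simp [nf, IsCorner, ht.1.ne', ht.2.ne] at e
      exact e.symm
    · obtain ⟨t, ht, e⟩ := htop k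
      simp only [flip, if_true] at e
      have hnc : ¬ IsCorner (t + Complex.I) := by simp [IsCorner, ht.1.ne', ht.2.ne]
      rw [hP.eq_iff_nf (by simp [closedSquare, ht.1.le, ht.2.le])
        (by simp [closedSquare, ht.1.le, ht.2.le]) hnc] at e
      simp [nf, IsCorner, ht.1.ne', ht.2.ne] at e
      exact e.symm
  · right
    refine ⟨Equiv.ext fun k => ?_, Equiv.ext fun k => ?_⟩
    · obtain ⟨t, ht, e⟩ := hright k
      simp only [flip, if_neg (by norm_num : ¬ (-1 : ℤ) = 1)] at e
      have e1 : 1 + Complex.I - (1 + t * Complex.I) = (1 - t : ℝ) * Complex.I := by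
        push_cast; ring
      have e2 : 1 + Complex.I - t * Complex.I = 1 + (1 - t : ℝ) * Complex.I := by
        push_cast; ring
      have hnc : ¬ IsCorner ((1 - t : ℝ) * Complex.I) := by
        simp [IsCorner, ht.1.ne', sub_eq_zero, ht.2.ne']
      rw [e1, e2, hP.eq_iff_nf (by simp [closedSquare, ht.1.le, ht.2.le])
        (by simp [closedSquare, ht.1.le, ht.2.le]) hnc] at e
      simp [nf, IsCorner, ht.1.ne', sub_eq_zero, ht.2.ne'] at e
      exact e.symm
    · obtain ⟨t, ht, e⟩ := htop k
      simp only [flip, if_neg (by norm_num : ¬ (-1 : ℤ) = 1)] at e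
      have e1 : 1 + Complex.I - (t + Complex.I) = (1 - t : ℝ) := by
        push_cast; ring
      have e2 : 1 + Complex.I - t = (1 - t : ℝ) + Complex.I := by
        push_cast; ring
      have hnc : ¬ IsCorner ((1 - t : ℝ) : ℂ) := by
        simp [IsCorner, ht.1.ne', sub_eq_zero, ht.2.ne']
      rw [e1, e2, hP.eq_iff_nf (by simp [closedSquare, ht.1.le, ht.2.le])
        (by simp [closedSquare, ht.1.le, ht.2.le]) hnc] at e
      simp [nf, IsCorner, ht.1.ne', sub_eq_zero, ht.2.ne'] at e
      exact e.symm

end IsFlatInvolution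

end IsTopTiling

end Origami
end

noncomputable section

/-! ### Local complex analysis -/

theorem exists_primitive {f : ℂ → ℂ} {U : Set ℂ} (hU : IsOpen U) (hf : DifferentiableOn ℂ f U)
    {z : ℂ} (hz : z ∈ U) (w : ℂ) :
    ∃ r > 0, ∃ h : ℂ → ℂ, Metric.ball z r ⊆ U ∧ h z = w ∧
      ∀ y ∈ Metric.ball z r, HasDerivAt h (f y) y := by
  obtain ⟨r, hr, hrU⟩ := Metric.isOpen_iff.1 hU z hz
  obtain ⟨h, hz, hh⟩ := (hf.mono hrU).isExactOn_ball.with_val_at z w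
  exact ⟨r, hr, h, hrU, hz, hh⟩

theorem eventually_eq_const_of_deriv_eq_zero {f : ℂ → ℂ} {z : ℂ}
    (h : ∀ᶠ w in 𝓝 z, HasDerivAt f 0 w) : ∀ᶠ w in 𝓝 z, f w = f z := by
  obtain ⟨r, hr, hb⟩ := Metric.eventually_nhds_iff_ball.1 h
  filter_upwards [Metric.ball_mem_nhds z hr] with w hw
  exact (convex_ball z r).is_const_of_fderivWithin_eq_zero (𝕜 := ℂ)
    (fun y hy => (hb y hy).differentiableAt.differentiableWithinAt) (fun y hy => by
      rw [(hb y hy).hasFDerivAt.hasFDerivWithinAt.fderivWithin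
        (Metric.isOpen_ball.uniqueDiffWithinAt hy)]
      ext; simp) hw (Metric.mem_ball_self hr)

/-- The quotient `Q w / Q z` is close to `1`, inside the slit plane, where the principal square root
is analytic; a constant root of `Q z` corrects the value. -/
theorem exists_analytic_sqrt {Q : ℂ → ℂ} {z : ℂ} (hQ : AnalyticAt ℂ Q z) (h0 : Q z ≠ 0) :
    ∃ s : ℂ → ℂ, AnalyticAt ℂ s z ∧ ∀ᶠ w in 𝓝 z, s w ^ 2 = Q w := by
  obtain ⟨b, hb⟩ := IsAlgClosed.exists_pow_nat_eq (Q z) two_pos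
  refine ⟨fun w => b * (Q w / Q z) ^ (((2 : ℕ) : ℂ)⁻¹), ?_, .of_forall fun w => ?_⟩
  · refine analyticAt_const.mul (AnalyticAt.cpow (hQ.div analyticAt_const h0) analyticAt_const ?_)
    rw [div_self h0]
    exact Complex.one_mem_slitPlane
  · rw [mul_pow, hb, Complex.cpow_nat_inv_pow _ two_ne_zero]
    field_simp

/-- If `f² = g²` near a point, for analytic functions, then `f = ± g` near that point. -/
theorem eventually_eq_or_eq_neg_of_sq_eq_sq {f g : ℂ → ℂ} {z : ℂ} (hf : AnalyticAt ℂ f z)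
    (hg : AnalyticAt ℂ g z) (h : ∀ᶠ w in 𝓝[≠] z, f w ^ 2 = g w ^ 2) :
    (∀ᶠ w in 𝓝 z, f w = g w) ∨ ∀ᶠ w in 𝓝 z, f w = -g w := by
  rcases (hf.sub hg).eventually_eq_zero_or_eventually_ne_zero with h1 | h1
  · exact .inl (h1.mono fun w hw => sub_eq_zero.1 hw)
  · right
    have h2 : ∀ᶠ w in 𝓝[≠] z, f w = (-g) w := by
      filter_upwards [h, h1] with w hw hw1
      rcases sq_eq_sq_iff_eq_or_eq_neg.1 hw with e | e
      · exact absurd (sub_eq_zero.2 e) hw1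
      · exact e
    exact (hf.frequently_eq_iff_eventually_eq hg.neg).1 h2.frequently

namespace Origami

variable {ι : Type} {O : Origami ι} {X Y : ClosedRiemannSurface} {α : AbelianDifferential X}
  {P : ι → ℂ → X}

theorem _root_.AbelianDifferential.analyticAt (α : AbelianDifferential X)
    {e : OpenPartialHomeomorph X ℂ} (he : e ∈ atlas ℂ X) {z : ℂ} (hz : z ∈ e.target) :
    AnalyticAt ℂ (α.coeff e) z :=
  (α.holomorphic e he).analyticAt (e.open_target.mem_nhds hz)

/-- Near every point, the projection to the torus is given by a primitive of the Abelian
differential. -/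
theorem IsTiling.exists_primitive [Finite ι] (h : O.IsTiling α P) (x : X)
    {e : OpenPartialHomeomorph X ℂ} (he : e ∈ atlas ℂ X) (hx : x ∈ e.source) :
    ∃ f : ℂ → ℂ, (∀ᶠ z in 𝓝 (e x), HasDerivAt f (α.coeff e z) z) ∧
      ∀ᶠ y in 𝓝 x, h.isTopTiling.proj y = toTorus (f (e y)) := by
  obtain ⟨i₀, z₀, hz₀, hx₀⟩ := h.surjective x
  obtain ⟨r, hr, f, hrU, hfx, hf⟩ :=
    _root_.exists_primitive e.open_target (α.holomorphic e he) (e.map_source hx) z₀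
  refine ⟨f, Metric.eventually_nhds_iff_ball.2 ⟨r, hr, hf⟩, ?_⟩
  refine h.isTopTiling.eventually_of_forall_fiber fun i z hz hzx => ?_
  have hN : e.source ∩ e ⁻¹' Metric.ball (e x) r ∈ 𝓝 x :=
    Filter.inter_mem (e.open_source.mem_nhds hx)
      ((e.continuousAt hx).preimage_mem_nhds (Metric.ball_mem_nhds _ hr))
  have hN' : e.source ∩ e ⁻¹' Metric.ball (e x) r ∈ 𝓝 (P i z) := by rwa [hzx]
  have h1 := eventually_nhdsWithin_iff.1 ((h.continuousOn i z hz).eventually hN')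
  obtain ⟨δ, hδ, hb⟩ := Metric.eventually_nhds_iff_ball.1 h1
  -- By `pullback` the derivative of `g` vanishes in the open square. Thus `g` is constant there
  -- and, by continuity, on the closed square near `z`.
  let g : ℂ → ℂ := fun w => f (e (P i w)) - w
  have hgc : ContinuousOn g (closedSquare ∩ Metric.ball z δ) := by
    refine ContinuousOn.sub ?_ continuousOn_id
    intro w hw
    have h2 := hb w hw.2 hw.1
    refine ContinuousAt.comp_continuousWithinAt (hf _ h2.2).continuousAt ?_
    refine ContinuousAt.comp_continuousWithinAt (e.continuousAt h2.1) ?_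
    exact (h.continuousOn i).mono Set.inter_subset_left w hw
  have hgd : ∀ w ∈ openSquare ∩ Metric.ball z δ, HasDerivAt g 0 w := by
    intro w hw
    have h2 := hb w hw.2 (openSquare_subset hw.1)
    obtain ⟨h3, h4⟩ := h.pullback i w hw.1 e he h2.1
    have h5 := (HasDerivAt.comp w (hf _ h2.2) h3.hasDerivAt).sub (hasDerivAt_id w)
    simp only [Function.comp_apply] at h5
    rw [h4, sub_self] at h5
    exact h5
  have hconv : Convex ℝ (openSquare ∩ Metric.ball z δ) := by
    refine Convex.inter ?_ (convex_ball z δ)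
    have : openSquare = Complex.re ⁻¹' Set.Ioo 0 1 ∩ Complex.im ⁻¹' Set.Ioo 0 1 := by
      ext w; simp [openSquare, and_assoc]
    rw [this]
    exact ((convex_Ioo 0 1).is_linear_preimage Complex.reLm.isLinear).inter
      ((convex_Ioo 0 1).is_linear_preimage Complex.imLm.isLinear)
  have hopen : IsOpen (openSquare ∩ Metric.ball z δ) := isOpen_openSquare.inter Metric.isOpen_ball
  have hconst : ∀ w ∈ openSquare ∩ Metric.ball z δ, ∀ u ∈ openSquare ∩ Metric.ball z δ,
      g w = g u := fun w hw u hu =>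
    hopen.is_const_of_deriv_eq_zero hconv.isPreconnected
      (fun y hy => (hgd y hy).differentiableAt.differentiableWithinAt)
      (fun y hy => (hgd y hy).deriv) hw hu
  obtain ⟨u, hu, huz⟩ := mem_closure_openSquare hz (Metric.ball_mem_nhds z hδ)
  have hval : ∀ w ∈ closedSquare ∩ Metric.ball z δ, g w = g u := by
    intro w hw
    by_contra hne
    have h3 := (hgc w hw).eventually (isOpen_ne.mem_nhds hne)
    rw [eventually_nhdsWithin_iff] at h3
    obtain ⟨v, hv, hv1, hv2⟩ := mem_closure_openSquare hw.1
      (Filter.inter_mem h3 (Metric.isOpen_ball.mem_nhds hw.2))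
    exact hv1 ⟨openSquare_subset hv, hv2⟩ (hconst v ⟨hv, hv2⟩ u ⟨hu, huz⟩)
  -- The constant of integration was fixed with the representative `z₀` of `x`; any other
  -- representative `z` differs from it by a lattice vector.
  have hz1 : toTorus z = toTorus z₀ := by
    rw [← h.isTopTiling.proj_apply hz, hzx, ← hx₀, h.isTopTiling.proj_apply hz₀]
  filter_upwards [self_mem_nhdsWithin, nhdsWithin_le_nhds (Metric.ball_mem_nhds z hδ)] with w hw hwb
  have e1 : g w = g z := (hval w ⟨hw, hwb⟩).trans (hval z ⟨hz, Metric.mem_ball_self hδ⟩).symm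
  have e2 : f (e (P i w)) = w + (z₀ - z) := by
    have : g z = z₀ - z := by simp only [g, hzx, hfx]
    rw [this] at e1
    linear_combination e1
  rw [h.isTopTiling.proj_apply hw, e2, map_add, map_sub, hz1, sub_self, add_zero]

/-- A primitive of a form vanishing near `x` is constant, and the projection to the torus would be
constant near `x`. -/
theorem IsTiling.not_eventually_coeff_eq_zero [Finite ι] (h : O.IsTiling α P) (x : X)
    {e : OpenPartialHomeomorph X ℂ} (he : e ∈ atlas ℂ X) (hx : x ∈ e.source) :
    ¬ ∀ᶠ z in 𝓝[≠] (e x), α.coeff e z = 0 := by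
  intro h0
  have h1 : ∀ᶠ z in 𝓝 (e x), α.coeff e z = 0 :=
    ((α.analyticAt he (e.map_source hx)).frequently_eq_iff_eventually_eq analyticAt_const).1
      h0.frequently
  obtain ⟨f, hf, hp⟩ := h.exists_primitive x he hx
  have h2 : ∀ᶠ z in 𝓝 (e x), f z = f (e x) :=
    eventually_eq_const_of_deriv_eq_zero ((hf.and h1).mono fun z hz => hz.2 ▸ hz.1)
  refine h.isTopTiling.not_eventually_two_nsmul_proj (x := x) ((2 : ℤ) • toTorus (f (e x))) ?_
  refine nhdsWithin_le_nhds ?_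
  filter_upwards [hp, (e.continuousAt hx).eventually h2] with y h3 h4
  rw [h3, h4]

/-! ### The deck involution of an orientation double cover. -/

section Cover

variable {π : X → Y} {q : QuadraticDifferential Y}

theorem _root_.IsDoubleCover.analyticAt (hπ : IsDoubleCover π) {x : X} {y : Y}
    (hy : π x ∈ (chartAt ℂ y).source) :
    AnalyticAt ℂ (chartAt ℂ y ∘ π ∘ (chartAt ℂ x).symm) (chartAt ℂ x x) := by
  have := ((contMDiffAt_iff_of_mem_source (mem_chart_source ℂ x) hy).1
    (hπ.holomorphic.contMDiffAt (x := x))).2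
  simp only [mfld_simps, contDiffWithinAt_univ] at this
  exact this.analyticAt

variable [Finite ι] (h : O.IsTiling α P) (hπ : IsDoubleCover π) (hq : PullbackEqSq π q α)

-- If the map were constant in charts near `x`, its derivative would vanish, and with it the square
-- of the Abelian differential.
include h hq in

theorem not_eventually_const (x : X) {y : Y} (hy : π x ∈ (chartAt ℂ y).source) (c : ℂ) :
    ¬ ∀ᶠ z in 𝓝 (chartAt ℂ x x), (chartAt ℂ y ∘ π ∘ (chartAt ℂ x).symm) z = c := by
  intro hc
  refine h.not_eventually_coeff_eq_zero x (chart_mem_atlas ℂ x) (mem_chart_source ℂ x) ?_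
  have h1 : ∀ᶠ z in 𝓝 (chartAt ℂ x x), deriv (chartAt ℂ y ∘ π ∘ (chartAt ℂ x).symm) z = 0 := by
    filter_upwards [eventually_eventually_nhds.2 hc] with z hz
    rw [Filter.EventuallyEq.deriv_eq (show _ =ᶠ[𝓝 z] fun _ => c from hz), deriv_const]
  have h2 := hq _ (chart_mem_atlas ℂ x) _ (chart_mem_atlas ℂ y) _ (mem_chart_target ℂ x)
    (by rwa [(chartAt ℂ x).left_inv (mem_chart_source ℂ x)])
  filter_upwards [h2, nhdsWithin_le_nhds h1] with z h3 h4
  rw [h4] at h3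
  simpa using h3.symm

-- This is the open mapping theorem at `x`: an analytic function that is not locally constant maps
-- neighbourhoods onto neighbourhoods.
include h hπ hq in
theorem nhds_le_map_nhds (x : X) : 𝓝 (π x) ≤ Filter.map π (𝓝 x) := by
  set e := chartAt ℂ x
  set e' := chartAt ℂ (π x)
  have hx : x ∈ e.source := mem_chart_source ℂ x
  have hy : π x ∈ e'.source := mem_chart_source ℂ (π x)
  have hc : Continuous π := hπ.holomorphic.continuous
  rcases (hπ.analyticAt hy).eventually_constant_or_nhds_le_map_nhds with h1 | h1
  · exact absurd h1 (not_eventually_const h hq x hy _)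
  · intro N hN
    rw [Filter.mem_map] at hN
    have h2 : (e' ∘ π ∘ e.symm) '' (e.target ∩ e.symm ⁻¹' (π ⁻¹' (N ∩ e'.source))) ∈
        𝓝 ((e' ∘ π ∘ e.symm) (e x)) := by
      refine h1 (Filter.image_mem_map (Filter.inter_mem (e.open_target.mem_nhds
        (e.map_source hx)) ((e.continuousAt_symm (e.map_source hx)).preimage_mem_nhds ?_)))
      rw [e.left_inv hx]
      exact Filter.inter_mem hN (hc.continuousAt.preimage_mem_nhds (e'.open_source.mem_nhds hy))
    simp only [Function.comp_apply, e.left_inv hx] at h2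
    have h3 := (e'.continuousAt hy).preimage_mem_nhds h2
    filter_upwards [h3, e'.open_source.mem_nhds hy] with y hy1 hy2
    obtain ⟨w, ⟨-, hw1, hw2⟩, hw3⟩ := hy1
    have : π (e.symm w) = y := e'.injOn hw2 hy2 hw3
    exact this ▸ hw1

include h hπ hq in
theorem eventually_ne (x : X) : ∀ᶠ y in 𝓝[≠] x, π y ≠ π x := by
  set e := chartAt ℂ x
  set e' := chartAt ℂ (π x)
  have hx : x ∈ e.source := mem_chart_source ℂ x
  have hy : π x ∈ e'.source := mem_chart_source ℂ (π x)
  rcases ((hπ.analyticAt hy).sub (analyticAt_const (v := e' (π x))))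
    |>.eventually_eq_zero_or_eventually_ne_zero with h1 | h1
  · exact absurd (h1.mono fun z hz => sub_eq_zero.1 hz) (not_eventually_const h hq x hy _)
  · rw [eventually_nhdsWithin_iff] at h1 ⊢
    filter_upwards [(e.continuousAt hx).eventually h1, e.open_source.mem_nhds hx] with y h2 hys hne
    intro h3
    refine h2 (fun h4 => hne (e.injOn hys hx h4)) ?_
    change e' (π (e.symm (e y))) - e' (π x) = 0
    rw [e.left_inv hys, h3, sub_self]

end Cover

/-- The points of `Y` near which, in some chart, the coefficient of `q` is holomorphic and does not
vanish. -/
def IsRegularPoint (q : QuadraticDifferential Y) (y : Y) : Prop :=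
  ∃ y₀, y ∈ (chartAt ℂ y₀).source ∧ AnalyticAt ℂ (q.coeff (chartAt ℂ y₀)) (chartAt ℂ y₀ y) ∧
    q.coeff (chartAt ℂ y₀) (chartAt ℂ y₀ y) ≠ 0

/-- Zeros and poles are isolated, and `Y` is compact. -/
theorem finite_not_isRegularPoint (q : QuadraticDifferential Y) :
    {y | ¬ IsRegularPoint q y}.Finite := by
  refine finite_setOf_not_of_eventually fun y₀ => ?_
  have hm := q.meromorphic _ (chart_mem_atlas ℂ y₀) _ (mem_chart_target ℂ y₀)
  have h1 := (meromorphicOrderAt_ne_top_iff_eventually_ne_zero hm).1 (q.nonzero y₀)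
  have h2 := hm.eventually_analyticAt.and h1
  have hy := mem_chart_source ℂ y₀
  rw [eventually_nhdsWithin_iff] at h2 ⊢
  filter_upwards [((chartAt ℂ y₀).continuousAt hy).eventually h2,
    (chartAt ℂ y₀).open_source.mem_nhds hy] with y h3 h4 hne
  exact ⟨y₀, h4, h3 fun h5 => hne ((chartAt ℂ y₀).injOn h4 hy h5)⟩

/-- The function `Θ` is a primitive of a local square root of `q`. Pulled back to `X`, its
differential squares to `α²`, so it is `α` or `-α`, and integration gives the formula. One and the
same `Θ` serves all points of the fibre, so two of them can be compared. -/
theorem exists_local_sign [Finite ι] {π : X → Y} {q : QuadraticDifferential Y}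
    (h : O.IsTiling α P) (hπ : IsDoubleCover π) (hq : PullbackEqSq π q α) {y : Y}
    (hy : IsRegularPoint q y) : ∃ Θ : Y → Torus, ∀ x, π x = y → ∃ ε : ℤ, (ε = 1 ∨ ε = -1) ∧
      ∃ c : Torus, ∀ᶠ x' in 𝓝 x, Θ (π x') = ε • h.isTopTiling.proj x' + c := by
  obtain ⟨y₀, hys, hQ, hQ0⟩ := hy
  set e' := chartAt ℂ y₀
  obtain ⟨s, hs, hsQ⟩ := exists_analytic_sqrt hQ hQ0
  obtain ⟨U, hU, hUo, hyU⟩ := eventually_nhds_iff.1 hs.eventually_analyticAt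
  obtain ⟨r, hr, H, -, -, hH⟩ := _root_.exists_primitive hUo
    (fun w hw => (hU w hw).differentiableAt.differentiableWithinAt) hyU 0
  refine ⟨fun y' => toTorus (H (e' y')), ?_⟩
  rintro x rfl
  set e := chartAt ℂ x
  have hx : x ∈ e.source := mem_chart_source ℂ x
  have hgx : (e' ∘ π ∘ e.symm) (e x) = e' (π x) := by simp [e.left_inv hx]
  have hg : AnalyticAt ℂ (e' ∘ π ∘ e.symm) (e x) := hπ.analyticAt hys
  set g := e' ∘ π ∘ e.symm
  have ha := α.analyticAt (chart_mem_atlas ℂ x) (mem_chart_target ℂ x)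
  have hsg : AnalyticAt ℂ (fun z => s (g z) * deriv g z) (e x) :=
    (AnalyticAt.fun_comp (hgx ▸ hs) hg).mul hg.deriv
  have hsq : ∀ᶠ z in 𝓝[≠] (e x), (s (g z) * deriv g z) ^ 2 = α.coeff e z ^ 2 := by
    have h2 := hq _ (chart_mem_atlas ℂ x) _ (chart_mem_atlas ℂ y₀) _ (mem_chart_target ℂ x)
      (by rwa [(chartAt ℂ x).left_inv (mem_chart_source ℂ x)])
    have h3 : ∀ᶠ z in 𝓝 (e x), s (g z) ^ 2 = q.coeff e' (g z) :=
      hg.continuousAt.eventually (hgx ▸ hsQ)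
    filter_upwards [h2, nhdsWithin_le_nhds h3] with z h4 h5
    rw [mul_pow, h5, ← h4]
    rfl
  have hHg : ∀ᶠ z in 𝓝 (e x), HasDerivAt (fun z => H (g z)) (s (g z) * deriv g z) z := by
    have h3 : ∀ᶠ z in 𝓝 (e x), g z ∈ Metric.ball (e' (π x)) r :=
      hg.continuousAt.eventually (hgx ▸ Metric.ball_mem_nhds _ hr)
    filter_upwards [h3, hg.eventually_analyticAt] with z h4 h5
    exact (hH _ h4).comp z h5.differentiableAt.hasDerivAt
  obtain ⟨f, hf, hp⟩ := h.exists_primitive x (chart_mem_atlas ℂ x) hx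
  have key : ∃ ε : ℤ, (ε = 1 ∨ ε = -1) ∧
      ∀ᶠ z in 𝓝 (e x), s (g z) * deriv g z = ε * α.coeff e z := by
    rcases eventually_eq_or_eq_neg_of_sq_eq_sq hsg ha hsq with h1 | h1
    · exact ⟨1, .inl rfl, by simpa using h1⟩
    · exact ⟨-1, .inr rfl, by simpa using h1⟩
  obtain ⟨ε, hε, h1⟩ := key
  have h2 : ∀ᶠ z in 𝓝 (e x), H (g z) - ε * f z = H (g (e x)) - ε * f (e x) := by
    refine eventually_eq_const_of_deriv_eq_zero (f := fun z => H (g z) - ε * f z) ?_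
    filter_upwards [hHg, hf, h1] with z h3 h4 h5
    have := h3.sub (h4.const_mul (ε : ℂ))
    rwa [h5, sub_self] at this
  refine ⟨ε, hε, toTorus (H (g (e x)) - ε * f (e x)), ?_⟩
  filter_upwards [hp, (e.continuousAt hx).eventually h2, e.open_source.mem_nhds hx]
    with x' h3 h4 h5
  have h6 : H (e' (π x')) = ε • f (e x') + (H (g (e x)) - ε * f (e x)) := by
    rw [← h4]
    simp [g, e.left_inv h5]
  rw [h6, map_add, map_zsmul, h3]

/-- The involution exchanges the two points of a fibre. The finite set consists of the points over
exceptional fibres and over the zeros and poles of `q`. -/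
theorem exists_isFlatInvolution [Finite ι] {π : X → Y} {q : QuadraticDifferential Y}
    (h : O.IsTiling α P) (hπ : IsDoubleCover π) (hq : PullbackEqSq π q α) :
    ∃ F inv, IsTopTiling.IsFlatInvolution h.isTopTiling F inv := by
  classical
  obtain ⟨S, hS, hS2⟩ := hπ.degree_two
  have hπc : Continuous π := hπ.holomorphic.continuous
  let B : Set Y := S ∪ {y | ¬ IsRegularPoint q y}
  have hB : B.Finite := hS.union (finite_not_isRegularPoint q)
  have hF : (π ⁻¹' B).Finite := by
    refine (finite_setOf_not_of_eventually (p := fun x => π x ∉ B) fun x => ?_).subset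
      fun x hx hx' => hx' hx
    have h1 : ∀ᶠ x' in 𝓝 x, π x' ∉ B \ {π x} := hπc.continuousAt.eventually
      ((hB.subset Set.sdiff_subset).isClosed.isOpen_compl.mem_nhds (by simp))
    filter_upwards [eventually_ne h hπ hq x, nhdsWithin_le_nhds h1] with x' h2 h3 h4
    exact h3 ⟨h4, h2⟩
  have hpart : ∀ x, ∃ x', x ∉ π ⁻¹' B → x' ≠ x ∧ π x' = π x ∧ ∀ u, π u = π x → u = x ∨ u = x' := by
    intro x
    by_cases hx : x ∈ π ⁻¹' B
    · exact ⟨x, fun h => absurd hx h⟩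
    · obtain ⟨a, b, hab, he⟩ := Set.ncard_eq_two.1 (hS2 (π x) fun hs => hx (.inl hs))
      have hm : ∀ u, π u = π x ↔ u = a ∨ u = b := by
        intro u
        have : u ∈ π ⁻¹' {π x} ↔ u ∈ ({a, b} : Set X) := by rw [he]
        simpa using this
      rcases (hm x).1 rfl with rfl | rfl
      · exact ⟨b, fun _ => ⟨hab.symm, (hm b).2 (.inr rfl), fun u hu => (hm u).1 hu⟩⟩
      · exact ⟨a, fun _ => ⟨hab, (hm a).2 (.inl rfl), fun u hu => ((hm u).1 hu).symm⟩⟩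
  choose inv hinv using hpart
  have hnm : ∀ x ∉ π ⁻¹' B, inv x ∉ π ⁻¹' B := by
    intro x hx h1
    rw [Set.mem_preimage, (hinv x hx).2.1] at h1
    exact hx h1
  have hcont : ∀ x ∉ π ⁻¹' B, ContinuousAt inv x := by
    intro x hx
    obtain ⟨h1, h2, h3⟩ := hinv x hx
    intro N hN
    -- For `x'` close to `x`, openness of `π` provides a point near `inv x` over `π x'`. It differs
    -- from `x'` because `U` and `V` are disjoint, so it is `inv x'`.
    obtain ⟨U, V, hU, hV, hxU, hxV, hUV⟩ := t2_separation h1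
    have h4 : π '' (N ∩ U) ∈ 𝓝 (π x) := by
      rw [← h2]
      exact nhds_le_map_nhds h hπ hq (inv x)
        (Filter.image_mem_map (Filter.inter_mem hN (hU.mem_nhds hxU)))
    rw [Filter.mem_map]
    filter_upwards [hπc.continuousAt.preimage_mem_nhds h4, hV.mem_nhds hxV,
      hF.isClosed.isOpen_compl.mem_nhds hx] with x' h5 h6 h7
    obtain ⟨w, ⟨hwN, hwU⟩, hw⟩ := h5
    rcases (hinv x' h7).2.2 w hw with rfl | rfl
    · exact absurd h6 (Set.disjoint_left.1 hUV hwU)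
    · exact hwN
  refine ⟨π ⁻¹' B, inv, hF, hcont, hnm, ?_, fun x hx => (hinv x hx).1, ?_⟩
  · intro x hx
    obtain ⟨h1, h2, h3⟩ := hinv x hx
    obtain ⟨h4, h5, h6⟩ := hinv _ (hnm x hx)
    rcases h3 _ (h5.trans h2) with h7 | h7
    · exact h7
    · exact absurd h7 h4
  · intro x hx
    have hreg : IsRegularPoint q (π x) := by
      by_contra hr
      exact hx (.inr hr)
    obtain ⟨Θ, hΘ⟩ := exists_local_sign h hπ hq hreg
    obtain ⟨h1, h2, h3⟩ := hinv x hx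
    obtain ⟨ε, hε, c, hc⟩ := hΘ x rfl
    obtain ⟨ε', hε', c', hc'⟩ := hΘ _ h2
    -- Solving `ε' • proj (inv u) + c' = ε • proj u + c` for `proj (inv u)`, with `ε'` its own
    -- inverse.
    refine ⟨ε' * ε, ?_, ε' • (c - c'), ?_⟩
    · rcases hε with rfl | rfl <;> rcases hε' with rfl | rfl <;> simp
    · filter_upwards [hc, (hcont x hx).eventually hc', hF.isClosed.isOpen_compl.mem_nhds hx]
        with u h4 h5 h6
      rw [(hinv u h6).2.1, h4] at h5
      have h7 : ε' • h.isTopTiling.proj (inv u) = ε • h.isTopTiling.proj u + c - c' :=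
        eq_sub_of_add_eq h5.symm
      rcases hε' with rfl | rfl
      · simp only [one_smul, one_mul] at h7 ⊢
        rw [h7]; abel
      · simp only [neg_smul, one_smul, neg_mul, one_mul] at h7 ⊢
        rw [← neg_neg (h.isTopTiling.proj (inv u)), h7]; abel

/-- An origami that is an orientation double cover has a symmetry: an automorphism of order two, or
an involution of the squares that inverts both permutations. -/
theorem IsOrientationDoubleCover.exists_perm [Finite ι] [Nonempty ι]
    (h : O.IsOrientationDoubleCover) {i : ι}
    (hi : O.right (O.top (O.right⁻¹ (O.top⁻¹ i))) ≠ i) :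
    ∃ ρ : Equiv.Perm ι, ρ * ρ = 1 ∧
      ((ρ ≠ 1 ∧ ρ * O.right = O.right * ρ ∧ ρ * O.top = O.top * ρ) ∨
        (O.right * ρ * O.right = ρ ∧ O.top * ρ * O.top = ρ)) := by
  obtain ⟨X, α, ⟨P, hP⟩, Y, q, π, hπ, hq⟩ := h
  obtain ⟨F, inv, hF⟩ := exists_isFlatInvolution hP hπ hq
  refine hF.exists_perm (hasConnectedPuncturedNhds_of_chartedSpace X) hi ?_
  have hT := hP.isTopTiling
  have h0 : (0 : ℂ) ∈ closedSquare := by simp [closedSquare]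
  have h1 : (1 : ℂ) ∈ closedSquare := by simp [closedSquare]
  have hI : (Complex.I : ℂ) ∈ closedSquare := by simp [closedSquare]
  have h1I : (1 + Complex.I : ℂ) ∈ closedSquare := by simp [closedSquare]
  have hr1 : ∀ k, P k 1 = P (O.right k) 0 := fun k => by simpa using hT.eq_right h1 (i := k)
  have hr2 : ∀ k, P k (1 + Complex.I) = P (O.right k) Complex.I := fun k => by
    simpa using hT.eq_right h1I (i := k)
  have ht1 : ∀ k, P k Complex.I = P (O.top k) 0 := fun k => by simpa using hT.eq_top hI (i := k)
  have ht2 : ∀ k, P k (1 + Complex.I) = P (O.top k) 1 := fun k => by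
    simpa using hT.eq_top h1I (i := k)
  -- Walking once around the vertex: the lower left corner of the square obtained from `i` by the
  -- commutator is the lower right corner of one neighbour, the upper right corner of the next, the
  -- upper left corner of `O.top⁻¹ i`, hence the lower left corner of `i`.
  rw [← hr1, ← ht2, hr2, ht1]
  simp

end Origami
end

noncomputable section

/-! ### The surface of an origami with a single vertex -/

namespace Origami

variable {ι : Type}

/-- The corners of the unit square, counterclockwise. -/
def corner : Fin 4 → ℂ := ![0, 1, 1 + Complex.I, Complex.I]

theorem corner_mem (b : Fin 4) : corner b ∈ closedSquare := by
  fin_cases b <;> simp [corner, closedSquare]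

theorem isCorner_corner (b : Fin 4) : IsCorner (corner b) := by
  fin_cases b <;> simp [corner, IsCorner]

theorem exists_corner_eq {z : ℂ} (hz : IsCorner z) : ∃ b, corner b = z := by
  obtain ⟨h1 | h1, h2 | h2⟩ := hz
  · exact ⟨0, by apply Complex.ext <;> simp [corner, h1, h2]⟩
  · exact ⟨3, by apply Complex.ext <;> simp [corner, h1, h2]⟩
  · exact ⟨1, by apply Complex.ext <;> simp [corner, h1, h2]⟩
  · exact ⟨2, by apply Complex.ext <;> simp [corner, h1, h2]⟩

/-- The square in which one arrives when turning clockwise around a corner. -/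
def turn (O : Origami ι) : Fin 4 → Equiv.Perm ι := ![O.right⁻¹, O.top⁻¹, O.right, O.top]

/-- Turning clockwise around the corners of the squares. -/
def cornerPerm (O : Origami ι) : Equiv.Perm (ι × Fin 4) where
  toFun c := (O.turn c.2 c.1, c.2 + 1)
  invFun c := ((O.turn (c.2 - 1))⁻¹ c.1, c.2 - 1)
  left_inv c := by simp
  right_inv c := by simp

theorem cornerPerm_apply (O : Origami ι) (i : ι) (b : Fin 4) :
    O.cornerPerm (i, b) = (O.turn b i, b + 1) := rfl

theorem eqvGen_cornerPerm (O : Origami ι) (c : ι × Fin 4) :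
    Relation.EqvGen O.Glue (c.1, corner c.2) ((O.cornerPerm c).1, corner (O.cornerPerm c).2) := by
  obtain ⟨i, b⟩ := c
  have hh (i : ι) (t : ℝ) (h0 h1) := Relation.EqvGen.rel _ _ (Glue.horizontal (O := O) i t h0 h1)
  have hv (i : ι) (t : ℝ) (h0 h1) := Relation.EqvGen.rel _ _ (Glue.vertical (O := O) i t h0 h1)
  fin_cases b
  · simpa [cornerPerm_apply, turn, corner] using (hh (O.right⁻¹ i) 0 le_rfl zero_le_one).symm
  · simpa [cornerPerm_apply, turn, corner] using (hv (O.top⁻¹ i) 1 zero_le_one le_rfl).symm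
  · simpa [cornerPerm_apply, turn, corner] using hh i 1 zero_le_one le_rfl
  · simpa [cornerPerm_apply, turn, corner] using hv i 0 le_rfl zero_le_one

/-- All corners of the squares are glued to each other. -/
def HasOneVertex (O : Origami ι) : Prop := ∀ a b, O.cornerPerm.SameCycle a b

theorem HasOneVertex.eqvGen {O : Origami ι} (h : O.HasOneVertex) {i j : ι} {z w : ℂ}
    (hz : IsCorner z) (hw : IsCorner w) : Relation.EqvGen O.Glue (i, z) (j, w) := by
  obtain ⟨b, rfl⟩ := exists_corner_eq hz
  obtain ⟨b', rfl⟩ := exists_corner_eq hw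
  have key : ∀ (m : ℤ) (c : ι × Fin 4), Relation.EqvGen O.Glue (c.1, corner c.2)
      (((O.cornerPerm ^ m) c).1, corner ((O.cornerPerm ^ m) c).2) := by
    intro m
    induction m with
    | zero => intro c; exact .refl _
    | succ m ih =>
      intro c
      rw [zpow_add_one, Equiv.Perm.mul_apply]
      exact (eqvGen_cornerPerm O c).trans _ _ _ (ih _)
    | pred m ih =>
      intro c
      have := eqvGen_cornerPerm O (O.cornerPerm⁻¹ c)
      rw [show O.cornerPerm (O.cornerPerm⁻¹ c) = c by simp] at this
      rw [sub_eq_add_neg, zpow_add, zpow_neg_one, Equiv.Perm.mul_apply]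
      exact (this.symm).trans _ _ _ (ih _)
  obtain ⟨m, hm⟩ := h (i, b) (j, b')
  have := key m (i, b)
  rwa [hm] at this

/-- The identification of points of the squares. -/
def surfaceSetoid (O : Origami ι) : Setoid (Σ _ : ι, closedSquare) :=
  (Relation.EqvGen.setoid O.Glue).comap fun a => (a.1, (a.2 : ℂ))

/-- The topological surface of an origami. -/
def Surface (O : Origami ι) : Type := Quotient O.surfaceSetoid

instance (O : Origami ι) : TopologicalSpace O.Surface :=
  inferInstanceAs (TopologicalSpace (Quotient O.surfaceSetoid))

instance (O : Origami ι) [Finite ι] : CompactSpace O.Surface := by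
  have : CompactSpace closedSquare := isCompact_iff_compactSpace.1 isCompact_closedSquare
  exact inferInstanceAs (CompactSpace (Quotient O.surfaceSetoid))

open Classical in
/-- The parametrisation of the surface of an origami by squares. -/
def param (O : Origami ι) (i : ι) (z : ℂ) : O.Surface :=
  Quotient.mk O.surfaceSetoid ⟨i, if h : z ∈ closedSquare then ⟨z, h⟩ else ⟨0, corner_mem 0⟩⟩

theorem param_apply (O : Origami ι) (i : ι) (z : closedSquare) :
    O.param i z = Quotient.mk O.surfaceSetoid ⟨i, z⟩ := by
  simp only [param, dif_pos z.2]
  rfl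

theorem isTopTiling_param (O : Origami ι) : O.IsTopTiling O.param where
  continuousOn i := by
    rw [continuousOn_iff_continuous_domRestrict]
    have : closedSquare.domRestrict (O.param i) =
        Quotient.mk O.surfaceSetoid ∘ Sigma.mk (β := fun _ : ι => closedSquare) i := by
      ext z
      exact O.param_apply i z
    rw [this]
    exact continuous_quot_mk.comp continuous_sigmaMk
  surjective x := by
    obtain ⟨⟨i, z⟩, rfl⟩ := Quotient.exists_rep x
    exact ⟨i, z, z.2, O.param_apply i z⟩
  eq_iff i j z hz w hw := by
    lift z to closedSquare using hz
    lift w to closedSquare using hw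
    rw [param_apply, param_apply]
    exact Quotient.eq (r := O.surfaceSetoid)

/-- A function on the squares that is compatible with the gluing. -/
def lift (O : Origami ι) {Y : Type*} (f : ι × ℂ → Y) (hf : ∀ a b, O.Glue a b → f a = f b) :
    O.Surface → Y :=
  Quotient.lift (fun a : Σ _ : ι, closedSquare => f (a.1, a.2)) fun _ _ h => eqvGen_map hf h

theorem lift_param {O : Origami ι} {Y : Type*} {f : ι × ℂ → Y}
    {hf : ∀ a b, O.Glue a b → f a = f b} {i : ι} {z : ℂ} (hz : z ∈ closedSquare) :
    O.lift f hf (O.param i z) = f (i, z) := by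
  lift z to closedSquare using hz
  rw [param_apply]
  rfl

theorem continuous_lift {O : Origami ι} {Y : Type*} [TopologicalSpace Y] {f : ι × ℂ → Y}
    {hf : ∀ a b, O.Glue a b → f a = f b} (h : ∀ i, Continuous fun z => f (i, z)) :
    Continuous (O.lift f hf) :=
  Continuous.quotient_lift (continuous_sigma fun i => (h i).comp continuous_subtype_val) _

open Classical in
/-- A function that vanishes on the boundary of the squares and outside the square `k`. -/
def faceBump (k : ι) (a : ι × ℂ) : ℝ :=
  if a.1 = k then a.2.re * (1 - a.2.re) * (a.2.im * (1 - a.2.im)) else 0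

open Classical in
/-- A function that is positive on the left side of the square `k` and vanishes on all other left
sides and on the horizontal sides. -/
def sideBump (O : Origami ι) (k : ι) (a : ι × ℂ) : ℝ :=
  a.2.im * (1 - a.2.im) *
    ((if a.1 = k then 1 - a.2.re else 0) + if O.right a.1 = k then a.2.re else 0)

open Classical in
/-- A function that is positive on the bottom side of the square `k` and vanishes on all other
bottom sides and on the vertical sides. -/
def bottomBump (O : Origami ι) (k : ι) (a : ι × ℂ) : ℝ :=
  a.2.re * (1 - a.2.re) *
    ((if a.1 = k then 1 - a.2.im else 0) + if O.top a.1 = k then a.2.im else 0)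

theorem faceBump_eq {O : Origami ι} (k : ι) (a b : ι × ℂ) (h : O.Glue a b) :
    faceBump k a = faceBump k b := by
  cases h <;> simp [faceBump]

theorem sideBump_eq {O : Origami ι} (k : ι) (a b : ι × ℂ) (h : O.Glue a b) :
    O.sideBump k a = O.sideBump k b := by
  cases h <;> simp [sideBump]

theorem bottomBump_eq {O : Origami ι} (k : ι) (a b : ι × ℂ) (h : O.Glue a b) :
    O.bottomBump k a = O.bottomBump k b := by
  cases h <;> simp [bottomBump]

theorem nf_mem {O : Origami ι} {i : ι} {z : ℂ} (hz : z ∈ closedSquare) {b : ι × ℂ}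
    (h : O.nf (i, z) = some b) : (0 ≤ b.2.re ∧ b.2.re < 1 ∧ 0 ≤ b.2.im ∧ b.2.im < 1) ∧
      ¬ IsCorner b.2 := by
  obtain ⟨h1, h2, h3, h4⟩ := hz
  unfold nf at h
  simp only [IsCorner] at h ⊢
  split_ifs at h with c1 c2 c3 <;> obtain rfl := Option.some.inj h <;>
    simp only [Complex.sub_re, Complex.sub_im, Complex.one_re, Complex.one_im, Complex.I_re,
      Complex.I_im] <;> grind

/-- Points are separated by continuous functions to Hausdorff spaces. The torus projection separates
points with different positions in a square, and the bump functions separate points of different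
squares, sides or bottoms. Corners need no separation because they form one point. -/
theorem HasOneVertex.t2Space {O : Origami ι} (hO : O.HasOneVertex) : T2Space O.Surface := by
  refine ⟨fun x y hxy => ?_⟩
  obtain ⟨i, z, hz, rfl⟩ := O.isTopTiling_param.surjective x
  obtain ⟨j, w, hw, rfl⟩ := O.isTopTiling_param.surjective y
  by_contra hsep
  have key : ∀ {Y : Type} [TopologicalSpace Y] [T2Space Y] (f : ι × ℂ → Y)
      (_ : ∀ a b, O.Glue a b → f a = f b) (_ : ∀ i, Continuous fun z => f (i, z)),
      f (i, z) = f (j, w) := by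
    intro Y _ _ f hf hc
    by_contra hne
    exact hsep (separated_by_continuous (continuous_lift (hf := hf) hc)
      (by rwa [lift_param hz, lift_param hw]))
  rw [Ne, O.isTopTiling_param.eq_iff i j z hz w hw] at hxy
  have ht : toTorus z = toTorus w := key (fun a => toTorus a.2)
    (fun _ _ h => h.toTorus_eq) fun _ => continuous_toTorus
  have h1 (k : ι) : faceBump k (i, z) = faceBump k (j, w) := key _ (faceBump_eq k) fun l => by
    simp only [faceBump]; split_ifs <;> fun_prop
  have h2 (k : ι) : O.sideBump k (i, z) = O.sideBump k (j, w) := key _ (sideBump_eq k) fun l => by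
    simp only [sideBump]; split_ifs <;> fun_prop
  have h3 (k : ι) : O.bottomBump k (i, z) = O.bottomBump k (j, w) :=
    key _ (bottomBump_eq k) fun l => by
      simp only [bottomBump]; split_ifs <;> fun_prop
  have hcor : ∀ u ∈ closedSquare, IsCorner u ↔ toTorus u = 0 := by
    intro u hu
    rw [toTorus_eq_zero_iff]
    constructor
    · rintro ⟨h | h, h' | h'⟩
      · exact ⟨⟨0, by simp [h]⟩, 0, by simp [h']⟩
      · exact ⟨⟨0, by simp [h]⟩, 1, by simp [h']⟩
      · exact ⟨⟨1, by simp [h]⟩, 0, by simp [h']⟩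
      · exact ⟨⟨1, by simp [h]⟩, 1, by simp [h']⟩
    · rintro ⟨⟨a, ha⟩, b, hb⟩
      have h0 := hu.1
      have h1 := hu.2.1
      have h2 := hu.2.2.1
      have h3 := hu.2.2.2
      rw [ha] at h0 h1
      rw [hb] at h2 h3
      have h0 : 0 ≤ a := by exact_mod_cast h0
      have h1 : a ≤ 1 := by exact_mod_cast h1
      have h2 : 0 ≤ b := by exact_mod_cast h2
      have h3 : b ≤ 1 := by exact_mod_cast h3
      have ha' : a = 0 ∨ a = 1 := by omega
      have hb' : b = 0 ∨ b = 1 := by omega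
      rcases ha' with rfl | rfl <;> rcases hb' with rfl | rfl <;> simp [IsCorner, ha, hb]
  by_cases hc : IsCorner z
  · exact hxy (hO.eqvGen hc ((hcor w hw).2 (ht ▸ (hcor z hz).1 hc)))
  have hc' : ¬ IsCorner w := fun h => hc ((hcor z hz).2 (ht ▸ (hcor w hw).1 h))
  obtain ⟨⟨i', z'⟩, hzn⟩ := Option.ne_none_iff_exists'.1 (mt nf_eq_none.1 hc : O.nf (i, z) ≠ none)
  obtain ⟨⟨j', w'⟩, hwn⟩ := Option.ne_none_iff_exists'.1 (mt nf_eq_none.1 hc' : O.nf (j, w) ≠ none)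
  have ez := eqvGen_of_nf hz hzn
  have ew := eqvGen_of_nf hw hwn
  obtain ⟨⟨z1, z2, z3, z4⟩, zc⟩ := nf_mem hz hzn
  obtain ⟨⟨w1, w2, w3, w4⟩, wc⟩ := nf_mem hw hwn
  dsimp only at z1 z2 z3 z4 w1 w2 w3 w4 zc wc
  have hzw : z' = w' := by
    have e1 := eqvGen_toTorus ez
    have e2 := eqvGen_toTorus ew
    refine toTorus_eq_of_norm_lt (e1.symm.trans (ht.trans e2)) ?_ ?_ <;> rw [abs_lt] <;>
      constructor <;> linarith
  subst hzw
  suffices i' = j' by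
    subst this
    exact hxy (ez.trans _ _ _ (.symm _ _ ew))
  have g1 : faceBump i' (i', z') = faceBump i' (j', z') := by
    rw [← eqvGen_map (faceBump_eq i') ez, h1, eqvGen_map (faceBump_eq i') ew]
  have g2 : O.sideBump i' (i', z') = O.sideBump i' (j', z') := by
    rw [← eqvGen_map (sideBump_eq i') ez, h2, eqvGen_map (sideBump_eq i') ew]
  have g3 : O.bottomBump i' (i', z') = O.bottomBump i' (j', z') := by
    rw [← eqvGen_map (bottomBump_eq i') ez, h3, eqvGen_map (bottomBump_eq i') ew]
  by_contra hne
  have hne' : j' ≠ i' := Ne.symm hne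
  -- The common representative lies on the left side, on the bottom side or in the interior; the
  -- corresponding bump is positive for the square `i'` and zero for `j'`.
  rcases z1.eq_or_lt with h | h
  · rcases z3.eq_or_lt with h' | h'
    · exact zc ⟨.inl h.symm, .inl h'.symm⟩
    · simp [sideBump, ← h, hne'] at g2
      grind
  · rcases z3.eq_or_lt with h' | h'
    · simp [bottomBump, ← h', hne'] at g3
      grind
    · simp [faceBump, hne'] at g1
      grind

theorem convex_closedSquare : Convex ℝ closedSquare := by
  rintro x ⟨h1, h2, h3, h4⟩ y ⟨k1, k2, k3, k4⟩ a b ha hb hab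
  refine ⟨?_, ?_, ?_, ?_⟩ <;> simp <;> nlinarith

theorem HasOneVertex.connectedSpace [Nonempty ι] {O : Origami ι} (hO : O.HasOneVertex) :
    ConnectedSpace O.Surface := by
  have h0 : (0 : ℂ) ∈ closedSquare := corner_mem 0
  have hU : (⋃ i, O.param i '' closedSquare) = Set.univ := by
    ext x
    obtain ⟨i, z, hz, rfl⟩ := O.isTopTiling_param.surjective x
    simp only [Set.mem_iUnion, Set.mem_univ, iff_true]
    exact ⟨i, z, hz, rfl⟩
  have : IsPreconnected (Set.univ : Set O.Surface) := by
    rw [← hU]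
    obtain ⟨i₀⟩ := ‹Nonempty ι›
    refine isPreconnected_iUnion ⟨O.param i₀ 0, Set.mem_iInter.2 fun i => ?_⟩ fun i =>
      convex_closedSquare.isPreconnected.image _ (O.isTopTiling_param.continuousOn i)
    exact ⟨0, h0, (O.isTopTiling_param.eq_iff _ _ _ h0 _ h0).2
        (hO.eqvGen (isCorner_corner 0) (isCorner_corner 0))⟩
  exact { isPreconnected_univ := this, toNonempty := ⟨O.param (Classical.arbitrary ι) 0⟩ }

end Origami
end

noncomputable section

/-! ### The chart around the vertex -/

/-- The principal `n`-th root of a complex number. -/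
def nthRoot (n : ℕ) (z : ℂ) : ℂ := z ^ ((n : ℂ)⁻¹)

theorem nthRoot_pow {n : ℕ} (hn : n ≠ 0) (z : ℂ) : nthRoot n z ^ n = z :=
  Complex.cpow_nat_inv_pow z hn

/-- On the closed first quadrant the principal root does not jump, so it is multiplicative on the
boundary ray. The factor `nthRoot n I` is what the weights of the sectors have to compensate. -/
theorem nthRoot_I_mul {n : ℕ} (hn : n ≠ 0) {t : ℝ} (ht : 0 ≤ t) :
    nthRoot n (t * Complex.I) = nthRoot n Complex.I * nthRoot n t := by
  have hn' : ((n : ℂ)⁻¹) ≠ 0 := by simpa using hn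
  rcases ht.eq_or_lt with rfl | ht
  · simp [nthRoot, hn]
  · have h0 : (t : ℂ) ≠ 0 := by exact_mod_cast ht.ne'
    rw [nthRoot, nthRoot, nthRoot, Complex.cpow_def_of_ne_zero (by simp [h0]),
      Complex.cpow_def_of_ne_zero (by simp), Complex.cpow_def_of_ne_zero h0,
      Complex.log_ofReal_mul ht (by simp), ← Complex.exp_add, Complex.ofReal_log ht.le]
    ring_nf

/-- One `n`-th of a quarter turn is one `4n`-th of a full turn, which matches the `4n` sectors
around the vertex. -/
theorem isPrimitiveRoot_nthRoot_I {n : ℕ} (hn : n ≠ 0) :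
    IsPrimitiveRoot (nthRoot n Complex.I) (4 * n) := by
  have := Complex.isPrimitiveRoot_exp (4 * n) (by omega)
  convert this using 1
  rw [nthRoot, Complex.cpow_def_of_ne_zero (by simp), Complex.log_I]
  congr 1
  push_cast
  field_simp
  norm_num

theorem norm_nthRoot_lt {n : ℕ} (hn : n ≠ 0) {z w : ℂ} {r : ℝ} (hr : 0 ≤ r) (h : w ^ n = z) :
    ‖w‖ < r ^ ((n : ℝ)⁻¹) ↔ ‖z‖ < r := by
  rw [← h, norm_pow]
  have hn' : (0 : ℝ) < n := by exact_mod_cast Nat.pos_of_ne_zero hn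
  rw [Real.lt_rpow_inv_iff_of_pos (norm_nonneg _) hr hn', Real.rpow_natCast]

namespace Origami

variable {ι : Type}

theorem cornerPerm_pow_snd (O : Origami ι) (k : ℕ) (c : ι × Fin 4) :
    ((O.cornerPerm ^ k) c).2 = c.2 + Fin.ofNat 4 k := by
  induction k with
  | zero => simp
  | succ k ih =>
    rw [pow_succ', Equiv.Perm.mul_apply]
    change ((O.cornerPerm ^ k) c).2 + 1 = _
    rw [ih, add_assoc]
    congr 1
    ext
    simp [Fin.val_add]

theorem HasOneVertex.isCycleOn [Finite ι] {O : Origami ι} (hO : O.HasOneVertex) :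
    O.cornerPerm.IsCycleOn Set.univ :=
  ⟨O.cornerPerm.bijective.bijOn_univ, fun a _ b _ => hO a b⟩

/-- Weights of the corners that are multiplied by a primitive root of unity under turning. -/
theorem HasOneVertex.exists_weight [Finite ι] [Nonempty ι] {O : Origami ι} (hO : O.HasOneVertex) :
    ∃ E : ι × Fin 4 → ℂ, (∀ c, E (O.cornerPerm c) = nthRoot (Nat.card ι) Complex.I * E c) ∧
      Function.Injective E ∧ (∀ c, E c ^ Nat.card ι = Complex.I ^ (c.2 : ℕ)) ∧
      ∀ c (ζ : ℂ), ζ ^ Nat.card ι = 1 → ∃ d, d.2 = c.2 ∧ E d = ζ * E c := by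
  have := Fintype.ofFinite ι
  have hn : Nat.card ι ≠ 0 := Nat.card_pos.ne'
  set n := Nat.card ι with hnd
  set η := nthRoot n Complex.I with hη
  have hprim : IsPrimitiveRoot η (4 * n) := isPrimitiveRoot_nthRoot_I hn
  have hord : orderOf η = 4 * n := hprim.eq_orderOf.symm
  have hcyc : O.cornerPerm.IsCycleOn ((Finset.univ : Finset (ι × Fin 4)) : Set (ι × Fin 4)) := by
    simpa using hO.isCycleOn
  have hcard : (Finset.univ : Finset (ι × Fin 4)).card = 4 * n := by
    rw [Finset.card_univ, Fintype.card_prod, Fintype.card_fin, hnd, Nat.card_eq_fintype_card,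
      mul_comm]
  obtain ⟨i₀⟩ := ‹Nonempty ι›
  have hex (c : ι × Fin 4) : ∃ k : ℕ, (O.cornerPerm ^ k) (i₀, 0) = c := by
    obtain ⟨k, -, hk⟩ := hcyc.exists_pow_eq (Finset.mem_univ (i₀, 0)) (Finset.mem_univ c)
    exact ⟨k, hk⟩
  choose k hk using hex
  -- The corner permutation is a cycle of length `4n`, the order of `η`, so the corner reached after
  -- `k` turns can be given the weight `η ^ k`.
  have hmod {a b : ℕ} : (O.cornerPerm ^ a) (i₀, 0) = (O.cornerPerm ^ b) (i₀, 0) ↔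
      η ^ a = η ^ b := by
    rw [hcyc.pow_apply_eq_pow_apply (Finset.mem_univ _), hcard,
      (hprim.isOfFinOrder (by omega)).pow_eq_pow_iff_modEq, hord]
  have hE (a : ℕ) : η ^ k ((O.cornerPerm ^ a) (i₀, 0)) = η ^ a := hmod.1 (hk _)
  refine ⟨fun c => η ^ k c, fun c => ?_, fun c d h => ?_, fun c => ?_, fun c ζ hζ => ?_⟩
  · have := hE (k c + 1)
    rw [pow_succ', Equiv.Perm.mul_apply, hk] at this
    change η ^ _ = η * η ^ _
    rw [this, pow_succ']
  · have := hmod.2 h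
    rwa [hk, hk] at this
  · have h2 := cornerPerm_pow_snd O (k c) (i₀, 0)
    rw [hk, zero_add] at h2
    rw [h2, ← pow_mul, mul_comm, pow_mul, hη, nthRoot_pow hn, Complex.I_pow_eq_pow_mod]
    simp
  · have : NeZero (4 * n) := ⟨by omega⟩
    obtain ⟨a, -, ha⟩ := hprim.eq_pow_of_pow_eq_one (ξ := ζ) (by rw
      [mul_comm, pow_mul, hζ, one_pow])
    refine ⟨(O.cornerPerm ^ (a + k c)) (i₀, 0), ?_, ?_⟩
    · have h4 : 4 ∣ a := by
        have : η ^ (a * n) = 1 := by rw [pow_mul, ha, hζ]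
        rw [hprim.pow_eq_one_iff_dvd] at this
        exact Nat.dvd_of_mul_dvd_mul_right (Nat.pos_of_ne_zero hn) this
      rw [pow_add, Equiv.Perm.mul_apply, hk, cornerPerm_pow_snd]
      obtain ⟨m, rfl⟩ := h4
      have : Fin.ofNat 4 (4 * m) = 0 := by ext; simp
      rw [this, add_zero]
    · change η ^ _ = _ * η ^ _
      rw [hE, pow_add, ha]

/-- As `s` commutes with the cycle, the ratio of `E (s c)` to `E c` is the same for all corners.
Applying `s` twice shows that its square is `1`, and it is not `1` because `E` is injective and `s`
has no fixed point. -/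
theorem weight_neg [Finite ι] {O : Origami ι} (hO : O.HasOneVertex) {E : ι × Fin 4 → ℂ} {η : ℂ}
    (hE : ∀ c, E (O.cornerPerm c) = η * E c) (hinj : Function.Injective E)
    {s : ι × Fin 4 → ι × Fin 4} (hs : ∀ c, s (O.cornerPerm c) = O.cornerPerm (s c))
    (hss : ∀ c, s (s c) = c) (hsc : ∀ c, s c ≠ c) (c : ι × Fin 4) : E (s c) = - E c := by
  have := Fintype.ofFinite ι
  have hcyc : O.cornerPerm.IsCycleOn ((Finset.univ : Finset (ι × Fin 4)) : Set (ι × Fin 4)) := by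
    simpa using hO.isCycleOn
  have key (m : ℕ) : E (s ((O.cornerPerm ^ m) c)) * E c = E (s c) * E ((O.cornerPerm ^ m) c) := by
    induction m with
    | zero => rfl
    | succ m ih =>
      rw [pow_succ', Equiv.Perm.mul_apply, hs, hE, hE]
      linear_combination η * ih
  obtain ⟨m, -, hm⟩ := hcyc.exists_pow_eq (Finset.mem_univ c) (Finset.mem_univ (s c))
  have := key m
  rw [hm, hss] at this
  rcases mul_self_eq_mul_self_iff.1 this with h | h
  · exact absurd (hinj h).symm (hsc c)
  · rw [h, neg_neg]

open Classical in
/-- The corner of the unit square next to a point. -/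
def nearest (z : ℂ) : Fin 4 :=
  if z.re < 1 / 2 then if z.im < 1 / 2 then 0 else 3 else if z.im < 1 / 2 then 1 else 2

/-- The coordinate of a point with respect to the nearest corner. -/
def sector (z : ℂ) : ℂ := (z - corner (nearest z)) / Complex.I ^ (nearest z : ℕ)

/-- The part of the unit square in the chart around the vertex. -/
def vertexNhd : Set ℂ := {z | z ∈ closedSquare ∧ ‖z - corner (nearest z)‖ < 1 / 4}

theorem sector_mul (z : ℂ) :
    sector z * Complex.I ^ (nearest z : ℕ) = z - corner (nearest z) := by
  rw [sector, div_mul_cancel₀]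
  exact pow_ne_zero _ Complex.I_ne_zero

theorem sector_nonneg {z : ℂ} (hz : z ∈ closedSquare) : 0 ≤ (sector z).re ∧ 0 ≤ (sector z).im := by
  obtain ⟨h1, h2, h3, h4⟩ := hz
  unfold sector nearest
  split_ifs <;> simp [corner, Complex.div_re, Complex.div_im, pow_succ, h1, h2, h3, h4]

theorem nearest_corner_add (b : Fin 4) {w : ℂ} (h2 : w.re < 1 / 2)
    (h4 : w.im < 1 / 2) : nearest (corner b + Complex.I ^ (b : ℕ) * w) = b := by
  fin_cases b
  · simp [corner, nearest] at *
    rw [if_pos h2, if_pos h4]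
  · simp [corner, nearest] at *
    rw [if_neg (by linarith), if_pos h2]
  · simp [corner, nearest] at *
    rw [if_neg (by linarith), if_neg (by linarith)]
  · simp [corner, nearest, pow_succ] at *
    rw [if_pos h4, if_neg (by linarith)]

theorem corner_add_mem (b : Fin 4) {w : ℂ} (h1 : 0 ≤ w.re) (h2 : w.re ≤ 1) (h3 : 0 ≤ w.im)
    (h4 : w.im ≤ 1) : corner b + Complex.I ^ (b : ℕ) * w ∈ closedSquare := by
  fin_cases b <;> simp [corner, closedSquare, pow_succ] at * <;> simp_all

theorem sector_corner_add (b : Fin 4) {w : ℂ} (h2 : w.re < 1 / 2)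
    (h4 : w.im < 1 / 2) : sector (corner b + Complex.I ^ (b : ℕ) * w) = w := by
  rw [sector, nearest_corner_add b h2 h4, add_sub_cancel_left, mul_div_cancel_left₀]
  exact pow_ne_zero _ Complex.I_ne_zero

theorem corner_add_mem_vertexNhd (b : Fin 4) {w : ℂ} (h1 : 0 ≤ w.re) (h3 : 0 ≤ w.im)
    (h : ‖w‖ < 1 / 4) : corner b + Complex.I ^ (b : ℕ) * w ∈ vertexNhd := by
  have h2 := (Complex.re_le_norm w).trans_lt h
  have h4 := (Complex.im_le_norm w).trans_lt h
  refine ⟨corner_add_mem b h1 (by linarith) h3 (by linarith), ?_⟩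
  rw [nearest_corner_add b (by linarith) (by linarith)]
  simpa using h

theorem corner_add_sector (z : ℂ) :
    corner (nearest z) + Complex.I ^ (nearest z : ℕ) * sector z = z := by
  rw [mul_comm, sector_mul, add_sub_cancel]

theorem norm_sector (z : ℂ) : ‖sector z‖ = ‖z - corner (nearest z)‖ := by
  rw [sector]; simp

/-- Two points of sectors of the plane that agree lie in the same sector or on the common side of
adjacent sectors. -/
theorem eq_or_of_sector {b c : Fin 4} {p q : ℂ} (hp : 0 ≤ p.re ∧ 0 ≤ p.im)
    (hq : 0 ≤ q.re ∧ 0 ≤ q.im) (h : p * Complex.I ^ (b : ℕ) = q * Complex.I ^ (c : ℕ)) :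
    (p = 0 ∧ q = 0) ∨ (b = c ∧ p = q) ∨ (c = b + 1 ∧ p = q.re * Complex.I ∧ q = q.re) ∨
      (b = c + 1 ∧ q = p.re * Complex.I ∧ p = p.re) := by
  obtain ⟨hp1, hp2⟩ := hp
  obtain ⟨hq1, hq2⟩ := hq
  have h1 := congrArg Complex.re h
  have h2 := congrArg Complex.im h
  fin_cases b <;> fin_cases c <;> simp [pow_succ] at h1 h2 <;>
    simp [Complex.ext_iff] <;> grind

/-- The final ray of the sector at the corner `b` is the initial ray of the next sector in the
clockwise order of the corners. -/
theorem eqvGen_turn (O : Origami ι) (i : ι) (b : Fin 4) {t : ℝ} (h0 : 0 ≤ t) (h1 : t ≤ 1) :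
    Relation.EqvGen O.Glue (i, corner b + Complex.I ^ (b : ℕ) * (t * Complex.I))
      (O.turn b i, corner (b + 1) + Complex.I ^ ((b + 1 : Fin 4) : ℕ) * t) := by
  have hh (i : ι) (t : ℝ) (h0 h1) := Relation.EqvGen.rel _ _ (Glue.horizontal (O := O) i t h0 h1)
  have hv (i : ι) (t : ℝ) (h0 h1) := Relation.EqvGen.rel _ _ (Glue.vertical (O := O) i t h0 h1)
  fin_cases b
  · convert (hh (O.right⁻¹ i) t h0 h1).symm using 2 <;> simp [turn, corner, mul_comm]
  · convert (hv (O.top⁻¹ i) (1 - t) (by linarith) (by linarith)).symm using 2 <;>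
      simp [turn, corner] <;> first | ring1 | linear_combination (t : ℂ) * Complex.I_mul_I
  · convert hh i (1 - t) (by linarith) (by linarith) using 2 <;>
      simp [turn, corner, pow_succ] <;> ring1
  · convert hv i t h0 h1 using 2 <;> simp [turn, corner, pow_succ]
    linear_combination -t * Complex.I_mul_I

open Classical in
/-- The cone coordinate around the vertex. -/
def vertexCoord (E : ι × Fin 4 → ℂ) (n : ℕ) (a : ι × ℂ) : ℂ :=
  E (a.1, nearest a.2) * nthRoot n (sector a.2)

theorem vertexCoord_turn {O : Origami ι} {E : ι × Fin 4 → ℂ} {n : ℕ} (hn : n ≠ 0)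
    (hE : ∀ c, E (O.cornerPerm c) = nthRoot n Complex.I * E c) (i : ι) (b : Fin 4) {t : ℝ}
    (h0 : 0 ≤ t) (h1 : t < 1 / 2) :
    vertexCoord E n (i, corner b + Complex.I ^ (b : ℕ) * (t * Complex.I)) =
      vertexCoord E n (O.turn b i, corner (b + 1) + Complex.I ^ ((b + 1 : Fin 4) : ℕ) * t) := by
  have h1' : t < 2⁻¹ := by linarith
  unfold vertexCoord
  dsimp only
  rw [nearest_corner_add b (by simp) (by simpa),
    nearest_corner_add (b + 1) (by simpa) (by simp),
    sector_corner_add b (by simp) (by simpa),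
    sector_corner_add (b + 1) (by simpa) (by simp), ← cornerPerm_apply, hE,
    nthRoot_I_mul hn h0]
  ring

/-- Only the two end quarters of a side meet the neighbourhood of the vertex. There the gluing is a
turn around a corner, and the weights were chosen so that the coordinate is unchanged by a turn. -/
theorem vertex_glue {O : Origami ι} {E : ι × Fin 4 → ℂ} {n : ℕ} (hn : n ≠ 0)
    (hE : ∀ c, E (O.cornerPerm c) = nthRoot n Complex.I * E c) {a b : ι × ℂ} (h : O.Glue a b) :
    (a.2 ∈ vertexNhd ↔ b.2 ∈ vertexNhd) ∧
      (a.2 ∈ vertexNhd → vertexCoord E n a = vertexCoord E n b) := by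
  have hm := h.mem_closedSquare
  have hmem (b : Fin 4) (t : ℝ) (h0 : 0 ≤ t) (h1 : t < 1 / 4) :
      corner b + Complex.I ^ (b : ℕ) * (t * Complex.I) ∈ vertexNhd ∧
      corner (b + 1) + Complex.I ^ ((b + 1 : Fin 4) : ℕ) * t ∈ vertexNhd :=
    ⟨corner_add_mem_vertexNhd b (by simp) (by simpa)
        (by simpa [abs_of_nonneg h0] using by linarith),
      corner_add_mem_vertexNhd (b + 1) (by simpa) (by simp)
        (by simpa [abs_of_nonneg h0] using by linarith)⟩
  have hbd {z : ℂ} (hz : z ∈ vertexNhd) : (z.re < 1 / 4 ∨ 3 / 4 < z.re) ∧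
      (z.im < 1 / 4 ∨ 3 / 4 < z.im) := by
    obtain ⟨⟨h1, h2, h3, h4⟩, h⟩ := hz
    have k1 := abs_lt.1 ((Complex.abs_re_le_norm _).trans_lt h)
    have k2 := abs_lt.1 ((Complex.abs_im_le_norm _).trans_lt h)
    unfold nearest at k1 k2
    split_ifs at k1 k2 <;> simp [corner] at k1 k2 <;> grind
  cases h with
  | horizontal i t h0 h1 =>
    rcases lt_or_ge t (1 / 4) with ht | ht
    · have k1 := hmem 0 t h0 ht
      have k2 := vertexCoord_turn hn hE (O.right i) 0 h0 (by linarith)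
      have e1 : corner 0 + Complex.I ^ ((0 : Fin 4) : ℕ) * (t * Complex.I) = t * Complex.I := by
        simp [corner]
      have e2 : corner (0 + 1) + Complex.I ^ ((0 + 1 : Fin 4) : ℕ) * t = 1 + t * Complex.I := by
        simp [corner, mul_comm]
      rw [e1, e2] at k1 k2
      simp only [turn, Matrix.cons_val_zero, Equiv.Perm.inv_def, Equiv.symm_apply_apply] at k2
      exact ⟨iff_of_true k1.2 k1.1, fun _ => k2.symm⟩
    rcases lt_or_ge (3 / 4) t with ht' | ht'
    · have k1 := hmem 2 (1 - t) (by linarith) (by linarith)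
      have k2 := vertexCoord_turn hn hE i 2 (t := 1 - t) (by linarith) (by linarith)
      have e1 : corner 2 + Complex.I ^ ((2 : Fin 4) : ℕ) * ((1 - t : ℝ) * Complex.I) =
          1 + t * Complex.I := by
        simp [corner]; ring
      have e2 : corner (2 + 1) + Complex.I ^ ((2 + 1 : Fin 4) : ℕ) * (1 - t : ℝ) =
          t * Complex.I := by
        simp [corner, pow_succ]; ring
      rw [e1, e2] at k1 k2
      exact ⟨iff_of_true k1.1 k1.2, fun _ => k2⟩
    · have k1 : (1 + t * Complex.I) ∉ vertexNhd := by
        intro h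
        have := (hbd h).2
        simp at this
        grind
      have k2 : (t * Complex.I) ∉ vertexNhd := by
        intro h
        have := (hbd h).2
        simp at this
        grind
      simp [k1, k2]
  | vertical i t h0 h1 =>
    rcases lt_or_ge t (1 / 4) with ht | ht
    · have k1 := hmem 3 t h0 ht
      have k2 := vertexCoord_turn hn hE i 3 h0 (by linarith)
      have e1 : corner 3 + Complex.I ^ ((3 : Fin 4) : ℕ) * (t * Complex.I) = t + Complex.I := by
        simp [corner, pow_succ]
        linear_combination -t * Complex.I_mul_I
      have e2 : corner (3 + 1) + Complex.I ^ ((3 + 1 : Fin 4) : ℕ) * t = t := by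
        simp [corner]
      rw [e1, e2] at k1 k2
      exact ⟨iff_of_true k1.1 k1.2, fun _ => k2⟩
    rcases lt_or_ge (3 / 4) t with ht' | ht'
    · have k1 := hmem 1 (1 - t) (by linarith) (by linarith)
      have k2 := vertexCoord_turn hn hE (O.top i) 1 (t := 1 - t) (by linarith) (by linarith)
      have e1 : corner 1 + Complex.I ^ ((1 : Fin 4) : ℕ) * ((1 - t : ℝ) * Complex.I) = t := by
        simp [corner]
        linear_combination (1 - t : ℂ) * Complex.I_mul_I
      have e2 : corner (1 + 1) + Complex.I ^ ((1 + 1 : Fin 4) : ℕ) * (1 - t : ℝ) =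
          t + Complex.I := by
        simp [corner]; ring
      rw [e1, e2] at k1 k2
      simp only [turn, Matrix.cons_val_one, Matrix.cons_val_zero,
        Equiv.Perm.inv_def, Equiv.symm_apply_apply] at k2
      exact ⟨iff_of_true k1.2 k1.1, fun _ => k2.symm⟩
    · have k1 : (t + Complex.I) ∉ vertexNhd := by
        intro h
        have := (hbd h).1
        simp at this
        grind
      have k2 : (t : ℂ) ∉ vertexNhd := by
        intro h
        have := (hbd h).1
        simp at this
        grind
      simp [k1, k2]

/-- The midpoint symmetry of the square on corners. -/
def flipCorner (ρ : Equiv.Perm ι) (c : ι × Fin 4) : ι × Fin 4 := (ρ c.1, c.2 + 2)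

/-- A half turn of the square exchanges opposite corners together with their sectors. The sector
coordinate, taken relative to the corner, is unchanged. -/
theorem nearest_flip {z : ℂ} (hz : z ∈ vertexNhd) : nearest (1 + Complex.I - z) = nearest z + 2 ∧
    sector (1 + Complex.I - z) = sector z ∧ 1 + Complex.I - z ∈ vertexNhd := by
  obtain ⟨h1, h⟩ := hz
  have hs := sector_nonneg h1
  rw [← norm_sector] at h
  have h2 := (Complex.re_le_norm _).trans_lt h
  have h4 := (Complex.im_le_norm _).trans_lt h
  have e : 1 + Complex.I - z = corner (nearest z + 2) +
      Complex.I ^ ((nearest z + 2 : Fin 4) : ℕ) * sector z := by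
    have key (b : Fin 4) (w : ℂ) : 1 + Complex.I - (corner b + Complex.I ^ (b : ℕ) * w) =
        corner (b + 2) + Complex.I ^ ((b + 2 : Fin 4) : ℕ) * w := by
      fin_cases b <;> simp [corner, pow_succ] <;> ring
    rw [← key, corner_add_sector]
  rw [e]
  exact ⟨nearest_corner_add _ (by linarith) (by linarith),
    sector_corner_add _ (by linarith) (by linarith),
    corner_add_mem_vertexNhd _ hs.1 hs.2 h⟩

theorem continuousAt_nearest {z : ℂ}
    (h : ‖z - corner (nearest z)‖ ≤ 1 / 4) : ∀ᶠ w in 𝓝 z, nearest w = nearest z := by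
  have k1 := abs_le.1 ((Complex.abs_re_le_norm _).trans h)
  have k2 := abs_le.1 ((Complex.abs_im_le_norm _).trans h)
  have hre : z.re ≠ 1 / 2 := by
    unfold nearest at k1
    intro hh
    split_ifs at k1 <;> simp [corner, hh] at k1 <;> linarith [k1.1, k1.2]
  have him : z.im ≠ 1 / 2 := by
    unfold nearest at k2
    intro hh
    split_ifs at k2 <;> simp [corner, hh] at k2 <;> linarith [k2.1, k2.2]
  have e1 : ∀ᶠ w : ℂ in 𝓝 z, (w.re < 1 / 2 ↔ z.re < 1 / 2) := by
    rcases lt_or_gt_of_ne hre with h | h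
    · filter_upwards [(isOpen_lt Complex.continuous_re continuous_const).mem_nhds h] with w hw
      exact iff_of_true hw h
    · filter_upwards [(isOpen_lt continuous_const Complex.continuous_re).mem_nhds h] with w hw
      exact iff_of_false (not_lt.2 (le_of_lt hw)) (not_lt.2 h.le)
  have e2 : ∀ᶠ w : ℂ in 𝓝 z, (w.im < 1 / 2 ↔ z.im < 1 / 2) := by
    rcases lt_or_gt_of_ne him with h | h
    · filter_upwards [(isOpen_lt Complex.continuous_im continuous_const).mem_nhds h] with w hw
      exact iff_of_true hw h
    · filter_upwards [(isOpen_lt continuous_const Complex.continuous_im).mem_nhds h] with w hw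
      exact iff_of_false (not_lt.2 (le_of_lt hw)) (not_lt.2 h.le)
  filter_upwards [e1, e2] with w h1 h2
  simp only [nearest, h1, h2]

theorem isClosed_closedVertexNhd :
    IsClosed {z | z ∈ closedSquare ∧ ‖z - corner (nearest z)‖ ≤ 1 / 4} := by
  have : {z | z ∈ closedSquare ∧ ‖z - corner (nearest z)‖ ≤ 1 / 4} =
      ⋃ b, closedSquare ∩ Metric.closedBall (corner b) (1 / 4) := by
    ext z
    simp only [Set.mem_ofPred_eq, Set.mem_iUnion, Set.mem_inter_iff, mem_closedBall_iff_norm]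
    constructor
    · rintro ⟨h1, h2⟩
      exact ⟨_, h1, h2⟩
    · rintro ⟨b, hz, h⟩
      have k1 := abs_le.1 ((Complex.abs_re_le_norm _).trans h)
      have k2 := abs_le.1 ((Complex.abs_im_le_norm _).trans h)
      suffices nearest z = b by
        rw [this]; exact ⟨hz, h⟩
      unfold nearest
      fin_cases b <;> simp [corner] at k1 k2 <;> split_ifs <;>
        first | rfl | (exfalso; linarith [k1.1, k1.2, k2.1, k2.2])
  rw [this]
  exact isClosed_iUnion_of_finite fun b =>
    isCompact_closedSquare.isClosed.inter Metric.isClosed_closedBall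

theorem isClosed_sdiff_vertexNhd : IsClosed (closedSquare \ vertexNhd) := by
  have : closedSquare \ vertexNhd =
      closedSquare \ ⋃ b, Metric.ball (corner b) (1 / 4) := by
    ext z
    simp only [Set.mem_sdiff, Set.mem_iUnion, mem_ball_iff_norm, vertexNhd, Set.mem_ofPred_eq]
    refine and_congr_right fun hz => not_congr ⟨fun h => ⟨_, h.2⟩, ?_⟩
    rintro ⟨b, h⟩
    have k1 := abs_lt.1 ((Complex.abs_re_le_norm _).trans_lt h)
    have k2 := abs_lt.1 ((Complex.abs_im_le_norm _).trans_lt h)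
    suffices nearest z = b by
      rw [this]; exact ⟨hz, h⟩
    unfold nearest
    fin_cases b <;> simp [corner] at k1 k2 <;> split_ifs <;>
      first | rfl | (exfalso; linarith [k1.1, k1.2, k2.1, k2.2])
  rw [this]
  exact isCompact_closedSquare.isClosed.sdiff (isOpen_iUnion fun b => Metric.isOpen_ball)

end Origami
end

noncomputable section

namespace Origami

variable {ι : Type}

theorem mul_top_inv_symm {ρ σ : Equiv.Perm ι} (h : σ * ρ * σ = ρ) (i : ι) :
    ρ (σ⁻¹ i) = σ (ρ i) := by
  have := congrArg (fun f : Equiv.Perm ι => f (σ⁻¹ i)) h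
  simpa using this.symm

theorem mul_top_symm {ρ σ : Equiv.Perm ι} (h : σ * ρ * σ = ρ) (i : ι) :
    ρ (σ i) = σ⁻¹ (ρ i) := by
  have := congrArg (fun f : Equiv.Perm ι => σ⁻¹ (f i)) h
  simpa using this

theorem flipCorner_cornerPerm {O : Origami ι} {ρ : Equiv.Perm ι}
    (hσ : O.right * ρ * O.right = ρ) (hτ : O.top * ρ * O.top = ρ) (c : ι × Fin 4) :
    flipCorner ρ (O.cornerPerm c) = O.cornerPerm (flipCorner ρ c) := by
  obtain ⟨i, b⟩ := c
  fin_cases b <;> simp [flipCorner, cornerPerm_apply, turn]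
  · exact mul_top_inv_symm hσ i
  · exact mul_top_inv_symm hτ i
  · exact mul_top_symm hσ i
  · exact mul_top_symm hτ i

/-- The cone chart around the vertex of an origami with a single vertex. -/
theorem HasOneVertex.exists_vertexChart [Finite ι] [Nonempty ι] {O : Origami ι}
    (hO : O.HasOneVertex) {X : Type*} [TopologicalSpace X] [T2Space X] {P : ι → ℂ → X}
    (hP : O.IsTopTiling P) :
    ∃ e : OpenPartialHomeomorph X ℂ,
      (∀ k, ∀ z ∈ closedSquare, P k z ∈ e.source ↔ z ∈ vertexNhd) ∧
      (∃ r > 0, e.target = Metric.ball 0 r) ∧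
      (∀ k, ∀ z ∈ vertexNhd, e (P k z) ^ Nat.card ι = z - corner (nearest z)) ∧
      ∀ ρ : Equiv.Perm ι, ρ * ρ = 1 → O.right * ρ * O.right = ρ → O.top * ρ * O.top = ρ →
        ∀ k, ∀ z ∈ vertexNhd, e (P (ρ k) (1 + Complex.I - z)) = - e (P k z) := by
  obtain ⟨E, hE, hinj, hpow, hroot⟩ := hO.exists_weight
  have hn : Nat.card ι ≠ 0 := Nat.card_pos.ne'
  set n := Nat.card ι with hnd
  have hn' : (0 : ℝ) < n := by exact_mod_cast Nat.pos_of_ne_zero hn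
  have hE0 (c) : E c ≠ 0 := by
    intro h
    have := hpow c
    rw [h, zero_pow hn] at this
    exact pow_ne_zero _ Complex.I_ne_zero this.symm
  have hfpow (i : ι) (z : ℂ) : vertexCoord E n (i, z) ^ n = z - corner (nearest z) := by
    rw [vertexCoord, mul_pow, hpow, nthRoot_pow hn, mul_comm, sector_mul]
  have hV : vertexNhd ⊆ closedSquare := fun z hz => hz.1
  suffices H : ∃ e : OpenPartialHomeomorph X ℂ,
      (∀ k, ∀ z ∈ closedSquare, P k z ∈ e.source ↔ z ∈ vertexNhd) ∧
      e.target = Metric.ball 0 ((1 / 4 : ℝ) ^ ((n : ℝ)⁻¹)) ∧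
      ∀ k, ∀ z ∈ vertexNhd, e (P k z) = vertexCoord E n (k, z) by
    obtain ⟨e, h1, h2, h3⟩ := H
    refine ⟨e, h1, ⟨_, by positivity, h2⟩, fun k z hz => by rw [h3 k z hz, hfpow], ?_⟩
    intro ρ hρ hσ hτ k z hz
    obtain ⟨k1, k2, k3⟩ := nearest_flip hz
    rw [h3 k z hz, h3 _ _ k3, vertexCoord, vertexCoord]
    dsimp only
    rw [k1, k2]
    -- The half turn shifts the corners by two, so it has no fixed corner; the coordinate changes
    -- sign through the weight alone.
    have := weight_neg hO hE hinj (flipCorner_cornerPerm hσ hτ) (fun c => ?_) (fun c => ?_)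
      (k, nearest z)
    · rw [flipCorner] at this
      dsimp only at this
      rw [this, neg_mul]
    · have h4 : (2 : Fin 4) + 2 = 0 := rfl
      have := congrArg (fun f : Equiv.Perm ι => f c.1) hρ
      simp only [Equiv.Perm.mul_apply, Equiv.Perm.one_apply] at this
      simp [flipCorner, this, add_assoc, h4]
    · intro h
      have := congrArg Prod.snd h
      simp [flipCorner] at this
  refine hP.exists_chart (fun i z => vertexCoord E n (i, z))
    (fun _ => {z | z ∈ closedSquare ∧ ‖z - corner (nearest z)‖ ≤ 1 / 4}) (fun _ => vertexNhd)
    _ Metric.isOpen_ball (fun _ => isClosed_closedVertexNhd) (fun _ z hz => hz.1)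
    (fun _ z hz => ⟨hz.1, hz.2.le⟩) (fun _ => isClosed_sdiff_vertexNhd) ?_ ?_ ?_ ?_
  · intro i z hz
    have hnear := continuousAt_nearest hz.2
    have hre := (sector_nonneg hz.1).1
    have hsec : ContinuousAt sector z := by
      have : ContinuousAt (fun w => (w - corner (nearest z)) / Complex.I ^ (nearest z : ℕ)) z := by
        fun_prop
      refine this.congr ?_
      filter_upwards [hnear] with w hw
      rw [sector, hw]
    have hroot : ContinuousAt (nthRoot n) (sector z) := by
      refine Complex.continuousAt_cpow_const_of_re_pos (.inl hre) ?_
      rw [← Complex.ofReal_natCast, ← Complex.ofReal_inv, Complex.ofReal_re]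
      positivity
    have : ContinuousAt (fun w => E (i, nearest z) * nthRoot n (sector w)) z :=
      continuousAt_const.mul (ContinuousAt.comp (f := sector) hroot hsec)
    refine ContinuousAt.continuousWithinAt (this.congr ?_)
    filter_upwards [hnear] with w hw
    rw [vertexCoord, hw]
  · intro i z hz j w hw
    rw [hP.eq_iff _ _ _ hz.1 _ hw]
    constructor
    · intro h
      classical
      have := eqvGen_map (f := fun a => if a.2 ∈ vertexNhd then some (vertexCoord E n a) else none)
        (fun a b hab => ?_) h
      · simp only [if_pos hz] at this
        by_cases hw' : w ∈ vertexNhd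
        · rw [if_pos hw'] at this
          exact ⟨hw', Option.some.inj this⟩
        · rw [if_neg hw'] at this
          exact absurd this (by simp)
      · obtain ⟨h1, h2⟩ := vertex_glue hn hE hab
        by_cases ha : a.2 ∈ vertexNhd
        · simp only [if_pos ha, if_pos (h1.1 ha), h2 ha]
        · simp only [if_neg ha, if_neg (mt h1.2 ha)]
    · rintro ⟨hw', h⟩
      -- The `n`-th powers show that the two points have the same flat coordinate, so they lie in
      -- the same kind of sector or on a common ray of consecutive ones. The injectivity of the
      -- weights then identifies the squares.
      have hp := congrArg (· ^ n) h
      simp only [hfpow] at hp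
      rw [← sector_mul, ← sector_mul] at hp
      have hzs := corner_add_sector z
      have hws := corner_add_sector w
      have hz1 := (norm_sector z).trans_lt hz.2
      have hw1 := (norm_sector w).trans_lt hw'.2
      have sub : ∀ {i j : ι} {z w : ℂ} (_ : z ∈ vertexNhd) (_ : w ∈ vertexNhd)
          (_ : vertexCoord E n (i, z) = vertexCoord E n (j, w)) (_ : nearest w = nearest z + 1)
          (_ : sector z = (sector w).re * Complex.I) (_ : sector w = (sector w).re)
          (_ : sector w ≠ 0), Relation.EqvGen O.Glue (i, z) (j, w) := by
        intro i j z w hz hw h hb hs1 hs2 hs0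
        have hnn := (sector_nonneg hw.1).1
        have hle : (sector w).re ≤ 1 := by
          have := (Complex.re_le_norm _).trans_lt ((norm_sector w).trans_lt hw.2)
          linarith
        have key := eqvGen_turn O i (nearest z) hnn hle
        rw [← hs1, corner_add_sector, ← hb, ← hs2, corner_add_sector] at key
        suffices O.turn (nearest z) i = j by rwa [this] at key
        rw [vertexCoord, vertexCoord] at h
        dsimp only at h
        have hr0 : nthRoot n (sector w) ≠ 0 := by
          intro h0
          have := nthRoot_pow hn (sector w)
          rw [h0, zero_pow hn] at this
          exact hs0 this.symm
        rw [hs1, nthRoot_I_mul hn hnn, ← hs2, ← mul_assoc, mul_left_inj' hr0, mul_comm, ← hE,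
          cornerPerm_apply] at h
        exact congrArg Prod.fst (hinj h)
      have hzero (h1 : sector z = 0) (h2 : sector w = 0) :
          Relation.EqvGen O.Glue (i, z) (j, w) := by
        rw [h1, mul_zero, add_zero] at hzs
        rw [h2, mul_zero, add_zero] at hws
        rw [← hzs, ← hws]
        exact hO.eqvGen (isCorner_corner _) (isCorner_corner _)
      rcases eq_or_of_sector (sector_nonneg hz.1) (sector_nonneg hw) hp with
        ⟨h1, h2⟩ | ⟨h1, h2⟩ | ⟨h1, h2, h3⟩ | ⟨h1, h2, h3⟩
      · exact hzero h1 h2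
      · by_cases h0 : sector w = 0
        · exact hzero (h2.trans h0) h0
        · have hr0 : nthRoot n (sector w) ≠ 0 := by
            intro h0'
            have := nthRoot_pow hn (sector w)
            rw [h0', zero_pow hn] at this
            exact h0 this.symm
          have hzw : z = w := by rw [← hzs, h1, h2, hws]
          subst hzw
          rw [vertexCoord, vertexCoord] at h
          dsimp only at h
          rw [mul_left_inj' hr0] at h
          rw [show i = j from congrArg Prod.fst (hinj h)]
          exact .refl _
      · by_cases h0 : sector w = 0
        · exact hzero (by rw [h2, h0]; simp) h0
        · exact sub hz hw' h h1 h2 h3 h0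
      · by_cases h0 : sector z = 0
        · exact hzero h0 (by rw [h2, h0]; simp)
        · exact (sub hw' hz h.symm h1 h2 h3 h0).symm
  · intro i z hz
    rw [mem_ball_zero_iff, norm_nthRoot_lt hn (by norm_num) (hfpow i z)]
    exact ⟨fun h => ⟨hz.1, h⟩, fun h => h.2⟩
  · intro d hd
    rw [mem_ball_zero_iff, norm_nthRoot_lt hn (by norm_num) rfl] at hd
    -- The quadrant that contains `d ^ n` determines the kind of corner.
    obtain ⟨b, p, hp1, hp2, hp⟩ : ∃ (b : Fin 4) (p : ℂ), 0 ≤ p.re ∧ 0 ≤ p.im ∧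
        Complex.I ^ (b : ℕ) * p = d ^ n := by
      generalize d ^ n = u
      rcases le_total 0 u.re with h1 | h1 <;> rcases le_total 0 u.im with h2 | h2
      · exact ⟨0, u, h1, h2, by simp⟩
      · exact ⟨3, Complex.I * u, by simpa using h2, by simpa using h1, by
          simp [pow_succ, ← mul_assoc]⟩
      · exact ⟨1, -Complex.I * u, by simpa using h2, by simpa using h1, by
          simp [← mul_assoc]⟩
      · exact ⟨2, -u, by simpa using h1, by simpa using h2, by simp⟩
    have hpn : ‖p‖ < 1 / 4 := by
      rw [← hp] at hd
      simpa using hd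
    have h2 := (Complex.re_le_norm _).trans_lt hpn
    have h4 := (Complex.im_le_norm _).trans_lt hpn
    have hf (i : ι) : vertexCoord E n (i, corner b + Complex.I ^ (b : ℕ) * p) =
        E (i, b) * nthRoot n p := by
      rw [vertexCoord]
      dsimp only
      rw [nearest_corner_add b (by linarith) (by linarith),
        sector_corner_add b (by linarith) (by linarith)]
    obtain ⟨i⟩ := ‹Nonempty ι›
    have hd0 : (E (i, b) * nthRoot n p) ^ n = d ^ n := by
      rw [mul_pow, hpow, nthRoot_pow hn, hp]
    -- The point found so far has the right `n`-th power. The remaining root of unity is absorbed by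
    -- another corner of the same kind.
    obtain ⟨c, hc, hcE⟩ : ∃ c : ι × Fin 4, c.2 = b ∧ E c * nthRoot n p = d := by
      by_cases h0 : E (i, b) * nthRoot n p = 0
      · refine ⟨(i, b), rfl, ?_⟩
        rw [h0, zero_pow hn] at hd0
        rw [h0]
        exact (eq_zero_of_pow_eq_zero hd0.symm).symm
      · obtain ⟨c, hc, hcE⟩ := hroot (i, b) (d / (E (i, b) * nthRoot n p))
          (by rw [div_pow, hd0, div_self (by rw [← hd0]; exact pow_ne_zero _ h0)])
        exact ⟨c, hc, by rw [hcE, mul_assoc, div_mul_cancel₀ _ h0]⟩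
    obtain ⟨k, b'⟩ := c
    dsimp only at hc
    subst hc
    exact ⟨k, _, corner_add_mem_vertexNhd b' hp1 hp2 hpn, (hf k).trans hcE⟩

end Origami
end

noncomputable section

/-! ### Riemann surfaces from cone charts -/

/-- The outer function has a local inverse at `t z`. In the application it is a power, so `t` is a
holomorphic branch of a root. -/
theorem DifferentiableAt.of_comp_left {t g : ℂ → ℂ} {g' z : ℂ} (ht : ContinuousAt t z)
    (hg : HasStrictDerivAt g g' (t z)) (hg' : g' ≠ 0) (h : DifferentiableAt ℂ (g ∘ t) z) :
    DifferentiableAt ℂ t z := by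
  have hinv := (hg.to_localInverse hg').hasDerivAt.differentiableAt
  refine (DifferentiableAt.comp z hinv h).congr_of_eventuallyEq ?_
  filter_upwards [ht.eventually (hg.eventually_left_inverse hg')] with w hw
  exact hw.symm

theorem DifferentiableAt.of_comp_right {h p : ℂ → ℂ} {p' z : ℂ} (hp : HasStrictDerivAt p p' z)
    (hp' : p' ≠ 0) (hd : DifferentiableAt ℂ (h ∘ p) z) : DifferentiableAt ℂ h (p z) := by
  have hinv := (hp.to_localInverse hp').hasDerivAt.differentiableAt
  have hz : hp.localInverse p p' z hp' (p z) = z := (hp.eventually_left_inverse hp').self_of_nhds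
  have hd' : DifferentiableAt ℂ (h ∘ p) (hp.localInverse p p' z hp' (p z)) := by rwa [hz]
  refine (DifferentiableAt.comp (p z) hd' hinv).congr_of_eventuallyEq ?_
  filter_upwards [hp.eventually_right_inverse hp'] with w hw
  exact (congrArg h hw).symm

theorem eventually_ne_punctured (a z : ℂ) : ∀ᶠ w in 𝓝[≠] z, w ≠ a := by
  by_cases h : z = a
  · subst h
    exact self_mem_nhdsWithin
  · exact nhdsWithin_le_nhds (isOpen_ne.mem_nhds h)

/-- The Riemann surface defined by a family of charts. -/
def ClosedRiemannSurface.ofCharts {X K : Type} [TopologicalSpace X] [T2Space X] [CompactSpace X]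
    [ConnectedSpace X] (f : K → OpenPartialHomeomorph X ℂ)
    (hcov : ∀ x, ∃ k, x ∈ (f k).source)
    (hdiff : ∀ k l, DifferentiableOn ℂ (f l ∘ (f k).symm) ((f k).symm.trans (f l)).source) :
    ClosedRiemannSurface :=
  letI : ChartedSpace ℂ X :=
    { atlas := Set.range f
      chartAt := fun x => f (hcov x).choose
      mem_chart_source := fun x => (hcov x).choose_spec
      chart_mem_atlas := fun _ => ⟨_, rfl⟩ }
  { carrier := X
    isManifold := by
      refine isManifold_of_contDiffOn _ _ _ ?_
      rintro _ _ ⟨k, rfl⟩ ⟨l, rfl⟩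
      have := (hdiff k l).contDiffOn (n := ω) ((f k).symm.trans (f l)).open_source
      simpa using this }

/-- The singularity at `0` is removable. This is needed at the centres of charts of the quotient,
where transitions pass through a square root. -/
theorem differentiableOn_of_ne_zero {T : ℂ → ℂ} {s : Set ℂ} (hs : IsOpen s) (hc : ContinuousOn T s)
    (h : ∀ w ∈ s, w ≠ 0 → DifferentiableAt ℂ T w) : DifferentiableOn ℂ T s := by
  by_cases h0 : (0 : ℂ) ∈ s
  · exact (Complex.differentiableOn_compl_singleton_and_continuousAt_iff (hs.mem_nhds h0)).1
      ⟨fun w hw => (h w hw.1 hw.2).differentiableWithinAt, hc.continuousAt (hs.mem_nhds h0)⟩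
  · exact fun w hw => (h w hw fun e => h0 (e ▸ hw)).differentiableWithinAt

/-- An atlas of cone charts: in terms of the chart `e` of degree `d`, the flat coordinate is
`e ^ d`, and flat coordinates differ locally by constants. -/
structure ConeAtlas (X K : Type) [TopologicalSpace X] where
  chart : K → OpenPartialHomeomorph X ℂ
  degree : K → ℕ
  degree_ne_zero : ∀ k, degree k ≠ 0
  exists_mem : ∀ x, ∃ k, x ∈ (chart k).source
  zero_mem : ∀ k, 0 ∈ (chart k).target
  eq_of_center : ∀ k l x, x ∈ (chart k).source → x ∈ (chart l).source → chart k x = 0 → k = l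
  transition : ∀ k l x, x ∈ (chart k).source → x ∈ (chart l).source →
    ∃ c, ∀ᶠ y in 𝓝 x, chart l y ^ degree l = chart k y ^ degree k + c

namespace ConeAtlas

variable {X K : Type} [TopologicalSpace X] (A : ConeAtlas X K)

/-- The centre of a cone chart. -/
def center (k : K) : X := (A.chart k).symm 0

theorem center_mem (k : K) : A.center k ∈ (A.chart k).source :=
  (A.chart k).map_target (A.zero_mem k)

theorem chart_center (k : K) : A.chart k (A.center k) = 0 :=
  (A.chart k).right_inv (A.zero_mem k)

theorem eq_center {k : K} {x : X} (hx : x ∈ (A.chart k).source) (h : A.chart k x = 0) :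
    x = A.center k := by
  rw [center, ← h, (A.chart k).left_inv hx]

theorem chart_injective : Function.Injective A.chart := fun k l h =>
  A.eq_of_center k l _ (A.center_mem k) (h ▸ A.center_mem k) (A.chart_center k)

/-- Differentiate `t ^ degree l = z ^ degree k + c`. For `k ≠ l` the value `t z` is not zero,
because the centre of a chart lies in no other chart, so the power can be inverted and `t` is
holomorphic. The resulting identity is the transformation rule of the form with coefficient `d * z ^
(d - 1)`. -/
theorem hasDerivAt_transition {k l : K} {z : ℂ}
    (hz : z ∈ ((A.chart k).symm.trans (A.chart l)).source) :
    DifferentiableAt ℂ (A.chart l ∘ (A.chart k).symm) z ∧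
      A.degree l * A.chart l ((A.chart k).symm z) ^ (A.degree l - 1) *
        deriv (A.chart l ∘ (A.chart k).symm) z = A.degree k * z ^ (A.degree k - 1) := by
  have hz' := hz
  rw [OpenPartialHomeomorph.trans_source, OpenPartialHomeomorph.symm_source] at hz'
  obtain ⟨hk, hl⟩ := hz'
  have hl : (A.chart k).symm z ∈ (A.chart l).source := hl
  have hzk : A.chart k ((A.chart k).symm z) = z := (A.chart k).right_inv hk
  have hsk : (A.chart k).symm z ∈ (A.chart k).source := (A.chart k).map_target hk
  have hev : ∀ᶠ w in 𝓝 z, A.chart k ((A.chart k).symm w) = w := by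
    filter_upwards [(A.chart k).open_target.mem_nhds hk] with w hw
    exact (A.chart k).right_inv hw
  by_cases hkl : k = l
  · subst hkl
    have he : (A.chart k ∘ (A.chart k).symm) =ᶠ[𝓝 z] id := hev
    refine ⟨differentiableAt_id.congr_of_eventuallyEq he, ?_⟩
    rw [he.deriv_eq, hzk, deriv_id, mul_one]
  · set t := A.chart l ∘ (A.chart k).symm with ht
    have ht0 : t z ≠ 0 := fun h => hkl (A.eq_of_center l k _ hl hsk h).symm
    obtain ⟨c, hc⟩ := A.transition k l _ hsk hl
    have htc : ContinuousAt t z :=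
      ((A.chart l).continuousAt hl).comp ((A.chart k).symm.continuousAt hk)
    have he : (fun w => w ^ A.degree l) ∘ t =ᶠ[𝓝 z] fun w => w ^ A.degree k + c := by
      filter_upwards [((A.chart k).symm.continuousAt hk).eventually hc, hev] with w h1 h2
      simp only [Function.comp, ht, h1, h2]
    have hd : HasDerivAt ((fun w => w ^ A.degree l) ∘ t) (A.degree k * z ^ (A.degree k - 1)) z :=
      ((hasDerivAt_pow _ z).add_const c).congr_of_eventuallyEq he
    have hdl : (A.degree l : ℂ) * t z ^ (A.degree l - 1) ≠ 0 :=
      mul_ne_zero (by exact_mod_cast A.degree_ne_zero l) (pow_ne_zero _ ht0)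
    have hdt := DifferentiableAt.of_comp_left htc (hasStrictDerivAt_pow (A.degree l) (t z)) hdl
      hd.differentiableAt
    exact ⟨hdt, ((hasDerivAt_pow _ (t z)).comp z hdt.hasDerivAt).unique hd⟩

/-- The coefficients of the flat Abelian differential. -/
def abelianCoeff : OpenPartialHomeomorph X ℂ → ℂ → ℂ :=
  Function.extend A.chart (fun k z => A.degree k * z ^ (A.degree k - 1)) 0

theorem abelianCoeff_chart (k : K) :
    A.abelianCoeff (A.chart k) = fun z : ℂ => (A.degree k : ℂ) * z ^ (A.degree k - 1) :=
  A.chart_injective.extend_apply _ _ k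

variable [T2Space X] [CompactSpace X] [ConnectedSpace X]

/-- The Riemann surface defined by an atlas of cone charts. -/
def surface : ClosedRiemannSurface :=
  .ofCharts A.chart A.exists_mem fun _ _ _ hz =>
    (A.hasDerivAt_transition hz).1.differentiableWithinAt

theorem mem_atlas {e : OpenPartialHomeomorph A.surface ℂ} (he : e ∈ atlas ℂ A.surface) :
    ∃ k, A.chart k = e := he

/-- The flat Abelian differential of an atlas of cone charts. -/
def abelian : AbelianDifferential A.surface where
  coeff := A.abelianCoeff
  holomorphic e he := by
    obtain ⟨k, rfl⟩ := A.mem_atlas he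
    rw [A.abelianCoeff_chart]
    fun_prop
  transform e he e' he' z hz := by
    obtain ⟨k, rfl⟩ := A.mem_atlas he
    obtain ⟨l, rfl⟩ := A.mem_atlas he'
    rw [A.abelianCoeff_chart, A.abelianCoeff_chart]
    exact (A.hasDerivAt_transition hz).2.symm
  nonzero := by
    obtain ⟨k, -⟩ := A.exists_mem (Classical.arbitrary X)
    have h1 : ∀ᶠ z in 𝓝[≠] (0 : ℂ), z ∈ (A.chart k).target :=
      nhdsWithin_le_nhds ((A.chart k).open_target.mem_nhds (A.zero_mem k))
    obtain ⟨z, hz, hz0⟩ := (h1.and self_mem_nhdsWithin).exists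
    refine ⟨A.chart k, ⟨k, rfl⟩, z, hz, ?_⟩
    rw [A.abelianCoeff_chart]
    exact mul_ne_zero (by exact_mod_cast A.degree_ne_zero k) (pow_ne_zero _ hz0)

end ConeAtlas

/-- Since `g ∘ e` has the same fibres as `π` on the domain of `e`, it descends to an injective map;
openness of `π` and of `g` makes this map a homeomorphism onto its image. -/
theorem exists_descended_chart {X Y : Type*} [TopologicalSpace X] [TopologicalSpace Y]
    [Nonempty Y] {π : X → Y} (hπ : IsOpenQuotientMap π) (e : OpenPartialHomeomorph X ℂ)
    {g : ℂ → ℂ} (hg : Continuous g) (hgo : IsOpenMap g)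
    (h : ∀ x ∈ e.source, ∀ x' ∈ e.source, π x = π x' ↔ g (e x) = g (e x')) :
    ∃ f : OpenPartialHomeomorph Y ℂ, f.source = π '' e.source ∧ f.target = g '' e.target ∧
      ∀ x ∈ e.source, f (π x) = g (e x) := by
  classical
  let F : Y → ℂ := fun y => if h : ∃ x ∈ e.source, π x = y then g (e h.choose) else 0
  have hF : ∀ x ∈ e.source, F (π x) = g (e x) := by
    intro x hx
    have hex : ∃ x' ∈ e.source, π x' = π x := ⟨x, hx, rfl⟩
    have : F (π x) = g (e hex.choose) := dif_pos hex
    rw [this]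
    exact (h _ hex.choose_spec.1 x hx).1 hex.choose_spec.2
  have hinj : Set.InjOn F (π '' e.source) := by
    rintro _ ⟨x, hx, rfl⟩ _ ⟨x', hx', rfl⟩ he
    rw [hF x hx, hF x' hx'] at he
    exact (h x hx x' hx').2 he
  have hcont : ContinuousOn F (π '' e.source) := by
    rintro _ ⟨x, hx, rfl⟩
    refine ContinuousAt.continuousWithinAt ?_
    rw [ContinuousAt, hF x hx]
    intro N hN
    have h1 : (fun x' => g (e x')) ⁻¹' N ∈ 𝓝 x :=
      (hg.continuousAt.comp (e.continuousAt hx)) hN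
    have h2 := hπ.isOpenMap.image_mem_nhds (Filter.inter_mem h1 (e.open_source.mem_nhds hx))
    refine Filter.mem_map.2 (Filter.mem_of_superset h2 ?_)
    rintro _ ⟨x', ⟨hx', hxs⟩, rfl⟩
    rw [Set.mem_preimage, hF x' hxs]
    exact hx'
  have hopen : IsOpenMap ((hinj.toPartialEquiv F).source.domRestrict (hinj.toPartialEquiv F)) := by
    intro U hU
    obtain ⟨V, hV, rfl⟩ := isOpen_induced_iff.1 hU
    have : (hinj.toPartialEquiv F).source.domRestrict (hinj.toPartialEquiv F) ''
        (Subtype.val ⁻¹' V) = g '' (e '' (e.source ∩ π ⁻¹' V)) := by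
      ext u
      constructor
      · rintro ⟨⟨_, x, hx, rfl⟩, hy, rfl⟩
        exact ⟨e x, ⟨x, ⟨hx, hy⟩, rfl⟩, (hF x hx).symm⟩
      · rintro ⟨_, ⟨x, ⟨hx, hy⟩, rfl⟩, rfl⟩
        exact ⟨⟨π x, x, hx, rfl⟩, hy, hF x hx⟩
    rw [this]
    exact hgo _ (e.isOpen_image_of_subset_source
      (e.open_source.inter (hV.preimage hπ.continuous)) Set.inter_subset_left)
  refine ⟨OpenPartialHomeomorph.ofContinuousOpenRestrict (hinj.toPartialEquiv F) hcont hopen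
    (hπ.isOpenMap _ e.open_source), rfl, ?_, hF⟩
  change F '' (π '' e.source) = _
  rw [← e.image_source_eq_target, Set.image_image, Set.image_image]
  exact Set.image_congr hF
end

noncomputable section

/-! ### Quotients of cone surfaces by an involution -/

namespace ConeAtlas

variable {X K : Type} [TopologicalSpace X] (A : ConeAtlas X K)

/-- An involution of a surface that is `-1` in the cone charts, and has a fixed point in a chart
only if it maps the chart to itself; the other charts are flat. -/
structure Involution where
  inv : X → X
  continuous_inv : Continuous inv
  inv_inv : ∀ x, inv (inv x) = x
  star : K → K
  star_star : ∀ k, star (star k) = k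
  degree_star : ∀ k, A.degree (star k) = A.degree k
  mem_star : ∀ k x, x ∈ (A.chart k).source → inv x ∈ (A.chart (star k)).source
  chart_star : ∀ k x, x ∈ (A.chart k).source → A.chart (star k) (inv x) = - A.chart k x
  star_eq : ∀ k x, x ∈ (A.chart k).source → inv x ∈ (A.chart k).source → star k = k
  degree_eq_one : ∀ k, star k ≠ k → A.degree k = 1

namespace Involution

variable {A} (J : A.Involution)

/-- The orbit relation of an involution. -/
def setoid : Setoid X where
  r x y := x = y ∨ J.inv x = y
  iseqv := ⟨fun x => .inl rfl, fun {x y} h => by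
    rcases h with rfl | rfl
    · exact .inl rfl
    · exact .inr (J.inv_inv x), fun {x y z} h h' => by
    rcases h with rfl | rfl <;> rcases h' with rfl | rfl
    · exact .inl rfl
    · exact .inr rfl
    · exact .inr rfl
    · exact .inl (J.inv_inv x).symm⟩

/-- The quotient by an involution. -/
def Quot : Type := Quotient J.setoid

instance : TopologicalSpace J.Quot := inferInstanceAs (TopologicalSpace (Quotient J.setoid))

/-- The quotient map. -/
def toQuot (x : X) : J.Quot := Quotient.mk J.setoid x

theorem toQuot_eq_iff {x y : X} : J.toQuot x = J.toQuot y ↔ x = y ∨ J.inv x = y :=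
  Quotient.eq (r := J.setoid)

theorem toQuot_inv (x : X) : J.toQuot (J.inv x) = J.toQuot x := J.toQuot_eq_iff.2
    (.inr (J.inv_inv x))

theorem isOpenQuotientMap_toQuot : IsOpenQuotientMap J.toQuot where
  surjective := Quotient.exists_rep
  continuous := continuous_quot_mk
  isOpenMap U hU := by
    have : J.toQuot ⁻¹' (J.toQuot '' U) = U ∪ J.inv ⁻¹' U := by
      ext x
      simp only [Set.mem_preimage, Set.mem_image, Set.mem_union, J.toQuot_eq_iff]
      constructor
      · rintro ⟨y, hy, rfl | rfl⟩
        · exact .inl hy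
        · right; rwa [J.inv_inv]
      · rintro (h | h)
        · exact ⟨x, h, .inl rfl⟩
        · exact ⟨_, h, .inr (J.inv_inv x)⟩
    refine isOpen_coinduced.2 (?_ : IsOpen (J.toQuot ⁻¹' (J.toQuot '' U)))
    rw [this]
    exact hU.union (hU.preimage J.continuous_inv)

instance [T2Space X] : T2Space J.Quot := by
  rw [t2Space_iff_of_isOpenQuotientMap J.isOpenQuotientMap_toQuot]
  have : {q : X × X | J.toQuot q.1 = J.toQuot q.2} = {q | q.1 = q.2} ∪ {q | J.inv q.1 = q.2} := by
    ext q
    exact J.toQuot_eq_iff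
  rw [this]
  exact (isClosed_eq continuous_fst continuous_snd).union
    (isClosed_eq (J.continuous_inv.comp continuous_fst) continuous_snd)

instance [CompactSpace X] : CompactSpace J.Quot :=
  inferInstanceAs (CompactSpace (Quotient J.setoid))

instance [ConnectedSpace X] : ConnectedSpace J.Quot :=
  inferInstanceAs (ConnectedSpace (Quotient J.setoid))

theorem star_eq_star {k : K} : J.star (J.star k) = J.star k ↔ J.star k = k := by
  rw [J.star_star, eq_comm]

theorem mem_star_iff {k : K} {x : X} :
    J.inv x ∈ (A.chart k).source ↔ x ∈ (A.chart (J.star k)).source := by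
  refine ⟨fun h => ?_, fun h => ?_⟩
  · have := J.mem_star _ _ h
    rwa [J.inv_inv] at this
  · have := J.mem_star _ _ h
    rwa [J.star_star] at this

open Classical in
/-- The number of times that a chart is wrapped onto its image in the quotient. -/
def wrap (k : K) : ℕ := if J.star k = k then 2 else 1

theorem wrap_ne_zero (k : K) : J.wrap k ≠ 0 := by
  unfold wrap; split_ifs <;> simp

/-- A chart mapped to itself is folded by `z ↦ -z` and its quotient has the coordinate `z ^ 2`. A
chart exchanged with another one is disjoint from its image, by `star_eq`, and embeds into the
quotient. -/
theorem exists_quotChart [Nonempty X] (k : K) : ∃ f : OpenPartialHomeomorph J.Quot ℂ,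
    f.source = J.toQuot '' (A.chart k).source ∧ f.target = (· ^ J.wrap k) '' (A.chart k).target ∧
      ∀ x ∈ (A.chart k).source, f (J.toQuot x) = A.chart k x ^ J.wrap k := by
  have : NeZero (J.wrap k) := ⟨J.wrap_ne_zero k⟩
  have : Nonempty J.Quot := ⟨J.toQuot (Classical.arbitrary X)⟩
  refine exists_descended_chart J.isOpenQuotientMap_toQuot (A.chart k) (continuous_pow _)
    (Complex.isOpenQuotientMap_pow _).isOpenMap fun x hx x' hx' => ?_
  rw [J.toQuot_eq_iff]
  by_cases hk : J.star k = k
  · have hw : J.wrap k = 2 := if_pos hk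
    rw [hw, sq_eq_sq_iff_eq_or_eq_neg]
    have h1 := J.mem_star k x hx
    have h2 := J.chart_star k x hx
    rw [hk] at h1 h2
    refine or_congr ⟨fun h => by rw [h], fun h => (A.chart k).injOn hx hx' h⟩ ?_
    rw [← neg_eq_iff_eq_neg, ← h2]
    exact ⟨fun h => by rw [h], fun h => (A.chart k).injOn h1 hx' h⟩
  · have hw : J.wrap k = 1 := if_neg hk
    rw [hw, pow_one, pow_one]
    constructor
    · rintro (rfl | rfl)
      · rfl
      · exact absurd (J.star_eq k x hx hx') hk
    · exact fun h => .inl ((A.chart k).injOn hx hx' h)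

variable [ConnectedSpace X]

/-- The charts of the quotient. -/
def quotChart (k : K) : OpenPartialHomeomorph J.Quot ℂ := (J.exists_quotChart k).choose

theorem source_quotChart (k : K) : (J.quotChart k).source = J.toQuot '' (A.chart k).source :=
  (J.exists_quotChart k).choose_spec.1

theorem target_quotChart (k : K) :
    (J.quotChart k).target = (· ^ J.wrap k) '' (A.chart k).target :=
  (J.exists_quotChart k).choose_spec.2.1

theorem quotChart_toQuot {k : K} {x : X} (hx : x ∈ (A.chart k).source) :
    J.quotChart k (J.toQuot x) = A.chart k x ^ J.wrap k :=
  (J.exists_quotChart k).choose_spec.2.2 x hx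

theorem toQuot_mem_source {k : K} {x : X} :
    J.toQuot x ∈ (J.quotChart k).source ↔
      x ∈ (A.chart k).source ∨ x ∈ (A.chart (J.star k)).source := by
  rw [source_quotChart, ← mem_star_iff]
  constructor
  · rintro ⟨y, hy, he⟩
    rcases J.toQuot_eq_iff.1 he with rfl | rfl
    · exact .inl hy
    · right; rwa [J.inv_inv]
  · rintro (h | h)
    · exact ⟨x, h, rfl⟩
    · exact ⟨_, h, J.toQuot_inv x⟩

/-- Near each point the charts of the quotient are, up to sign, powers of cone charts. -/
theorem exists_lift {l : K} {x : X} (hx : J.toQuot x ∈ (J.quotChart l).source) :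
    ∃ l', (l' = l ∨ l' = J.star l) ∧ x ∈ (A.chart l').source ∧ ∃ ε : ℂ, ε ^ 2 = 1 ∧
      ∀ y ∈ (A.chart l').source, J.quotChart l (J.toQuot y) = (ε * A.chart l' y) ^ J.wrap l := by
  rcases J.toQuot_mem_source.1 hx with h | h
  · exact ⟨l, .inl rfl, h, 1, by simp, fun y hy => by rw [J.quotChart_toQuot hy, one_mul]⟩
  · refine ⟨_, .inr rfl, h, -1, by simp, fun y hy => ?_⟩
    have h1 := J.mem_star_iff.2 hy
    have h2 := J.chart_star _ _ h1
    rw [J.inv_inv] at h2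
    rw [← J.toQuot_inv, J.quotChart_toQuot h1, h2, neg_one_mul, neg_neg]

open Classical in
/-- The coefficient of the quadratic differential of the quotient in the chart number `l`. -/
def quadCoeff (l : K) (u : ℂ) : ℂ :=
  -- With `u = z ^ 2` and `du = 2 z dz`, the square of `d z ^ (d - 1) dz` becomes `d ^ 2 / 4 * u ^
  -- (d - 2) du ^ 2`. The charts that are exchanged have degree one, where the differential is `dz ^
  -- 2`.
  if J.star l = l then (A.degree l : ℂ) ^ 2 / 4 * u ^ ((A.degree l : ℤ) - 2) else 1

/-- Both parts follow from the chain rule applied to a power of a transition of `A`. The centre is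
excluded in the formula because for degree one the coefficient has a pole there and the integer
power takes its default value. -/
theorem pullback_quotChart {k l : K} {ζ : ℂ} (hζ : ζ ∈ (A.chart k).target)
    (hl : J.toQuot ((A.chart k).symm ζ) ∈ (J.quotChart l).source) :
    DifferentiableAt ℂ (J.quotChart l ∘ J.toQuot ∘ (A.chart k).symm) ζ ∧
      (J.quotChart l (J.toQuot ((A.chart k).symm ζ)) ≠ 0 →
        J.quadCoeff l (J.quotChart l (J.toQuot ((A.chart k).symm ζ))) *
          deriv (J.quotChart l ∘ J.toQuot ∘ (A.chart k).symm) ζ ^ 2 =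
        (A.degree k * ζ ^ (A.degree k - 1)) ^ 2) := by
  obtain ⟨l', hl', hx, ε, hε, hf⟩ := J.exists_lift hl
  have hz : ζ ∈ ((A.chart k).symm.trans (A.chart l')).source := by
    rw [OpenPartialHomeomorph.trans_source]
    exact ⟨hζ, hx⟩
  obtain ⟨hd, hd'⟩ := A.hasDerivAt_transition hz
  have hs : J.star l' = l' ↔ J.star l = l := by
    rcases hl' with rfl | rfl
    · rfl
    · exact J.star_eq_star
  have hdeg : A.degree l' = A.degree l := by
    rcases hl' with rfl | rfl
    · rfl
    · exact J.degree_star l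
  have hev : J.quotChart l ∘ J.toQuot ∘ (A.chart k).symm =ᶠ[𝓝 ζ]
      fun w => (ε * (A.chart l' ∘ (A.chart k).symm) w) ^ J.wrap l := by
    filter_upwards [((A.chart k).symm.trans (A.chart l')).open_source.mem_nhds hz] with w hw
    rw [OpenPartialHomeomorph.trans_source] at hw
    exact hf _ hw.2
  have hD := (hd.hasDerivAt.const_mul ε).pow (J.wrap l)
  refine ⟨hD.differentiableAt.congr_of_eventuallyEq hev, fun h0 => ?_⟩
  rw [hf _ hx] at h0 ⊢
  rw [hev.deriv_eq]
  have hD' := hD.deriv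
  simp only [Function.comp_apply] at hD'
  simp only [Function.comp_apply]
  have hD'' : deriv (fun w => (ε * A.chart l' ((A.chart k).symm w)) ^ J.wrap l) ζ = _ := hD'
  rw [hD'', ← hd', hdeg]
  set t := A.chart l' ((A.chart k).symm ζ) with ht
  set t' := deriv (A.chart l' ∘ (A.chart k).symm) ζ with ht'
  by_cases hl : J.star l = l
  · have hw : J.wrap l = 2 := if_pos hl
    rw [hw] at h0 ⊢
    have h0' : ε * t ≠ 0 := fun h => h0 (by rw [h]; simp)
    have ht0 : t ≠ 0 := right_ne_zero_of_mul h0'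
    rw [quadCoeff, if_pos hl, mul_pow ε t 2, hε, one_mul]
    obtain ⟨m, hm⟩ : ∃ m, A.degree l = m + 1 := Nat.exists_eq_succ_of_ne_zero (A.degree_ne_zero l)
    have hz1 : (t ^ 2) ^ ((A.degree l : ℤ) - 2) * t ^ 2 = (t ^ m) ^ 2 := by
      rw [← zpow_natCast t 2, ← zpow_mul, ← zpow_add₀ ht0, ← pow_mul, ← zpow_natCast t (m * 2), hm]
      congr 1
      push_cast
      ring
    rw [hm] at hz1 ⊢
    simp only [Nat.add_sub_cancel]
    push_cast at hz1 ⊢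
    linear_combination (((m : ℂ) + 1) * t') ^ 2 * hz1 +
      ((m : ℂ) + 1) ^ 2 * (t ^ 2) ^ ((m : ℤ) + 1 - 2) * t' ^ 2 * t ^ 2 * (ε ^ 2 + 1) * hε
  · have hw : J.wrap l = 1 := if_neg hl
    have hdl : A.degree l = 1 := J.degree_eq_one l hl
    rw [hw, quadCoeff, if_neg hl, hdl]
    simp
    linear_combination t' ^ 2 * hε

end Involution
end ConeAtlas
end

/-! ### The Riemann surface structure and the quadratic differential of the quotient. -/

noncomputable section

namespace ConeAtlas.Involution

variable {X K : Type} [TopologicalSpace X] {A : ConeAtlas X K} (J : A.Involution)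

theorem quadCoeff_star (l : K) : J.quadCoeff (J.star l) = J.quadCoeff l := by
  ext u
  unfold quadCoeff
  rw [J.degree_star]
  congr 1
  exact propext J.star_eq_star

theorem meromorphicAt_quadCoeff (k : K) (u : ℂ) : MeromorphicAt (J.quadCoeff k) u := by
  unfold quadCoeff
  split_ifs <;> fun_prop

theorem meromorphicOrderAt_quadCoeff (k : K) (u : ℂ) [Decidable (J.star k = k ∧ u = 0)] :
    meromorphicOrderAt (J.quadCoeff k) u =
      ((if J.star k = k ∧ u = 0 then (A.degree k : ℤ) - 2 else 0 : ℤ) : WithTop ℤ) := by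
  rw [meromorphicOrderAt_eq_int_iff (J.meromorphicAt_quadCoeff k u)]
  have hd : (A.degree k : ℂ) ^ 2 / 4 ≠ 0 :=
    div_ne_zero (pow_ne_zero _ (by exact_mod_cast A.degree_ne_zero k)) (by norm_num)
  by_cases hk : J.star k = k
  · by_cases hu : u = 0
    · subst hu
      refine ⟨fun _ => (A.degree k : ℂ) ^ 2 / 4, analyticAt_const, hd, .of_forall fun z => ?_⟩
      simp only [hk, and_self, if_true, quadCoeff, sub_zero, smul_eq_mul]
      ring
    · refine ⟨fun z => (A.degree k : ℂ) ^ 2 / 4 * z ^ ((A.degree k : ℤ) - 2),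
        analyticAt_const.mul (AnalyticAt.zpow analyticAt_id hu), mul_ne_zero hd (zpow_ne_zero _ hu),
        .of_forall fun z => ?_⟩
      simp only [hk, hu, and_false, if_true, if_false, quadCoeff, zpow_zero, one_smul]
  · refine ⟨fun _ => 1, analyticAt_const, one_ne_zero, .of_forall fun z => ?_⟩
    simp [hk, quadCoeff]

/-- In a chart around a fixed point the involution is `z ↦ -z`, whose only fixed point is `0`. -/
theorem eq_center_of_inv_eq {x : X} (hx : J.inv x = x) : ∃ k, x = A.center k := by
  obtain ⟨k, hk⟩ := A.exists_mem x
  have h1 := J.star_eq k x hk (hx.symm ▸ hk)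
  have h2 := J.chart_star k x hk
  rw [h1, hx] at h2
  exact ⟨k, A.eq_center hk (self_eq_neg.1 h2)⟩

variable [ConnectedSpace X]

theorem exists_mem_quotChart (y : J.Quot) : ∃ k, y ∈ (J.quotChart k).source := by
  obtain ⟨x, rfl⟩ := J.isOpenQuotientMap_toQuot.surjective y
  obtain ⟨k, hk⟩ := A.exists_mem x
  exact ⟨k, J.toQuot_mem_source.2 (.inl hk)⟩

theorem exists_pow_eq_of_mem {k : K} {w : ℂ} (hw : w ∈ (J.quotChart k).target) :
    ∃ ζ ∈ (A.chart k).target, ζ ^ J.wrap k = w := by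
  rw [target_quotChart] at hw
  exact hw

theorem quotChart_symm_pow {k : K} {ζ : ℂ} (hζ : ζ ∈ (A.chart k).target) :
    (J.quotChart k).symm (ζ ^ J.wrap k) = J.toQuot ((A.chart k).symm ζ) := by
  have h1 := (A.chart k).map_target hζ
  have h2 := J.quotChart_toQuot h1
  rw [(A.chart k).right_inv hζ] at h2
  rw [← h2, (J.quotChart k).left_inv (J.toQuot_mem_source.2 (.inl h1))]

/-- The transition functions between charts of the quotient, away from the centre. -/
theorem transition_quotChart {k l : K} {w : ℂ}
    (hw : w ∈ ((J.quotChart k).symm.trans (J.quotChart l)).source) (hw0 : w ≠ 0) :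
    DifferentiableAt ℂ (J.quotChart l ∘ (J.quotChart k).symm) w ∧
      (J.quotChart l ((J.quotChart k).symm w) ≠ 0 →
        J.quadCoeff k w = J.quadCoeff l (J.quotChart l ((J.quotChart k).symm w)) *
          deriv (J.quotChart l ∘ (J.quotChart k).symm) w ^ 2) := by
  rw [OpenPartialHomeomorph.trans_source] at hw
  obtain ⟨hwk, hwl⟩ := hw
  have hwl : (J.quotChart k).symm w ∈ (J.quotChart l).source := hwl
  obtain ⟨ζ, hζ, rfl⟩ := J.exists_pow_eq_of_mem hwk
  have hζ0 : ζ ≠ 0 := by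
    rintro rfl
    exact hw0 (zero_pow (J.wrap_ne_zero k))
  have hsk := (A.chart k).map_target hζ
  rw [J.quotChart_symm_pow hζ] at hwl ⊢
  obtain ⟨h1, h2⟩ := J.pullback_quotChart hζ hwl
  obtain ⟨h3, h4⟩ := J.pullback_quotChart hζ (l := k) (J.toQuot_mem_source.2 (.inl hsk))
  have hev : ∀ᶠ u in 𝓝 ζ, u ∈ (A.chart k).target := (A.chart k).open_target.mem_nhds hζ
  have e1 : J.quotChart l ∘ J.toQuot ∘ (A.chart k).symm =ᶠ[𝓝 ζ]
      (J.quotChart l ∘ (J.quotChart k).symm) ∘ fun u => u ^ J.wrap k := by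
    filter_upwards [hev] with u hu
    simp only [Function.comp_apply, J.quotChart_symm_pow hu]
  have e2 : J.quotChart k ∘ J.toQuot ∘ (A.chart k).symm =ᶠ[𝓝 ζ] fun u => u ^ J.wrap k := by
    filter_upwards [hev] with u hu
    simp only [Function.comp_apply]
    rw [J.quotChart_toQuot ((A.chart k).map_target hu), (A.chart k).right_inv hu]
  have hp0 : (J.wrap k : ℂ) * ζ ^ (J.wrap k - 1) ≠ 0 :=
    mul_ne_zero (by exact_mod_cast J.wrap_ne_zero k) (pow_ne_zero _ hζ0)
  have hd : DifferentiableAt ℂ (J.quotChart l ∘ (J.quotChart k).symm) (ζ ^ J.wrap k) :=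
    DifferentiableAt.of_comp_right (hasStrictDerivAt_pow (J.wrap k) ζ) hp0
      (h1.congr_of_eventuallyEq e1.symm)
  refine ⟨hd, fun h0 => ?_⟩
  have h2 := h2 h0
  have ek : J.quotChart k (J.toQuot ((A.chart k).symm ζ)) = ζ ^ J.wrap k := e2.self_of_nhds
  rw [ek] at h4
  have h4 := h4 hw0
  have h5 : deriv ((J.quotChart l ∘ (J.quotChart k).symm) ∘ fun u => u ^ J.wrap k) ζ = _ :=
    (hd.hasDerivAt.comp ζ (hasDerivAt_pow (J.wrap k) ζ)).deriv
  rw [e1.deriv_eq, h5] at h2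
  rw [e2.deriv_eq, (hasDerivAt_pow (J.wrap k) ζ).deriv] at h4
  -- Both coefficients have the same pull-back to the chart of `X`. The squared derivative of the
  -- folding map is cancelled; it is not zero since `ζ ≠ 0`.
  refine mul_right_cancel₀ (pow_ne_zero 2 hp0) ?_
  rw [h4, ← h2]
  ring

theorem differentiableOn_transition (k l : K) :
    DifferentiableOn ℂ (J.quotChart l ∘ (J.quotChart k).symm)
      ((J.quotChart k).symm.trans (J.quotChart l)).source :=
  differentiableOn_of_ne_zero ((J.quotChart k).symm.trans (J.quotChart l)).open_source
    ((J.quotChart k).symm.trans (J.quotChart l)).continuousOn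
    fun _ hw hw0 => (J.transition_quotChart hw hw0).1

/-- A point of a chart that becomes the centre of a chart of the quotient is a centre. -/
theorem eq_or_eq_star {k l : K} {x : X} (hk : x ∈ (A.chart k).source)
    (hl : J.toQuot x ∈ (J.quotChart l).source) (h0 : A.chart k x = 0) :
    k = l ∨ k = J.star l := by
  rcases J.toQuot_mem_source.1 hl with h | h
  · exact .inl (A.eq_of_center k l x hk h h0)
  · exact .inr (A.eq_of_center k _ x hk h h0)

theorem quotChart_eq_zero {k l : K} {x : X} (hk : x ∈ (A.chart k).source)
    (hl : J.toQuot x ∈ (J.quotChart l).source) :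
    J.quotChart l (J.toQuot x) = 0 ↔ x = A.center l ∨ x = A.center (J.star l) := by
  obtain ⟨l', hl', hx, ε, hε, hf⟩ := J.exists_lift hl
  have hε0 : ε ≠ 0 := by rintro rfl; simp at hε
  rw [hf x hx, pow_eq_zero_iff (J.wrap_ne_zero l), mul_eq_zero, or_iff_right hε0]
  constructor
  · intro h
    have := A.eq_center hx h
    rcases hl' with rfl | rfl
    · exact .inl this
    · exact .inr this
  · have key : ∀ m, x = A.center m → (m = l ∨ m = J.star l) → A.chart l' x = 0 := by
      rintro m rfl hm
      have h1 := A.eq_of_center m l' _ (A.center_mem m) hx (A.chart_center m)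
      rw [← h1, A.chart_center]
    rintro (h | h)
    · exact key _ h (.inl rfl)
    · exact key _ h (.inr rfl)

/-- The coefficients of the quadratic differential of the quotient. -/
def quadCoeffs : OpenPartialHomeomorph J.Quot ℂ → ℂ → ℂ :=
  Function.extend J.quotChart J.quadCoeff 0

/-- Different indices can have the same chart in the quotient, but then they are equal or exchanged
by `star`, and their coefficients coincide. Thus the extension by chart is well defined. -/
theorem quadCoeffs_quotChart (k : K) : J.quadCoeffs (J.quotChart k) = J.quadCoeff k := by
  refine Function.FactorsThrough.extend_apply (fun k l h => ?_) _ k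
  have h1 := J.toQuot_mem_source.2 (.inl (A.center_mem k))
  have h2 := h1
  rw [h] at h2
  rcases J.eq_or_eq_star (A.center_mem k) h2 (A.chart_center k) with rfl | rfl
  · rfl
  · exact J.quadCoeff_star _

variable [T2Space X] [CompactSpace X]

/-- The quotient surface. -/
def quotSurface : ClosedRiemannSurface :=
  .ofCharts J.quotChart J.exists_mem_quotChart J.differentiableOn_transition

theorem mem_atlas_quot {e : OpenPartialHomeomorph J.quotSurface ℂ}
    (he : e ∈ atlas ℂ J.quotSurface) : ∃ k, J.quotChart k = e := he

theorem chartAt_quot (y : J.quotSurface) :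
    ∃ k, chartAt ℂ y = J.quotChart k ∧ y ∈ (J.quotChart k).source :=
  ⟨_, rfl, mem_chart_source ℂ y⟩

/-- The quotient of the square of the flat Abelian differential. -/
def meromorphicQuad : MeromorphicQuadraticDifferential J.quotSurface where
  coeff := J.quadCoeffs
  meromorphic e he z hz := by
    obtain ⟨k, rfl⟩ := J.mem_atlas_quot he
    rw [J.quadCoeffs_quotChart]
    exact J.meromorphicAt_quadCoeff k z
  transform e he e' he' z hz := by
    obtain ⟨k, rfl⟩ := J.mem_atlas_quot he
    obtain ⟨l, rfl⟩ := J.mem_atlas_quot he'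
    change ∀ᶠ w in 𝓝[≠] z, J.quadCoeffs (J.quotChart k) w =
      J.quadCoeffs (J.quotChart l) (J.quotChart l ((J.quotChart k).symm w)) *
        deriv (J.quotChart l ∘ (J.quotChart k).symm) w ^ 2
    rw [J.quadCoeffs_quotChart, J.quadCoeffs_quotChart]
    filter_upwards [nhdsWithin_le_nhds
      (((J.quotChart k).symm.trans (J.quotChart l)).open_source.mem_nhds hz),
      eventually_ne_punctured 0 z,
      -- The point where the chart `l` vanishes may be a pole of the differential; it is the other
      -- point at which the transformation rule is not available.
      eventually_ne_punctured (J.quotChart k ((J.quotChart l).symm 0)) z] with w hw hw0 hw1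
    refine (J.transition_quotChart hw hw0).2 fun h0 => hw1 ?_
    rw [OpenPartialHomeomorph.trans_source] at hw
    have h2 : (J.quotChart k).symm w ∈ (J.quotChart l).source := hw.2
    rw [← h0, (J.quotChart l).left_inv h2, (J.quotChart k).right_inv hw.1]

theorem order_eq {x : X} {k : K} (hx : x ∈ (A.chart k).source)
    [Decidable (J.star k = k ∧ A.chart k x = 0)] :
    J.meromorphicQuad.order (J.toQuot x) =
      ((if J.star k = k ∧ A.chart k x = 0 then (A.degree k : ℤ) - 2 else 0 : ℤ) : WithTop ℤ) := by
  classical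
  obtain ⟨l, hl, hxl⟩ := J.chartAt_quot (J.toQuot x)
  have ho : J.meromorphicQuad.order (J.toQuot x) =
      meromorphicOrderAt (J.meromorphicQuad.coeff (chartAt (M := J.quotSurface) ℂ (J.toQuot x)))
        (chartAt (M := J.quotSurface) ℂ (J.toQuot x) (J.toQuot x)) := rfl
  rw [hl] at ho
  rw [ho]
  change meromorphicOrderAt (J.quadCoeffs (J.quotChart l)) (J.quotChart l (J.toQuot x)) = _
  have hxl : J.toQuot x ∈ (J.quotChart l).source := hxl
  rw [J.quadCoeffs_quotChart, J.meromorphicOrderAt_quadCoeff]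
  by_cases h0 : A.chart k x = 0
  · have hkl := J.eq_or_eq_star hx hxl h0
    have h1 : J.quotChart l (J.toQuot x) = 0 := by
      rw [J.quotChart_eq_zero hx hxl]
      rcases hkl with rfl | rfl
      · exact .inl (A.eq_center hx h0)
      · exact .inr (A.eq_center hx h0)
    have h2 : J.star k = k ↔ J.star l = l := by
      rcases hkl with rfl | rfl
      · rfl
      · exact J.star_eq_star
    have h3 : A.degree k = A.degree l := by
      rcases hkl with rfl | rfl
      · rfl
      · exact J.degree_star l
    simp only [h0, h1, h2, h3]
  · have h5 : ¬ (J.star l = l ∧ J.quotChart l (J.toQuot x) = 0) := by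
      rintro ⟨h1, h2⟩
      rw [J.quotChart_eq_zero hx hxl, h1, or_self] at h2
      have h3 := A.eq_of_center l k x (h2 ▸ A.center_mem l) hx (h2 ▸ A.chart_center l)
      exact h0 (h3 ▸ h2 ▸ A.chart_center l)
    rw [if_neg h5, if_neg (fun h => h0 h.2)]

/-- The quotient of the square of the flat Abelian differential, as a quadratic differential. -/
def quad : QuadraticDifferential J.quotSurface where
  toMeromorphicQuadraticDifferential := J.meromorphicQuad
  nonzero p := by
    classical
    obtain ⟨x, rfl⟩ := J.isOpenQuotientMap_toQuot.surjective p
    obtain ⟨k, hk⟩ := A.exists_mem x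
    rw [J.order_eq hk]
    exact WithTop.coe_ne_top
  simple_poles p := by
    classical
    obtain ⟨x, rfl⟩ := J.isOpenQuotientMap_toQuot.surjective p
    obtain ⟨k, hk⟩ := A.exists_mem x
    rw [J.order_eq hk, WithTop.coe_le_coe]
    have := Nat.pos_of_ne_zero (A.degree_ne_zero k)
    split_ifs <;> omega

/-- The quotient map, as a map of Riemann surfaces. -/
def projection : A.surface → J.quotSurface := J.toQuot

theorem pullbackEqSq : PullbackEqSq J.projection J.quad A.abelian := by
  intro e he e' he' z hz hz'
  obtain ⟨k, rfl⟩ := A.mem_atlas he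
  obtain ⟨l, rfl⟩ := J.mem_atlas_quot he'
  have hz' : J.toQuot ((A.chart k).symm z) ∈ (J.quotChart l).source := hz'
  change ∀ᶠ w in 𝓝[≠] z, J.quadCoeffs (J.quotChart l)
      (J.quotChart l (J.toQuot ((A.chart k).symm w))) *
      deriv (J.quotChart l ∘ J.toQuot ∘ (A.chart k).symm) w ^ 2 =
    A.abelianCoeff (A.chart k) w ^ 2
  rw [J.quadCoeffs_quotChart, A.abelianCoeff_chart]
  have hc : ContinuousAt (fun w => J.toQuot ((A.chart k).symm w)) z :=
    (J.isOpenQuotientMap_toQuot.continuous.continuousAt).comp ((A.chart k).symm.continuousAt hz)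
  filter_upwards [nhdsWithin_le_nhds ((A.chart k).open_target.mem_nhds hz),
    nhdsWithin_le_nhds (hc.eventually ((J.quotChart l).open_source.mem_nhds hz')),
    eventually_ne_punctured (A.chart k (A.center l)) z,
    eventually_ne_punctured (A.chart k (A.center (J.star l))) z] with w h1 h2 h3 h4
  refine (J.pullback_quotChart h1 h2).2 fun h0 => ?_
  rw [J.quotChart_eq_zero ((A.chart k).map_target h1) h2] at h0
  rcases h0 with h0 | h0
  · exact h3 (by rw [← h0, (A.chart k).right_inv h1])
  · exact h4 (by rw [← h0, (A.chart k).right_inv h1])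

theorem contMDiff_projection : ContMDiff 𝓘(ℂ) 𝓘(ℂ) ω J.projection := by
  rw [contMDiff_iff]
  refine ⟨J.isOpenQuotientMap_toQuot.continuous, fun x y => ?_⟩
  obtain ⟨k, hk⟩ := A.mem_atlas (chart_mem_atlas ℂ x)
  obtain ⟨l, hl⟩ := J.mem_atlas_quot (chart_mem_atlas ℂ y)
  simp only [mfld_simps, ← hk, ← hl]
  have hs : IsOpen ((A.chart k).target ∩ (A.chart k).symm ⁻¹'
      (J.toQuot ⁻¹' (J.quotChart l).source)) :=
    (A.chart k).isOpen_inter_preimage_symm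
      ((J.quotChart l).open_source.preimage J.isOpenQuotientMap_toQuot.continuous)
  have hd : DifferentiableOn ℂ (J.quotChart l ∘ J.toQuot ∘ (A.chart k).symm)
      ((A.chart k).target ∩ (A.chart k).symm ⁻¹' (J.toQuot ⁻¹' (J.quotChart l).source)) :=
    fun w hw => (J.pullback_quotChart hw.1 hw.2).1.differentiableWithinAt
  exact hd.contDiffOn hs

/-- The fixed points of the involution are among the finitely many centres; every other fibre
consists of `x` and `J.inv x`. -/
theorem isDoubleCover [Finite K] : IsDoubleCover J.projection where
  holomorphic := J.contMDiff_projection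
  degree_two := by
    refine ⟨Set.range fun k => J.projection (A.center k), Set.finite_range _, fun y hy => ?_⟩
    obtain ⟨x, rfl⟩ := J.isOpenQuotientMap_toQuot.surjective y
    have hx : J.inv x ≠ x := fun h => hy (by
      obtain ⟨k, rfl⟩ := J.eq_center_of_inv_eq h
      exact ⟨k, rfl⟩)
    have h2 : J.toQuot ⁻¹' {J.toQuot x} = {x, J.inv x} := by
      ext x'
      rw [Set.mem_preimage, Set.mem_singleton_iff, eq_comm, J.toQuot_eq_iff,
        Set.mem_insert_iff, Set.mem_singleton_iff, eq_comm, eq_comm (a := x')]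
      exact or_congr Iff.rfl eq_comm
    exact (congrArg Set.ncard h2).trans (Set.ncard_pair hx.symm)

theorem isOrientationDoubleCoverOf [Finite K] : IsOrientationDoubleCoverOf A.abelian J.quad :=
  ⟨J.projection, J.isDoubleCover, J.pullbackEqSq⟩

end ConeAtlas.Involution
end

noncomputable section

/-! ### The cone atlas of an origami with a single vertex -/

/-- The lattice is discrete: congruent values closer than `1` are equal. -/
theorem eventually_eq_of_toTorus_eq {X : Type*} [TopologicalSpace X] {h : X → ℂ} {x : X}
    (hc : ContinuousAt h x) (ht : ∀ᶠ y in 𝓝 x, toTorus (h y) = toTorus (h x)) :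
    ∀ᶠ y in 𝓝 x, h y = h x := by
  have h1 : ∀ᶠ y in 𝓝 x, ‖h y - h x‖ < 1 := by
    have : ContinuousAt (fun y => ‖h y - h x‖) x := (hc.sub continuousAt_const).norm
    refine this.eventually (Iio_mem_nhds ?_)
    simp
  filter_upwards [ht, h1] with y hy hy1
  refine toTorus_eq_of_norm_lt hy ?_ ?_
  · rw [← Complex.sub_re]
    exact (Complex.abs_re_le_norm _).trans_lt hy1
  · rw [← Complex.sub_im]
    exact (Complex.abs_im_le_norm _).trans_lt hy1

namespace Origami

theorem bounds_of_mem_vertexNhd {z : ℂ} (hz : z ∈ vertexNhd) : (z.re < 1 / 4 ∨ 3 / 4 < z.re) ∧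
    (z.im < 1 / 4 ∨ 3 / 4 < z.im) := by
  obtain ⟨⟨h1, h2, h3, h4⟩, h⟩ := hz
  have k1 := abs_lt.1 ((Complex.abs_re_le_norm _).trans_lt h)
  have k2 := abs_lt.1 ((Complex.abs_im_le_norm _).trans_lt h)
  unfold nearest at k1 k2
  split_ifs at k1 k2 <;> simp [corner] at k1 k2 <;> grind

theorem toTorus_corner (b : Fin 4) : toTorus (corner b) = 0 := by
  fin_cases b <;> simp [corner]

theorem flip_mem {z : ℂ} (hz : z ∈ closedSquare) : 1 + Complex.I - z ∈ closedSquare := by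
  obtain ⟨h1, h2, h3, h4⟩ := hz
  refine ⟨?_, ?_, ?_, ?_⟩ <;> simp <;> linarith

variable {ι : Type} {O : Origami ι}

open IsTopTiling (rightNhd topNhd rightCoord topCoord)

/-- The charts of a square-tiled surface with one vertex: around the vertex, around the centres of
the squares, and around the midpoints of their right sides and of their top sides. -/
abbrev ChartIndex (ι : Type) : Type := Option (ι ⊕ ι ⊕ ι)

/-- The part of the square `j` in a chart. -/
def chartNhd (O : Origami ι) : ChartIndex ι → ι → Set ℂ
  | none, _ => vertexNhd
  | some (.inl i), j => {z | j = i ∧ z ∈ openSquare}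
  | some (.inr (.inl i)), j => rightNhd O i j
  | some (.inr (.inr i)), j => topNhd O i j

/-- The degree of a chart. -/
def chartDegree : ChartIndex ι → ℕ
  | none => Nat.card ι
  | some _ => 1

/-- The flat coordinate of a chart. -/
def chartCoord : ChartIndex ι → ℂ → ℂ
  | none, z => z - corner (nearest z)
  | some (.inl _), z => z - (1 / 2 + Complex.I / 2)
  | some (.inr (.inl _)), z => rightCoord z
  | some (.inr (.inr _)), z => topCoord z

/-- The image of a chart under the rotation given by a permutation. -/
def starIndex (O : Origami ι) (ρ : Equiv.Perm ι) : ChartIndex ι → ChartIndex ι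
  | none => none
  | some (.inl i) => some (.inl (ρ i))
  -- The half turn takes the right side of `i` to the left side of `ρ i`, the right side of
  -- `O.right⁻¹ (ρ i)`. This square is `ρ (O.right i)` when `ρ` inverts `O.right`; the top sides
  -- behave in the same way.
  | some (.inr (.inl i)) => some (.inr (.inl (ρ (O.right i))))
  | some (.inr (.inr i)) => some (.inr (.inr (ρ (O.top i))))

/-- All flat coordinates lift the projection to the torus up to a constant, so they agree with each
other up to constants modulo the lattice. -/
theorem exists_toTorus_chartCoord (k : ChartIndex ι) :
    ∃ a, ∀ z, toTorus (chartCoord k z) = toTorus z - a := by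
  rcases k with _ | i | i | i
  · refine ⟨0, fun z => ?_⟩
    rw [chartCoord, map_sub, toTorus_corner]
  · exact ⟨_, fun z => map_sub _ _ _⟩
  · refine ⟨toTorus (Complex.I / 2), fun z => ?_⟩
    rw [chartCoord, rightCoord]
    split_ifs <;> simp
  · refine ⟨toTorus (1 / 2), fun z => ?_⟩
    rw [chartCoord, topCoord]
    split_ifs <;> simp

theorem exists_mem_chartNhd {j : ι} {z : ℂ} (hz : z ∈ closedSquare) :
    ∃ k, z ∈ O.chartNhd k j := by
  obtain ⟨h1, h2, h3, h4⟩ := hz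
  by_cases hc : IsCorner z
  · obtain ⟨b, rfl⟩ := exists_corner_eq hc
    refine ⟨none, ?_⟩
    have := corner_add_mem_vertexNhd b (w := 0) le_rfl le_rfl (by norm_num)
    change corner b ∈ vertexNhd
    simpa using this
  rcases h1.eq_or_lt with h | h
  · refine ⟨some (.inr (.inl (O.right⁻¹ j))), .inr ⟨by simp, h1, by linarith⟩, ?_, ?_⟩
    · exact h3.lt_of_ne fun e => hc ⟨.inl h.symm, .inl e.symm⟩
    · exact h4.lt_of_ne fun e => hc ⟨.inl h.symm, .inr e⟩
  rcases h2.eq_or_lt with h' | h'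
  · refine ⟨some (.inr (.inl j)), .inl ⟨rfl, by linarith, h2⟩, ?_, ?_⟩
    · exact h3.lt_of_ne fun e => hc ⟨.inr h', .inl e.symm⟩
    · exact h4.lt_of_ne fun e => hc ⟨.inr h', .inr e⟩
  rcases h3.eq_or_lt with h'' | h''
  · exact ⟨some (.inr (.inr (O.top⁻¹ j))), .inr ⟨by simp, h3, by linarith⟩, h, h'⟩
  rcases h4.eq_or_lt with h3' | h3'
  · exact ⟨some (.inr (.inr j)), .inl ⟨rfl, by linarith, h4⟩, h, h'⟩
  exact ⟨some (.inl j), rfl, h, h', h'', h3'⟩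

/-- The centre of a chart lies in no other chart. -/
theorem chartIndex_eq {k l : ChartIndex ι} {j : ι} {z : ℂ} (hk : z ∈ O.chartNhd k j)
    (hl : z ∈ O.chartNhd l j) (h0 : chartCoord k z = 0) : k = l := by
  have hcor : ∀ {z : ℂ}, z - corner (nearest z) = 0 → IsCorner z := by
    intro z h
    rw [sub_eq_zero.1 h]
    exact isCorner_corner _
  rcases k with _ | i | i | i <;> rcases l with _ | i' | i' | i'
  · rfl
  · exfalso
    obtain ⟨h1 | h1, -⟩ := hcor h0
    · exact hl.2.1.ne' h1
    · exact hl.2.2.1.ne h1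
  · exfalso
    obtain ⟨-, h1 | h1⟩ := hcor h0
    · exact hl.2.1.ne' h1
    · exact hl.2.2.ne h1
  · exfalso
    obtain ⟨h1 | h1, -⟩ := hcor h0
    · exact hl.2.1.ne' h1
    · exact hl.2.2.ne h1
  all_goals
    have hre := congrArg Complex.re h0
    have him := congrArg Complex.im h0
  · exfalso
    have := bounds_of_mem_vertexNhd hl
    simp [chartCoord] at hre him
    grind
  · rw [show i = i' from hk.1.symm.trans hl.1]
  · exfalso
    simp [chartCoord] at hre him
    obtain ⟨⟨h1, h2, h3⟩ | ⟨h1, h2, h3⟩, h4, h5⟩ := hl <;> linarith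
  · exfalso
    simp [chartCoord] at hre him
    obtain ⟨⟨h1, h2, h3⟩ | ⟨h1, h2, h3⟩, h4, h5⟩ := hl <;> linarith
  · exfalso
    have := bounds_of_mem_vertexNhd hl
    simp only [chartCoord, rightCoord] at hre him
    split_ifs at him <;> simp at him <;> grind
  · exfalso
    obtain ⟨-, h6, h7, -, -⟩ := hl
    simp only [chartCoord, rightCoord] at hre him
    split_ifs at hre <;> simp at hre <;> linarith
  · obtain ⟨⟨h1, h2, h3⟩ | ⟨h1, h2, h3⟩, h4, h5⟩ := hk <;>
      obtain ⟨⟨k1, k2, k3⟩ | ⟨k1, k2, k3⟩, k4, k5⟩ := hl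
    · rw [← h1, ← k1]
    · exfalso; linarith
    · exfalso; linarith
    · rw [O.right.injective (h1.symm.trans k1)]
  · exfalso
    obtain ⟨h1, h2, h3⟩ := hl
    simp only [chartCoord, rightCoord] at hre him
    split_ifs at him <;> simp at him <;> grind
  · exfalso
    have := bounds_of_mem_vertexNhd hl
    simp only [chartCoord, topCoord] at hre him
    split_ifs at hre <;> simp at hre <;> grind
  · exfalso
    obtain ⟨-, -, -, h6, h7⟩ := hl
    simp only [chartCoord, topCoord] at hre him
    split_ifs at him <;> simp at him <;> linarith
  · exfalso
    obtain ⟨h1, h2, h3⟩ := hl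
    simp only [chartCoord, topCoord] at hre him
    split_ifs at hre <;> simp at hre <;> grind
  · obtain ⟨⟨h1, h2, h3⟩ | ⟨h1, h2, h3⟩, h4, h5⟩ := hk <;>
      obtain ⟨⟨k1, k2, k3⟩ | ⟨k1, k2, k3⟩, k4, k5⟩ := hl
    · rw [← h1, ← k1]
    · exfalso; linarith
    · exfalso; linarith
    · rw [O.top.injective (h1.symm.trans k1)]

theorem perm_perm {ρ : Equiv.Perm ι} (h : ρ * ρ = 1) (i : ι) : ρ (ρ i) = i := by
  simpa using congrArg (fun f : Equiv.Perm ι => f i) h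

theorem perm_mul_perm {ρ σ : Equiv.Perm ι} (h : σ * ρ * σ = ρ) (i : ι) : σ (ρ (σ i)) = ρ i := by
  simpa using congrArg (fun f : Equiv.Perm ι => f i) h

theorem flip_mem_chartNhd {ρ : Equiv.Perm ι} (hσ : O.right * ρ * O.right = ρ)
    (hτ : O.top * ρ * O.top = ρ) {k : ChartIndex ι} {j : ι} {z : ℂ} (hz : z ∈ O.chartNhd k j) :
    1 + Complex.I - z ∈ O.chartNhd (O.starIndex ρ k) (ρ j) := by
  rcases k with _ | i | i | i
  · exact (nearest_flip hz).2.2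
  · obtain ⟨rfl, h1, h2, h3, h4⟩ := hz
    refine ⟨rfl, ?_, ?_, ?_, ?_⟩ <;> simp <;> linarith
  · obtain ⟨⟨rfl, h2, h3⟩ | ⟨rfl, h2, h3⟩, h4, h5⟩ := hz
    · refine ⟨.inr ⟨(perm_mul_perm hσ j).symm, ?_, ?_⟩, ?_, ?_⟩ <;> simp <;> linarith
    · refine ⟨.inl ⟨rfl, ?_, ?_⟩, ?_, ?_⟩ <;> simp <;> linarith
  · obtain ⟨⟨rfl, h2, h3⟩ | ⟨rfl, h2, h3⟩, h4, h5⟩ := hz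
    · refine ⟨.inr ⟨(perm_mul_perm hτ j).symm, ?_, ?_⟩, ?_, ?_⟩ <;> simp <;> linarith
    · refine ⟨.inl ⟨rfl, ?_, ?_⟩, ?_, ?_⟩ <;> simp <;> linarith

theorem chartCoord_flip {ρ : Equiv.Perm ι} {i : ι ⊕ ι ⊕ ι} {j : ι} {z : ℂ}
    (hz : z ∈ O.chartNhd (some i) j) :
    chartCoord (O.starIndex ρ (some i)) (1 + Complex.I - z) = - chartCoord (some i) z := by
  rcases i with i | i | i
  · simp [chartCoord, starIndex]
    ring
  · obtain ⟨⟨h1, h2, h3⟩ | ⟨h1, h2, h3⟩, h4, h5⟩ := hz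
    · simp only [chartCoord, starIndex, rightCoord]
      rw [if_neg (by simp; linarith), if_pos (by linarith)]
      ring
    · simp only [chartCoord, starIndex, rightCoord]
      rw [if_pos (by simp; linarith), if_neg (by linarith)]
      ring
  · obtain ⟨⟨h1, h2, h3⟩ | ⟨h1, h2, h3⟩, h4, h5⟩ := hz
    · simp only [chartCoord, starIndex, topCoord]
      rw [if_neg (by simp; linarith), if_pos (by linarith)]
      ring
    · simp only [chartCoord, starIndex, topCoord]
      rw [if_pos (by simp; linarith), if_neg (by linarith)]
      ring

theorem starIndex_eq {ρ : Equiv.Perm ι} (hρ : ρ * ρ = 1) {k : ChartIndex ι} {j : ι} {z : ℂ}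
    (hz : z ∈ O.chartNhd k j) (hz' : 1 + Complex.I - z ∈ O.chartNhd k (ρ j)) :
    O.starIndex ρ k = k := by
  rcases k with _ | i | i | i
  · rfl
  · obtain ⟨rfl, -⟩ := hz
    rw [starIndex, hz'.1]
  · obtain ⟨⟨rfl, h2, h3⟩ | ⟨rfl, h2, h3⟩, h4, h5⟩ := hz <;>
      obtain ⟨⟨k1, k2, k3⟩ | ⟨k1, k2, k3⟩, k4, k5⟩ := hz' <;> simp at k2 k3
    · linarith
    · rw [starIndex, ← k1, perm_perm hρ]
    · rw [starIndex, k1]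
    · linarith
  · obtain ⟨⟨rfl, h2, h3⟩ | ⟨rfl, h2, h3⟩, h4, h5⟩ := hz <;>
      obtain ⟨⟨k1, k2, k3⟩ | ⟨k1, k2, k3⟩, k4, k5⟩ := hz' <;> simp at k2 k3
    · linarith
    · rw [starIndex, ← k1, perm_perm hρ]
    · rw [starIndex, k1]
    · linarith

theorem starIndex_starIndex {ρ : Equiv.Perm ι} (hρ : ρ * ρ = 1) (hσ : O.right * ρ * O.right = ρ)
    (hτ : O.top * ρ * O.top = ρ) (k : ChartIndex ι) :
    O.starIndex ρ (O.starIndex ρ k) = k := by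
  rcases k with _ | i | i | i
  · rfl
  · simp only [starIndex, perm_perm hρ]
  · simp only [starIndex, perm_mul_perm hσ, perm_perm hρ]
  · simp only [starIndex, perm_mul_perm hτ, perm_perm hρ]

namespace IsTopTiling

variable {X : Type} [TopologicalSpace X] {P : ι → ℂ → X}

/-- The half turn exchanges the right side of `i` with the left side of `ρ i` and reverses its
parameter; the relations `σ ρ σ = ρ` and `τ ρ τ = ρ` say that this respects the gluing. -/
theorem exists_inv (hP : O.IsTopTiling P) {ρ : Equiv.Perm ι}
    (hσ : O.right * ρ * O.right = ρ) (hτ : O.top * ρ * O.top = ρ) :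
    ∃ f : X → X, ∀ i, ∀ z ∈ closedSquare, f (P i z) = P (ρ i) (1 + Complex.I - z) := by
  choose i z hz hiz using hP.surjective
  refine ⟨fun x => P (ρ (i x)) (1 + Complex.I - z x), fun j w hw => ?_⟩
  have h := (hP.eq_iff _ _ _ (hz (P j w)) _ hw).1 (hiz (P j w))
  refine eqvGen_map (f := fun a => P (ρ a.1) (1 + Complex.I - a.2)) (fun a b hab => ?_) h
  cases hab with
  | horizontal i t h0 h1 =>
    have e1 : 1 + Complex.I - t * Complex.I = 1 + ((1 - t : ℝ) : ℂ) * Complex.I := by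
      push_cast; ring
    have e2 : 1 + Complex.I - (1 + t * Complex.I) = ((1 - t : ℝ) : ℂ) * Complex.I := by
      push_cast; ring
    dsimp only
    have := Glue.horizontal (O := O) (ρ (O.right i)) (1 - t) (by linarith) (by linarith)
    rw [perm_mul_perm hσ] at this
    rw [e1, e2, eq_comm, hP.eq_iff _ _ _ this.mem_closedSquare.1 _ this.mem_closedSquare.2]
    exact .rel _ _ this
  | vertical i t h0 h1 =>
    have e1 : 1 + Complex.I - t = ((1 - t : ℝ) : ℂ) + Complex.I := by
      push_cast; ring
    have e2 : 1 + Complex.I - (t + Complex.I) = ((1 - t : ℝ) : ℂ) := by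
      push_cast; ring
    dsimp only
    have := Glue.vertical (O := O) (ρ (O.top i)) (1 - t) (by linarith) (by linarith)
    rw [perm_mul_perm hτ] at this
    rw [e1, e2, eq_comm, hP.eq_iff _ _ _ this.mem_closedSquare.1 _ this.mem_closedSquare.2]
    exact .rel _ _ this

variable [T2Space X] [Finite ι] [Nonempty ι]

theorem exists_charts (hP : O.IsTopTiling P) (hO : O.HasOneVertex) (k : ChartIndex ι) :
    ∃ e : OpenPartialHomeomorph X ℂ,
      (∀ j, ∀ z ∈ closedSquare, P j z ∈ e.source ↔ z ∈ O.chartNhd k j) ∧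
      0 ∈ e.target ∧
      (∀ j, ∀ z ∈ O.chartNhd k j, e (P j z) ^ chartDegree k = chartCoord k z) ∧
      ∀ ρ : Equiv.Perm ι, ρ * ρ = 1 → O.right * ρ * O.right = ρ → O.top * ρ * O.top = ρ →
        k = none → ∀ j, ∀ z ∈ vertexNhd, e (P (ρ j) (1 + Complex.I - z)) = - e (P j z) := by
  rcases k with _ | i | i | i
  · obtain ⟨e, h1, ⟨r, hr, h2⟩, h3, h4⟩ := hO.exists_vertexChart hP
    exact ⟨e, h1, by rw [h2]; simpa using hr, h3, fun ρ h5 h6 h7 _ => h4 ρ h5 h6 h7⟩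
  · obtain ⟨e, h1, h2, h3⟩ := hP.exists_faceChart i
    refine ⟨e, h1, by rw [h2]; simp, ?_, by simp⟩
    rintro j z ⟨rfl, hz⟩
    rw [chartDegree, pow_one]
    exact h3 z hz
  · obtain ⟨e, h1, h2, h3⟩ := hP.exists_rightChart i
    refine ⟨e, h1, by rw [h2]; simp, fun j z hz => ?_, by simp⟩
    rw [chartDegree, pow_one]
    exact h3 j z hz
  · obtain ⟨e, h1, h2, h3⟩ := hP.exists_topChart i
    refine ⟨e, h1, by rw [h2]; simp, fun j z hz => ?_, by simp⟩
    rw [chartDegree, pow_one]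
    exact h3 j z hz

/-- The charts of a square-tiled surface with one vertex. -/
def coneChart (hP : O.IsTopTiling P) (hO : O.HasOneVertex) (k : ChartIndex ι) :
    OpenPartialHomeomorph X ℂ :=
  (hP.exists_charts hO k).choose

variable (hP : O.IsTopTiling P) (hO : O.HasOneVertex)

theorem mem_coneChart {k : ChartIndex ι} {j : ι} {z : ℂ} (hz : z ∈ closedSquare) :
    P j z ∈ (hP.coneChart hO k).source ↔ z ∈ O.chartNhd k j :=
  (hP.exists_charts hO k).choose_spec.1 j z hz

theorem coneChart_pow {k : ChartIndex ι} {j : ι} {z : ℂ} (hz : z ∈ O.chartNhd k j) :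
    hP.coneChart hO k (P j z) ^ chartDegree k = chartCoord k z :=
  (hP.exists_charts hO k).choose_spec.2.2.1 j z hz

/-- The atlas of cone charts of a square-tiled surface with one vertex. -/
def coneAtlas : ConeAtlas X (ChartIndex ι) where
  chart := hP.coneChart hO
  degree := chartDegree
  degree_ne_zero k := by
    rcases k with _ | i
    · exact Nat.card_pos.ne'
    · exact one_ne_zero
  exists_mem x := by
    obtain ⟨j, z, hz, rfl⟩ := hP.surjective x
    obtain ⟨k, hk⟩ := exists_mem_chartNhd (O := O) (j := j) hz
    exact ⟨k, (hP.mem_coneChart hO hz).2 hk⟩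
  zero_mem k := (hP.exists_charts hO k).choose_spec.2.1
  eq_of_center k l x hk hl h0 := by
    obtain ⟨j, z, hz, rfl⟩ := hP.surjective x
    rw [hP.mem_coneChart hO hz] at hk hl
    refine chartIndex_eq hk hl ?_
    rw [← hP.coneChart_pow hO hk, h0, zero_pow]
    rcases k with _ | i
    · exact Nat.card_pos.ne'
    · exact one_ne_zero
  transition k l x hk hl := by
    have key (k : ChartIndex ι) : ∃ a, ∀ y ∈ (hP.coneChart hO k).source,
        toTorus (hP.coneChart hO k y ^ chartDegree k) = hP.proj y - a := by
      obtain ⟨a, ha⟩ := exists_toTorus_chartCoord k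
      refine ⟨a, fun y hy => ?_⟩
      obtain ⟨j, z, hz, rfl⟩ := hP.surjective y
      rw [hP.coneChart_pow hO ((hP.mem_coneChart hO hz).1 hy), ha, hP.proj_apply hz]
    obtain ⟨a, ha⟩ := key k
    obtain ⟨b, hb⟩ := key l
    -- The difference of two flat coordinates is continuous and constant modulo the lattice, hence
    -- locally constant.
    let h : X → ℂ := fun y => hP.coneChart hO l y ^ chartDegree l -
      hP.coneChart hO k y ^ chartDegree k
    have hc : ContinuousAt h x := (((hP.coneChart hO l).continuousAt hl).pow _).sub
      (((hP.coneChart hO k).continuousAt hk).pow _)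
    refine ⟨h x, ?_⟩
    have hev : ∀ᶠ y in 𝓝 x, toTorus (h y) = toTorus (h x) := by
      filter_upwards [(hP.coneChart hO k).open_source.mem_nhds hk,
        (hP.coneChart hO l).open_source.mem_nhds hl] with y hyk hyl
      simp only [h, map_sub, ha y hyk, hb y hyl, ha x hk, hb x hl]
      abel
    filter_upwards [eventually_eq_of_toTorus_eq hc hev] with y hy
    rw [← hy]
    ring

/-- The involution of a square-tiled surface that rotates the squares. -/
def involution {ρ : Equiv.Perm ι} (hρ : ρ * ρ = 1) (hσ : O.right * ρ * O.right = ρ)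
    (hτ : O.top * ρ * O.top = ρ) : (hP.coneAtlas hO).Involution where
  inv := (hP.exists_inv hσ hτ).choose
  continuous_inv := by
    refine hP.continuous_of_comp fun i => ?_
    have : ContinuousOn (fun z => P (ρ i) (1 + Complex.I - z)) closedSquare :=
      (hP.continuousOn (ρ i)).comp (by fun_prop) fun z hz => flip_mem hz
    exact this.congr fun z hz => (hP.exists_inv hσ hτ).choose_spec i z hz
  inv_inv x := by
    obtain ⟨j, z, hz, rfl⟩ := hP.surjective x
    rw [(hP.exists_inv hσ hτ).choose_spec j z hz,
      (hP.exists_inv hσ hτ).choose_spec _ _ (flip_mem hz), perm_perm hρ, sub_sub_cancel]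
  star := O.starIndex ρ
  star_star := starIndex_starIndex hρ hσ hτ
  degree_star k := by
    rcases k with _ | i | i | i <;> rfl
  mem_star k x hx := by
    obtain ⟨j, z, hz, rfl⟩ := hP.surjective x
    rw [(hP.exists_inv hσ hτ).choose_spec j z hz]
    exact (hP.mem_coneChart hO (flip_mem hz)).2
      (flip_mem_chartNhd hσ hτ ((hP.mem_coneChart hO hz).1 hx))
  chart_star k x hx := by
    obtain ⟨j, z, hz, rfl⟩ := hP.surjective x
    rw [(hP.exists_inv hσ hτ).choose_spec j z hz]
    have hx' := (hP.mem_coneChart hO hz).1 hx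
    rcases k with _ | i
    · exact (hP.exists_charts hO none).choose_spec.2.2.2 ρ hρ hσ hτ rfl j z hx'
    · have h1 := hP.coneChart_pow hO hx'
      have h2 := hP.coneChart_pow hO (flip_mem_chartNhd hσ hτ hx')
      rw [chartCoord_flip hx', ← h1] at h2
      rcases i with i | i | i <;>
        · simp only [starIndex, chartDegree, pow_one] at h2
          exact h2
  star_eq k x hx hx' := by
    obtain ⟨j, z, hz, rfl⟩ := hP.surjective x
    rw [(hP.exists_inv hσ hτ).choose_spec j z hz] at hx'
    exact starIndex_eq hρ ((hP.mem_coneChart hO hz).1 hx)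
      ((hP.mem_coneChart hO (flip_mem hz)).1 hx')
  degree_eq_one k hk := by
    rcases k with _ | i
    · exact absurd rfl hk
    · rfl

theorem inv_apply {ρ : Equiv.Perm ι} (hρ : ρ * ρ = 1) (hσ : O.right * ρ * O.right = ρ)
    (hτ : O.top * ρ * O.top = ρ) {i : ι} {z : ℂ} (hz : z ∈ closedSquare) :
    (hP.involution hO hρ hσ hτ).inv (P i z) = P (ρ i) (1 + Complex.I - z) :=
  (hP.exists_inv hσ hτ).choose_spec i z hz

end IsTopTiling

end Origami
end

/-! ### Singularities of the quotient differential and the stratum. -/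

noncomputable section

namespace ConeAtlas.Involution

variable {X K : Type} [TopologicalSpace X] {A : ConeAtlas X K} (J : A.Involution)

theorem inv_center {k : K} (hk : J.star k = k) : J.inv (A.center k) = A.center k := by
  have h1 := J.mem_star k _ (A.center_mem k)
  have h2 := J.chart_star k _ (A.center_mem k)
  rw [hk] at h1 h2
  exact A.eq_center h1 (by rw [h2, A.chart_center, neg_zero])

theorem toQuot_center_injOn : Set.InjOn (fun k => J.toQuot (A.center k)) {k | J.star k = k} := by
  intro k hk l _ h
  have h' : A.center k = A.center l := by
    rcases J.toQuot_eq_iff.1 h with h | h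
    · exact h
    · rwa [J.inv_center hk] at h
  exact A.eq_of_center k l _ (A.center_mem k) (h' ▸ A.center_mem l) (A.chart_center k)

variable [ConnectedSpace X] [T2Space X] [CompactSpace X]

theorem order_center {k : K} (hk : J.star k = k) :
    J.quad.order (J.toQuot (A.center k)) = (((A.degree k : ℤ) - 2 : ℤ) : WithTop ℤ) := by
  classical
  exact (J.order_eq (A.center_mem k)).trans (by rw [if_pos ⟨hk, A.chart_center k⟩])

/-- The singularities of the quadratic differential of the quotient. -/
theorem exists_singularities (T : Finset K) (hT : ∀ k, k ∈ T ↔ J.star k = k ∧ A.degree k ≠ 2) :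
    ∃ S : Finset J.quotSurface, (∀ p, p ∈ S ↔ J.quad.order p ≠ 0) ∧
      S.val.map (fun p => J.quad.order p) =
        (T.val.map fun k => ((A.degree k : ℤ) - 2 : ℤ)).map (fun k : ℤ => (k : WithTop ℤ)) := by
  classical
  let c : K → J.quotSurface := fun k => J.toQuot (A.center k)
  have hc : Set.InjOn c T := J.toQuot_center_injOn.mono fun k hk => ((hT k).1 hk).1
  refine ⟨T.image c, fun p => ?_, ?_⟩
  · rw [Finset.mem_image]
    constructor
    · rintro ⟨k, hk, rfl⟩
      rw [J.order_center ((hT k).1 hk).1, ← WithTop.coe_zero, Ne, WithTop.coe_inj]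
      have := ((hT k).1 hk).2
      omega
    · intro hp
      obtain ⟨x, rfl⟩ := J.isOpenQuotientMap_toQuot.surjective p
      obtain ⟨k, hk⟩ := A.exists_mem x
      have ho : J.quad.order (J.toQuot x) = _ := J.order_eq hk
      by_cases h : J.star k = k ∧ A.chart k x = 0
      · rw [ho, if_pos h, ← WithTop.coe_zero, Ne, WithTop.coe_inj] at hp
        refine ⟨k, (hT k).2 ⟨h.1, by omega⟩, ?_⟩
        rw [A.eq_center hk h.2]
      · rw [ho, if_neg h] at hp
        exact absurd rfl hp
  · rw [Finset.image_val_of_injOn hc, Multiset.map_map, Multiset.map_map]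
    exact Multiset.map_congr rfl fun k hk => J.order_center ((hT k).1 hk).1

end ConeAtlas.Involution

namespace Origami.IsTopTiling

variable {ι : Type} {O : Origami ι} [Finite ι] [Nonempty ι] {X : Type} [TopologicalSpace X]
  [T2Space X] {P : ι → ℂ → X} (hP : O.IsTopTiling P) (hO : O.HasOneVertex)

/-- The face chart has degree one and its coordinate is that of the square up to a translation. Its
transition to any other chart gives the normalisation of the pull-back. -/
theorem isTiling [CompactSpace X] [ConnectedSpace X] :
    O.IsTiling (X := (hP.coneAtlas hO).surface) (hP.coneAtlas hO).abelian P where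
  continuousOn := hP.continuousOn
  surjective := hP.surjective
  eq_iff := hP.eq_iff
  pullback i z hz e he hze := by
    obtain ⟨k, rfl⟩ := (hP.coneAtlas hO).mem_atlas he
    set A := hP.coneAtlas hO with hA
    let f : ChartIndex ι := some (.inl i)
    have hface : ∀ w ∈ openSquare, P i w ∈ (A.chart f).source ∧
        A.chart f (P i w) = w - (1 / 2 + Complex.I / 2) := by
      intro w hw
      have hw' : w ∈ O.chartNhd f i := ⟨rfl, hw⟩
      refine ⟨(hP.mem_coneChart hO (openSquare_subset hw)).2 hw', ?_⟩
      have := hP.coneChart_pow hO hw'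
      rw [chartDegree, pow_one] at this
      exact this
    have hsymm : ∀ w ∈ openSquare, (A.chart f).symm (w - (1 / 2 + Complex.I / 2)) = P i w := by
      intro w hw
      rw [← (hface w hw).2, (A.chart f).left_inv (hface w hw).1]
    have hze' : P i z ∈ (A.chart k).source := hze
    have hmem : z - (1 / 2 + Complex.I / 2) ∈ ((A.chart f).symm.trans (A.chart k)).source := by
      rw [OpenPartialHomeomorph.trans_source]
      refine ⟨?_, ?_⟩
      · rw [OpenPartialHomeomorph.symm_source, ← (hface z hz).2]
        exact (A.chart f).map_source (hface z hz).1
      · rw [Set.mem_preimage, hsymm z hz]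
        exact hze'
    obtain ⟨h1, h2⟩ := A.hasDerivAt_transition hmem
    have hdeg : A.degree f = 1 := rfl
    rw [hsymm z hz, hdeg] at h2
    have hev : A.chart k ∘ P i =ᶠ[𝓝 z] (A.chart k ∘ (A.chart f).symm) ∘
        fun w => w - (1 / 2 + Complex.I / 2) := by
      filter_upwards [isOpen_openSquare.mem_nhds hz] with w hw
      simp only [Function.comp_apply]
      rw [hsymm w hw]
    have hd := h1.hasDerivAt.comp z ((hasDerivAt_id z).sub_const (1 / 2 + Complex.I / 2))
    have hd' := hd.congr_of_eventuallyEq hev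
    refine ⟨hd'.differentiableAt, ?_⟩
    have h3 : deriv (A.chart k ∘ P i) z = _ := hd'.deriv
    change A.abelianCoeff (A.chart k) (A.chart k (P i z)) * deriv (A.chart k ∘ P i) z = 1
    rw [A.abelianCoeff_chart, h3, mul_one]
    simpa using h2

/-- The quotient of an origami with one vertex by a rotation, all of whose fixed points are known,
gives a quadratic differential in a known stratum. -/
theorem isOrientationDoubleCoverIn [CompactSpace X] [ConnectedSpace X] {ρ : Equiv.Perm ι}
    (hρ : ρ * ρ = 1) (hσ : O.right * ρ * O.right = ρ) (hτ : O.top * ρ * O.top = ρ) {h : ℕ}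
    (hg : HasGenus (hP.involution hO hρ hσ hτ).Quot h) (hn : Nat.card ι ≠ 2) {i₁ i₂ i₃ : ι}
    (h1 : ∀ i, ρ i = i ↔ i = i₁) (h2 : ∀ i, ρ (O.right i) = i ↔ i = i₂)
    (h3 : ∀ i, ρ (O.top i) = i ↔ i = i₃) :
    O.IsOrientationDoubleCoverIn h {(Nat.card ι : ℤ) - 2, -1, -1, -1} := by
  set J := hP.involution hO hρ hσ hτ with hJ
  refine ⟨(hP.coneAtlas hO).surface, (hP.coneAtlas hO).abelian, ⟨P, hP.isTiling hO⟩,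
    J.quotSurface, J.quad, ⟨hg, ?_⟩, J.isOrientationDoubleCoverOf⟩
  classical
  -- The charts mapped to themselves: around the vertex, always, and around the three given centres.
  -- Since `Nat.card ι ≠ 2`, the vertex is not an ordinary point of the quotient.
  let T : Finset (ChartIndex ι) :=
    {none, some (.inl i₁), some (.inr (.inl i₂)), some (.inr (.inr i₃))}
  obtain ⟨S, hS, hS'⟩ := J.exists_singularities T fun k => by
    change k ∈ T ↔ O.starIndex ρ k = k ∧ chartDegree k ≠ 2
    rcases k with _ | i | i | i <;> simp [T, starIndex, chartDegree, h1, h2, h3, hn]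
  have hT : T.val.map (fun k => ((hP.coneAtlas hO).degree k : ℤ) - 2) =
      {(Nat.card ι : ℤ) - 2, -1, -1, -1} := by
    rw [Finset.insert_val_of_notMem (by simp), Finset.insert_val_of_notMem (by simp),
      Finset.insert_val_of_notMem (by simp)]
    rfl
  refine ⟨S, hS, hS'.trans ?_⟩
  rw [hT, Multiset.map_id']
  rfl

end Origami.IsTopTiling
end

noncomputable section

/-! ### Finite cell decompositions -/

/-- A finite cell decomposition, given by the characteristic maps of the cells and by the map that
locates a point in its open cell. -/
abbrev cwComplexOfLocate {Y : Type} [TopologicalSpace Y] [T2Space Y] (cell : ℕ → Type)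
    (f : ∀ n, cell n → (Fin n → ℝ) → Y) (loc : Y → Σ n, cell n × (Fin n → ℝ))
    (hempty : ∀ n, 2 < n → IsEmpty (cell n)) (hfin : ∀ n, Finite (cell n))
    (hcont : ∀ n i, ContinuousOn (f n i) (Metric.closedBall 0 1))
    (hmem : ∀ y, (loc y).2.2 ∈ Metric.ball (0 : Fin (loc y).1 → ℝ) 1)
    (hloc : ∀ y, f (loc y).1 (loc y).2.1 (loc y).2.2 = y)
    (hf : ∀ n i, ∀ x ∈ Metric.ball (0 : Fin n → ℝ) 1, loc (f n i x) = ⟨n, i, x⟩)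
    (hb : ∀ n i, ∀ x ∈ Metric.sphere (0 : Fin n → ℝ) 1, (loc (f n i x)).1 < n) :
    Topology.CWComplex (Set.univ : Set Y) :=
  have hinj : ∀ n i, Set.InjOn (f n i) (Metric.ball 0 1) := fun n i x hx y hy h => by
    have := (hf n i x hx).symm.trans ((congrArg loc h).trans (hf n i y hy))
    simpa using this
  Topology.CWComplex.mkFinite Set.univ cell (fun n i => (hinj n i).toPartialEquiv (f n i) _)
    (Filter.eventually_atTop.2 ⟨3, fun n hn => hempty n hn⟩) hfin (fun _ _ => rfl) hcont
    (by
      intro n i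
      rw [continuousOn_iff_isClosed]
      intro C hC
      -- The image of a closed subset of the closed cell is compact. It meets the open cell only in
      -- images of interior points, because by `hb` the boundary goes to cells of smaller dimension;
      -- this gives the continuity of the inverse.
      have hcl : IsClosed (f n i '' (C ∩ Metric.closedBall 0 1)) :=
        (((isCompact_closedBall (0 : Fin n → ℝ) 1).inter_left hC).image_of_continuousOn
          ((hcont n i).mono Set.inter_subset_right)).isClosed
      refine ⟨_, hcl, ?_⟩
      ext y
      constructor
      · rintro ⟨hy, hyt⟩
        have hs := ((hinj n i).toPartialEquiv (f n i) _).map_target hyt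
        have hr := ((hinj n i).toPartialEquiv (f n i) _).right_inv hyt
        exact ⟨⟨_, ⟨hy, Metric.ball_subset_closedBall hs⟩, hr⟩, hyt⟩
      · rintro ⟨⟨x, ⟨hx, hxb⟩, rfl⟩, hyt⟩
        refine ⟨?_, hyt⟩
        obtain ⟨x', hx', he⟩ := hyt
        have hxball : x ∈ Metric.ball (0 : Fin n → ℝ) 1 := by
          by_contra hn
          have hxs : x ∈ Metric.sphere (0 : Fin n → ℝ) 1 := by
            rw [Metric.mem_ball, not_lt] at hn
            exact le_antisymm hxb hn
          have h1 := hb n i x hxs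
          have h2 := hf n i x' hx'
          rw [show f n i x' = f n i x from he] at h2
          rw [h2] at h1
          exact lt_irrefl _ h1
        have := ((hinj n i).toPartialEquiv (f n i) _).left_inv hxball
        rw [Set.mem_preimage]
        exact this.symm ▸ hx)
    (by
      rintro ⟨n, i⟩ - ⟨m, j⟩ - hne
      rw [Function.onFun, Set.disjoint_left]
      rintro _ ⟨x, hx, rfl⟩ ⟨x', hx', he⟩
      have h1 := hf n i x hx
      have h2 := hf m j x' hx'
      rw [show f m j x' = f n i x from he, h1] at h2
      apply hne
      cases h2
      rfl)
    (by
      intro n i x hx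
      simp only [Set.mem_iUnion]
      exact ⟨_, hb n i x hx, _, _, Metric.ball_subset_closedBall (hmem _), hloc _⟩)
    (by
      ext y
      simp only [Set.mem_iUnion, Set.mem_univ, iff_true]
      exact ⟨_, _, _, Metric.ball_subset_closedBall (hmem y), hloc y⟩)

/-- The genus of a surface decomposed into finitely many vertices, edges and faces. -/
theorem hasGenus_of_cells {Y V E F : Type} [TopologicalSpace Y] [T2Space Y] [Finite V] [Finite E]
    [Finite F] (v : V → Y) (e : E → ℝ → Y) (f : F → ℝ → ℝ → Y)
    (loc : Y → V ⊕ (E × ℝ) ⊕ (F × ℝ × ℝ))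
    (he : ∀ i, ContinuousOn (e i) (Set.Icc (-1) 1))
    (hf : ∀ i, ContinuousOn (fun p : ℝ × ℝ => f i p.1 p.2) (Set.Icc (-1) 1 ×ˢ Set.Icc (-1) 1))
    (hv : ∀ i, loc (v i) = .inl i) (hel : ∀ i, ∀ t ∈ Set.Ioo (-1 : ℝ) 1, loc (e i t) = .inr
      (.inl (i, t)))
    (hfl : ∀ i, ∀ s ∈ Set.Ioo (-1 : ℝ) 1, ∀ t ∈ Set.Ioo (-1 : ℝ) 1,
      loc (f i s t) = .inr (.inr (i, s, t)))
    (hloc : ∀ y, (∃ i, loc y = .inl i ∧ v i = y) ∨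
      (∃ i, ∃ t ∈ Set.Ioo (-1 : ℝ) 1, loc y = .inr (.inl (i, t)) ∧ e i t = y) ∨
      ∃ i, ∃ s ∈ Set.Ioo (-1 : ℝ) 1, ∃ t ∈ Set.Ioo (-1 : ℝ) 1,
        loc y = .inr (.inr (i, s, t)) ∧ f i s t = y)
    (heb : ∀ i t, (t = -1 ∨ t = 1) → (loc (e i t)).isLeft)
    (hfb : ∀ i, ∀ s ∈ Set.Icc (-1 : ℝ) 1, ∀ t ∈ Set.Icc (-1 : ℝ) 1,
      (s = -1 ∨ s = 1 ∨ t = -1 ∨ t = 1) → ∀ p, loc (f i s t) ≠ .inr (.inr p))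
    {h : ℕ} (hχ : (Nat.card V : ℤ) - Nat.card E + Nat.card F = 2 - 2 * h) : HasGenus Y h := by
  let cell : ℕ → Type
    | 0 => V
    | 1 => E
    | 2 => F
    | _ + 3 => Empty
  let g : ∀ n, cell n → (Fin n → ℝ) → Y
    | 0, i, _ => v i
    | 1, i, x => e i (x 0)
    | 2, i, x => f i (x 0) (x 1)
    | _ + 3, i, _ => i.elim
  let loc' : Y → Σ n, cell n × (Fin n → ℝ) := fun y =>
    match loc y with
    | .inl i => ⟨0, i, 0⟩
    | .inr (.inl (i, t)) => ⟨1, i, fun _ => t⟩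
    | .inr (.inr (i, s, t)) => ⟨2, i, ![s, t]⟩
  -- For the supremum norm the unit balls are cubes, so squares serve directly as two-dimensional
  -- cells.
  have b1 : ∀ x : Fin 1 → ℝ, x ∈ Metric.ball (0 : Fin 1 → ℝ) 1 ↔ x 0 ∈ Set.Ioo (-1 : ℝ) 1 := by
    intro x
    rw [mem_ball_zero_iff, pi_norm_lt_iff one_pos]
    simp [abs_lt]
  have b2 : ∀ x : Fin 2 → ℝ, x ∈ Metric.ball (0 : Fin 2 → ℝ) 1 ↔
      x 0 ∈ Set.Ioo (-1 : ℝ) 1 ∧ x 1 ∈ Set.Ioo (-1 : ℝ) 1 := by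
    intro x
    rw [mem_ball_zero_iff, pi_norm_lt_iff one_pos]
    simp [abs_lt]
  have c1 : ∀ x : Fin 1 → ℝ, x ∈ Metric.closedBall (0 : Fin 1 → ℝ) 1 ↔
      x 0 ∈ Set.Icc (-1 : ℝ) 1 := by
    intro x
    rw [mem_closedBall_zero_iff, pi_norm_le_iff_of_nonneg zero_le_one]
    simp [abs_le]
  have c2 : ∀ x : Fin 2 → ℝ, x ∈ Metric.closedBall (0 : Fin 2 → ℝ) 1 ↔
      x 0 ∈ Set.Icc (-1 : ℝ) 1 ∧ x 1 ∈ Set.Icc (-1 : ℝ) 1 := by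
    intro x
    rw [mem_closedBall_zero_iff, pi_norm_le_iff_of_nonneg zero_le_one]
    simp [abs_le]
  have hsph : ∀ {n : ℕ} {x : Fin n → ℝ}, x ∈ Metric.sphere (0 : Fin n → ℝ) 1 →
      x ∈ Metric.closedBall (0 : Fin n → ℝ) 1 ∧ x ∉ Metric.ball (0 : Fin n → ℝ) 1 := by
    intro n x hx
    refine ⟨Metric.sphere_subset_closedBall hx, fun h => ?_⟩
    rw [Metric.mem_sphere] at hx
    rw [Metric.mem_ball, hx] at h
    exact lt_irrefl _ h
  have hempty : ∀ n, 2 < n → IsEmpty (cell n) := by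
    intro n hn
    obtain ⟨m, rfl⟩ : ∃ m, n = m + 3 := ⟨n - 3, by omega⟩
    exact inferInstanceAs (IsEmpty Empty)
  have hfin : ∀ n, Finite (cell n) := by
    intro n
    match n with
    | 0 => exact inferInstanceAs (Finite V)
    | 1 => exact inferInstanceAs (Finite E)
    | 2 => exact inferInstanceAs (Finite F)
    | _ + 3 => exact inferInstanceAs (Finite Empty)
  have hloc' : ∀ y, ∃ p : Σ n, cell n × (Fin n → ℝ), loc' y = p ∧
      p.2.2 ∈ Metric.ball (0 : Fin p.1 → ℝ) 1 ∧ g p.1 p.2.1 p.2.2 = y := by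
    intro y
    rcases hloc y with ⟨i, h, h'⟩ | ⟨i, t, ht, h, h'⟩ | ⟨i, s, hs, t, ht, h, h'⟩
    · refine ⟨⟨0, i, 0⟩, ?_, ?_, h'⟩
      · simp only [loc', h]
      · exact Metric.mem_ball_self one_pos
    · refine ⟨⟨1, i, fun _ => t⟩, ?_, (b1 _).2 ht, h'⟩
      simp only [loc', h]
    · refine ⟨⟨2, i, ![s, t]⟩, ?_, (b2 _).2 ⟨hs, ht⟩, h'⟩
      simp only [loc', h]
  refine ⟨cwComplexOfLocate cell g loc' hempty hfin ?_ ?_ ?_ ?_ ?_, hfin, hempty, hχ⟩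
  · intro n i
    match n, i with
    | 0, i => exact continuousOn_const
    | 1, i => exact (he i).comp (continuous_apply 0).continuousOn fun x hx => (c1 x).1 hx
    | 2, i =>
      exact (hf i).comp (f := fun x : Fin 2 → ℝ => (x 0, x 1))
        ((continuous_apply 0).prodMk (continuous_apply 1)).continuousOn fun x hx => (c2 x).1 hx
    | _ + 3, i => exact i.elim
  · intro y
    obtain ⟨p, hp, hm, -⟩ := hloc' y
    rw [hp]
    exact hm
  · intro y
    obtain ⟨p, hp, -, hm⟩ := hloc' y
    rw [hp]
    exact hm
  · intro n i x hx
    match n, i, x, hx with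
    | 0, i, x, hx =>
      simp only [loc', g]
      rw [hv, Subsingleton.elim x 0]
    | 1, i, x, hx =>
      simp only [loc', g]
      rw [hel i _ ((b1 x).1 hx)]
      have : (fun _ => x 0) = x := by ext k; rw [Subsingleton.elim k 0]
      simp only [this]
    | 2, i, x, hx =>
      simp only [loc', g]
      rw [hfl i _ ((b2 x).1 hx).1 _ ((b2 x).1 hx).2]
      have : ![x 0, x 1] = x := by ext k; fin_cases k <;> rfl
      simp only [this]
    | _ + 3, i, x, hx => exact i.elim
  · intro n i x hx
    obtain ⟨hx1, hx2⟩ := hsph hx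
    match n, i, x, hx1, hx2 with
    | 0, i, x, hx1, hx2 =>
      exfalso
      apply hx2
      rw [Subsingleton.elim x 0]
      simp
    | 1, i, x, hx1, hx2 =>
      rw [c1] at hx1
      rw [b1] at hx2
      have := heb i (x 0) (by
        simp only [Set.mem_Icc, Set.mem_Ioo] at hx1 hx2
        grind)
      simp only [loc', g]
      obtain ⟨j, hj⟩ := Sum.isLeft_iff.1 this
      rw [hj]
      exact Nat.zero_lt_one
    | 2, i, x, hx1, hx2 =>
      rw [c2] at hx1
      rw [b2] at hx2
      have := hfb i (x 0) hx1.1 (x 1) hx1.2 (by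
        simp only [Set.mem_Icc, Set.mem_Ioo] at hx1 hx2
        grind)
      simp only [loc', g]
      rcases hl : loc (f i (x 0) (x 1)) with j | j | j
      · exact Nat.two_pos
      · exact Nat.one_lt_two
      · exact absurd hl (this j)
    | _ + 3, i, x, hx1, hx2 => exact i.elim
end

noncomputable section

/-! ### The genus of the quotient by a rotation -/

/-- The condition `i ≤ κ i` selects one element of each orbit, and all orbits but one have two
elements. -/
theorem two_mul_card_le_image {ι : Type} [Finite ι] [LinearOrder ι] {κ : Equiv.Perm ι}
    (hκ : ∀ i, κ (κ i) = i) {i₀ : ι} (h : ∀ i, κ i = i ↔ i = i₀) :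
    2 * Nat.card {i // i ≤ κ i} = Nat.card ι + 1 := by
  classical
  have := Fintype.ofFinite ι
  rw [Nat.card_eq_fintype_card, Nat.card_eq_fintype_card, Fintype.card_subtype]
  have h1 : (Finset.univ.filter fun i => i ≤ κ i).card =
      (Finset.univ.filter fun i => κ i ≤ i).card := by
    refine Finset.card_bij (fun i _ => κ i) ?_ (fun _ _ _ _ h => κ.injective h) ?_
    · intro i hi
      simpa [hκ] using hi
    · intro i hi
      exact ⟨κ i, by simpa [hκ] using hi, hκ i⟩
  have h2 := Finset.card_union_add_card_inter (Finset.univ.filter fun i => i ≤ κ i)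
    (Finset.univ.filter fun i => κ i ≤ i)
  have h3 : (Finset.univ.filter fun i => i ≤ κ i) ∪ (Finset.univ.filter fun i => κ i ≤ i) =
      Finset.univ := by
    ext i
    simpa using le_total i (κ i)
  have h4 : (Finset.univ.filter fun i => i ≤ κ i) ∩ (Finset.univ.filter fun i => κ i ≤ i) =
      {i₀} := by
    ext i
    simp only [Finset.mem_inter, Finset.mem_filter, Finset.mem_univ, true_and,
      Finset.mem_singleton, ← h i]
    exact ⟨fun h => le_antisymm h.2 h.1, fun h => ⟨h.ge, h.le⟩⟩
  rw [h3, h4, ← h1, Finset.card_univ, Finset.card_singleton] at h2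
  omega

namespace Origami

variable {ι : Type} (O : Origami ι) (ρ : Equiv.Perm ι)

/-- The action of the rotation by `ρ` on the horizontal middle lines, the right edges and the top
edges of the squares. -/
def segmentPerm : Fin 3 → Equiv.Perm ι
  | 0 => ρ
  | 1 => ρ * O.right
  | 2 => ρ * O.top

/-- The horizontal middle line, the right edge and the top edge of the unit square. -/
def segment : Fin 3 → ℝ → ℂ
  | 0, s => s + Complex.I / 2
  | 1, s => 1 + s * Complex.I
  | 2, s => s + Complex.I

theorem continuous_segment (m : Fin 3) : Continuous (segment m) := by
  match m with
  | 0 => unfold segment; fun_prop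
  | 1 => unfold segment; fun_prop
  | 2 => unfold segment; fun_prop

theorem segment_mem (m : Fin 3) {s : ℝ} (h0 : 0 ≤ s) (h1 : s ≤ 1) :
    segment m s ∈ closedSquare := by
  fin_cases m <;> simp [segment, closedSquare, h0, h1]; norm_num

variable {O ρ}

theorem segmentPerm_segmentPerm (hρ : ρ * ρ = 1) (hσ : O.right * ρ * O.right = ρ)
    (hτ : O.top * ρ * O.top = ρ) (m : Fin 3) (i : ι) :
    O.segmentPerm ρ m (O.segmentPerm ρ m i) = i := by
  fin_cases m
  · exact perm_perm hρ i
  · simp [segmentPerm, perm_mul_perm hσ, perm_perm hρ]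
  · simp [segmentPerm, perm_mul_perm hτ, perm_perm hρ]

variable [LinearOrder ι]

variable (O ρ) in
/-- The vertices of the decomposition of the quotient of a surface with one vertex by a rotation:
the vertex and the centres of the segments. -/
abbrev QuotVertex : Type := Option (Σ m : Fin 3, {i // i ≤ O.segmentPerm ρ m i})

variable (O ρ) in
/-- The points of the open cells of the decomposition of the quotient: the edges are the halves of
the segments, the faces are the upper halves of the squares. -/
abbrev QuotCell : Type := QuotVertex O ρ ⊕ ((Fin 3 × ι) × ℝ) ⊕ (ι × ℝ × ℝ)

/-- The centre of a segment. -/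
def segmentCenter (h : ∀ m i, O.segmentPerm ρ m (O.segmentPerm ρ m i) = i) (m : Fin 3) (i : ι) :
    QuotVertex O ρ :=
  some ⟨m, min i (O.segmentPerm ρ m i), by
    rcases le_total i (O.segmentPerm ρ m i) with h' | h' <;> simp [h', h]⟩

/-- The cell of a point of an open segment. -/
def locateSegment (h : ∀ m i, O.segmentPerm ρ m (O.segmentPerm ρ m i) = i) (m : Fin 3) (i : ι)
    (s : ℝ) : QuotCell O ρ :=
  if s = 1 / 2 then .inl (segmentCenter h m i) else
  -- The half with `1/2 < s < 1` is parametrised by `(-1, 1)`. The other half is replaced by its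
  -- image under the rotation, a second half with parameter `1 - s`, and `4 * (1 - s) - 3 = 1 - 4 *
  -- s`.
  if 1 / 2 < s then .inr (.inl ((m, i), 4 * s - 3)) else
  .inr (.inl ((m, O.segmentPerm ρ m i), 1 - 4 * s))

open Classical in
/-- The cell of a point of a square. -/
def locate (h : ∀ m i, O.segmentPerm ρ m (O.segmentPerm ρ m i) = i) (a : ι × ℂ) : QuotCell O ρ :=
  if IsCorner a.2 then .inl none else
  if a.2.re = 0 then locateSegment h 1 (O.right⁻¹ a.1) a.2.im else
  if a.2.re = 1 then locateSegment h 1 a.1 a.2.im else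
  if a.2.im = 0 then locateSegment h 2 (O.top⁻¹ a.1) a.2.re else
  if a.2.im = 1 then locateSegment h 2 a.1 a.2.re else
  if a.2.im = 1 / 2 then locateSegment h 0 a.1 a.2.re else
  if 1 / 2 < a.2.im then .inr (.inr (a.1, 2 * a.2.re - 1, 4 * a.2.im - 3)) else
  -- The lower half of a square is rotated to the upper half of the square `ρ a.1`.
  .inr (.inr (ρ a.1, 1 - 2 * a.2.re, 1 - 4 * a.2.im))

section

variable {h : ∀ m i, O.segmentPerm ρ m (O.segmentPerm ρ m i) = i}

theorem segmentCenter_flip (m : Fin 3) (i : ι) :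
    segmentCenter h m (O.segmentPerm ρ m i) = segmentCenter h m i := by
  simp only [segmentCenter, h]
  congr 3
  exact min_comm _ _

theorem segmentCenter_of_le (m : Fin 3) {i : ι} (hi : i ≤ O.segmentPerm ρ m i) :
    segmentCenter h m i = some ⟨m, i, hi⟩ := by
  simp only [segmentCenter]
  congr 3
  exact min_eq_left hi

theorem locateSegment_flip (m : Fin 3) (i : ι) (s : ℝ) :
    locateSegment h m (O.segmentPerm ρ m i) (1 - s) = locateSegment h m i s := by
  simp only [locateSegment, segmentCenter_flip, h]
  rcases lt_trichotomy s (1 / 2) with hs | hs | hs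
  · rw [if_neg (by linarith), if_pos (by linarith), if_neg (by linarith), if_neg (by linarith)]
    congr 3
    ring
  · rw [if_pos (by linarith), if_pos hs]
  · rw [if_neg (by linarith), if_neg (by linarith), if_neg (by linarith), if_pos (by linarith)]
    congr 3
    ring

theorem locate_eq_of_glue {a b : ι × ℂ} (hab : O.Glue a b) : locate h a = locate h b := by
  cases hab with
  | horizontal i t h0 h1 =>
    by_cases ht : t = 0 ∨ t = 1
    · rcases ht with rfl | rfl <;> simp [locate, IsCorner]
    · rw [not_or] at ht
      simp [locate, IsCorner, ht]
  | vertical i t h0 h1 =>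
    by_cases ht : t = 0 ∨ t = 1
    · rcases ht with rfl | rfl <;> simp [locate, IsCorner]
    · rw [not_or] at ht
      simp [locate, IsCorner, ht]

theorem isCorner_flip {z : ℂ} : IsCorner (1 + Complex.I - z) ↔ IsCorner z := by
  simp only [IsCorner, Complex.sub_re, Complex.add_re, Complex.one_re, Complex.I_re,
    Complex.sub_im, Complex.add_im, Complex.one_im, Complex.I_im]
  grind

theorem locate_flip (hρ : ρ * ρ = 1) (hσ : O.right * ρ * O.right = ρ)
    (hτ : O.top * ρ * O.top = ρ) (i : ι) (z : ℂ) :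
    locate h (ρ i, 1 + Complex.I - z) = locate h (i, z) := by
  have hre : (1 + Complex.I - z).re = 1 - z.re := by simp
  have him : (1 + Complex.I - z).im = 1 - z.im := by simp
  have e1 : O.right⁻¹ (ρ i) = O.segmentPerm ρ 1 i := by
    rw [Equiv.Perm.inv_eq_iff_eq]; exact (perm_mul_perm hσ i).symm
  have e2 : O.top⁻¹ (ρ i) = O.segmentPerm ρ 2 i := by
    rw [Equiv.Perm.inv_eq_iff_eq]; exact (perm_mul_perm hτ i).symm
  have e3 : ρ i = O.segmentPerm ρ 1 (O.right⁻¹ i) := by simp [segmentPerm]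
  have e4 : ρ i = O.segmentPerm ρ 2 (O.top⁻¹ i) := by simp [segmentPerm]
  simp only [locate, hre, him]
  by_cases hc : IsCorner z
  · rw [if_pos hc, if_pos (isCorner_flip.2 hc)]
  rw [if_neg hc, if_neg (mt isCorner_flip.1 hc)]
  by_cases h1 : z.re = 0
  · rw [if_neg (by linarith), if_pos (by linarith), if_pos h1, e3, locateSegment_flip]
  by_cases h2 : z.re = 1
  · rw [if_pos (by linarith), if_neg h1, if_pos h2, e1, locateSegment_flip]
  rw [if_neg (fun h => h2 (by linarith)), if_neg (fun h => h1 (by linarith)), if_neg h1, if_neg h2]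
  by_cases h3 : z.im = 0
  · rw [if_neg (by linarith), if_pos (by linarith), if_pos h3, e4, locateSegment_flip]
  by_cases h4 : z.im = 1
  · rw [if_pos (by linarith), if_neg h3, if_pos h4, e2, locateSegment_flip]
  rw [if_neg (fun h => h4 (by linarith)), if_neg (fun h => h3 (by linarith)), if_neg h3, if_neg h4]
  rcases lt_trichotomy z.im (1 / 2) with hs | hs | hs
  · rw [if_neg (by linarith), if_pos (by linarith), if_neg (by linarith), if_neg (by linarith)]
    congr 4 <;> ring
  · rw [if_pos (by linarith), if_pos hs, show ρ i = O.segmentPerm ρ 0 i from rfl,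
      locateSegment_flip]
  · rw [if_neg (by linarith), if_neg (by linarith), if_neg (by linarith), if_pos (by linarith),
      perm_perm hρ]
    congr 4 <;> ring

theorem locate_segment (m : Fin 3) (i : ι) {s : ℝ} (h0 : 0 < s) (h1 : s < 1) :
    locate h (i, segment m s) = locateSegment h m i s := by
  fin_cases m <;> simp [locate, segment, IsCorner, h0.ne', h1.ne]

theorem locate_upper (i : ι) {x y : ℝ} (h0 : 0 < x) (h1 : x < 1) (h2 : 1 / 2 < y) (h3 : y < 1) :
    locate h (i, x + y * Complex.I) = .inr (.inr (i, 2 * x - 1, 4 * y - 3)) := by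
  have : 0 < y := by linarith
  simp only [locate, IsCorner]
  simp [h0.ne', h1.ne, this.ne', h3.ne]
  rw [if_neg (by linarith), if_pos (by linarith)]

theorem locateSegment_ne (m : Fin 3) (i : ι) (s : ℝ) (p : ι × ℝ × ℝ) :
    locateSegment h m i s ≠ .inr (.inr p) := by
  simp only [locateSegment]
  split_ifs <;> simp

theorem locate_ne {i : ι} {z : ℂ} (hz : z.re = 0 ∨ z.re = 1 ∨ z.im = 1 / 2 ∨ z.im = 1)
    (p : ι × ℝ × ℝ) : locate h (i, z) ≠ .inr (.inr p) := by
  simp only [locate]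
  split_ifs <;> first | exact locateSegment_ne _ _ _ _ | exact Sum.inl_ne_inr | grind

end

/-- The rotation exchanges upper and lower halves of squares, so the quotient has one face for each
of the `n` squares. The edges are the `3n` outer halves of middle lines, right sides and top sides.
The vertices are the vertex of the surface and the centres of these three kinds of segments modulo
the rotation, `(n + 1) / 2` of each kind as the rotation fixes exactly one. The middle lines are
included so that all fixed points become vertices. -/
theorem hasGenus_of_half_tiling [Finite ι] [Nonempty ι] (hO : O.HasOneVertex) (hρ : ρ * ρ = 1)
    (hσ : O.right * ρ * O.right = ρ) (hτ : O.top * ρ * O.top = ρ) {Y : Type} [TopologicalSpace Y]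
    [T2Space Y] (q : ι → ℂ → Y) (hq : ∀ i, ContinuousOn (q i) closedSquare)
    (hqs : ∀ y, ∃ i, ∃ z ∈ closedSquare, q i z = y)
    (hqe : ∀ i j, ∀ z ∈ closedSquare, ∀ w ∈ closedSquare, q i z = q j w ↔
      Relation.EqvGen O.Glue (i, z) (j, w) ∨
        Relation.EqvGen O.Glue (ρ i, 1 + Complex.I - z) (j, w))
    {i₁ i₂ i₃ : ι} (h1 : ∀ i, ρ i = i ↔ i = i₁) (h2 : ∀ i, ρ (O.right i) = i ↔ i = i₂)
    (h3 : ∀ i, ρ (O.top i) = i ↔ i = i₃) {h : ℕ} (hn : Nat.card ι = 4 * h + 1) :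
    HasGenus Y h := by
  classical
  have hκ := segmentPerm_segmentPerm hρ hσ hτ
  obtain ⟨i₀⟩ := ‹Nonempty ι›
  let Q : Fin 3 → ι → ℝ → Y := fun m i s => q i (segment m s)
  have hflip : ∀ i, ∀ z ∈ closedSquare, q (ρ i) (1 + Complex.I - z) = q i z := fun i z hz =>
    (hqe _ _ _ (flip_mem hz) _ hz).2 (.inr (by
      rw [perm_perm hρ, sub_sub_cancel]; exact .refl _))
  have hglue : ∀ i j, ∀ z ∈ closedSquare, ∀ w ∈ closedSquare, O.Glue (i, z) (j, w) →
      q i z = q j w := fun i j z hz w hw hg => (hqe _ _ _ hz _ hw).2 (.inl (.rel _ _ hg))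
  have hglue1 : ∀ i, ∀ s : ℝ, 0 ≤ s → s ≤ 1 → q (O.right i) (s * Complex.I) = Q 1 i s := by
    intro i s h0 h1
    exact (hglue _ _ _ (segment_mem 1 h0 h1) _ (by simp [closedSquare, h0, h1])
      (.horizontal i s h0 h1)).symm
  have hglue2 : ∀ i, ∀ s : ℝ, 0 ≤ s → s ≤ 1 → q (O.top i) s = Q 2 i s := by
    intro i s h0 h1
    exact (hglue _ _ _ (segment_mem 2 h0 h1) _ (by simp [closedSquare, h0, h1])
      (.vertical i s h0 h1)).symm
  have hQflip : ∀ m i, ∀ s : ℝ, 0 ≤ s → s ≤ 1 → Q m (O.segmentPerm ρ m i) (1 - s) = Q m i s := by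
    intro m i s h0 h1
    have h0' : 0 ≤ 1 - s := by linarith
    have h1' : 1 - s ≤ 1 := by linarith
    refine Eq.trans ?_ (hflip i (segment m s) (segment_mem m h0 h1))
    fin_cases m
    · change q _ (_ + _) = q _ (_ - (_ + _))
      congr 1
      push_cast
      ring
    · change Q 1 (O.segmentPerm ρ 1 i) _ = q _ (_ - (_ + _))
      rw [← hglue1 _ _ h0' h1', show O.right (O.segmentPerm ρ 1 i) = ρ i from perm_mul_perm hσ i]
      congr 1
      push_cast
      ring
    · change Q 2 (O.segmentPerm ρ 2 i) _ = q _ (_ - (_ + _))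
      rw [← hglue2 _ _ h0' h1', show O.top (O.segmentPerm ρ 2 i) = ρ i from perm_mul_perm hτ i]
      congr 1
      push_cast
      ring
  -- The location is computed from an arbitrary representative; `locate` is invariant under gluing
  -- and under the rotation, so the choice is irrelevant.
  let L : Y → QuotCell O ρ := fun y => locate hκ ((hqs y).choose, (hqs y).choose_spec.choose)
  have hL : ∀ i, ∀ z ∈ closedSquare, L (q i z) = locate hκ (i, z) := by
    intro i z hz
    have hs := (hqs (q i z)).choose_spec.choose_spec
    rcases (hqe _ _ _ hs.1 _ hz).1 hs.2 with hg | hg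
    · exact eqvGen_map (fun _ _ => locate_eq_of_glue) hg
    · exact (locate_flip hρ hσ hτ _ _).symm.trans (eqvGen_map (fun _ _ => locate_eq_of_glue) hg)
  let v : QuotVertex O ρ → Y
    | none => q i₀ 0
    | some ⟨m, i⟩ => Q m i (1 / 2)
  let e : Fin 3 × ι → ℝ → Y := fun p t => Q p.1 p.2 ((3 + t) / 4)
  let f : ι → ℝ → ℝ → Y := fun i s t => q i (((1 + s) / 2 : ℝ) + ((3 + t) / 4 : ℝ) * Complex.I)
  have hfm : ∀ s ∈ Set.Icc (-1 : ℝ) 1, ∀ t ∈ Set.Icc (-1 : ℝ) 1,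
      (((1 + s) / 2 : ℝ) + ((3 + t) / 4 : ℝ) * Complex.I : ℂ) ∈ closedSquare := by
    rintro s ⟨hs1, hs2⟩ t ⟨ht1, ht2⟩
    simp only [closedSquare, Set.mem_ofPred_eq, Complex.add_re, Complex.ofReal_re,
      Complex.re_ofReal_mul,
      Complex.I_re, Complex.add_im, Complex.ofReal_im, Complex.im_ofReal_mul, Complex.I_im]
    refine ⟨?_, ?_, ?_, ?_⟩ <;> linarith
  have hem : ∀ m, ∀ t ∈ Set.Icc (-1 : ℝ) 1, segment m ((3 + t) / 4) ∈ closedSquare :=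
    fun m t ht => segment_mem m (by linarith [ht.1]) (by linarith [ht.2])
  have hcorner : ∀ i, ∀ z ∈ closedSquare, IsCorner z → q i z = v none := by
    intro i z hz hc
    have h0 : IsCorner 0 := by simp [IsCorner]
    exact (hqe _ _ _ hz _ (by simp [closedSquare])).2 (.inl (hO.eqvGen hc h0))
  have hcenter : ∀ m i, v (segmentCenter hκ m i) = Q m i (1 / 2) := by
    intro m i
    rcases le_total i (O.segmentPerm ρ m i) with hi | hi
    · rw [segmentCenter_of_le m hi]
    · rw [← segmentCenter_flip, segmentCenter_of_le m (by rwa [hκ]),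
        ← hQflip m i (1 / 2) (by norm_num) (by norm_num)]
      change Q _ _ _ = _
      norm_num
  let Good : Y → Prop := fun y => (∃ i, L y = .inl i ∧ v i = y) ∨
      (∃ i, ∃ t ∈ Set.Ioo (-1 : ℝ) 1, L y = .inr (.inl (i, t)) ∧ e i t = y) ∨
      ∃ i, ∃ s ∈ Set.Ioo (-1 : ℝ) 1, ∃ t ∈ Set.Ioo (-1 : ℝ) 1,
        L y = .inr (.inr (i, s, t)) ∧ f i s t = y
  have hseg : ∀ m i, ∀ s : ℝ, 0 < s → s < 1 → Good (Q m i s) := by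
    intro m i s h0 h1
    have hLs : L (Q m i s) = locateSegment hκ m i s := by
      rw [hL _ _ (segment_mem m h0.le h1.le), locate_segment m i h0 h1]
    rw [locateSegment] at hLs
    rcases lt_trichotomy s (1 / 2) with hs | hs | hs
    · rw [if_neg (by linarith), if_neg (by linarith)] at hLs
      refine .inr (.inl ⟨_, _, ⟨by linarith, by linarith⟩, hLs, ?_⟩)
      rw [← hQflip m i s h0.le h1.le]
      change Q _ _ _ = _
      congr 1
      ring
    · rw [if_pos (by linarith)] at hLs
      refine .inl ⟨_, hLs, ?_⟩
      rw [hcenter, hs]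
    · rw [if_neg (by linarith), if_pos (by linarith)] at hLs
      refine .inr (.inl ⟨_, _, ⟨by linarith, by linarith⟩, hLs, ?_⟩)
      change Q _ _ _ = _
      congr 1
      ring
  have hgood : ∀ i, ∀ z ∈ closedSquare, 1 / 2 ≤ z.im → Good (q i z) := by
    intro i z hz hz'
    have hze : z = z.re + z.im * Complex.I := (Complex.re_add_im z).symm
    by_cases hc : IsCorner z
    · refine .inl ⟨none, ?_, (hcorner i z hz hc).symm⟩
      rw [hL _ _ hz, locate, if_pos hc]
    have hz2 := hz
    obtain ⟨z1, z2, z3, z4⟩ := hz2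
    by_cases hx0 : z.re = 0
    · have : q i z = Q 1 (O.right⁻¹ i) z.im := by
        rw [← hglue1 _ _ z3 z4, Equiv.Perm.inv_def, Equiv.apply_symm_apply]
        congr 1
        rw [hze, hx0]; simp
      rw [this]
      exact hseg _ _ _ (lt_of_le_of_ne z3 fun h => hc ⟨.inl hx0, .inl h.symm⟩)
        (lt_of_le_of_ne z4 fun h => hc ⟨.inl hx0, .inr h⟩)
    by_cases hx1 : z.re = 1
    · have : q i z = Q 1 i z.im := by
        change _ = q _ (_ + _)
        congr 1
        rw [hze, hx1]; simp
      rw [this]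
      exact hseg _ _ _ (lt_of_le_of_ne z3 fun h => hc ⟨.inr hx1, .inl h.symm⟩)
        (lt_of_le_of_ne z4 fun h => hc ⟨.inr hx1, .inr h⟩)
    have hx0' := lt_of_le_of_ne z1 (Ne.symm hx0)
    have hx1' := lt_of_le_of_ne z2 hx1
    by_cases hy1 : z.im = 1
    · have : q i z = Q 2 i z.re := by
        change _ = q _ (_ + _)
        congr 1
        rw [hze, hy1]; simp
      rw [this]
      exact hseg _ _ _ hx0' hx1'
    by_cases hy2 : z.im = 1 / 2
    · have : q i z = Q 0 i z.re := by
        change _ = q _ (_ + _)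
        congr 1
        rw [hze, hy2]; apply Complex.ext <;> simp
      rw [this]
      exact hseg _ _ _ hx0' hx1'
    refine .inr (.inr ⟨i, 2 * z.re - 1, ⟨by linarith, by linarith⟩, 4 * z.im - 3, ⟨?_, ?_⟩, ?_, ?_⟩)
    · linarith [lt_of_le_of_ne hz' (Ne.symm hy2)]
    · linarith [lt_of_le_of_ne z4 hy1]
    · rw [hL _ _ hz]
      conv_lhs => rw [hze]
      exact locate_upper _ hx0' hx1' (lt_of_le_of_ne hz' (Ne.symm hy2)) (lt_of_le_of_ne z4 hy1)
    · change q _ _ = _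
      congr 1
      rw [hze]
      apply Complex.ext <;> simp
  refine hasGenus_of_cells v e f L ?_ ?_ ?_ ?_ ?_ ?_ ?_ ?_ ?_
  · intro p
    exact (hq _).comp ((continuous_segment _).comp (by fun_prop)).continuousOn fun t ht => hem _ t
      ht
  · intro i
    refine (hq i).comp (f := fun p : ℝ × ℝ =>
      (((1 + p.1) / 2 : ℝ) + ((3 + p.2) / 4 : ℝ) * Complex.I : ℂ)) ?_ fun p hp => hfm _ hp.1 _ hp.2
    fun_prop
  · rintro (_ | ⟨m, i, hi⟩)
    · change L (q i₀ 0) = _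
      rw [hL _ _ (by simp [closedSquare]), locate, if_pos (by simp [IsCorner])]
    · change L (q i (segment m (1 / 2))) = _
      rw [hL _ _ (segment_mem m (by norm_num) (by norm_num)),
        locate_segment m i (by norm_num) (by norm_num), locateSegment, if_pos rfl,
        segmentCenter_of_le m hi]
  · rintro ⟨m, i⟩ t ⟨ht1, ht2⟩
    change L (q i (segment m _)) = _
    rw [hL _ _ (hem _ t ⟨ht1.le, ht2.le⟩), locate_segment m i (by linarith) (by linarith),
      locateSegment, if_neg (by linarith), if_pos (by linarith)]
    congr 3
    ring
  · rintro i s ⟨hs1, hs2⟩ t ⟨ht1, ht2⟩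
    rw [hL _ _ (hfm _ ⟨hs1.le, hs2.le⟩ _ ⟨ht1.le, ht2.le⟩),
      locate_upper i (by linarith) (by linarith) (by linarith) (by linarith)]
    congr 4 <;> ring
  · intro y
    obtain ⟨i, z, hz, rfl⟩ := hqs y
    rcases le_total (1 / 2) z.im with h' | h'
    · exact hgood i z hz h'
    · rw [← hflip i z hz]
      exact hgood _ _ (flip_mem hz) (by simp; linarith)
  · rintro ⟨m, i⟩ t (rfl | rfl)
    · change (L (q i (segment m _))).isLeft = _
      rw [hL _ _ (hem _ _ (by simp)), locate_segment m i (by norm_num) (by norm_num),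
        locateSegment, if_pos (by norm_num)]
      rfl
    · change (L (q i (segment m _))).isLeft = _
      rw [hL _ _ (hem _ _ (by simp))]
      norm_num
      fin_cases m
      · change (locate hκ (i, _ + _)).isLeft = _
        simp [locate, IsCorner, locateSegment]
      · simp [locate, segment, IsCorner]
      · simp [locate, segment, IsCorner]
  · intro i s hs t ht hst p
    rw [hL _ _ (hfm _ hs _ ht)]
    apply locate_ne
    simp
    grind
  · have hc : ∀ m, 2 * Nat.card {i // i ≤ O.segmentPerm ρ m i} = Nat.card ι + 1 := by
      intro m
      fin_cases m
      · exact two_mul_card_le_image (hκ 0) h1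
      · exact two_mul_card_le_image (hκ 1) h2
      · exact two_mul_card_le_image (hκ 2) h3
    -- With `n = 4h + 1` each kind of segment has `2h + 1` centres, and `1 + 3 * (2h + 1) - 3n + n =
    -- 2 - 2h`.
    have hV : Nat.card (QuotVertex O ρ) = 1 + 3 * (2 * h + 1) := by
      rw [Finite.card_option, Nat.card_sigma, Fin.sum_univ_three]
      have := hc 0
      have := hc 1
      have := hc 2
      omega
    rw [hV, Nat.card_prod, hn, Nat.card_fin]
    push_cast
    ring

end Origami

namespace Origami.HasOneVertex

/-- An origami with one vertex which is invariant under a rotation with a unique fixed point in each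
of the three classes of half-integral points is an orientation double cover. -/
theorem isOrientationDoubleCoverIn {ι : Type} {O : Origami ι} [Finite ι] [Nonempty ι]
    (hO : O.HasOneVertex) {ρ : Equiv.Perm ι} (hρ : ρ * ρ = 1) (hσ : O.right * ρ * O.right = ρ)
    (hτ : O.top * ρ * O.top = ρ) {h : ℕ} (hn : Nat.card ι = 4 * h + 1) {i₁ i₂ i₃ : ι}
    (h1 : ∀ i, ρ i = i ↔ i = i₁) (h2 : ∀ i, ρ (O.right i) = i ↔ i = i₂)
    (h3 : ∀ i, ρ (O.top i) = i ↔ i = i₃) :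
    O.IsOrientationDoubleCoverIn h {(Nat.card ι : ℤ) - 2, -1, -1, -1} := by
  have := hO.t2Space
  have := hO.connectedSpace
  let _ : LinearOrder ι := LinearOrder.lift' (Finite.equivFin ι) (Finite.equivFin ι).injective
  have hP := O.isTopTiling_param
  set J := hP.involution hO hρ hσ hτ with hJ
  refine hP.isOrientationDoubleCoverIn hO hρ hσ hτ ?_ (by omega) h1 h2 h3
  refine hasGenus_of_half_tiling hO hρ hσ hτ (fun i z => J.toQuot (O.param i z)) (fun i => ?_)
    (fun y => ?_) (fun i j z hz w hw => ?_) h1 h2 h3 hn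
  · exact J.isOpenQuotientMap_toQuot.continuous.comp_continuousOn (hP.continuousOn i)
  · obtain ⟨x, rfl⟩ := J.isOpenQuotientMap_toQuot.surjective y
    obtain ⟨i, z, hz, rfl⟩ := hP.surjective x
    exact ⟨i, z, hz, rfl⟩
  · rw [J.toQuot_eq_iff, hP.eq_iff _ _ _ hz _ hw, hJ, hP.inv_apply hO hρ hσ hτ hz,
      hP.eq_iff _ _ _ (flip_mem hz) _ hw]

end Origami.HasOneVertex
end

noncomputable section

/-! ### Origamis with one horizontal cylinder of height one -/

theorem sigma_val {g : ℕ} (x : Squares g) :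
    (sigma g x).1 = if x.1 < 2 * g - 1 then x.1 + 1 else 1 := rfl

theorem sigma_val_cases {g : ℕ} (x : Squares g) :
    (x.1 < 2 * g - 1 ∧ (sigma g x).1 = x.1 + 1) ∨ (x.1 = 2 * g - 1 ∧ (sigma g x).1 = 1) := by
  have := x.2
  rw [sigma_val]
  split_ifs <;> omega

/-- A property preserved by `σ_g` that holds for one label holds for all of them. -/
theorem sigma_induction {g : ℕ} {p : Squares g → Prop} {a : Squares g} (ha : p a)
    (h : ∀ x, p x → p (sigma g x)) (x : Squares g) : p x := by
  have up : ∀ (b : Squares g), p b → ∀ k (hk : 1 ≤ b.1 + k ∧ b.1 + k ≤ 2 * g - 1),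
      p ⟨b.1 + k, hk⟩ := by
    intro b hb k
    induction k with
    | zero => exact fun _ => hb
    | succ k ih =>
      intro hk
      have hk' : 1 ≤ b.1 + k ∧ b.1 + k ≤ 2 * g - 1 := ⟨by have := b.2; omega, by omega⟩
      have := h _ (ih hk')
      rcases sigma_val_cases (⟨b.1 + k, hk'⟩ : Squares g) with ⟨h1, h2⟩ | ⟨h1, h2⟩
      · rwa [show sigma g ⟨b.1 + k, hk'⟩ = ⟨b.1 + (k + 1), hk⟩ from Subtype.ext h2] at this
      · dsimp only at h1
        omega
  have ha' := a.2
  have hx' := x.2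
  have hlast : p ⟨2 * g - 1, by omega, le_rfl⟩ := by
    have := up a ha (2 * g - 1 - a.1) (by omega)
    rwa [show (⟨a.1 + (2 * g - 1 - a.1), by omega⟩ : Squares g) = ⟨2 * g - 1, by omega, le_rfl⟩
      from Subtype.ext (by dsimp only; omega)] at this
  have hone : p ⟨1, le_rfl, by omega⟩ := by
    have := h _ hlast
    rwa [show sigma g ⟨2 * g - 1, by omega, le_rfl⟩ = ⟨1, le_rfl, by omega⟩ from
      Subtype.ext (by rw [sigma_val]; exact if_neg (lt_irrefl _))] at this
  have := up _ hone (x.1 - 1) (by dsimp only; omega)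
  rwa [show (⟨1 + (x.1 - 1), by omega⟩ : Squares g) = x from Subtype.ext (by dsimp only; omega)]
    at this

theorem card_squares (g : ℕ) : Nat.card (Squares g) = 2 * g - 1 := by
  rw [Nat.subtype_card (Finset.Icc 1 (2 * g - 1)) fun x => Finset.mem_Icc, Nat.card_Icc]
  omega

instance finite_squares (g : ℕ) : Finite (Squares g) :=
  Finite.of_injective (fun x : Squares g => (⟨x.1, by have := x.2; omega⟩ : Fin (2 * g)))
    fun x y h => Subtype.ext (by simpa using h)

theorem Sends.bounds {g : ℕ} {τ : Equiv.Perm (Squares g)} {a b : ℕ} (h : Sends τ a b) :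
    1 ≤ a ∧ a ≤ 2 * g - 1 ∧ 1 ≤ b ∧ b ≤ 2 * g - 1 := by
  obtain ⟨x, rfl, rfl⟩ := h
  exact ⟨x.2.1, x.2.2, (τ x).2.1, (τ x).2.2⟩

theorem Sends.eq {g : ℕ} {τ : Equiv.Perm (Squares g)} {a b b' : ℕ} (h : Sends τ a b)
    (h' : Sends τ a b') : b = b' := by
  obtain ⟨x, rfl, rfl⟩ := h
  obtain ⟨y, hy, rfl⟩ := h'
  rw [Subtype.ext hy]

theorem exists_sends {g : ℕ} (τ : Equiv.Perm (Squares g)) {a : ℕ} (h1 : 1 ≤ a)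
    (h2 : a ≤ 2 * g - 1) : ∃ b, Sends τ a b := ⟨_, ⟨a, h1, h2⟩, rfl, rfl⟩

/-- The ordering of the pairs enters most later arguments only through this successor rule: a pair
is placed, with its members exchanged, above a different pair, or above `(c, c + 1)` if it is the
last one. -/
theorem PlacesPairs.next {g m c : ℕ} {τ : Equiv.Perm (Squares g)} (h : PlacesPairs g m c τ)
    (hm : 2 ≤ m) {j : ℕ} (hj : j = 1 ∨ m ≤ j ∧ j ≤ g - 1) :
    (∃ l, m ≤ l ∧ l ≤ g - 1 ∧ l ≠ j ∧ Sends τ (2 * j + 1) (2 * l) ∧ Sends τ (2 * j) (2 * l + 1)) ∨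
      Sends τ (2 * j + 1) c ∧ Sends τ (2 * j) (c + 1) := by
  obtain ⟨k, h0, hk, hp, hl⟩ := h
  obtain ⟨i, hi, rfl⟩ : ∃ i ≤ g - m, k i = j := by
    rcases hj with rfl | hj
    · exact ⟨0, Nat.zero_le _, h0⟩
    · obtain ⟨i, hi, rfl⟩ := hk.surjOn hj
      exact ⟨i, hi.2, rfl⟩
  rcases hi.lt_or_eq with hi' | rfl
  · have hmem : i + 1 ∈ Set.Icc 1 (g - m) := ⟨by omega, hi'⟩
    have := hk.mapsTo hmem
    refine .inl ⟨k (i + 1), this.1, this.2, fun he => ?_, hp i hi'⟩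
    rcases Nat.eq_zero_or_pos i with rfl | hpos
    · rw [h0] at he
      rw [he] at this
      have := this.1
      omega
    · have := hk.injOn hmem ⟨hpos, hi⟩ he
      omega
  · exact .inr hl

/-- A rotation that inverts `σ_g` is a reflection of the labels. -/
theorem exists_add_eq {g : ℕ} {ρ : Equiv.Perm (Squares g)} (hρ : sigma g * ρ * sigma g = ρ)
    (hg : 1 ≤ g) : ∃ c, 2 ≤ c ∧ c ≤ 2 * g ∧
      ∀ x, x.1 + (ρ x).1 = c ∨ x.1 + (ρ x).1 = c + (2 * g - 1) := by
  let o : Squares g := ⟨1, le_rfl, by omega⟩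
  have := (ρ o).2
  refine ⟨1 + (ρ o).1, by omega, by omega, ?_⟩
  refine sigma_induction (a := o) (.inl rfl) fun x hx => ?_
  -- Passing from `x` to its successor replaces `ρ x` by its predecessor, so the sum of the two
  -- labels is constant modulo `2g - 1`.
  have h1 := Origami.perm_mul_perm hρ x
  have h2 := sigma_val_cases x
  have h3 := sigma_val_cases (ρ (sigma g x))
  rw [h1] at h3
  have := (ρ (sigma g x)).2
  have := (ρ x).2
  omega

/-- An involution commuting with the odd cycle `σ_g` is trivial. -/
theorem eq_one_of_commute_sigma {g : ℕ} {ρ : Equiv.Perm (Squares g)} (h2 : ρ * ρ = 1)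
    (h : ρ * sigma g = sigma g * ρ) (hg : 1 ≤ g) : ρ = 1 := by
  have hfix : ∃ x, ρ x = x := by
    classical
    have := Fintype.ofFinite (Squares g)
    -- An involution of the odd number `2g - 1` of labels has a fixed point; commuting with the
    -- cycle then makes every label fixed.
    refine Equiv.Perm.exists_fixed_point_of_prime (p := 2) (n := 1) ?_ (by rw [pow_one, sq, h2])
    rw [← Nat.card_eq_fintype_card, card_squares]
    omega
  obtain ⟨x, hx⟩ := hfix
  ext1 y
  refine sigma_induction (p := fun y => ρ y = y) hx (fun y hy => ?_) y
  have := congrArg (fun f : Equiv.Perm (Squares g) => f y) h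
  simp only [Equiv.Perm.mul_apply, hy] at this
  exact this

/-- An orientation double cover of the form `(σ_g, τ)` has a rotation. -/
theorem exists_rotation {g : ℕ} {τ : Equiv.Perm (Squares g)} (hg : 2 ≤ g)
    (h : (origamiOf g τ).IsOrientationDoubleCover) {i : Squares g}
    (hi : sigma g (τ ((sigma g)⁻¹ (τ⁻¹ i))) ≠ i) :
    ∃ ρ : Equiv.Perm (Squares g), ρ * ρ = 1 ∧ sigma g * ρ * sigma g = ρ ∧ τ * ρ * τ = ρ := by
  have : Nonempty (Squares g) := ⟨i⟩
  obtain ⟨ρ, h2, ⟨hne, hs, -⟩ | ⟨hs, ht⟩⟩ := h.exists_perm hi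
  · exact absurd (eq_one_of_commute_sigma h2 hs (by omega)) hne
  · exact ⟨ρ, h2, hs, ht⟩

/-- If the pair `(3, 2)` is placed above `(b, b + 1)`, then `σ_g` and `τ` do not commute. -/
theorem commutator_ne {g : ℕ} {τ : Equiv.Perm (Squares g)} {b c : ℕ}
    (h1 : Sends τ 3 b) (h2 : Sends τ 2 c) (h : c + 1 ≠ b) (h' : c < 2 * g - 1 ∨ b ≠ 1) :
    ∃ i : Squares g, sigma g (τ ((sigma g)⁻¹ (τ⁻¹ i))) ≠ i := by
  obtain ⟨x, hx, rfl⟩ := h1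
  obtain ⟨y, hy, rfl⟩ := h2
  refine ⟨τ x, ?_⟩
  have e1 : τ⁻¹ (τ x) = x := τ.symm_apply_apply x
  have e2 : (sigma g)⁻¹ x = y := by
    rw [Equiv.Perm.inv_eq_iff_eq]
    have := sigma_val_cases y
    have := x.2
    apply Subtype.ext
    omega
  rw [e1, e2]
  intro he
  have := sigma_val_cases (τ y)
  rw [he] at this
  omega

/-- In an orientation double cover of the form `(σ_g, τ)`, the entries of the two-row notation are
exchanged in pairs by a reflection. -/
theorem exists_reflected {g : ℕ} {τ : Equiv.Perm (Squares g)} (hg : 2 ≤ g)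
    (h : (origamiOf g τ).IsOrientationDoubleCover) {i : Squares g}
    (hi : sigma g (τ ((sigma g)⁻¹ (τ⁻¹ i))) ≠ i) :
    ∃ c, 2 ≤ c ∧ c ≤ 2 * g ∧ ∀ a b, Sends τ a b → ∃ a' b', Sends τ a' b' ∧
      (a' + b = c ∨ a' + b = c + (2 * g - 1)) ∧ (a + b' = c ∨ a + b' = c + (2 * g - 1)) := by
  obtain ⟨ρ, h2, hs, ht⟩ := exists_rotation hg h hi
  obtain ⟨c, hc1, hc2, hc⟩ := exists_add_eq hs (by omega)
  refine ⟨c, hc1, hc2, ?_⟩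
  rintro _ _ ⟨x, rfl, rfl⟩
  refine ⟨(ρ (τ x)).1, (ρ x).1, ⟨_, rfl, ?_⟩, ?_, hc x⟩
  · rw [Origami.perm_mul_perm ht]
  · rw [add_comm]
    exact hc _

/-- If `1` is the only label moved by two by `τ`, the reflection is determined. -/
theorem exists_reflected_four {g : ℕ} {τ : Equiv.Perm (Squares g)} (hg : 2 ≤ g)
    (h : (origamiOf g τ).IsOrientationDoubleCover) {i : Squares g}
    (hi : sigma g (τ ((sigma g)⁻¹ (τ⁻¹ i))) ≠ i) (h13 : Sends τ 1 3)
    (hu : ∀ a b, Sends τ a b → b = a + 2 ∨ b + (2 * g - 1) = a + 2 → a = 1) :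
    ∀ a b, Sends τ a b → ∃ a' b', Sends τ a' b' ∧
      (a' + b = 4 ∨ a' + b = 4 + (2 * g - 1)) ∧ (a + b' = 4 ∨ a + b' = 4 + (2 * g - 1)) := by
  obtain ⟨c, hc1, hc2, hc⟩ := exists_reflected hg h hi
  obtain ⟨a', b', h1, h2, h3⟩ := hc 1 3 h13
  have hb := h1.bounds
  -- The reflected entry has the same displacement as `1 ↦ 3`, so it is this entry itself, and `c =
  -- 1 + 3`.
  have := hu a' b' h1 (by omega)
  have : c = 4 := by omega
  rwa [this] at hc

/-! ### Families 2 to 5 contain no orientation double covers. -/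

theorem IsOddGenusEvenSpin.not_isOrientationDoubleCover {g : ℕ} (hg : 5 ≤ g)
    {τ : Equiv.Perm (Squares g)} (hτ : IsOddGenusEvenSpin g τ) :
    ¬ (origamiOf g τ).IsOrientationDoubleCover := by
  intro h
  obtain ⟨h9, h6, h1, h8, h7, h5, h4, hp⟩ := hτ
  have hn := fun j hj => hp.next (j := j) (by norm_num) hj
  obtain ⟨i, hi⟩ : ∃ i : Squares g, sigma g (τ ((sigma g)⁻¹ (τ⁻¹ i))) ≠ i := by
    rcases hn 1 (.inl rfl) with ⟨l, hl, -, -, ha, hb⟩ | ⟨ha, hb⟩ <;>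
      exact commutator_ne ha hb (by omega) (by omega)
  have key := exists_reflected_four (by omega) h hi h1 ?_
  -- The entry `8 ↦ 4` would be reflected to `2g - 1 ↦ 2g - 5`. For `g = 5` the label `9` goes to
  -- `1`; for larger `g` the last odd label goes to an even one.
  · obtain ⟨a, b, hab, ha, hb⟩ := key 8 4 h8
    have hbd := hab.bounds
    obtain rfl : a = 2 * (g - 1) + 1 := by omega
    by_cases h5 : g = 5
    · subst h5
      have := hab.eq h9
      omega
    · rcases hn (g - 1) (.inr (by omega)) with ⟨l, hl, -, -, ha', -⟩ | ⟨ha', -⟩ <;>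
      · have := hab.eq ha'
        omega
  · intro a b hab hd
    have hbd := hab.bounds
    have small : a = 9 → b = 1 := fun h => (h ▸ hab).eq h9
    have small : a = 8 → b = 4 := fun h => (h ▸ hab).eq h8
    have small : a = 7 → b = 5 := fun h => (h ▸ hab).eq h7
    have small : a = 6 → b = 2 := fun h => (h ▸ hab).eq h6
    have small : a = 5 → b = 6 := fun h => (h ▸ hab).eq h5
    have small : a = 4 → b = 7 := fun h => (h ▸ hab).eq h4
    by_contra hne
    obtain ⟨j, hj, hja⟩ : ∃ j, (j = 1 ∨ 5 ≤ j ∧ j ≤ g - 1) ∧ (a = 2 * j ∨ a = 2 * j + 1) :=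
      ⟨a / 2, by omega, by omega⟩
    rcases hn j hj with ⟨l, hl, -, -, ha, hb⟩ | ⟨ha, hb⟩ <;> rcases hja with rfl | rfl
    · have := hab.eq hb; omega
    · have := hab.eq ha; omega
    · have := hab.eq hb; omega
    · have := hab.eq ha; omega

theorem IsEvenGenusOddSpin.not_isOrientationDoubleCover {g : ℕ} (hg : 4 ≤ g)
    {τ : Equiv.Perm (Squares g)} (hτ : IsEvenGenusOddSpin g τ) :
    ¬ (origamiOf g τ).IsOrientationDoubleCover := by
  intro h
  obtain ⟨h4, h6, h1, h5, h7, hp⟩ := hτ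
  have hn := fun j hj => hp.next (j := j) (by norm_num) hj
  obtain ⟨i, hi⟩ : ∃ i : Squares g, sigma g (τ ((sigma g)⁻¹ (τ⁻¹ i))) ≠ i := by
    rcases hn 1 (.inl rfl) with ⟨l, hl, -, -, ha, hb⟩ | ⟨ha, hb⟩ <;>
      exact commutator_ne ha hb (by omega) (by omega)
  have key := exists_reflected_four (by omega) h hi h1 ?_
  -- The entry `4 ↦ 1` would be reflected to `3 ↦ 2g - 1`, but `3` is placed above an even label.
  · obtain ⟨a, b, hab, ha, hb⟩ := key 4 1 h4
    have hbd := hab.bounds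
    obtain rfl : a = 3 := by omega
    rcases hn 1 (.inl rfl) with ⟨l, hl, -, -, ha', -⟩ | ⟨ha', -⟩ <;>
    · have := hab.eq ha'
      omega
  · intro a b hab hd
    have hbd := hab.bounds
    have small : a = 7 → b = 5 := fun h => (h ▸ hab).eq h7
    have small : a = 6 → b = 2 := fun h => (h ▸ hab).eq h6
    have small : a = 5 → b = 4 := fun h => (h ▸ hab).eq h5
    have small : a = 4 → b = 1 := fun h => (h ▸ hab).eq h4
    by_contra hne
    obtain ⟨j, hj, hja⟩ : ∃ j, (j = 1 ∨ 4 ≤ j ∧ j ≤ g - 1) ∧ (a = 2 * j ∨ a = 2 * j + 1) :=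
      ⟨a / 2, by omega, by omega⟩
    rcases hn j hj with ⟨l, hl, -, -, ha, hb⟩ | ⟨ha, hb⟩ <;> rcases hja with rfl | rfl
    · have := hab.eq hb; omega
    · have := hab.eq ha; omega
    · have := hab.eq hb; omega
    · have := hab.eq ha; omega

theorem IsEvenGenusEvenSpin.not_isOrientationDoubleCover {g : ℕ} (hg : 4 ≤ g)
    {τ : Equiv.Perm (Squares g)} (hτ : IsEvenGenusEvenSpin g τ) :
    ¬ (origamiOf g τ).IsOrientationDoubleCover := by
  intro h
  obtain ⟨h7, h5, h1, h6, h4, hp⟩ := hτ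
  have hn := fun j hj => hp.next (j := j) (by norm_num) hj
  obtain ⟨i, hi⟩ : ∃ i : Squares g, sigma g (τ ((sigma g)⁻¹ (τ⁻¹ i))) ≠ i := by
    rcases hn 1 (.inl rfl) with ⟨l, hl, -, -, ha, hb⟩ | ⟨ha, hb⟩ <;>
      exact commutator_ne ha hb (by omega) (by omega)
  have key := exists_reflected_four (by omega) h hi h1 ?_
  -- The entry `5 ↦ 2` would be reflected to `2 ↦ 2g - 2`, but `2` is placed above an odd label.
  · obtain ⟨a, b, hab, ha, hb⟩ := key 5 2 h5
    have hbd := hab.bounds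
    obtain rfl : a = 2 := by omega
    rcases hn 1 (.inl rfl) with ⟨l, hl, -, -, -, ha'⟩ | ⟨-, ha'⟩ <;>
    · have := hab.eq ha'
      omega
  · intro a b hab hd
    have hbd := hab.bounds
    have small : a = 7 → b = 1 := fun h => (h ▸ hab).eq h7
    have small : a = 6 → b = 4 := fun h => (h ▸ hab).eq h6
    have small : a = 5 → b = 2 := fun h => (h ▸ hab).eq h5
    have small : a = 4 → b = 5 := fun h => (h ▸ hab).eq h4
    by_contra hne
    obtain ⟨j, hj, hja⟩ : ∃ j, (j = 1 ∨ 4 ≤ j ∧ j ≤ g - 1) ∧ (a = 2 * j ∨ a = 2 * j + 1) :=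
      ⟨a / 2, by omega, by omega⟩
    rcases hn j hj with ⟨l, hl, -, -, ha, hb⟩ | ⟨ha, hb⟩ <;> rcases hja with rfl | rfl
    · have := hab.eq hb; omega
    · have := hab.eq ha; omega
    · have := hab.eq hb; omega
    · have := hab.eq ha; omega

/-- In an odd genus Aougab–Menasco–Nieland origami, the two-row notation changes the parity of the
labels, apart from four entries. -/
theorem IsAMNOdd.sends {g : ℕ} (hg : 3 ≤ g) {τ : Equiv.Perm (Squares g)} (hτ : IsAMNOdd g τ)
    {a b : ℕ} (h : Sends τ a b) :
    (a = 1 ∧ b = 3) ∨ (Odd a ∧ 3 ≤ a ∧ b = 1) ∨ (Even a ∧ b = 2) ∨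
      (Odd a ∧ Even b ∧ 3 ≤ a ∧ 4 ≤ b ∧ b + 1 ≠ a) ∨
      (Even a ∧ Odd b ∧ 5 ≤ b ∧ b ≠ a + 1) := by
  have hb := h.bounds
  by_cases h1 : a = 1
  · subst h1
    exact .inl ⟨rfl, h.eq hτ.1⟩
  obtain ⟨j, hj, hja⟩ : ∃ j, (j = 1 ∨ 2 ≤ j ∧ j ≤ g - 1) ∧ (a = 2 * j ∨ a = 2 * j + 1) :=
    ⟨a / 2, by omega, by omega⟩
  rcases hτ.2.next le_rfl hj with ⟨l, hl, -, hlj, hA, hB⟩ | ⟨hA, hB⟩ <;>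
    rcases hja with rfl | rfl
  · have := h.eq hB; grind
  · have := h.eq hA; grind
  · have := h.eq hB; grind
  · have := h.eq hA; grind

theorem IsAMNEven.not_isOrientationDoubleCover {g : ℕ} (hg : 4 ≤ g)
    {τ : Equiv.Perm (Squares g)} (hτ : IsAMNEven g τ) :
    ¬ (origamiOf g τ).IsOrientationDoubleCover := by
  intro h
  obtain ⟨η, hη, k, hodd, hk3, hkg, hk1, hτη, hkn, hn, hnk⟩ := hτ
  have hs : ∀ {a b}, Sends η a b → _ := fun h => hη.sends (by omega) h
  obtain ⟨K, hK⟩ := exists_sends η (a := k) (by omega) (by omega)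
  have hnk := hnk K hK
  have hKs := hs hK
  have hK1 : K ≠ 1 := fun h => hk1 (h ▸ hK)
  have hKb := hK.bounds
  have h13 : Sends τ 1 3 := hτη 1 3 hη.1 (by omega)
  obtain ⟨j, hj⟩ := hodd
  have hcase : ∀ {a b}, Sends τ a b → (a = k ∧ b = 2 * g - 1) ∨ (a = 2 * g - 1 ∧ b = 2 * g - 2) ∨
      (a = 2 * g - 2 ∧ b = K) ∨ (a ≠ k ∧ Sends η a b) := by
    intro a b hab
    have hb := hab.bounds
    by_cases h1 : a = k
    · subst h1; exact .inl ⟨rfl, hab.eq hkn⟩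
    by_cases h2 : a = 2 * g - 1
    · subst h2; exact .inr (.inl ⟨rfl, hab.eq hn⟩)
    by_cases h3 : a = 2 * g - 2
    · subst h3; exact .inr (.inr (.inl ⟨rfl, hab.eq hnk⟩))
    obtain ⟨b', hb'⟩ := exists_sends η (a := a) (by omega) (by omega)
    have := hab.eq (hτη _ _ hb' h1)
    subst this
    exact .inr (.inr (.inr ⟨h1, hb'⟩))
  obtain ⟨b3, hb3⟩ := exists_sends τ (a := 3) (by omega) (by omega)
  obtain ⟨b2, hb2⟩ := exists_sends τ (a := 2) (by omega) (by omega)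
  have hb2' : Sends η 2 b2 := by
    rcases hcase hb2 with h | h | h | h
    · omega
    · omega
    · omega
    · exact h.2
  have hb2s := hs hb2'
  have hb2b := hb2'.bounds
  obtain ⟨i, hi⟩ : ∃ i : Squares g, sigma g (τ ((sigma g)⁻¹ (τ⁻¹ i))) ≠ i := by
    refine commutator_ne hb3 hb2 ?_ (by omega)
    rcases hcase hb3 with h | h | h | h
    · grind
    · omega
    · omega
    · rcases hη.2.next le_rfl (.inl rfl) with ⟨l, -, -, -, h3, h2⟩ | ⟨h3, h2⟩
      · have := h.2.eq h3
        have := hb2'.eq h2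
        omega
      · have := h.2.eq h3
        omega
  obtain ⟨c, hc1, hc2, hc⟩ := exists_reflected (by omega) h hi
  obtain ⟨a', b', hab, ha, hb⟩ := hc 1 3 h13
  have hbd := hab.bounds
  obtain ⟨a'', b'', hab', ha', hb'⟩ := hc _ _ hn
  have hbd' := hab'.bounds
  -- Displacement `2` modulo `2g - 1` occurs at `1` and, when `k = 2g - 3`, at the new entry `k ↦ 2g
  -- - 1`. The new entry at `2g - 2` has it only if `K = 1`, which is excluded.
  have hor : a' = 1 ∨ a' = 2 * g - 3 := by
    rcases hcase hab with h | h | h | h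
    · omega
    · omega
    · omega
    · have := hs h.2
      have := h.2.bounds
      grind
  -- Reflecting `2g - 1 ↦ 2g - 2` forces `5 ↦ 4` when `c = 4` and `2 ↦ 1` when `c = 2g`; the list in
  -- `IsAMNOdd.sends` allows neither.
  rcases hor with rfl | rfl
  · obtain rfl : c = 4 := by omega
    obtain rfl : a'' = 5 := by omega
    obtain rfl : b'' = 4 := by omega
    rcases hcase hab' with h | h | h | h
    · omega
    · omega
    · omega
    · have := hs h.2
      grind
  · obtain rfl : c = 2 * g := by omega
    obtain rfl : a'' = 2 := by omega
    obtain rfl : b'' = 1 := by omega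
    have := hb2.eq hab'
    subst this
    grind
end

noncomputable section

/-! ### The odd genus Aougab–Menasco–Nieland origamis -/

/-- The permutation of the construction for the increasing order of the pairs. -/
def amnBase (g : ℕ) (hg : 3 ≤ g) : Equiv.Perm (Squares g) where
  toFun i := ⟨if i.1 = 1 then 3 else if i.1 = 2 * g - 1 then 1 else if i.1 = 2 * g - 2 then 2 else
    if i.1 % 2 = 0 then i.1 + 3 else i.1 + 1, by have := i.2; split_ifs <;> omega⟩
  invFun i := ⟨if i.1 = 3 then 1 else if i.1 = 1 then 2 * g - 1 else if i.1 = 2 then 2 * g - 2 else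
    if i.1 % 2 = 0 then i.1 - 1 else i.1 - 3, by have := i.2; split_ifs <;> omega⟩
  left_inv i := by
    have := i.2; ext; dsimp only; split_ifs <;> omega
  right_inv i := by
    have := i.2; ext; dsimp only; split_ifs <;> omega

/-- The rotation of the symmetric origamis: the reflection `x ↦ 4 - x` modulo `2g - 1`. -/
def reflection (g : ℕ) (hg : 3 ≤ g) : Equiv.Perm (Squares g) where
  toFun i := ⟨if i.1 < 4 then 4 - i.1 else 2 * g + 3 - i.1, by have := i.2; split_ifs <;> omega⟩
  invFun i := ⟨if i.1 < 4 then 4 - i.1 else 2 * g + 3 - i.1, by have := i.2; split_ifs <;> omega⟩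
  left_inv i := by
    have := i.2; ext; dsimp only; split_ifs <;> omega
  right_inv i := by
    have := i.2; ext; dsimp only; split_ifs <;> omega

/-- The permutation `e` on blocks of positions. -/
def pairFun (g : ℕ) (e : Equiv.Perm (Fin (g - 2))) (a : ℕ) : ℕ :=
  if h : 4 ≤ a ∧ a ≤ 2 * g - 1 then 2 * (e ⟨a / 2 - 2, by omega⟩).1 + 4 + a % 2 else a

theorem pairFun_of_lt {g : ℕ} {e : Equiv.Perm (Fin (g - 2))} {a : ℕ} (h : a < 4) :
    pairFun g e a = a := dif_neg (by omega)

theorem pairFun_even {g : ℕ} {e : Equiv.Perm (Fin (g - 2))} (i : Fin (g - 2)) :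
    pairFun g e (2 * i.1 + 4) = 2 * (e i).1 + 4 := by
  have := i.2
  rw [pairFun, dif_pos (by omega)]
  have h1 : (2 * i.1 + 4) / 2 - 2 = i.1 := by omega
  have h2 : (2 * i.1 + 4) % 2 = 0 := by omega
  simp only [h1, h2, add_zero]

theorem pairFun_odd {g : ℕ} {e : Equiv.Perm (Fin (g - 2))} (i : Fin (g - 2)) :
    pairFun g e (2 * i.1 + 5) = 2 * (e i).1 + 5 := by
  have := i.2
  rw [pairFun, dif_pos (by omega)]
  have h1 : (2 * i.1 + 5) / 2 - 2 = i.1 := by omega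
  have h2 : (2 * i.1 + 5) % 2 = 1 := by omega
  simp only [h1, h2]

theorem cases_label {g a : ℕ} (h1 : 1 ≤ a) (h2 : a ≤ 2 * g - 1) :
    a < 4 ∨ (∃ i : Fin (g - 2), a = 2 * i.1 + 4) ∨ ∃ i : Fin (g - 2), a = 2 * i.1 + 5 := by
  by_cases h : a < 4
  · exact .inl h
  rcases Nat.even_or_odd' a with ⟨k, rfl | rfl⟩
  · exact .inr (.inl ⟨⟨k - 2, by omega⟩, by dsimp only; omega⟩)
  · exact .inr (.inr ⟨⟨k - 2, by omega⟩, by dsimp only; omega⟩)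

theorem pairFun_bounds {g : ℕ} {e : Equiv.Perm (Fin (g - 2))} {a : ℕ} (h1 : 1 ≤ a)
    (h2 : a ≤ 2 * g - 1) : 1 ≤ pairFun g e a ∧ pairFun g e a ≤ 2 * g - 1 := by
  rcases cases_label h1 h2 with h | ⟨i, rfl⟩ | ⟨i, rfl⟩
  · rw [pairFun_of_lt h]; exact ⟨h1, h2⟩
  · rw [pairFun_even]; have := (e i).2; omega
  · rw [pairFun_odd]; have := (e i).2; omega

theorem pairFun_pairFun {g : ℕ} {e f : Equiv.Perm (Fin (g - 2))} {a : ℕ} (h1 : 1 ≤ a)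
    (h2 : a ≤ 2 * g - 1) : pairFun g e (pairFun g f a) = pairFun g (e * f) a := by
  rcases cases_label h1 h2 with h | ⟨i, rfl⟩ | ⟨i, rfl⟩
  · rw [pairFun_of_lt h, pairFun_of_lt h, pairFun_of_lt h]
  · rw [pairFun_even, pairFun_even, pairFun_even]; rfl
  · rw [pairFun_odd, pairFun_odd, pairFun_odd]; rfl

theorem pairFun_one {g a : ℕ} (h1 : 1 ≤ a) (h2 : a ≤ 2 * g - 1) : pairFun g 1 a = a := by
  rcases cases_label h1 h2 with h | ⟨i, rfl⟩ | ⟨i, rfl⟩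
  · rw [pairFun_of_lt h]
  · rw [pairFun_even]; rfl
  · rw [pairFun_odd]; rfl

/-- The permutation of the labels that permutes the pairs `(2j, 2j + 1)`, `2 ≤ j ≤ g - 1`. -/
def pairPerm (g : ℕ) (e : Equiv.Perm (Fin (g - 2))) : Equiv.Perm (Squares g) where
  toFun i := ⟨pairFun g e i.1, pairFun_bounds i.2.1 i.2.2⟩
  invFun i := ⟨pairFun g e⁻¹ i.1, pairFun_bounds i.2.1 i.2.2⟩
  left_inv i := by
    ext
    dsimp only
    rw [pairFun_pairFun i.2.1 i.2.2, inv_mul_cancel, pairFun_one i.2.1 i.2.2]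
  right_inv i := by
    ext
    dsimp only
    rw [pairFun_pairFun i.2.1 i.2.2, mul_inv_cancel, pairFun_one i.2.1 i.2.2]

theorem pairPerm_val {g : ℕ} {e : Equiv.Perm (Fin (g - 2))} (x : Squares g) :
    (pairPerm g e x).1 = pairFun g e x.1 := rfl

theorem amnBase_val {g : ℕ} {hg : 3 ≤ g} (x : Squares g) : (amnBase g hg x).1 =
    if x.1 = 1 then 3 else if x.1 = 2 * g - 1 then 1 else if x.1 = 2 * g - 2 then 2 else
      if x.1 % 2 = 0 then x.1 + 3 else x.1 + 1 := rfl

theorem reflection_val {g : ℕ} {hg : 3 ≤ g} (x : Squares g) :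
    (reflection g hg x).1 = if x.1 < 4 then 4 - x.1 else 2 * g + 3 - x.1 := rfl

/-- The permutation of the construction with the pairs in the order given by `e`. -/
def amnPerm (g : ℕ) (hg : 3 ≤ g) (e : Equiv.Perm (Fin (g - 2))) : Equiv.Perm (Squares g) :=
  pairPerm g e * amnBase g hg * (pairPerm g e)⁻¹

section

variable {g : ℕ} {hg : 3 ≤ g} {e : Equiv.Perm (Fin (g - 2))}

theorem amnPerm_pairPerm (x : Squares g) :
    amnPerm g hg e (pairPerm g e x) = pairPerm g e (amnBase g hg x) := by
  simp [amnPerm]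

theorem sends_amnPerm {a b : ℕ} (h : Sends (amnBase g hg) a b) :
    Sends (amnPerm g hg e) (pairFun g e a) (pairFun g e b) := by
  obtain ⟨x, rfl, rfl⟩ := h
  exact ⟨pairPerm g e x, rfl, by rw [amnPerm_pairPerm]; rfl⟩

theorem sends_amnBase {a : ℕ} (h1 : 1 ≤ a) (h2 : a ≤ 2 * g - 1) : Sends (amnBase g hg) a
    (if a = 1 then 3 else if a = 2 * g - 1 then 1 else if a = 2 * g - 2 then 2 else
      if a % 2 = 0 then a + 3 else a + 1) := ⟨⟨a, h1, h2⟩, rfl, rfl⟩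

/-- The order of the pairs, as a sequence. -/
def pairSeq (g : ℕ) (e : Equiv.Perm (Fin (g - 2))) (i : ℕ) : ℕ := pairFun g e (2 * i + 2) / 2

theorem pairSeq_zero : pairSeq g e 0 = 1 := by
  rw [pairSeq, pairFun_of_lt (by norm_num)]

theorem pairSeq_succ (i : Fin (g - 2)) : pairSeq g e (i.1 + 1) = (e i).1 + 2 := by
  rw [pairSeq, show 2 * (i.1 + 1) + 2 = 2 * i.1 + 4 by ring, pairFun_even]
  omega

theorem pairFun_eq_pairSeq {i : ℕ} (hi : i ≤ g - 2) :
    pairFun g e (2 * i + 2) = 2 * pairSeq g e i ∧ pairFun g e (2 * i + 3) = 2 * pairSeq g e i + 1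
      := by
  rcases i with _ | i
  · rw [pairSeq_zero, pairFun_of_lt (by norm_num), pairFun_of_lt (by norm_num)]
    exact ⟨rfl, rfl⟩
  · have h : i + 1 = (⟨i, hi⟩ : Fin (g - 2)).1 + 1 := rfl
    generalize (⟨i, hi⟩ : Fin (g - 2)) = j at h
    rw [h, pairSeq_succ, show 2 * (j.1 + 1) + 2 = 2 * j.1 + 4 by ring,
      show 2 * (j.1 + 1) + 3 = 2 * j.1 + 5 by ring, pairFun_even, pairFun_odd]
    omega

/-- Conjugation by `pairPerm` fixes `1`, `2`, `3` and renames the pairs, so it turns the increasing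
order into the order `pairSeq`. -/
theorem isAMNOdd_amnPerm : IsAMNOdd g (amnPerm g hg e) := by
  refine ⟨?_, pairSeq g e, pairSeq_zero, ⟨?_, ?_, ?_⟩, ?_, ?_⟩
  · have := sends_amnPerm (e := e) (sends_amnBase (hg := hg) le_rfl (by omega))
    rwa [if_pos rfl, pairFun_of_lt (by norm_num), pairFun_of_lt (by norm_num)] at this
  · rintro i ⟨h1, h2⟩
    obtain ⟨i, rfl⟩ : ∃ k, i = k + 1 := ⟨i - 1, by omega⟩
    have := pairSeq_succ (e := e) ⟨i, h2⟩
    dsimp only at this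
    have := (e ⟨i, h2⟩).2
    rw [Set.mem_Icc]
    omega
  · rintro i ⟨h1, h2⟩ j ⟨h3, h4⟩ h
    obtain ⟨i, rfl⟩ : ∃ k, i = k + 1 := ⟨i - 1, by omega⟩
    obtain ⟨j, rfl⟩ : ∃ k, j = k + 1 := ⟨j - 1, by omega⟩
    have h5 := pairSeq_succ (e := e) ⟨i, h2⟩
    have h6 := pairSeq_succ (e := e) ⟨j, h4⟩
    dsimp only at h5 h6
    have := e.injective (Fin.ext (by omega) : e ⟨i, h2⟩ = e ⟨j, h4⟩)
    simpa using this
  · rintro j ⟨h1, h2⟩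
    refine ⟨(e⁻¹ ⟨j - 2, by omega⟩).1 + 1, ⟨by omega, (e⁻¹ ⟨j - 2, by omega⟩).2⟩, ?_⟩
    rw [pairSeq_succ, Equiv.Perm.inv_def, Equiv.apply_symm_apply]
    dsimp only
    omega
  · intro i hi
    have hp := pairFun_eq_pairSeq (e := e) hi.le
    have hp' := pairFun_eq_pairSeq (e := e) (i := i + 1) hi
    have h1 := sends_amnPerm (e := e) (sends_amnBase (hg := hg) (a := 2 * i + 3) (by omega)
      (by omega))
    have h2 := sends_amnPerm (e := e) (sends_amnBase (hg := hg) (a := 2 * i + 2) (by omega)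
      (by omega))
    rw [if_neg (by omega), if_neg (by omega), if_neg (by omega), if_neg (by omega), hp.2,
      show 2 * i + 3 + 1 = 2 * (i + 1) + 2 by ring, hp'.1] at h1
    rw [if_neg (by omega), if_neg (by omega), if_neg (by omega), if_pos (by omega), hp.1,
      show 2 * i + 2 + 3 = 2 * (i + 1) + 3 by ring, hp'.2] at h2
    exact ⟨h1, h2⟩
  · have hp := pairFun_eq_pairSeq (e := e) (le_refl (g - 2))
    have h1 := sends_amnPerm (e := e) (sends_amnBase (hg := hg) (a := 2 * (g - 2) + 3) (by omega)
      (by omega))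
    have h2 := sends_amnPerm (e := e) (sends_amnBase (hg := hg) (a := 2 * (g - 2) + 2) (by omega)
      (by omega))
    rw [if_neg (by omega), if_pos (by omega), hp.2, pairFun_of_lt (by norm_num)] at h1
    rw [if_neg (by omega), if_neg (by omega), if_pos (by omega), hp.1,
      pairFun_of_lt (by norm_num)] at h2
    exact ⟨h1, h2⟩

/-- The sequence of pairs that defines `τ` is itself the permutation `e`, after a shift of indices
by `1` and of pair numbers by `2`. -/
theorem exists_amnPerm_eq {τ : Equiv.Perm (Squares g)} (h : IsAMNOdd g τ) :
    ∃ e, amnPerm g hg e = τ := by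
  obtain ⟨h13, k, h0, hk, hp, hl⟩ := h
  have hk' : ∀ i : Fin (g - 2), 2 ≤ k (i.1 + 1) ∧ k (i.1 + 1) ≤ g - 1 := fun i =>
    hk.mapsTo ⟨by omega, i.2⟩
  let f : Fin (g - 2) → Fin (g - 2) := fun i => ⟨k (i.1 + 1) - 2, by have := hk' i; omega⟩
  have hf : Function.Injective f := by
    intro i j hij
    have hij : k (i.1 + 1) - 2 = k (j.1 + 1) - 2 := by simpa [f] using hij
    have hi := hk' i
    have hj := hk' j
    have := hk.injOn (⟨by omega, i.2⟩ : i.1 + 1 ∈ Set.Icc 1 (g - 2))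
      (⟨by omega, j.2⟩ : j.1 + 1 ∈ Set.Icc 1 (g - 2)) (by omega)
    exact Fin.ext (by omega)
  let e : Equiv.Perm (Fin (g - 2)) := Equiv.ofBijective f (Finite.injective_iff_bijective.1 hf)
  have hs : ∀ i ≤ g - 2, pairSeq g e i = k i := by
    intro i hi
    rcases i with _ | i
    · rw [h0, pairSeq_zero]
    · have := pairSeq_succ (e := e) ⟨i, hi⟩
      dsimp only at this
      rw [this]
      change k (i + 1) - 2 + 2 = _
      have := (hk' ⟨i, hi⟩).1
      dsimp only at this
      omega
  refine ⟨e, ?_⟩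
  have hall : ∀ a b, Sends (amnBase g hg) a b → Sends τ (pairFun g e a) (pairFun g e b) := by
    intro a b hab
    have hb := hab.bounds
    have hab := hab.eq (sends_amnBase hb.1 hb.2.1)
    subst hab
    by_cases h1 : a = 1
    · subst h1
      rwa [if_pos rfl, pairFun_of_lt (by norm_num), pairFun_of_lt (by norm_num)]
    rcases Nat.even_or_odd' a with ⟨j, rfl | rfl⟩
    · obtain ⟨i, rfl⟩ : ∃ i, j = i + 1 := ⟨j - 1, by omega⟩
      have hi : i ≤ g - 2 := by omega
      rw [show 2 * (i + 1) = 2 * i + 2 by ring, (pairFun_eq_pairSeq hi).1, hs i hi, if_neg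
        (by omega),
        if_neg (by omega)]
      rcases hi.lt_or_eq with hi' | rfl
      · rw [if_neg (by omega), if_pos (by omega), show 2 * i + 2 + 3 = 2 * (i + 1) + 3 by ring,
          (pairFun_eq_pairSeq hi').2, hs (i + 1) hi']
        exact (hp i hi').2
      · rw [if_pos (by omega), pairFun_of_lt (by norm_num)]
        exact hl.2
    · obtain ⟨i, rfl⟩ : ∃ i, j = i + 1 := ⟨j - 1, by omega⟩
      have hi : i ≤ g - 2 := by omega
      rw [show 2 * (i + 1) + 1 = 2 * i + 3 by ring, (pairFun_eq_pairSeq hi).2, hs i hi,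
        if_neg (by omega)]
      rcases hi.lt_or_eq with hi' | rfl
      · rw [if_neg (by omega), if_neg (by omega), if_neg (by omega),
          show 2 * i + 3 + 1 = 2 * (i + 1) + 2 by ring,
          (pairFun_eq_pairSeq hi').1, hs (i + 1) hi']
        exact (hp i hi').1
      · rw [if_pos (by omega), pairFun_of_lt (by norm_num)]
        exact hl.1
  ext x
  obtain ⟨y, rfl⟩ := (pairPerm g e).surjective x
  have h1 := hall y.1 _ ⟨y, rfl, rfl⟩
  rw [amnPerm_pairPerm]
  obtain ⟨z, hz, hz'⟩ := h1
  rw [← hz'.symm.trans (congrArg (fun w => (τ w).1) (Subtype.ext hz : z = pairPerm g e y))]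
  rfl

/-- The permutation determines the pair that follows a given pair, so the order is recovered step by
step from the initial pair `(2, 3)`. -/
theorem amnPerm_injective : Function.Injective (amnPerm g hg) := by
  intro e e' h
  have hs : ∀ i ≤ g - 2, pairSeq g e i = pairSeq g e' i := by
    intro i
    induction i with
    | zero => intro; rw [pairSeq_zero, pairSeq_zero]
    | succ i ih =>
      intro hi
      have hb := sends_amnBase (hg := hg) (a := 2 * i + 3) (by omega) (by omega)
      rw [if_neg (by omega), if_neg (by omega), if_neg (by omega), if_neg (by omega),
        show 2 * i + 3 + 1 = 2 * (i + 1) + 2 by ring] at hb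
      have h1 := sends_amnPerm (e := e) hb
      have h2 := sends_amnPerm (e := e') hb
      rw [(pairFun_eq_pairSeq (by omega)).2, (pairFun_eq_pairSeq hi).1] at h1 h2
      rw [ih (by omega), h] at h1
      have := h1.eq h2
      omega
  ext i
  have := hs _ i.2
  rw [pairSeq_succ, pairSeq_succ] at this
  omega

end
end

/-! ### Distinctness of the odd genus origamis and their symmetric members. -/

noncomputable section

section

variable {g : ℕ} {hg : 3 ≤ g} {e : Equiv.Perm (Fin (g - 2))}

/-- The label `1` is the only one that is moved by two. -/
theorem IsAMNOdd.eq_one {τ : Equiv.Perm (Squares g)} (hg : 3 ≤ g) (hτ : IsAMNOdd g τ) {a b : ℕ}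
    (h : Sends τ a b) (hab : b = a + 2 ∨ b + (2 * g - 1) = a + 2) : a = 1 := by
  have := hτ.sends hg h
  have := h.bounds
  grind

theorem IsAMNOdd.commutator_ne {τ : Equiv.Perm (Squares g)} (hg : 3 ≤ g) (hτ : IsAMNOdd g τ) :
    ∃ i : Squares g, sigma g (τ ((sigma g)⁻¹ (τ⁻¹ i))) ≠ i := by
  rcases hτ.2.next le_rfl (.inl rfl) with ⟨l, h1, h2, -, ha, hb⟩ | ⟨ha, hb⟩ <;>
    exact _root_.commutator_ne ha hb (by omega) (by omega)

/-- Different permutations of the construction give different origamis. -/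
theorem IsAMNOdd.eq_of_equivalent {τ τ' : Equiv.Perm (Squares g)} (hg : 3 ≤ g)
    (hτ : IsAMNOdd g τ) (hτ' : IsAMNOdd g τ')
    (h : (origamiOf g τ).Equivalent (origamiOf g τ')) : τ = τ' := by
  obtain ⟨ρ, h1, h2⟩ := h
  change ρ * sigma g * ρ⁻¹ = sigma g at h1
  change ρ * τ * ρ⁻¹ = τ' at h2
  rw [mul_inv_eq_iff_eq_mul] at h1 h2
  have h1 : ∀ x, ρ (sigma g x) = sigma g (ρ x) := fun x =>
    congrArg (fun f : Equiv.Perm (Squares g) => f x) h1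
  have h2' : ∀ x, ρ (τ x) = τ' (ρ x) := fun x =>
    congrArg (fun f : Equiv.Perm (Squares g) => f x) h2
  obtain ⟨x, hx, hx3⟩ := hτ.1
  have hx2 : τ x = sigma g (sigma g x) := by
    have := sigma_val_cases x
    have := sigma_val_cases (sigma g x)
    apply Subtype.ext
    omega
  have h3 : τ' (ρ x) = sigma g (sigma g (ρ x)) := by rw [← h2', hx2, h1, h1]
  have h4 : (ρ x).1 = 1 := by
    -- A relabelling that commutes with `σ_g` preserves displacements, so it fixes `1`, the only
    -- label with displacement `2`. Commuting with the cycle, it fixes everything.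
    refine hτ'.eq_one hg ⟨_, rfl, rfl⟩ ?_
    rw [h3]
    have := sigma_val_cases (ρ x)
    have := sigma_val_cases (sigma g (ρ x))
    omega
  have h5 : ∀ y, ρ y = y := sigma_induction (a := x) (Subtype.ext (h4.trans hx.symm)) fun y hy => by
    rw [h1, hy]
  have h6 : ρ = 1 := Equiv.ext h5
  rwa [h6, one_mul, mul_one] at h2

theorem reflection_mul_self : reflection g hg * reflection g hg = 1 := by
  ext x
  have := x.2
  simp only [Equiv.Perm.mul_apply, reflection_val, Equiv.Perm.one_apply]
  split_ifs <;> omega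

theorem sigma_mul_reflection_mul : sigma g * reflection g hg * sigma g = reflection g hg := by
  ext x
  have := x.2
  have h1 := sigma_val_cases x
  have h2 := sigma_val_cases (reflection g hg (sigma g x))
  simp only [Equiv.Perm.mul_apply]
  rw [reflection_val] at h2 ⊢
  split_ifs at h2 ⊢ <;> omega

theorem amnBase_val_cases (x : Squares g) :
    (x.1 = 1 ∧ (amnBase g hg x).1 = 3) ∨ (x.1 = 2 * g - 1 ∧ (amnBase g hg x).1 = 1) ∨
      (x.1 = 2 * g - 2 ∧ (amnBase g hg x).1 = 2) ∨
      (x.1 % 2 = 0 ∧ x.1 < 2 * g - 2 ∧ (amnBase g hg x).1 = x.1 + 3) ∨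
      (x.1 % 2 = 1 ∧ 1 < x.1 ∧ x.1 < 2 * g - 1 ∧ (amnBase g hg x).1 = x.1 + 1) := by
  have := x.2
  rw [amnBase_val]
  split_ifs <;> omega

theorem reflection_val_cases (x : Squares g) :
    (x.1 < 4 ∧ (reflection g hg x).1 = 4 - x.1) ∨
      (4 ≤ x.1 ∧ (reflection g hg x).1 = 2 * g + 3 - x.1) := by
  rw [reflection_val]
  split_ifs <;> omega

theorem amnBase_mul_reflection_mul :
    amnBase g hg * reflection g hg * amnBase g hg = reflection g hg := by
  ext x
  have := x.2
  have h1 := amnBase_val_cases (hg := hg) x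
  have h2 := reflection_val_cases (hg := hg) (amnBase g hg x)
  have h3 := amnBase_val_cases (hg := hg) (reflection g hg (amnBase g hg x))
  have h4 := reflection_val_cases (hg := hg) x
  simp only [Equiv.Perm.mul_apply]
  rcases h1 with h1 | h1 | h1 | h1 | h1 <;> omega

/-- The permutation of the construction acts transitively in odd genus. -/
theorem amnBase_induction (hodd : Odd g) {p : Squares g → Prop} {a : Squares g} (ha : a.1 = 1)
    (hpa : p a) (h : ∀ x, p x → p (amnBase g hg x)) (x : Squares g) : p x := by
  have step : ∀ {a b : ℕ}, (∃ y : Squares g, y.1 = a ∧ p y) → Sends (amnBase g hg) a b →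
      ∃ y : Squares g, y.1 = b ∧ p y := by
    rintro _ _ ⟨y, rfl, hy⟩ ⟨z, hz, rfl⟩
    rw [Subtype.ext hz]
    exact ⟨_, rfl, h _ hy⟩
  obtain ⟨k, rfl⟩ := hodd
  have h1 : ∃ y : Squares (2 * k + 1), y.1 = 1 ∧ p y := ⟨a, ha, hpa⟩
  -- The orbit of `1` is `1, 3, 4, 7, 8, …, 2g - 2, 2, 5, 6, 9, …, 2g - 1`. Its first part reaches
  -- `2g - 2` because this label is divisible by `4` for odd `g`.
  have low : ∀ m, m + 1 ≤ k → (∃ y : Squares (2 * k + 1), y.1 = 4 * m + 3 ∧ p y) ∧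
      ∃ y : Squares (2 * k + 1), y.1 = 4 * m + 4 ∧ p y := by
    intro m
    induction m with
    | zero =>
      intro hm
      have h3 := step h1 (sends_amnBase (by omega) (by omega))
      rw [if_pos rfl] at h3
      have h4 := step h3 (sends_amnBase (by omega) (by omega))
      rw [if_neg (by omega), if_neg (by omega), if_neg (by omega), if_neg (by omega)] at h4
      exact ⟨h3, h4⟩
    | succ m ih =>
      intro hm
      have h3 := step (ih (by omega)).2 (sends_amnBase (by omega) (by omega))
      rw [if_neg (by omega), if_neg (by omega), if_neg (by omega), if_pos (by omega)] at h3
      have h4 := step h3 (sends_amnBase (by omega) (by omega))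
      rw [if_neg (by omega), if_neg (by omega), if_neg (by omega), if_neg (by omega)] at h4
      exact ⟨h3, h4⟩
  have h2 : ∃ y : Squares (2 * k + 1), y.1 = 2 ∧ p y := by
    have h2 := step (low (k - 1) (by omega)).2 (sends_amnBase (by omega) (by omega))
    rwa [if_neg (by omega), if_neg (by omega), if_pos (by omega)] at h2
  have high : ∀ m, m + 1 ≤ k → (∃ y : Squares (2 * k + 1), y.1 = 4 * m + 2 ∧ p y) ∧
      ∃ y : Squares (2 * k + 1), y.1 = 4 * m + 5 ∧ p y := by
    intro m
    induction m with
    | zero =>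
      intro hm
      have h3 := step h2 (sends_amnBase (by omega) (by omega))
      rw [if_neg (by omega), if_neg (by omega), if_neg (by omega), if_pos (by omega)] at h3
      exact ⟨h2, h3⟩
    | succ m ih =>
      intro hm
      have h3 := step (ih (by omega)).2 (sends_amnBase (by omega) (by omega))
      rw [if_neg (by omega), if_neg (by omega), if_neg (by omega), if_neg (by omega)] at h3
      have h4 := step h3 (sends_amnBase (by omega) (by omega))
      rw [if_neg (by omega), if_neg (by omega), if_neg (by omega), if_pos (by omega)] at h4
      exact ⟨h3, h4⟩
  have hx := x.2
  have : ∃ y : Squares (2 * k + 1), y.1 = x.1 ∧ p y := by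
    obtain ⟨m, h | h | h | h⟩ : ∃ m, x.1 = 4 * m + 3 ∨ x.1 = 4 * m + 4 ∨ x.1 = 4 * m + 2 ∨
        x.1 = 4 * m + 1 := ⟨(x.1 - 1) / 4, by omega⟩ <;> rw [h]
    · exact (low m (by omega)).1
    · exact (low m (by omega)).2
    · exact (high m (by omega)).1
    · rcases m with _ | m
      · exact h1
      · exact (high m (by omega)).2
  obtain ⟨y, hy, hpy⟩ := this
  rwa [← Subtype.ext hy]

/-- The reflection reverses the order of the pairs and exchanges the members of each: `2i + 4` goes
to `2 * rev i + 5`. The labels `1`, `2`, `3`, which `pairPerm` fixes, are permuted among themselves.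
-/
theorem commute_reflection_iff : Commute (pairPerm g e) (reflection g hg) ↔ Commute e Fin.revPerm
    := by
  constructor
  · intro h
    ext i
    have hi := i.2
    have := congrArg (fun f : Equiv.Perm (Squares g) => (f ⟨2 * i.1 + 4, by omega, by omega⟩).1)
      h.eq
    simp only [Equiv.Perm.mul_apply, pairPerm_val, reflection_val, pairFun_even] at this
    rw [if_neg (by omega), if_neg (by omega),
      show 2 * g + 3 - (2 * i.1 + 4) = 2 * (Fin.rev i).1 + 5 by rw [Fin.val_rev]; omega,
      pairFun_odd] at this
    simp only [Equiv.Perm.mul_apply, Fin.revPerm_apply]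
    rw [Fin.val_rev (e i)]
    have := (e i).2
    omega
  · intro h
    have h : ∀ i, e (Fin.rev i) = Fin.rev (e i) := fun i =>
      congrArg (fun f : Equiv.Perm (Fin (g - 2)) => f i) h.eq
    ext x
    rw [Equiv.Perm.mul_apply, Equiv.Perm.mul_apply, pairPerm_val, reflection_val, reflection_val,
      pairPerm_val]
    rcases cases_label x.2.1 x.2.2 with hx | ⟨i, hx⟩ | ⟨i, hx⟩
    · have := x.2
      rw [if_pos hx, pairFun_of_lt hx, if_pos hx, pairFun_of_lt (by omega)]
    · have h1 := i.2
      have h2 := (e i).2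
      rw [hx, pairFun_even, if_neg (by omega), if_neg (by omega),
        show 2 * g + 3 - (2 * i.1 + 4) = 2 * (Fin.rev i).1 + 5 by rw [Fin.val_rev]; omega,
        pairFun_odd, h, Fin.val_rev]
      omega
    · have h1 := i.2
      have h2 := (e i).2
      rw [hx, pairFun_odd, if_neg (by omega), if_neg (by omega),
        show 2 * g + 3 - (2 * i.1 + 5) = 2 * (Fin.rev i).1 + 4 by rw [Fin.val_rev]; omega,
        pairFun_even, h, Fin.val_rev]
      omega

/-- The symmetric orders of the pairs are those that commute with the reversal. -/
theorem amnPerm_mul_reflection_mul_iff (hodd : Odd g) :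
    amnPerm g hg e * reflection g hg * amnPerm g hg e = reflection g hg ↔
      Commute e Fin.revPerm := by
  rw [← commute_reflection_iff (hg := hg)]
  set B := pairPerm g e
  set T := amnBase g hg
  set R := reflection g hg
  have hT : T * R * T = R := amnBase_mul_reflection_mul
  have hR : R * R = 1 := reflection_mul_self
  have hA : amnPerm g hg e = B * T * B⁻¹ := rfl
  constructor
  · intro h
    let R' := B⁻¹ * R * B
    have hR' : T * R' * T = R' := by
      simp only [R']
      rw [hA] at h
      conv_rhs => rw [← h]
      group
    -- Both `R` and its conjugate `R'` invert `T`, so their product commutes with `T`. It fixes `1`,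
    -- and `T` is transitive, so it is trivial.
    have hC : R * R' * T = T * (R * R') := by
      have h1 : R * T = T⁻¹ * R := by rw [eq_inv_mul_iff_mul_eq, ← mul_assoc, hT]
      have h2 : R' * T = T⁻¹ * R' := by rw [eq_inv_mul_iff_mul_eq, ← mul_assoc, hR']
      have h3 : R * T⁻¹ = T * R := by rw [mul_inv_eq_iff_eq_mul, hT]
      rw [mul_assoc, h2, ← mul_assoc, h3, mul_assoc]
    have h1 : ∀ x, (R * R') x = x := by
      refine amnBase_induction (hg := hg) hodd (a := ⟨1, le_rfl, by omega⟩) rfl ?_ fun x hx => ?_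
      · have e1 : B ⟨1, le_rfl, by omega⟩ = ⟨1, le_rfl, by omega⟩ :=
          Subtype.ext ((pairPerm_val _).trans (pairFun_of_lt (by norm_num)))
        have e2 : B⁻¹ ⟨3, by omega, by omega⟩ = ⟨3, by omega, by omega⟩ := by
          rw [Equiv.Perm.inv_eq_iff_eq]
          exact Subtype.ext ((pairPerm_val _).trans (pairFun_of_lt (by norm_num))).symm
        have e3 : R ⟨1, le_rfl, by omega⟩ = ⟨3, by omega, by omega⟩ := rfl
        have e4 : R ⟨3, by omega, by omega⟩ = ⟨1, le_rfl, by omega⟩ := rfl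
        simp only [R', Equiv.Perm.mul_apply, e1, e3, e2, e4]
      · have := congrArg (fun f : Equiv.Perm (Squares g) => f x) hC
        simp only [Equiv.Perm.mul_apply] at this hx ⊢
        rw [this, hx]
    have h2 : R * R' = 1 := Equiv.ext h1
    have h3 : R' = R := by rw [← mul_one R, ← h2, ← mul_assoc, hR, one_mul]
    simp only [R'] at h3
    rw [mul_assoc, inv_mul_eq_iff_eq_mul] at h3
    exact h3.symm
  · intro h
    rw [hA]
    have h1 : B⁻¹ * R * B = R := by rw [mul_assoc, ← h.eq, inv_mul_cancel_left]
    calc B * T * B⁻¹ * R * (B * T * B⁻¹) = B * (T * (B⁻¹ * R * B) * T) * B⁻¹ := by group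
      _ = R := by rw [h1, hT, h.eq, mul_inv_cancel_right]

/-- The rotation of a symmetric origami is the reflection `x ↦ 4 - x`. -/
theorem IsAMNOdd.mul_reflection_mul {τ : Equiv.Perm (Squares g)} (hτ : IsAMNOdd g τ)
    (h : (origamiOf g τ).IsOrientationDoubleCover) :
    τ * reflection g hg * τ = reflection g hg := by
  obtain ⟨i, hi⟩ := hτ.commutator_ne hg
  obtain ⟨ρ, h2, hs, ht⟩ := exists_rotation (by omega) h hi
  obtain ⟨c, hc1, hc2, hc⟩ := exists_add_eq hs (by omega)
  obtain ⟨x, hx, hx3⟩ := hτ.1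
  have h1 := hc x
  have h3 := hc (τ x)
  -- The rotation takes the entry `1 ↦ 3` to one of the same displacement, hence to itself; this
  -- fixes `c = 4`.
  have h4 : (ρ (τ x)).1 = 1 := by
    refine hτ.eq_one hg ⟨_, rfl, rfl⟩ ?_
    rw [Origami.perm_mul_perm ht]
    have := (ρ x).2
    have := (ρ (τ x)).2
    omega
  obtain rfl : c = 4 := by omega
  have : ρ = reflection g hg := by
    ext y
    have := hc y
    have := y.2
    have := (ρ y).2
    rw [reflection_val]
    split_ifs <;> omega
  rwa [← this]

end
end

/-! ### The single vertex and the symmetric double covers. -/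

noncomputable section

section

variable {g : ℕ}

theorem IsAMNOdd.exists_eq_of_sends {τ : Equiv.Perm (Squares g)} (hg : 3 ≤ g) (hτ : IsAMNOdd g τ)
    {a b : ℕ} (h : Sends τ a b) (hb : b = 1 ∨ Even b ∧ 4 ≤ b) : ∃ j, 1 ≤ j ∧ a = 2 * j + 1 := by
  have : Odd a ∧ 3 ≤ a := by
    have := hτ.sends hg h
    grind
  obtain ⟨⟨j, rfl⟩, h3⟩ := this
  exact ⟨j, by omega, rfl⟩

/-- It suffices to connect the lower left corners. Four turns join those of `τ (σ u)` and `σ (τ u)`.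
For `u = 2j`, with `2j + 1, 2j` placed above `l, l + 1`, this joins `l` to `l + 2`. For `u = 2j + 1`
with `j < g - 1` it joins the image of `2j` to the image of `2j + 2`. The first relation connects
`3`, `1` and the even labels from `4` on; the second connects the images of even labels, which are
`2` and the odd labels from `5` on. -/
theorem IsAMNOdd.hasOneVertex {τ : Equiv.Perm (Squares g)} (hg : 3 ≤ g) (hτ : IsAMNOdd g τ) :
    (origamiOf g τ).HasOneVertex := by
  set R := (origamiOf g τ).cornerPerm with hR
  have hstep : ∀ c, R.SameCycle (R c) c := fun c =>
    Equiv.Perm.sameCycle_apply_left.2 (Equiv.Perm.SameCycle.refl R c)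
  have h3 : ∀ i, R (i, 3) = (τ i, 0) := fun i => rfl
  have h2 : ∀ i, R (i, 2) = (sigma g i, 3) := fun i => rfl
  have h1 : ∀ i, R (τ i, 1) = (i, 2) := fun i => by
    rw [hR, Origami.cornerPerm_apply]
    exact Prod.ext (τ.symm_apply_apply i) rfl
  have h0 : ∀ i, R (sigma g i, 0) = (i, 1) := fun i => by
    rw [hR, Origami.cornerPerm_apply]
    exact Prod.ext ((sigma g).symm_apply_apply i) rfl
  have key : ∀ u, R.SameCycle (τ (sigma g u), 0) (sigma g (τ u), 0) := by
    intro u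
    have s0 := hstep (sigma g (τ u), 0)
    have s1 := hstep (τ u, 1)
    have s2 := hstep (u, 2)
    have s3 := hstep (sigma g u, 3)
    rw [h0] at s0
    rw [h1] at s1
    rw [h2] at s2
    rw [h3] at s3
    exact s3.trans (s2.trans (s1.trans s0))
  let t : Squares g := ⟨3, by omega, by omega⟩
  let P : ℕ → Prop := fun b => ∃ x : Squares g, x.1 = b ∧ R.SameCycle (x, 0) (t, 0)
  have hP : ∀ {a b b'}, Sends τ a b → Sends τ (a + 1) b' → b < 2 * g - 1 → (P (b + 1) ↔ P b') := by
    rintro _ _ b' ⟨x, rfl, rfl⟩ ⟨y, hy, rfl⟩ hb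
    have h4 : sigma g x = y := by
      have := sigma_val_cases x
      have := y.2
      apply Subtype.ext
      omega
    have h5 := key x
    rw [h4] at h5
    have h6 : (sigma g (τ x)).1 = (τ x).1 + 1 := by
      have := sigma_val_cases (τ x)
      omega
    constructor
    · rintro ⟨z, hz, hz'⟩
      rw [← h6] at hz
      rw [Subtype.ext hz] at hz'
      exact ⟨_, rfl, h5.trans hz'⟩
    · rintro ⟨z, hz, hz'⟩
      rw [Subtype.ext hz] at hz'
      exact ⟨_, h6, h5.symm.trans hz'⟩
  have hP1 : ∀ {a b'}, Sends τ a (2 * g - 1) → Sends τ (a + 1) b' → P 1 → P b' := by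
    rintro _ b' ⟨x, rfl, hx⟩ ⟨y, hy, rfl⟩ ⟨z, hz, hz'⟩
    have h4 : sigma g x = y := by
      have := sigma_val_cases x
      have := y.2
      apply Subtype.ext
      omega
    have h5 := key x
    rw [h4] at h5
    have h6 : sigma g (τ x) = z := by
      have := sigma_val_cases (τ x)
      apply Subtype.ext
      omega
    rw [h6] at h5
    exact ⟨_, rfl, h5.trans hz'⟩
  -- The successor of `2g - 1` is `1`, whose image is the base label `3`; this starts the chain of
  -- images of even labels.
  have hPlast : ∀ {b}, Sends τ (2 * g - 1) b → b < 2 * g - 1 → P (b + 1) := by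
    rintro b ⟨x, hx, rfl⟩ hb
    obtain ⟨y, hy, hy3⟩ := hτ.1
    have h4 : sigma g x = y := by
      have := sigma_val_cases x
      apply Subtype.ext
      omega
    have h5 := key x
    rw [h4, show τ y = t from Subtype.ext hy3] at h5
    refine ⟨_, ?_, h5.symm⟩
    have := sigma_val_cases (τ x)
    omega
  have hsurj : ∀ {b}, 1 ≤ b → b ≤ 2 * g - 1 → ∃ a, Sends τ a b := fun {b} hb1 hb2 =>
    ⟨_, τ⁻¹ ⟨b, hb1, hb2⟩, rfl, by rw [Equiv.Perm.inv_def, Equiv.apply_symm_apply]⟩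
  have hnext : ∀ {j}, 1 ≤ j → j ≤ g - 1 → ∃ l, Sends τ (2 * j + 1) l ∧ Sends τ (2 * j) (l + 1) := by
    intro j hj1 hj2
    rcases hτ.2.next le_rfl (j := j) (by omega) with ⟨l, -, -, -, ha, hb⟩ | ⟨ha, hb⟩
    · exact ⟨_, ha, hb⟩
    · exact ⟨_, ha, hb⟩
  have hpred : ∀ {l}, (l = 1 ∨ (Even l ∧ 4 ≤ l ∧ l ≤ 2 * g - 2)) →
      ∃ j, 1 ≤ j ∧ j ≤ g - 1 ∧ Sends τ (2 * j + 1) l ∧ Sends τ (2 * j) (l + 1) := by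
    intro l hl
    obtain ⟨a, ha⟩ := hsurj (b := l) (by omega) (by omega)
    have hab := ha.bounds
    obtain ⟨j, hj, rfl⟩ := hτ.exists_eq_of_sends hg ha (hl.imp_right fun h => ⟨h.1, h.2.1⟩)
    obtain ⟨l', h1, h2⟩ := hnext hj (by omega)
    rw [← ha.eq h1] at h2
    exact ⟨j, hj, by omega, ha, h2⟩
  have P3 : P 3 := ⟨t, rfl, .refl _ _⟩
  have P1 : P 1 := by
    obtain ⟨j, h1, h2, h3, h4⟩ := hpred (l := 1) (.inl rfl)
    exact (hP h4 h3 (by omega)).1 P3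
  -- Descending through the even labels: `2g - 2` is joined to `1`, the label two steps further on
  -- the cycle, and each smaller one to its even successor.
  have hev : ∀ m, m ≤ g - 3 → P (2 * (g - 1 - m)) := by
    intro m
    induction m with
    | zero =>
      intro _
      obtain ⟨j, h1, h2, h3, h4⟩ := hpred (l := 2 * (g - 1 - 0))
        (.inr ⟨by simp, by omega, by omega⟩)
      rw [show 2 * (g - 1 - 0) + 1 = 2 * g - 1 by omega] at h4
      exact hP1 h4 h3 P1
    | succ m ih =>
      intro hm
      obtain ⟨j, h1, h2, h3, h4⟩ :=
        hpred (l := 2 * (g - 1 - (m + 1))) (.inr ⟨by simp, by omega, by omega⟩)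
      refine (hP h4 h3 (by omega)).1 ?_
      rw [show 2 * (g - 1 - (m + 1)) + 1 + 1 = 2 * (g - 1 - m) by omega]
      exact ih (by omega)
  -- Descending through the even labels again, now for their images under `τ`, from `2g - 2` down to
  -- `2`.
  have hod : ∀ m, m ≤ g - 2 → ∀ b, Sends τ (2 * (g - 1 - m)) b → P b := by
    intro m
    induction m with
    | zero =>
      intro _ b hb
      obtain ⟨l, h1, h2⟩ := hnext (j := g - 1) (by omega) le_rfl
      obtain rfl := hb.eq h2
      rw [show 2 * (g - 1) + 1 = 2 * g - 1 by omega] at h1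
      have := h2.bounds
      exact hPlast h1 (by omega)
    | succ m ih =>
      intro hm b hb
      obtain ⟨l, h1, h2⟩ := hnext (j := g - 1 - (m + 1)) (by omega) (by omega)
      obtain rfl := hb.eq h2
      obtain ⟨b', hb'⟩ := exists_sends τ (a := 2 * (g - 1 - m)) (by omega) (by omega)
      have := h2.bounds
      refine (hP h1 ?_ (by omega)).2 (ih (by omega) b' hb')
      rwa [show 2 * (g - 1 - (m + 1)) + 1 + 1 = 2 * (g - 1 - m) by omega]
  have hall : ∀ x : Squares g, R.SameCycle (x, 0) (t, 0) := by
    intro x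
    suffices P x.1 by
      obtain ⟨y, hy, h⟩ := this
      rwa [Subtype.ext hy] at h
    have hx := x.2
    obtain ⟨a, ha⟩ := hsurj hx.1 hx.2
    have hb := ha.bounds
    rcases hτ.sends hg ha with h | h | h | h | h
    · rw [h.2]; exact P3
    · rw [h.2.2]; exact P1
    · obtain ⟨⟨j, hj⟩, -⟩ := h
      refine hod (g - 1 - j) (by omega) _ ?_
      rwa [show 2 * (g - 1 - (g - 1 - j)) = a by omega]
    · obtain ⟨-, ⟨j, hj⟩, -, h, -⟩ := h
      have := hev (g - 1 - j) (by omega)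
      rwa [show 2 * (g - 1 - (g - 1 - j)) = x.1 by omega] at this
    · obtain ⟨⟨j, hj⟩, -⟩ := h
      refine hod (g - 1 - j) (by omega) _ ?_
      rwa [show 2 * (g - 1 - (g - 1 - j)) = a by omega]
  have hall3 : ∀ i, R.SameCycle (i, 3) (t, 0) := fun i => (hstep (i, 3)).symm.trans (hall (τ i))
  have hall2 : ∀ i, R.SameCycle (i, 2) (t, 0) := fun i =>
    (hstep (i, 2)).symm.trans (hall3 (sigma g i))
  have hall1 : ∀ i, R.SameCycle (i, 1) (t, 0) := fun i => by
    obtain ⟨i, rfl⟩ := τ.surjective i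
    have := hstep (τ i, 1)
    rw [h1] at this
    exact this.symm.trans (hall2 i)
  have hfin : ∀ c, R.SameCycle c (t, 0) := by
    rintro ⟨i, b⟩
    match b with
    | 0 => exact hall i
    | 1 => exact hall1 i
    | 2 => exact hall2 i
    | 3 => exact hall3 i
  exact fun a b => (hfin a).trans (hfin b).symm

variable {hg : 3 ≤ g} {e : Equiv.Perm (Fin (g - 2))}

/-- The symmetric origamis are orientation double covers. -/
theorem isOrientationDoubleCoverIn_amnPerm (hodd : Odd g) (he : Commute e Fin.revPerm) :
    (origamiOf g (amnPerm g hg e)).IsOrientationDoubleCoverIn ((g - 1) / 2)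
      {2 * (g : ℤ) - 3, -1, -1, -1} := by
  have hone := isAMNOdd_amnPerm (hg := hg) (e := e) |>.hasOneVertex hg
  have : Nonempty (Squares g) := ⟨⟨1, le_rfl, by omega⟩⟩
  have hcomm := (commute_reflection_iff (hg := hg)).2 he
  have hmod : g % 2 = 1 := Nat.odd_iff.1 hodd
  -- The three fixed points solve `2x = 4`, `2x + 1 = 4` and `x + τ x = 4` modulo `2g - 1`. The
  -- second has the solution `g + 1`, and the third only `1`, as the base permutation shows after
  -- conjugation.
  have key := hone.isOrientationDoubleCoverIn (ρ := reflection g hg) (h := (g - 1) / 2)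
    (i₁ := ⟨2, by omega, by omega⟩) (i₂ := ⟨g + 1, by omega, by omega⟩)
    (i₃ := ⟨1, by omega, by omega⟩) reflection_mul_self sigma_mul_reflection_mul
    ((amnPerm_mul_reflection_mul_iff hodd).2 he) (by rw [card_squares]; omega) ?_ ?_ ?_
  · rw [card_squares] at key
    rwa [show ((2 * g - 1 : ℕ) : ℤ) - 2 = 2 * (g : ℤ) - 3 by omega] at key
  · intro i
    have := reflection_val_cases (hg := hg) i
    have := i.2
    rw [Subtype.ext_iff, Subtype.ext_iff]
    change _ ↔ i.1 = 2
    omega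
  · intro i
    have := reflection_val_cases (hg := hg) (sigma g i)
    have := sigma_val_cases i
    have := i.2
    rw [Subtype.ext_iff, Subtype.ext_iff]
    change (reflection g hg (sigma g i)).1 = _ ↔ i.1 = g + 1
    omega
  · intro i
    obtain ⟨i, rfl⟩ := (pairPerm g e).surjective i
    have h1 : pairPerm g e ⟨1, by omega, by omega⟩ = ⟨1, by omega, by omega⟩ :=
      Subtype.ext ((pairPerm_val _).trans (pairFun_of_lt (by norm_num)))
    have h2 : reflection g hg (pairPerm g e (amnBase g hg i)) =
        pairPerm g e (reflection g hg (amnBase g hg i)) :=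
      (congrArg (fun f : Equiv.Perm (Squares g) => f (amnBase g hg i)) hcomm.eq).symm
    change reflection g hg (amnPerm g hg e _) = _ ↔ _
    rw [amnPerm_pairPerm, h2, (pairPerm g e).apply_eq_iff_eq, ← h1, (pairPerm g e).apply_eq_iff_eq]
    have := reflection_val_cases (hg := hg) (amnBase g hg i)
    have := amnBase_val_cases (hg := hg) i
    have := i.2
    rw [Subtype.ext_iff, Subtype.ext_iff]
    change _ ↔ i.1 = 1
    omega

theorem Origami.IsOrientationDoubleCoverIn.isOrientationDoubleCover {ι : Type} {O : Origami ι}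
    {h : ℕ} {κ : Multiset ℤ} (hO : O.IsOrientationDoubleCoverIn h κ) :
    O.IsOrientationDoubleCover := by
  obtain ⟨X, α, hs, Y, q, -, hq⟩ := hO
  exact ⟨X, α, hs, Y, q, hq⟩

/-- An odd genus Aougab–Menasco–Nieland origami is an orientation double cover if and only if it is
symmetric. -/
theorem isOrientationDoubleCover_amnPerm_iff (hodd : Odd g) :
    (origamiOf g (amnPerm g hg e)).IsOrientationDoubleCover ↔ Commute e Fin.revPerm :=
  ⟨fun h => (amnPerm_mul_reflection_mul_iff hodd).1 (isAMNOdd_amnPerm.mul_reflection_mul h),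
    fun h => (isOrientationDoubleCoverIn_amnPerm hodd h).isOrientationDoubleCover⟩

theorem setOf_isAMNOdd : {τ | IsAMNOdd g τ} = Set.range (amnPerm g hg) := by
  ext τ
  refine ⟨exists_amnPerm_eq, ?_⟩
  rintro ⟨e, rfl⟩
  exact isAMNOdd_amnPerm

end

/-! ### Counting the symmetric orders and conclusion. -/

/-- The number of permutations that commute with the reversal of an odd number of points. -/
theorem ncard_commute_revPerm (m : ℕ) :
    {e : Equiv.Perm (Fin (2 * m + 1)) | Commute e Fin.revPerm}.ncard = (2 * m)‼ := by
  have h1 : {e : Equiv.Perm (Fin (2 * m + 1)) | Commute e Fin.revPerm} =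
      (Subgroup.centralizer {(Fin.revPerm : Equiv.Perm (Fin (2 * m + 1)))} : Set _) := by
    ext e
    rw [SetLike.mem_coe, Subgroup.mem_centralizer_singleton_iff]
    exact ⟨fun h => h.eq, fun h => h⟩
  set r : Equiv.Perm (Fin (2 * m + 1)) := Fin.revPerm with hr
  have h2 : r * r = 1 := by ext; simp [hr]
  have h3 : r.support.card = 2 * m := by
    have : r.support = {⟨m, by omega⟩}ᶜ := by
      ext i
      rw [Equiv.Perm.mem_support, Finset.mem_compl, Finset.mem_singleton, hr, Fin.revPerm_apply,
        not_iff_not, Fin.ext_iff, Fin.ext_iff, Fin.val_rev]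
      dsimp only
      omega
    rw [this, Finset.card_compl, Fintype.card_fin, Finset.card_singleton, Nat.add_sub_cancel]
  -- The reversal is an involution that moves all points but the middle one, so it consists of `m`
  -- transpositions.
  have h4 : r.cycleType = Multiset.replicate m 2 := by
    have h5 : ∀ n ∈ r.cycleType, n = 2 := by
      intro n hn
      have h6 := Equiv.Perm.two_le_of_mem_cycleType hn
      have h7 := (Equiv.Perm.dvd_of_mem_cycleType hn).trans (orderOf_dvd_of_pow_eq_one (n := 2)
        (by rw [sq, h2]))
      exact le_antisymm (Nat.le_of_dvd (by norm_num) h7) h6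
    have h8 := Equiv.Perm.sum_cycleType r
    rw [Multiset.eq_replicate_card.2 h5, Multiset.sum_replicate, h3, smul_eq_mul] at h8
    rw [Multiset.eq_replicate_card.2 h5]
    congr 1
    omega
  rw [h1, ← Nat.card_coe_set_eq]
  -- The one fixed point contributes `1!`, the `m` transpositions contribute `2 ^ m` for their own
  -- powers and `m!` for permuting them.
  refine (Equiv.Perm.nat_card_centralizer r).trans ?_
  rw [h4, Multiset.sum_replicate, Multiset.prod_replicate, Fintype.card_fin,
    Nat.doubleFactorial_two_mul,
    smul_eq_mul, show 2 * m + 1 - m * 2 = 1 by omega, Nat.factorial_one, one_mul]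
  rcases Nat.eq_zero_or_pos m with rfl | hm
  · simp
  · rw [Multiset.toFinset_replicate, if_neg hm.ne', Finset.prod_singleton,
      Multiset.count_replicate_self]

theorem theorem1p4 :
    -- odd genus Aougab–Menasco–Nieland origamis: there are `(g-2)!` of them, pairwise distinct as
    -- origamis; exactly `(g-3)!!` are orientation double covers in the stated stratum, and the
    -- others are not orientation double covers at all
    (∀ g : ℕ, 3 ≤ g → Odd g →
      {τ | IsAMNOdd g τ}.ncard = (g - 2)! ∧
      (∀ τ τ', IsAMNOdd g τ → IsAMNOdd g τ' →
        (origamiOf g τ).Equivalent (origamiOf g τ') → τ = τ') ∧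
      {τ | IsAMNOdd g τ ∧ (origamiOf g τ).IsOrientationDoubleCoverIn ((g - 1) / 2)
        {2 * (g : ℤ) - 3, -1, -1, -1}}.ncard = (g - 3)‼ ∧
      (∀ τ, IsAMNOdd g τ →
        ¬ (origamiOf g τ).IsOrientationDoubleCoverIn ((g - 1) / 2)
          {2 * (g : ℤ) - 3, -1, -1, -1} →
        ¬ (origamiOf g τ).IsOrientationDoubleCover)) ∧
    -- even genus Aougab–Menasco–Nieland origamis
    (∀ g : ℕ, 4 ≤ g → Even g → ∀ τ, IsAMNEven g τ →
      ¬ (origamiOf g τ).IsOrientationDoubleCover) ∧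
    -- the three generalised constructions
    (∀ g : ℕ, 5 ≤ g → Odd g → ∀ τ, IsOddGenusEvenSpin g τ →
      ¬ (origamiOf g τ).IsOrientationDoubleCover) ∧
    (∀ g : ℕ, 4 ≤ g → Even g → ∀ τ, IsEvenGenusOddSpin g τ →
      ¬ (origamiOf g τ).IsOrientationDoubleCover) ∧
    (∀ g : ℕ, 4 ≤ g → Even g → ∀ τ, IsEvenGenusEvenSpin g τ →
      ¬ (origamiOf g τ).IsOrientationDoubleCover) := by
  refine ⟨fun g hg hodd => ?_, fun g hg _ τ hτ => hτ.not_isOrientationDoubleCover hg,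
    fun g hg _ τ hτ => hτ.not_isOrientationDoubleCover hg,
    fun g hg _ τ hτ => hτ.not_isOrientationDoubleCover hg,
    fun g hg _ τ hτ => hτ.not_isOrientationDoubleCover hg⟩
  refine ⟨?_, fun τ τ' hτ hτ' => hτ.eq_of_equivalent hg hτ', ?_, fun τ hτ h h' => ?_⟩
  · rw [setOf_isAMNOdd (hg := hg), ← Set.image_univ, Set.ncard_image_of_injective _
      amnPerm_injective,
      Set.ncard_univ, Nat.card_perm, Nat.card_fin]
  · have hset : {τ | IsAMNOdd g τ ∧ (origamiOf g τ).IsOrientationDoubleCoverIn ((g - 1) / 2)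
        {2 * (g : ℤ) - 3, -1, -1, -1}} = amnPerm g hg '' {e | Commute e Fin.revPerm} := by
      ext τ
      constructor
      · rintro ⟨hτ, h⟩
        obtain ⟨e, rfl⟩ := exists_amnPerm_eq (hg := hg) hτ
        exact ⟨e, (isOrientationDoubleCover_amnPerm_iff hodd).1 h.isOrientationDoubleCover, rfl⟩
      · rintro ⟨e, he, rfl⟩
        exact ⟨isAMNOdd_amnPerm, isOrientationDoubleCoverIn_amnPerm hodd he⟩
    rw [hset, Set.ncard_image_of_injective _ amnPerm_injective]
    obtain ⟨m, rfl⟩ : ∃ m, g = 2 * m + 3 := ⟨g / 2 - 1, by have := Nat.odd_iff.1 hodd; omega⟩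
    exact ncard_commute_revPerm m
  · obtain ⟨e, rfl⟩ := exists_amnPerm_eq (hg := hg) hτ
    exact h (isOrientationDoubleCoverIn_amnPerm hodd
      ((isOrientationDoubleCover_amnPerm_iff hodd).1 h'))
end
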